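/- **Setting.** Consider the system $$y'-x^{-1}Ay-q(x)y=\rho By,\qquad x>0,\tag{1}$$ with $n\times n$ matrices such that: (A) $A$ is constant and off-diagonal (zero diagonal), and its eigenvalues satisfy $\mu_j-\mu_k\notin\mathbb Z$ for $j\ne k$, $\operatorname{Re}\mu_1<\dots<\operatorname{Re}\mu_n$, $\operatorname{Re}\mu_k\neq0$; (B) $B=\operatorname{diag}(b_1,\dots,b_n)$ with nonzero distinct complex $b_j$, no three of them collinear, $\sum_j b_j=0$. Let $\Sigma=\bigcup_{j\ne k}\{x\in\mathbb C:\operatorname{Re}(xb_j)=\operatorname{Re}(xb_k)\}$, let $\mathcal S\subset\mathbb C\setminus\Sigma$ be an open sector with vertex $0$, and let $R_1,\dots,R_n$ be the ordering of $b_1,\dots,b_n$ with $\operatorname{Re}(R_1x)<\dots<\operatorname{Re}(R_nx)$ for $x\in\mathcal S$. If $R_k=b_i$, then $\mathfrak f_k$ denotes the $i$-th standard basis vector. Powers $\xi^\nu$ are taken with a fixed continuous branch of $\log\xi$ on $\overline{\mathcal S}\setminus\{0\}$. For $y'-x^{-1}Ay=By$ on $\overline{\mathcal S}\setminus\{0\}$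 let $c=(c_1,\dots,c_n)$ and $e=(e_1,\dots,e_n)$ be fundamental matrices with $c_k(x)=x^{\mu_k}\hat c_k(x)$, $\hat c_k$ entire, $\hat c_k(0)=\mathfrak h_k$ an eigenvector of $A$ for $\mu_k$, $\det c\equiv1$, and $e_k(x)=e^{xR_k}(\mathfrak f_k+O(x^{-1}))$ for $|x|\ge1$, $x\in\overline{\mathcal S}$. Assume that $\det(e_1,\dots,e_{k-1},c_k,\dots,c_n)\ne0$ for $k=2,\dots,n$. Let $\psi_0=(\psi_{01},\dots,\psi_{0n})$ be the fundamental matrix on $\overline{\mathcal S}\setminus\{0\}$ with $\psi_{0k}(xt)=e^{xtR_k}(\mathfrak f_k+o(1))$ as $t\to+\infty$ for $x\in\mathcal S$, and $\psi_{0k}(x)=O(x^{\mu_k})$ as $x\to0$. Put $C(x,\rho)=c(\rho x)$, $E(x,\rho)=e(\rho x)$, $\Psi_0(x,\rho)=\psi_0(\rho x)$. *Weights.* Let $W=\operatorname{diag}(W_1,\dots,W_n)$, where the functions $W_k$ are continuous and have no zeros on $\overline{\mathcal S}\setminus\{0\}$, $W_k(\xi)=e^{R_k\xi}$ for $|\xi|>1$,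 and $W_k(\xi)/\xi^{\mu_k}\to1$ as $\xi\to0$. *Spaces.* $\mathcal X_p$ is the Banach space of off-diagonal matrix functions on $(0,\infty)$ with entries in $L_1(0,\infty)\cap L_p(0,\infty)$. For a closed set $L\subset\overline{\mathcal S}$, $C_0(L)$ is the space of continuous functions on $L$ vanishing at infinity, with the sup norm; for a ray $l$, $\mathcal H(l)=C_0(l)\cap L_2(l)$. $BC$ denotes bounded continuous functions. *Fundamental tensors.* For a matrix $V$ let $V^{(m)}(v_1\wedge\dots\wedge v_m)=\sum_j v_1\wedge\dots\wedge Vv_j\wedge\dots\wedge v_m$ on $\wedge^m\mathbb C^n$. For $h\in\wedge^n\mathbb C^n$ let $|h|$ be the number with $h=|h|\,\mathfrak e_1\wedge\dots\wedge\mathfrak e_n$, where the $\mathfrak e_j$ are the standard basis vectors. For $\alpha=\{\alpha_1<\dots<\alpha_m\}\subset\{1,\dots,n\}$ let $u_\alpha=u_{\alpha_1}\wedge\dots\wedge u_{\alpha_m}$, and let $\alpha'$ be the complement of $\alpha$. Let $$G_m(x,t,\rho)f=\sum_{|\alpha|=m}|\mathfrak h_\alpha\wedge\mathfrak h_{\alpha'}|\,|f\wedge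 C_{\alpha'}(t,\rho)|\,C_\alpha(x,\rho).$$ For $q\in\mathcal X_p$ and $\rho\in\overline{\mathcal S}\setminus\{0\}$ let $T_k(q,\cdot,\rho)$, $1\le k\le n$, and $F_k(q,\cdot,\rho)$, $0\le k\le n$ (so $F_0=1$), be the solutions of $$T_k(x)=C_k\wedge\dots\wedge C_n+\int_0^xG_{n-k+1}(x,t,\rho)\,q^{(n-k+1)}(t)T_k(t)\,dt,$$ $$F_k(x)=E_1\wedge\dots\wedge E_k-\int_x^\infty G_k(x,t,\rho)\,q^{(k)}(t)F_k(t)\,dt$$ such that, with $M$ independent of $x$, $\|T_k\|\le M|(\rho x)^{\mu_k+\dots+\mu_n}|$ and $\|F_k\|\le M|(\rho x)^{\mu_1+\dots+\mu_k}|$ for $|\rho x|\le1$, while $\|T_k\|\le M|e^{\rho x(R_k+\dots+R_n)}|$ and $\|F_k\|\le M|e^{\rho x(R_1+\dots+R_k)}|$ for $|\rho x|>1$. Put $\Delta_1=1$ and $\Delta_k(q,\rho)=|F_{k-1}\wedge T_k|$ for $2\le k\le n$ (this does not depend on $x$). *Weyl-type solutions.* For $\rho\in\overline{\mathcal S}\setminus\Sigma$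 a $k$-th Weyl-type solution is a solution $y$ of (1) with $y(x)=O(x^{\mu_k})$ as $x\to0$ and $y(x)=e^{\rho R_kx}(\mathfrak f_k+o(1))$ as $x\to\infty$. If $\Delta_k(q,\rho)\ne0$, then $\Psi_k(q,x,\rho)$ denotes the $k$-th Weyl-type solution; for $\rho\in\overline{\mathcal S}\setminus\{0\}$ in general, $\Psi_k$ denotes the solution of the linear system $F_{k-1}\wedge\Psi_k=F_k$, $\Psi_k\wedge T_k=0$. Let $\Psi=(\Psi_1,\dots,\Psi_n)$, $\tilde\Psi_0(x,\rho)=\Psi_0(x,\rho)W(\rho x)^{-1}$, $\tilde\Psi(q,x,\rho)=\Psi(q,x,\rho)W(\rho x)^{-1}$ and $$\beta(q,x,\rho)=(\tilde\Psi_0(x,\rho))^{-1}\tilde\Psi(q,x,\rho),$$ whose $k$-th column depends only on the column $\Psi_k$ of $\Psi$. **Theorem 2.** Let $p>2$. There are functions $d_{jk},d_k\in C(\mathcal X_p,BC([0,\infty),C_0(\overline{\mathcal S})))$, $1\le j,k\le n$, such that for all $q\in\mathcal X_p$, $\rho\in\overline{\mathcal S}\setminus\{0\}$ and $k$ with $\Delta_k(q,\rho)\ne0$,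 and all $x>0$, $1\le j\le n$, $$1+d_k(q,x,\rho)\neq0,\qquad \beta_{jk}(q,x,\rho)=\frac{\delta_{jk}+d_{jk}(q,x,\rho)}{1+d_k(q,x,\rho)}.$$ Moreover, for every ray $l=\{zt:t\ge0\}$ with $z\in\overline{\mathcal S}\setminus\{0\}$, the restrictions of $d_{jk}$ and $d_k$ to $\rho\in l$ belong to $C(\mathcal X_p,BC([0,\infty),\mathcal H(l)))$. -/

import Mathlib

open MeasureTheory Set Filter Topology Asymptotics
open scoped NNReal ENNReal ZeroAtInfty BoundedContinuousFunction

noncomputable section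

namespace WeylSystem

variable {n : ℕ}

/-! ### Assumptions on the constant matrices -/

/-- The conditions on the matrix `A` and on its eigenvalues `μ 0, …, μ (n - 1)`. -/
structure ConditionA (A : Matrix (Fin n) (Fin n) ℂ) (μ : Fin n → ℂ) : Prop where
  offDiag : ∀ i, A i i = 0
  eigenvalue : ∀ j, Module.End.HasEigenvalue (Matrix.toLin' A) (μ j)
  nonresonant : ∀ j k, j ≠ k → ∀ m : ℤ, μ j - μ k ≠ m
  ordered : StrictMono fun j => (μ j).re
  re_ne_zero : ∀ k, (μ k).re ≠ 0

/-- The conditions on the diagonal entries of `B = diag (b 0, …, b (n - 1))`. -/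
structure ConditionB (b : Fin n → ℂ) : Prop where
  ne_zero : ∀ j, b j ≠ 0
  injective : Function.Injective b
  noncollinear : ∀ i j k, i ≠ j → j ≠ k → i ≠ k → ¬ Collinear ℝ ({b i, b j, b k} : Set ℂ)
  sum_eq_zero : ∑ j, b j = 0

/-- The union of lines `Σ`. -/
def singularLines (b : Fin n → ℂ) : Set ℂ :=
  {x | ∃ j k, j ≠ k ∧ (x * b j).re = (x * b k).re}

/-! ### Sectors and powers -/

/-- The open sector with vertex `0`, with bisector of direction `exp (i ω)` and half-opening `h`. -/
def sector (ω h : ℝ) : Set ℂ :=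
  {ξ | ξ ≠ 0 ∧ |(ξ * Complex.exp (-(ω * Complex.I))).arg| < h}

/-- The closed sector. -/
abbrev closedSector (ω h : ℝ) : Set ℂ := closure (sector ω h)

/-- The branch of the power `ξ ^ ν` given by `log ξ = log |ξ| + i θ` with
`θ ∈ (ω - π, ω + π]`; it is continuous on the closed sector without its vertex when the
half-opening is less than `π`. -/
def sectorPow (ω : ℝ) (ξ ν : ℂ) : ℂ :=
  Complex.exp (ν * (Complex.log (ξ * Complex.exp (-(ω * Complex.I))) + ω * Complex.I))

/-! ### Solutions of the unperturbed system

A fundamental matrix is given by the family of its columns. -/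

/-- `y` is a solution of `y' - x⁻¹ A y = B y` on the closed sector without its vertex. -/
def SolvesUnperturbed (A : Matrix (Fin n) (Fin n) ℂ) (b : Fin n → ℂ) (ω h : ℝ)
    (y : ℂ → Fin n → ℂ) : Prop :=
  ∀ x ∈ closedSector ω h, x ≠ 0 →
    HasDerivWithinAt y ((x⁻¹ • A + Matrix.diagonal b).mulVec (y x)) (closedSector ω h) x

/-- The columns `c_k(x) = x ^ μ_k ĉ_k(x)`. -/
def frob (ω : ℝ) (μ : Fin n → ℂ) (chat : Fin n → ℂ → Fin n → ℂ) (k : Fin n) (x : ℂ) :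
    Fin n → ℂ :=
  sectorPow ω x (μ k) • chat k x

/-- The matrix with the columns `u 0, …, u (n - 1)`. -/
def ofCols (u : Fin n → Fin n → ℂ) : Matrix (Fin n) (Fin n) ℂ := Matrix.of fun i j => u j i

/-- The `ĉ_k` are entire, `ĉ_k(0)` is an eigenvector of `A` for `μ_k`, and the
`c_k(x) = x ^ μ_k ĉ_k(x)` are the columns of a fundamental matrix with determinant `1`. -/
structure IsFrobenius (A : Matrix (Fin n) (Fin n) ℂ) (b μ : Fin n → ℂ) (ω h : ℝ)
    (chat : Fin n → ℂ → Fin n → ℂ) : Prop where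
  entire : ∀ k, Differentiable ℂ (chat k)
  eigenvector : ∀ k, Module.End.HasEigenvector (Matrix.toLin' A) (μ k) (chat k 0)
  solves : ∀ k, SolvesUnperturbed A b ω h (frob ω μ chat k)
  det_eq_one : ∀ x ∈ closedSector ω h, x ≠ 0 → (ofCols fun k => frob ω μ chat k x).det = 1

/-- The columns `e_k` of a fundamental matrix with
`e_k(x) = exp (x R_k) (𝔣_k + O(x⁻¹))`, `|x| ≥ 1`, in the closed sector. Here
`R_k = b (σ k)`, and `𝔣_k` is the standard basis vector number `σ k`. -/
structure IsJost (A : Matrix (Fin n) (Fin n) ℂ) (b : Fin n → ℂ) (ω h : ℝ)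
    (σ : Equiv.Perm (Fin n)) (e : Fin n → ℂ → Fin n → ℂ) : Prop where
  solves : ∀ k, SolvesUnperturbed A b ω h (e k)
  asymp : ∀ k, ∃ M : ℝ, ∀ x ∈ closedSector ω h, 1 ≤ ‖x‖ →
    ‖Complex.exp (-(x * b (σ k))) • e k x - Pi.single (σ k) 1‖ ≤ M * ‖x‖⁻¹

/-- The condition `I(S)`: the Wronskians `det (e_1, …, e_{k-1}, c_k, …, c_n)`, `k = 2, …, n`,
do not vanish. -/
def ConditionI (μ : Fin n → ℂ) (ω h : ℝ) (chat e : Fin n → ℂ → Fin n → ℂ) : Prop :=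
  ∀ k : Fin n, k.val ≠ 0 → ∀ x ∈ closedSector ω h, x ≠ 0 →
    (ofCols fun j => if j < k then e j x else frob ω μ chat j x).det ≠ 0

/-- The columns `ψ_{0k}` of the fundamental matrix of Weyl-type solutions:
`ψ_{0k}(x t) = exp (x t R_k) (𝔣_k + o(1))` as `t → ∞` for `x` in the open sector, and
`ψ_{0k}(x) = O(x ^ μ_k)` as `x → 0`. -/
structure IsWeylZero (A : Matrix (Fin n) (Fin n) ℂ) (b μ : Fin n → ℂ) (ω h : ℝ)
    (σ : Equiv.Perm (Fin n)) (ψ : Fin n → ℂ → Fin n → ℂ) : Prop where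
  solves : ∀ k, SolvesUnperturbed A b ω h (ψ k)
  infty : ∀ k, ∀ x ∈ sector ω h,
    Tendsto (fun t : ℝ => Complex.exp (-(x * t * b (σ k))) • ψ k (x * t)) atTop
      (𝓝 (Pi.single (σ k) 1))
  zero : ∀ k, ψ k =O[𝓝[closedSector ω h \ {0}] 0] fun x => sectorPow ω x (μ k)

/-! ### Weight functions -/

/-- `W_1, …, W_n` is a system of weight functions: they are continuous and without zeros on the
closed sector without its vertex, `W_k(ξ) = exp (R_k ξ)` for `|ξ| > 1`, and
`W_k(ξ) ~ ξ ^ μ_k` as `ξ → 0`. -/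
structure IsWeight (b μ : Fin n → ℂ) (ω h : ℝ) (σ : Equiv.Perm (Fin n))
    (W : Fin n → ℂ → ℂ) : Prop where
  continuousOn : ∀ k, ContinuousOn (W k) (closedSector ω h \ {0})
  ne_zero : ∀ k, ∀ ξ ∈ closedSector ω h, ξ ≠ 0 → W k ξ ≠ 0
  eq_exp : ∀ k, ∀ ξ ∈ closedSector ω h, 1 < ‖ξ‖ → W k ξ = Complex.exp (b (σ k) * ξ)
  zero : ∀ k, Tendsto (fun ξ => W k ξ / sectorPow ω ξ (μ k))
    (𝓝[closedSector ω h \ {0}] 0) (𝓝 1)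

/-- The function `W_0(z) = (1 - |z|) z + |z|²` for `|z| ≤ 1`, `W_0(z) = W_0(z⁻¹)⁻¹` for
`|z| > 1`. -/
def weightZero (z : ℂ) : ℂ :=
  if ‖z‖ ≤ 1 then (1 - ‖z‖) * z + ‖z‖ ^ 2
  else ((1 - ‖z⁻¹‖) * z⁻¹ + ‖z⁻¹‖ ^ 2)⁻¹

/-- The explicit weights `W_0(ξ ^ μ_k) exp (R_k ξ)` for `|ξ| ≤ 1`, `exp (R_k ξ)` for `|ξ| > 1`. -/
def explicitWeight (b μ : Fin n → ℂ) (ω : ℝ) (σ : Equiv.Perm (Fin n)) (k : Fin n) (ξ : ℂ) : ℂ :=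
  if ‖ξ‖ ≤ 1 then weightZero (sectorPow ω ξ (μ k)) * Complex.exp (b (σ k) * ξ)
  else Complex.exp (b (σ k) * ξ)

/-- As `ξ → 0` in the sector, `ξ ^ ν → 0` if `Re ν > 0`. -/
theorem tendsto_norm_sectorPow (ω h : ℝ) {ν : ℂ} (hν : 0 < ν.re) :
    Tendsto (fun ξ => ‖sectorPow ω ξ ν‖) (𝓝[closedSector ω h \ {0}] 0) (𝓝 0) := by
  have hexp : ∀ ξ : ℂ, ‖ξ * Complex.exp (-(ω * Complex.I))‖ = ‖ξ‖ := by
    intro ξ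
    have : Complex.exp (-(ω * Complex.I)) = Complex.exp (((-ω : ℝ) : ℂ) * Complex.I) := by
      push_cast; ring_nf
    rw [norm_mul, this, Complex.norm_exp_ofReal_mul_I, mul_one]
  have hb : ∀ ξ : ℂ, ξ ≠ 0 → ‖sectorPow ω ξ ν‖ ≤
      ‖ξ‖ ^ ν.re * Real.exp (|ν.im| * (Real.pi + |ω|)) := by
    intro ξ hξ
    have h0 : 0 < ‖ξ‖ := norm_pos_iff.mpr hξ
    rw [sectorPow, Complex.norm_exp, Real.rpow_def_of_pos h0, ← Real.exp_add]
    apply Real.exp_le_exp.mpr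
    set a := (ξ * Complex.exp (-(ω * Complex.I))).arg with ha
    have : (ν * (Complex.log (ξ * Complex.exp (-(ω * Complex.I))) + ω * Complex.I)).re =
        Real.log ‖ξ‖ * ν.re + -(ν.im * (a + ω)) := by
      rw [Complex.mul_re, Complex.add_re, Complex.add_im, Complex.log_re, Complex.log_im, hexp,
        ← ha]
      simp
      ring
    rw [this]
    have h1 : |a + ω| ≤ Real.pi + |ω| :=
      (abs_add_le _ _).trans (by gcongr; exact Complex.abs_arg_le_pi _)
    have h2 : -(ν.im * (a + ω)) ≤ |ν.im| * |a + ω| := by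
      rw [← abs_mul]; exact neg_le_abs _
    have h3 := mul_le_mul_of_nonneg_left h1 (abs_nonneg ν.im)
    linarith
  have hlim : Tendsto (fun ξ : ℂ => ‖ξ‖ ^ ν.re * Real.exp (|ν.im| * (Real.pi + |ω|)))
      (𝓝[closedSector ω h \ {0}] 0) (𝓝 0) := by
    have : Continuous fun ξ : ℂ => ‖ξ‖ ^ ν.re * Real.exp (|ν.im| * (Real.pi + |ω|)) := by
      refine Continuous.mul ?_ continuous_const
      exact continuous_norm.rpow_const fun _ => Or.inr hν.le
    have h2 := (this.tendsto 0).mono_left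
      (nhdsWithin_le_nhds (s := closedSector ω h \ {0}))
    simpa [Real.zero_rpow hν.ne'] using h2
  refine squeeze_zero' (Eventually.of_forall fun _ => norm_nonneg _) ?_ hlim
  filter_upwards [self_mem_nhdsWithin] with ξ hξ using hb ξ hξ.2

/-- The explicit weights are weights whenever they are continuous and have no zeros. -/
theorem explicitWeight_isWeight (b μ : Fin n → ℂ) (ω h : ℝ) (σ : Equiv.Perm (Fin n))
    (hμ : ∀ k, (μ k).re ≠ 0)
    (hc : ∀ k, ContinuousOn (explicitWeight b μ ω σ k) (closedSector ω h \ {0}))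
    (h0 : ∀ k, ∀ ξ ∈ closedSector ω h, ξ ≠ 0 → explicitWeight b μ ω σ k ξ ≠ 0) :
    IsWeight b μ ω h σ (explicitWeight b μ ω σ) where
  continuousOn := hc
  ne_zero := h0
  eq_exp k ξ _ hξ := by simp [explicitWeight, not_le.mpr hξ]
  zero k := by
    have hne : ∀ ξ ν, sectorPow ω ξ ν ≠ 0 := fun ξ ν => Complex.exp_ne_zero _
    have hneg : ∀ ξ, (sectorPow ω ξ (μ k))⁻¹ = sectorPow ω ξ (-μ k) := by
      intro ξ; rw [sectorPow, sectorPow, ← Complex.exp_neg]; ring_nf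
    have hsmall : ∀ᶠ ξ : ℂ in 𝓝[closedSector ω h \ {0}] 0, ‖ξ‖ ≤ 1 := by
      have : Metric.closedBall (0 : ℂ) 1 ∈ 𝓝 (0 : ℂ) := Metric.closedBall_mem_nhds _ one_pos
      filter_upwards [mem_nhdsWithin_of_mem_nhds this] with ξ hξ
      simpa using hξ
    have hexp : Tendsto (fun ξ : ℂ => Complex.exp (b (σ k) * ξ))
        (𝓝[closedSector ω h \ {0}] 0) (𝓝 1) := by
      have hcont : Continuous fun ξ : ℂ => Complex.exp (b (σ k) * ξ) := by fun_prop
      simpa using (hcont.tendsto 0).mono_left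
        (nhdsWithin_le_nhds (s := closedSector ω h \ {0}))
    -- the auxiliary limit `(1 - r) + r² / z → 1` where `r = |z| → 0`
    have haux : ∀ z : ℂ → ℂ, (∀ ξ, z ξ ≠ 0) →
        Tendsto (fun ξ => ‖z ξ‖) (𝓝[closedSector ω h \ {0}] 0) (𝓝 0) →
        Tendsto (fun ξ => ((1 - ‖z ξ‖) * z ξ + ‖z ξ‖ ^ 2 : ℂ) / z ξ)
          (𝓝[closedSector ω h \ {0}] 0) (𝓝 1) := by
      intro z hz hlim
      rw [tendsto_iff_norm_sub_tendsto_zero]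
      have hlim2 : Tendsto (fun ξ => ‖z ξ‖ + ‖z ξ‖) (𝓝[closedSector ω h \ {0}] 0) (𝓝 0) := by
        simpa using hlim.add hlim
      refine squeeze_zero (fun _ => norm_nonneg _) (fun ξ => ?_) hlim2
      have e1 : ((1 - ‖z ξ‖) * z ξ + ‖z ξ‖ ^ 2 : ℂ) / z ξ - 1 =
          -(‖z ξ‖ : ℂ) + (‖z ξ‖ : ℂ) ^ 2 / z ξ := by
        field_simp [hz ξ]; ring
      rw [e1]
      refine (norm_add_le _ _).trans (le_of_eq ?_)
      have : ‖z ξ‖ ≠ 0 := norm_ne_zero_iff.mpr (hz ξ)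
      rw [norm_neg, norm_div, norm_pow, Complex.norm_real, norm_norm]
      field_simp
    rcases lt_or_gt_of_ne (hμ k) with hk | hk
    · have hl := tendsto_norm_sectorPow ω h (ν := -μ k) (by simpa using hk)
      have hlt : ∀ᶠ ξ : ℂ in 𝓝[closedSector ω h \ {0}] 0, ‖sectorPow ω ξ (-μ k)‖ < 1 :=
        hl.eventually (gt_mem_nhds one_pos)
      have h1 := ((haux _ (fun ξ => hne ξ _) hl).inv₀ one_ne_zero).mul hexp
      rw [inv_one, one_mul] at h1
      refine h1.congr' ?_
      filter_upwards [hsmall, hlt] with ξ h2 h3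
      have h4 : ¬ ‖sectorPow ω ξ (μ k)‖ ≤ 1 := by
        rw [← hneg, norm_inv] at h3
        intro h5
        have h6 : 0 < ‖sectorPow ω ξ (μ k)‖ := norm_pos_iff.mpr (hne _ _)
        exact absurd h3 (not_lt.mpr ((one_le_inv₀ h6).mpr h5))
      simp only [explicitWeight, h2, if_true, weightZero, h4, if_false, hneg]
      rw [inv_div, div_eq_mul_inv (sectorPow ω ξ (-μ k)), div_eq_mul_inv, hneg]
      ring
    · have hl := tendsto_norm_sectorPow ω h hk
      have hlt : ∀ᶠ ξ : ℂ in 𝓝[closedSector ω h \ {0}] 0, ‖sectorPow ω ξ (μ k)‖ < 1 :=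
        hl.eventually (gt_mem_nhds one_pos)
      have h1 := (haux _ (fun ξ => hne ξ _) hl).mul hexp
      rw [one_mul] at h1
      refine h1.congr' ?_
      filter_upwards [hsmall, hlt] with ξ h2 h3
      simp only [explicitWeight, h2, if_true, weightZero, h3.le, if_true]
      ring

/-! ### The exterior algebra -/

/-- The exterior algebra of `ℂⁿ`. -/
abbrev Ext (n : ℕ) : Type := ExteriorAlgebra ℂ (Fin n → ℂ)

/-- `u_α = u_{α_1} ∧ … ∧ u_{α_m}` for `α = {α_1 < … < α_m}`. -/
def wedge (u : Fin n → Fin n → ℂ) (α : Finset (Fin n)) : Ext n :=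
  ((α.sort (· ≤ ·)).map fun j => ExteriorAlgebra.ι ℂ (u j)).prod

/-- The number `|h|` with `h = |h| 𝔢_1 ∧ … ∧ 𝔢_n` for `h` of degree `n`
(extended by `0` to the components of other degrees). -/
def topCoeff (n : ℕ) : Ext n →ₗ[ℂ] ℂ :=
  ExteriorAlgebra.liftAlternating (R := ℂ) (M := Fin n → ℂ) (N := ℂ)
    (Pi.single n (Matrix.detRowAlternating (n := Fin n) (R := ℂ)))

/-- The operator `V^{(m)}`, for all `m` at once: the derivation of the exterior algebra that
extends the matrix `V`. -/
def derivExt (V : Matrix (Fin n) (Fin n) ℂ) (Y : Ext n) : Ext n :=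
  ∑ i, ∑ j, V i j • (ExteriorAlgebra.ι ℂ (Pi.single i 1 : Fin n → ℂ) *
    CliffordAlgebra.contractLeft (Q := (0 : QuadraticForm ℂ (Fin n → ℂ)))
      (LinearMap.proj j : (Fin n → ℂ) →ₗ[ℂ] ℂ) Y)

theorem derivExt_one (V : Matrix (Fin n) (Fin n) ℂ) : derivExt V (1 : Ext n) = 0 := by
  simp [derivExt, CliffordAlgebra.contractLeft_one]

/-- With `derivExt_one`: `V^{(m)} (v_1 ∧ … ∧ v_m) = ∑ j, v_1 ∧ … ∧ V v_j ∧ … ∧ v_m`. -/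
theorem derivExt_ι_mul (V : Matrix (Fin n) (Fin n) ℂ) (v : Fin n → ℂ) (Y : Ext n) :
    derivExt V (ExteriorAlgebra.ι ℂ v * Y) =
      ExteriorAlgebra.ι ℂ (V.mulVec v) * Y + ExteriorAlgebra.ι ℂ v * derivExt V Y := by
  have hV : V.mulVec v = ∑ i, ∑ j, (V i j * v j) • (Pi.single i 1 : Fin n → ℂ) := by
    ext i
    simp [Matrix.mulVec, dotProduct, Finset.sum_apply, Pi.single_apply]
  have key : ∀ i j : Fin n, V i j • (ExteriorAlgebra.ι ℂ (Pi.single i 1 : Fin n → ℂ) *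
      CliffordAlgebra.contractLeft (Q := (0 : QuadraticForm ℂ (Fin n → ℂ)))
        (LinearMap.proj j : (Fin n → ℂ) →ₗ[ℂ] ℂ) (ExteriorAlgebra.ι ℂ v * Y)) =
      (V i j * v j) • (ExteriorAlgebra.ι ℂ (Pi.single i 1 : Fin n → ℂ) * Y) +
      ExteriorAlgebra.ι ℂ v * (V i j • (ExteriorAlgebra.ι ℂ (Pi.single i 1 : Fin n → ℂ) *
      CliffordAlgebra.contractLeft (Q := (0 : QuadraticForm ℂ (Fin n → ℂ)))
        (LinearMap.proj j : (Fin n → ℂ) →ₗ[ℂ] ℂ) Y)) := by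
    intro i j
    have h1 := CliffordAlgebra.contractLeft_ι_mul (Q := (0 : QuadraticForm ℂ (Fin n → ℂ)))
      (LinearMap.proj j : (Fin n → ℂ) →ₗ[ℂ] ℂ) v Y
    have h2 := ExteriorAlgebra.ι_add_mul_swap (R := ℂ) (Pi.single i 1 : Fin n → ℂ) v
    have h3 := eq_neg_of_add_eq_zero_left h2
    change CliffordAlgebra.contractLeft (Q := (0 : QuadraticForm ℂ (Fin n → ℂ))) _
      (ExteriorAlgebra.ι ℂ v * Y) = _ • Y - ExteriorAlgebra.ι ℂ v * _ at h1
    rw [h1, mul_sub, ← mul_assoc, h3, mul_smul_comm, smul_sub, smul_smul, neg_mul, smul_neg,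
      sub_neg_eq_add, mul_smul_comm, mul_assoc]
    rfl
  simp only [derivExt, key, Finset.sum_add_distrib, ← Finset.mul_sum, hV, map_sum, map_smul,
    Finset.sum_mul, smul_mul_assoc]

/-- `|v_1 ∧ … ∧ v_n|` is the determinant of the matrix of the `v_j`. -/
theorem topCoeff_ιMulti (v : Fin n → Fin n → ℂ) :
    topCoeff n (ExteriorAlgebra.ιMulti ℂ n v) = (Matrix.of v).det := by
  rw [topCoeff, ExteriorAlgebra.liftAlternating_apply_ιMulti, Pi.single_eq_same]
  rfl

/-- The operator `G_m(x, t, ρ)`. -/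
def green (μ : Fin n → ℂ) (ω : ℝ) (chat : Fin n → ℂ → Fin n → ℂ) (m : ℕ) (x t : ℝ) (ρ : ℂ)
    (f : Ext n) : Ext n :=
  ∑ α ∈ Finset.powersetCard m (Finset.univ : Finset (Fin n)),
    (topCoeff n (wedge (fun j => chat j 0) α * wedge (fun j => chat j 0) αᶜ) *
      topCoeff n (f * wedge (fun j => frob ω μ chat j (ρ * t)) αᶜ)) •
        wedge (fun j => frob ω μ chat j (ρ * x)) α

/-! ### Potentials and function spaces -/

/-- Lebesgue measure on `(0, ∞)`. -/
abbrev halfLine : Measure ℝ := volume.restrict (Ioi 0)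

/-- The space of all off-diagonal matrix functions with entries in `L_1(0,∞) ∩ L_p(0,∞)`, an
element of `L_1 ∩ L_p` being a pair of equal elements of `L_1` and of `L_p`; the topology is that
of the norm `max (‖·‖_1, ‖·‖_p)` of the entries. -/
abbrev Potential (n : ℕ) (p : ℝ≥0∞) [Fact (1 ≤ p)] : Type :=
  {Q : Fin n → Fin n → Lp ℂ 1 halfLine × Lp ℂ p halfLine //
    (∀ i j, ⇑(Q i j).1 =ᵐ[halfLine] ⇑(Q i j).2) ∧ ∀ i, Q i i = 0}

/-- The matrix `q(t)`. -/
def Potential.mat {p : ℝ≥0∞} [Fact (1 ≤ p)] (q : Potential n p) (t : ℝ) :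
    Matrix (Fin n) (Fin n) ℂ :=
  Matrix.of fun i j => (q.1 i j).1 t

/-- The ray `{z t : t ≥ 0}`. -/
def ray (z : ℂ) : Set ℂ := Set.range fun t : ℝ≥0 => z * (t : ℝ)

/-- The arc length on a ray. -/
def rayMeasure (z : ℂ) : Measure (ray z) :=
  ENNReal.ofReal ‖z‖ •
    (volume.restrict (Ici (0 : ℝ))).map
      fun t : ℝ => (⟨z * ((t.toNNReal : ℝ≥0) : ℝ), t.toNNReal, rfl⟩ : ray z)

/-- The space `C_0(l) ∩ L_2(l)` for the ray `l` through `z`, with the topology of the maximum of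
the two norms. -/
abbrev RaySpace (z : ℂ) : Type :=
  {u : C₀(ray z, ℂ) × Lp ℂ 2 (rayMeasure z) // ⇑u.2 =ᵐ[rayMeasure z] ⇑u.1}

/-- The space `C(X_p, BC([0,∞), C_0(closed sector)))`. -/
abbrev SectorClass (n : ℕ) (p : ℝ≥0∞) [Fact (1 ≤ p)] (ω h : ℝ) : Type :=
  C(Potential n p, ℝ≥0 →ᵇ C₀(closedSector ω h, ℂ))

/-- The restriction of `d` to the ray through `z` belongs to
`C(X_p, BC([0,∞), C_0(l) ∩ L_2(l)))`. -/
def RestrictsToRay {p : ℝ≥0∞} [Fact (1 ≤ p)] {ω h : ℝ} (d : SectorClass n p ω h) (z : ℂ) : Prop :=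
  ∃ D : C(Potential n p, ℝ≥0 →ᵇ RaySpace z),
    ∀ (q : Potential n p) (x : ℝ≥0) (ρ : ℂ) (hl : ρ ∈ ray z) (hs : ρ ∈ closedSector ω h),
      (D q x).1.1 ⟨ρ, hl⟩ = d q x ⟨ρ, hs⟩

/-! ### Fundamental tensors -/

/-- `Y` is the fundamental tensor `T_k(·, ρ)`. The equation and the estimate are written for all
linear functionals `φ`, that is, coordinatewise. -/
structure IsTensorT (b μ : Fin n → ℂ) (ω : ℝ) (σ : Equiv.Perm (Fin n))
    (chat : Fin n → ℂ → Fin n → ℂ) (q : ℝ → Matrix (Fin n) (Fin n) ℂ) (ρ : ℂ) (k : Fin n)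
    (Y : ℝ → Ext n) : Prop where
  mem : ∀ x > 0, Y x ∈ ⋀[ℂ]^(n - k.val) (Fin n → ℂ)
  integrable : ∀ φ : Module.Dual ℂ (Ext n), ∀ x > 0,
    IntegrableOn (fun t => φ (green μ ω chat (n - k.val) x t ρ (derivExt (q t) (Y t)))) (Ioc 0 x)
  eqn : ∀ φ : Module.Dual ℂ (Ext n), ∀ x > 0,
    φ (Y x) = φ (wedge (fun j => frob ω μ chat j (ρ * x)) (Finset.univ.filter (k ≤ ·))) +
      ∫ t in Ioc 0 x, φ (green μ ω chat (n - k.val) x t ρ (derivExt (q t) (Y t)))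
  bound : ∀ φ : Module.Dual ℂ (Ext n), ∃ M : ℝ, ∀ x > 0,
    ‖φ (Y x)‖ ≤ M * if ‖ρ * x‖ ≤ 1
      then ‖sectorPow ω (ρ * x) (∑ j with k ≤ j, μ j)‖
      else ‖Complex.exp (ρ * x * ∑ j with k ≤ j, b (σ j))‖

/-- `Y` is the fundamental tensor `F_m(·, ρ)`, `0 ≤ m ≤ n` (with `F_0 = 1`). -/
structure IsTensorF (b μ : Fin n → ℂ) (ω : ℝ) (σ : Equiv.Perm (Fin n))
    (chat e : Fin n → ℂ → Fin n → ℂ) (q : ℝ → Matrix (Fin n) (Fin n) ℂ) (ρ : ℂ) (m : ℕ)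
    (Y : ℝ → Ext n) : Prop where
  mem : ∀ x > 0, Y x ∈ ⋀[ℂ]^m (Fin n → ℂ)
  integrable : ∀ φ : Module.Dual ℂ (Ext n), ∀ x > 0,
    IntegrableOn (fun t => φ (green μ ω chat m x t ρ (derivExt (q t) (Y t)))) (Ioi x)
  eqn : ∀ φ : Module.Dual ℂ (Ext n), ∀ x > 0,
    φ (Y x) = φ (wedge (fun j => e j (ρ * x)) (Finset.univ.filter (·.val < m))) -
      ∫ t in Ioi x, φ (green μ ω chat m x t ρ (derivExt (q t) (Y t)))
  bound : ∀ φ : Module.Dual ℂ (Ext n), ∃ M : ℝ, ∀ x > 0,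
    ‖φ (Y x)‖ ≤ M * if ‖ρ * x‖ ≤ 1
      then ‖sectorPow ω (ρ * x) (∑ j with j.val < m, μ j)‖
      else ‖Complex.exp (ρ * x * ∑ j with j.val < m, b (σ j))‖

/-- The characteristic function `Δ_k = |F_{k-1} ∧ T_k|`, `Δ_1 = 1`. The index `k : Fin n` here is
the usual index minus one, so that `F k.val` stands for `F_{k-1}`. -/
def charFun (F : ℕ → ℝ → Ext n) (T : Fin n → ℝ → Ext n) (k : Fin n) (x : ℝ) : ℂ :=
  if k.val = 0 then 1 else topCoeff n (F k.val x * T k x)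

/-! ### Weyl-type solutions -/

/-- `y` is a `k`-th Weyl-type solution of `y' - x⁻¹ A y - q(x) y = ρ B y`, `x > 0`. -/
structure IsWeylType (A : Matrix (Fin n) (Fin n) ℂ) (b μ : Fin n → ℂ) (σ : Equiv.Perm (Fin n))
    (q : ℝ → Matrix (Fin n) (Fin n) ℂ) (ρ : ℂ) (k : Fin n) (y : ℝ → Fin n → ℂ) : Prop where
  continuousOn : ContinuousOn y (Ioi 0)
  eqn : ∀ x₁ > 0, ∀ x₂ ≥ x₁, y x₂ - y x₁ =
    ∫ t in x₁..x₂, ((t : ℂ)⁻¹ • A + q t + ρ • Matrix.diagonal b).mulVec (y t)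
  zero : y =O[𝓝[>] 0] fun x : ℝ => (x : ℂ) ^ μ k
  infty : Tendsto (fun x : ℝ => Complex.exp (-(ρ * b (σ k) * x)) • y x) atTop
    (𝓝 (Pi.single (σ k) 1))

/-- For every `x`, `y x` solves the linear system `F_{k-1} ∧ y = F_k`, `y ∧ T_k = 0`. -/
def SolvesTensorSystem (F : ℕ → ℝ → Ext n) (T : Fin n → ℝ → Ext n) (k : Fin n)
    (y : ℝ → Fin n → ℂ) : Prop :=
  ∀ x > 0, F k.val x * ExteriorAlgebra.ι ℂ (y x) = F (k.val + 1) x ∧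
    ExteriorAlgebra.ι ℂ (y x) * T k x = 0

/-- The matrix `W(ξ) = diag (W_1(ξ), …, W_n(ξ))`. -/
def weightMatrix (W : Fin n → ℂ → ℂ) (ξ : ℂ) : Matrix (Fin n) (Fin n) ℂ :=
  Matrix.diagonal fun k => W k ξ

/-- The matrix `β = Ψ̃_0⁻¹ Ψ̃`, where `Ψ̃_0 = Ψ_0(x, ρ) W(ρ x)⁻¹`, `Ψ_0(x, ρ) = ψ_0(ρ x)` and
`Ψ̃ = Ψ W(ρ x)⁻¹`. -/
def beta (W : Fin n → ℂ → ℂ) (ψ : Fin n → ℂ → Fin n → ℂ) (Ψ : ℝ → Matrix (Fin n) (Fin n) ℂ)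
    (x : ℝ) (ρ : ℂ) : Matrix (Fin n) (Fin n) ℂ :=
  (ofCols (fun k => ψ k (ρ * x)) * (weightMatrix W (ρ * x))⁻¹)⁻¹ *
    (Ψ x * (weightMatrix W (ρ * x))⁻¹)

end WeylSystem

end

/-!
Dividing the tensors `F_m`, `T_k` by products of weights turns their equations into Volterra
equations (`volterra`) with a kernel `kernel` and a leading term `base` that are bounded and
continuous in `(x, ρ)` up to `ρ x = 0`. The two families are treated at once: `up = true` stands for
`F_m`, with integrals over `(x, ∞)`, and `up = false` for `T_k`, with integrals over `(0, x)`. A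
Gronwall estimate gives existence, uniqueness and joint continuity of the normalised tensors
(`exists_isTensorFamily`, `IsTensor.eq`), and bounds the difference between a normalised tensor and
its leading term by the first-order term of the iteration (`IsTensorFamily.exists_pert_le`).

The main point is the decay of the first-order term as `ρ → ∞`. The part with `|ρ t| ≤ 1` and the
error made by replacing `e_k` by its leading exponential are at most a multiple of the weakly damped
integral `weakMass`. What is left is a sum of oscillatory integrals `osc` of the entries `q_{ij}`,
`i ≠ j`. The coefficient of such an integral is a matrix element between eigenvectors of `B^{(m)}`,
and it vanishes unless the two eigenvalues differ by `b_i - b_j` (`RSum_sub_of_elemLim_ne_zero`); so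
the exponents are distinct whenever the integral occurs, and the Riemann-Lebesgue lemma applies
(`osc_decay`). On a ray either the exponential is damped, and the `L²` bound is an instance of the
Schur test, or it is purely oscillatory, and the bound is Plancherel's theorem
(`exists_lintegral_osc_sq_le`); the Schur test also bounds `weakMass`. This is where `p > 2` enters,
through `L₁ ∩ L_p ⊂ L₂`.

Families with the resulting decay, `L²` tails and continuous dependence on `q` are called good
(`IsGood`). Good families form a module over the regular ones (`IsReg`), the perturbations of the
normalised tensors are good (`IsTensorFamily.isGood`), and good families define elements of
`C(X_p, BC([0,∞), C₀))` whose restrictions to rays have the additional `L²` property.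

Finally, if `F_{k-1} ∧ y = F_k` and `y ∧ T_k = 0`, then contraction of `y ∧ T_k` with a linear form
`φ` gives Cramer's rule `φ(y) |F_{k-1} ∧ T_k| = |F_k ∧ (φ ⌋ T_k)|`. With the rows of `Ψ̃₀⁻¹` as `φ`
this expresses `β_{jk}` as a quotient of bilinear expressions in normalised tensors
(`beta_mul_topCoeff`), which for `q = 0` are `δ_{jk}` and `1` up to a common factor. A Weyl-type
solution satisfies the same linear system: `F_{k-1} ∧ Ψ_k - F_k` and `Ψ_k ∧ T_k` solve the equation
induced on the exterior algebra and are too small at one end of the half-line, hence vanish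
(`SolvesExt.eq_zero`).
-/

noncomputable section

namespace WeylSystem

variable {n : ℕ}

open ENNReal (ofReal ofReal_mul ofReal_ne_top ofReal_le_ofReal ofReal_add ofReal_pow
  mul_ne_top pow_ne_top)
open ExteriorAlgebra (ι)
open Complex (exp norm_real re_ofReal_mul exp_add exp_ne_zero sub_re norm_exp exp_sum exp_zero
  re_sum exp_neg)
open Finset (sum_congr smul_sum mem_filter mul_sum mem_powersetCard sum_nonneg mem_sort
  single_le_sum sum_le_sum sum_mul sum_eq_zero sum_smul sum_add_distrib)
open Real (norm_of_nonneg coe_toNNReal)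

/-! ### The exterior algebra: bases, top coefficients, derivations -/

/-- The standard basis vectors of `ℂⁿ`. -/
def stdVec (n : ℕ) : Fin n → Fin n → ℂ := fun j => Pi.single j 1

/-- The basis of the exterior algebra formed by the products of standard basis vectors. -/
abbrev extBasis (n : ℕ) : Module.Basis (Finset (Fin n)) ℂ (Ext n) :=
  (Pi.basisFun ℂ (Fin n)).ExteriorAlgebra

lemma wedge_eq_ιMulti (u : Fin n → Fin n → ℂ) (α : Finset (Fin n)) :
    wedge u α = ExteriorAlgebra.ιMulti ℂ α.card (u ∘ α.orderEmbOfFin rfl) := by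
  rw [wedge, ExteriorAlgebra.ιMulti_apply]
  congr 1
  apply List.ext_getElem
  · simp
  · intro i h1 h2
    simp [Finset.orderEmbOfFin_apply]

lemma wedge_mem (u : Fin n → Fin n → ℂ) (α : Finset (Fin n)) :
    wedge u α ∈ ⋀[ℂ]^α.card (Fin n → ℂ) := by
  rw [wedge_eq_ιMulti]
  exact ExteriorAlgebra.ιMulti_range ℂ _ ⟨_, rfl⟩

lemma wedge_stdVec (α : Finset (Fin n)) : wedge (stdVec n) α = extBasis n α := by
  rw [wedge_eq_ιMulti, ExteriorAlgebra.basis_apply_ofCard (Pi.basisFun ℂ (Fin n))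
    (rfl : α.card = _),
    ExteriorAlgebra.ιMulti_family]
  congr 1
  ext i j
  simp [stdVec, Set.powersetCard.ofFinEmbEquiv_symm_apply]

lemma map_wedge (f : (Fin n → ℂ) →ₗ[ℂ] (Fin n → ℂ)) (u : Fin n → Fin n → ℂ) (α : Finset (Fin n)) :
    ExteriorAlgebra.map f (wedge u α) = wedge (fun j => f (u j)) α := by
  simp only [wedge, map_list_prod, List.map_map]
  congr 2
  ext j
  simp

@[simp] lemma wedge_empty (u : Fin n → Fin n → ℂ) : wedge u ∅ = 1 := by
  simp [wedge]

lemma toLin'_stdVec (u : Fin n → Fin n → ℂ) (j : Fin n) :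
    Matrix.toLin' (ofCols u) (stdVec n j) = u j := by
  ext i
  simp [stdVec, ofCols, Matrix.mulVec_single]

lemma wedge_eq_map (u : Fin n → Fin n → ℂ) (α : Finset (Fin n)) :
    wedge u α = ExteriorAlgebra.map (Matrix.toLin' (ofCols u)) (wedge (stdVec n) α) := by
  rw [map_wedge]
  simp only [toLin'_stdVec]

lemma topCoeff_map (M : Matrix (Fin n) (Fin n) ℂ) (Z : Ext n) :
    topCoeff n (ExteriorAlgebra.map (Matrix.toLin' M) Z) = M.det * topCoeff n Z := by
  have : (topCoeff n).comp (ExteriorAlgebra.map (Matrix.toLin' M)).toLinearMap =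
      M.det • topCoeff n := by
    apply ExteriorAlgebra.lhom_ext
    intro i
    ext v
    by_cases hi : i = n
    · subst hi
      simp only [LinearMap.compAlternatingMap_apply, LinearMap.comp_apply, AlgHom.toLinearMap_apply,
        ExteriorAlgebra.map_apply_ιMulti, LinearMap.smul_apply, topCoeff_ιMulti]
      have : (Matrix.of (⇑(Matrix.toLin' M) ∘ v)) = Matrix.of v * M.transpose := by
        ext a b
        simp [Matrix.mul_apply, Matrix.mulVec, dotProduct, mul_comm]
      rw [this, Matrix.det_mul, Matrix.det_transpose, smul_eq_mul, mul_comm]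
    · simp only [LinearMap.compAlternatingMap_apply, LinearMap.comp_apply,
        AlgHom.toLinearMap_apply, ExteriorAlgebra.map_apply_ιMulti, LinearMap.smul_apply, topCoeff,
        ExteriorAlgebra.liftAlternating_apply_ιMulti, Pi.single_eq_of_ne hi]
      simp
  exact LinearMap.congr_fun this Z

/-- `topCoeff` vanishes on the components of degree `m ≠ n`. -/
lemma topCoeff_of_mem {m : ℕ} (hm : m ≠ n) {Z : Ext n} (hZ : Z ∈ ⋀[ℂ]^m (Fin n → ℂ)) :
    topCoeff n Z = 0 := by
  rw [← ExteriorAlgebra.ιMulti_span_fixedDegree] at hZ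
  induction hZ using Submodule.span_induction with
  | mem x hx =>
    obtain ⟨v, rfl⟩ := hx
    rw [topCoeff, ExteriorAlgebra.liftAlternating_apply_ιMulti, Pi.single_eq_of_ne hm]
    rfl
  | zero => simp
  | add x y _ _ hx hy => rw [map_add, hx, hy, add_zero]
  | smul a x _ hx => rw [map_smul, hx, smul_zero]

lemma topCoeff_wedge_univ (u : Fin n → Fin n → ℂ) :
    topCoeff n (wedge u Finset.univ) = (ofCols u).det := by
  rw [wedge_eq_map, topCoeff_map]
  suffices topCoeff n (wedge (stdVec n) Finset.univ) = 1 by rw [this, mul_one]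
  have : wedge (stdVec n) Finset.univ = ExteriorAlgebra.ιMulti ℂ n (stdVec n) := by
    rw [wedge, ExteriorAlgebra.ιMulti_apply, Fin.sort_univ, List.ofFn_eq_map]
  rw [this, topCoeff_ιMulti]
  have : Matrix.of (stdVec n) = 1 := by
    ext i j
    simp [stdVec, Matrix.one_apply, Pi.single_apply, eq_comm]
  rw [this, Matrix.det_one]

/-- The sign `|𝔢_α ∧ 𝔢_{α'}|`. -/
def shuffleSign (α : Finset (Fin n)) : ℂ :=
  topCoeff n (wedge (stdVec n) α * wedge (stdVec n) αᶜ)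

lemma shuffleSign_mul_self (α : Finset (Fin n)) : shuffleSign α * shuffleSign α = 1 := by
  have hd : Disjoint (⟨α, rfl⟩ : Set.powersetCard (Fin n) α.card).val
      (⟨αᶜ, rfl⟩ : Set.powersetCard (Fin n) αᶜ.card).val := disjoint_compl_right
  have h := ExteriorAlgebra.basis_mul_of_disjoint (Pi.basisFun ℂ (Fin n)) _ _ hd
  have hu : (Set.powersetCard.disjUnion hd : Finset (Fin n)) = Finset.univ := by
    simp [Set.powersetCard.disjUnion]
  rw [hu] at h
  have h2 : shuffleSign α = ((Set.powersetCard.permOfDisjoint hd).sign : ℤ) := by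
    rw [shuffleSign, wedge_stdVec, wedge_stdVec]
    rw [h, Units.smul_def, map_zsmul, ← wedge_stdVec, topCoeff_wedge_univ]
    have : ofCols (stdVec n) = 1 := by
      ext i j
      simp [ofCols, stdVec, Matrix.one_apply, Pi.single_apply]
    rw [this, Matrix.det_one, zsmul_eq_mul, mul_one]
  rw [h2]
  rcases Int.units_eq_one_or (Set.powersetCard.permOfDisjoint hd).sign with h | h <;> simp [h]

lemma topCoeff_wedge_mul_compl (u : Fin n → Fin n → ℂ) (α : Finset (Fin n)) :
    topCoeff n (wedge u α * wedge u αᶜ) = shuffleSign α * (ofCols u).det := by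
  rw [wedge_eq_map u α, wedge_eq_map u αᶜ, ← map_mul, topCoeff_map, shuffleSign, mul_comm]

lemma wedge_mul_of_not_disjoint (u : Fin n → Fin n → ℂ) {α β : Finset (Fin n)}
    (h : ¬ Disjoint α β) : wedge u α * wedge u β = 0 := by
  have h0 := ExteriorAlgebra.basis_mul_of_not_disjoint (Pi.basisFun ℂ (Fin n))
    (⟨α, rfl⟩ : Set.powersetCard (Fin n) α.card) (⟨β, rfl⟩ : Set.powersetCard (Fin n) β.card) h
  change extBasis n α * extBasis n β = 0 at h0
  rw [wedge_eq_map u α, wedge_eq_map u β, ← map_mul, wedge_stdVec, wedge_stdVec, h0, map_zero]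

lemma wedge_singleton (u : Fin n → Fin n → ℂ) (j : Fin n) :
    wedge u {j} = ι ℂ (u j) := by simp [wedge]

lemma wedge_mul_compl_of_ne (u : Fin n → Fin n → ℂ) {α β : Finset (Fin n)}
    (hc : α.card = β.card) (h : β ≠ α) : wedge u β * wedge u αᶜ = 0 := by
  refine wedge_mul_of_not_disjoint u fun hd => h (Finset.eq_of_subset_of_card_le (fun x hx => ?_)
    hc.le)
  by_contra hxa
  exact Finset.disjoint_left.mp hd hx (Finset.mem_compl.mpr hxa)

/-- The products of `m` standard basis vectors span the component of degree `m`. -/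
lemma span_wedge_stdVec (m : ℕ) : Submodule.span ℂ
    {Z : Ext n | ∃ α : Finset (Fin n), α.card = m ∧ Z = wedge (stdVec n) α} =
      ⋀[ℂ]^m (Fin n → ℂ) := by
  apply le_antisymm
  · rw [Submodule.span_le]
    rintro _ ⟨α, rfl, rfl⟩
    exact wedge_mem _ _
  · intro Z hZ
    have := ((Pi.basisFun ℂ (Fin n)).exteriorPower m).mem_span ⟨Z, hZ⟩
    have h2 := Submodule.mem_map_of_mem (f := (⋀[ℂ]^m (Fin n → ℂ)).subtype) this
    rw [Submodule.map_span] at h2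
    refine Submodule.span_mono ?_ h2
    rintro _ ⟨_, ⟨s, rfl⟩, rfl⟩
    refine ⟨s.1, s.2, ?_⟩
    rw [wedge_stdVec, Submodule.subtype_apply, ← ExteriorAlgebra.basis_eq_coe_basis]

lemma map_mem {m : ℕ} (f : (Fin n → ℂ) →ₗ[ℂ] (Fin n → ℂ)) {Z : Ext n}
    (hZ : Z ∈ ⋀[ℂ]^m (Fin n → ℂ)) : ExteriorAlgebra.map f Z ∈ ⋀[ℂ]^m (Fin n → ℂ) := by
  rw [← ExteriorAlgebra.ιMulti_span_fixedDegree] at hZ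
  induction hZ using Submodule.span_induction with
  | mem x hx =>
    obtain ⟨v, rfl⟩ := hx
    rw [ExteriorAlgebra.map_apply_ιMulti]
    exact ExteriorAlgebra.ιMulti_range ℂ _ ⟨_, rfl⟩
  | zero => simp
  | add x y _ _ hx hy => rw [map_add]; exact Submodule.add_mem _ hx hy
  | smul a x _ hx => rw [map_smul]; exact Submodule.smul_mem _ _ hx

/-- The map `f ↦ ∑ |f ∧ u_{α'}| v_α` with shuffle signs; it sends `u_α` to `v_α` up to the factor
`det u`. -/
def transfer (m : ℕ) (u v : Fin n → Fin n → ℂ) (f : Ext n) : Ext n :=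
  ∑ α ∈ Finset.powersetCard m .univ, (shuffleSign α * topCoeff n (f * wedge u αᶜ)) • wedge v α

lemma transfer_wedge {m : ℕ} (u v : Fin n → Fin n → ℂ) {β : Finset (Fin n)} (hβ : β.card = m) :
    transfer m u v (wedge u β) = (ofCols u).det • wedge v β := by
  rw [transfer, Finset.sum_eq_single β]
  · rw [topCoeff_wedge_mul_compl, ← mul_assoc, shuffleSign_mul_self, one_mul]
  · intro α hα hne
    rw [wedge_mul_compl_of_ne u ((mem_powersetCard.mp hα).2.trans hβ.symm) hne.symm]
    simp
  · intro h
    exact absurd (mem_powersetCard.mpr ⟨Finset.subset_univ _, hβ⟩) h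

lemma transfer_stdVec {m : ℕ} {f : Ext n} (hf : f ∈ ⋀[ℂ]^m (Fin n → ℂ)) :
    transfer m (stdVec n) (stdVec n) f = f := by
  have h1 : (ofCols (stdVec n)).det = 1 := by
    have : ofCols (stdVec n) = 1 := by
      ext i j
      simp [ofCols, stdVec, Matrix.one_apply, Pi.single_apply]
    rw [this, Matrix.det_one]
  rw [← span_wedge_stdVec] at hf
  induction hf using Submodule.span_induction with
  | mem x hx =>
    obtain ⟨α, h, rfl⟩ := hx
    rw [transfer_wedge _ _ h, h1, one_smul]
  | zero => simp [transfer]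
  | add x y _ _ hx hy =>
    rw [← hx, ← hy]
    simp only [hx, hy]
    conv_rhs => rw [← hx, ← hy]
    simp only [transfer, add_mul, map_add, mul_add, add_smul, sum_add_distrib]
  | smul a x _ hx =>
    conv_rhs => rw [← hx]
    simp only [transfer, smul_mul_assoc, map_smul, smul_eq_mul, smul_sum, smul_smul]
    refine sum_congr rfl fun α _ => ?_
    congr 1
    ring

/-- On the component of degree `m`, `transfer` is, up to the factor `det u`, the action of the
linear map that sends the vectors `u_j` to `v_j`. -/
lemma transfer_eq_map {m : ℕ} {u v : Fin n → Fin n → ℂ} (hu : (ofCols u).det ≠ 0) {f : Ext n}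
    (hf : f ∈ ⋀[ℂ]^m (Fin n → ℂ)) :
    transfer m u v f = (ofCols u).det •
      ExteriorAlgebra.map (Matrix.toLin' (ofCols v * (ofCols u)⁻¹)) f := by
  have hunit : IsUnit (ofCols u).det := isUnit_iff_ne_zero.mpr hu
  set g := ExteriorAlgebra.map (Matrix.toLin' (ofCols u)⁻¹) f with hg
  have hgm : g ∈ ⋀[ℂ]^m (Fin n → ℂ) := map_mem _ hf
  have hcomp : ∀ M N : Matrix (Fin n) (Fin n) ℂ, ∀ Z : Ext n,
      ExteriorAlgebra.map (Matrix.toLin' M) (ExteriorAlgebra.map (Matrix.toLin' N) Z) =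
        ExteriorAlgebra.map (Matrix.toLin' (M * N)) Z := by
    intro M N Z
    rw [Matrix.toLin'_mul, ← ExteriorAlgebra.map_comp_map]
    rfl
  have hfg : f = ExteriorAlgebra.map (Matrix.toLin' (ofCols u)) g := by
    rw [hg, hcomp, Matrix.mul_nonsing_inv _ hunit, Matrix.toLin'_one, ExteriorAlgebra.map_id]
    rfl
  have h1 : transfer m u v f = (ofCols u).det •
      ExteriorAlgebra.map (Matrix.toLin' (ofCols v)) (transfer m (stdVec n) (stdVec n) g) := by
    simp only [transfer, map_sum, map_smul, smul_sum, smul_smul]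
    refine sum_congr rfl fun α _ => ?_
    rw [hfg, wedge_eq_map u αᶜ, ← map_mul, topCoeff_map, ← wedge_eq_map]
    congr 1
    ring
  rw [h1, transfer_stdVec hgm, hg, hcomp]

lemma transfer_self {m : ℕ} {u : Fin n → Fin n → ℂ} (hu : (ofCols u).det ≠ 0) {f : Ext n}
    (hf : f ∈ ⋀[ℂ]^m (Fin n → ℂ)) : transfer m u u f = (ofCols u).det • f := by
  rw [transfer_eq_map hu hf, Matrix.mul_nonsing_inv _ (isUnit_iff_ne_zero.mpr hu),
    Matrix.toLin'_one, ExteriorAlgebra.map_id]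
  rfl

/-- In the exterior algebra of `ℂⁿ` there is nothing of degree `n + 1`. -/
lemma eq_zero_of_mem_succ {Z : Ext n} (hZ : Z ∈ ⋀[ℂ]^(n + 1) (Fin n → ℂ)) : Z = 0 := by
  rw [← span_wedge_stdVec] at hZ
  have : {Z : Ext n | ∃ α : Finset (Fin n), α.card = n + 1 ∧ Z = wedge (stdVec n) α} = ∅ := by
    ext Z
    simp only [mem_ofPred_eq, mem_empty_iff_false, iff_false, not_exists, not_and]
    intro α hα
    have := Finset.card_le_univ α
    simp only [Fintype.card_fin] at this
    omega
  rw [this] at hZ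
  simpa using hZ

lemma eq_smul_one_of_mem_zero {Z : Ext n} (hZ : Z ∈ ⋀[ℂ]^0 (Fin n → ℂ)) :
    ∃ a : ℂ, Z = a • (1 : Ext n) := by
  rw [ExteriorAlgebra.exteriorPower, pow_zero] at hZ
  obtain ⟨a, ha⟩ := Submodule.mem_one.mp hZ
  exact ⟨a, by rw [← ha, Algebra.algebraMap_eq_smul_one]⟩

lemma mul_mem_ext {l m : ℕ} {X Y : Ext n} (hX : X ∈ ⋀[ℂ]^l (Fin n → ℂ))
    (hY : Y ∈ ⋀[ℂ]^m (Fin n → ℂ)) : X * Y ∈ ⋀[ℂ]^(l + m) (Fin n → ℂ) :=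
  SetLike.mul_mem_graded hX hY

lemma ι_mem_ext (v : Fin n → ℂ) : ι ℂ v ∈ ⋀[ℂ]^1 (Fin n → ℂ) := by
  rw [ExteriorAlgebra.exteriorPower, pow_one]
  exact LinearMap.mem_range_self _ _

/-- Contraction with a covector `φ`. -/
def contract (φ : Module.Dual ℂ (Fin n → ℂ)) : Ext n →ₗ[ℂ] Ext n :=
  CliffordAlgebra.contractLeft (Q := (0 : QuadraticForm ℂ (Fin n → ℂ))) φ

lemma contract_ι_mul (φ : Module.Dual ℂ (Fin n → ℂ)) (v : Fin n → ℂ) (Y : Ext n) :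
    contract φ (ι ℂ v * Y) = φ v • Y - ι ℂ v * contract φ Y :=
  CliffordAlgebra.contractLeft_ι_mul (Q := (0 : QuadraticForm ℂ (Fin n → ℂ))) φ v Y

lemma derivExt_eq (V : Matrix (Fin n) (Fin n) ℂ) (Y : Ext n) :
    derivExt V Y = ∑ i, ∑ j, V i j • (ι ℂ (stdVec n i) * contract (LinearMap.proj j) Y) := rfl

/-- Cramer's rule for the system `F ∧ y = F'`, `y ∧ T = 0`. -/
lemma cramer_contract {F F' T : Ext n} {y : Fin n → ℂ} (h1 : F * ι ℂ y = F') (h2 : ι ℂ y * T = 0)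
    (φ : Module.Dual ℂ (Fin n → ℂ)) :
    φ y * topCoeff n (F * T) = topCoeff n (F' * contract φ T) := by
  have h := contract_ι_mul φ y T
  rw [h2, map_zero] at h
  have h3 : φ y • T = ι ℂ y * contract φ T := (sub_eq_zero.mp h.symm)
  rw [← h1, mul_assoc, ← h3, mul_smul_comm, map_smul, smul_eq_mul]

/-- The operator `V^{(m)}` as a bilinear map. -/
def derivExtₗ : Matrix (Fin n) (Fin n) ℂ →ₗ[ℂ] Ext n →ₗ[ℂ] Ext n :=
  LinearMap.mk₂ ℂ derivExt
    (by intro V W Y; simp only [derivExt_eq, Matrix.add_apply, add_smul, sum_add_distrib])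
    (by intro c V Y; simp only [derivExt_eq, Matrix.smul_apply, smul_assoc, smul_sum])
    (by intro V Y Z
        simp only [derivExt_eq, map_add, mul_add, smul_add, sum_add_distrib])
    (by intro c V Y
        simp only [derivExt_eq, map_smul, mul_smul_comm, smul_sum, smul_comm c])

lemma derivExtₗ_apply (V : Matrix (Fin n) (Fin n) ℂ) (Y : Ext n) :
    derivExtₗ V Y = derivExt V Y := rfl

lemma derivExt_add_left (V W : Matrix (Fin n) (Fin n) ℂ) (Y : Ext n) :
    derivExt (V + W) Y = derivExt V Y + derivExt W Y := derivExtₗ.map_add₂ V W Y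

lemma derivExt_add (V : Matrix (Fin n) (Fin n) ℂ) (Y Z : Ext n) :
    derivExt V (Y + Z) = derivExt V Y + derivExt V Z := (derivExtₗ V).map_add Y Z

lemma derivExt_smul (V : Matrix (Fin n) (Fin n) ℂ) (c : ℂ) (Y : Ext n) :
    derivExt V (c • Y) = c • derivExt V Y := (derivExtₗ V).map_smul c Y

lemma derivExt_ι (V : Matrix (Fin n) (Fin n) ℂ) (v : Fin n → ℂ) :
    derivExt V (ι ℂ v) = ι ℂ (V.mulVec v) := by
  have := derivExt_ι_mul V v 1
  simpa [derivExt_one] using this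

lemma derivExt_mul (V : Matrix (Fin n) (Fin n) ℂ) (X Y : Ext n) :
    derivExt V (X * Y) = derivExt V X * Y + X * derivExt V Y := by
  induction X using CliffordAlgebra.left_induction with
  | algebraMap r =>
    rw [Algebra.algebraMap_eq_smul_one, smul_mul_assoc, one_mul, derivExt_smul, derivExt_smul,
      derivExt_one, smul_zero, zero_mul, zero_add, smul_mul_assoc, one_mul]
  | add x y hx hy => rw [add_mul, derivExt_add, hx, hy, derivExt_add]; noncomm_ring
  | ι_mul x m hx =>
    change derivExt V (ι ℂ m * x * Y) = derivExt V (ι ℂ m * x) * Y + ι ℂ m * x * derivExt V Y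
    rw [mul_assoc, derivExt_ι_mul, hx, derivExt_ι_mul]
    noncomm_ring

/-- The commutator of the derivations defined by two matrices. -/
lemma derivExt_comm (V W : Matrix (Fin n) (Fin n) ℂ) (Y : Ext n) :
    derivExt V (derivExt W Y) = derivExt W (derivExt V Y) + derivExt (V * W - W * V) Y := by
  induction Y using CliffordAlgebra.left_induction with
  | algebraMap r =>
    simp only [Algebra.algebraMap_eq_smul_one, derivExt_smul, derivExt_one, smul_zero]
    have := (derivExtₗ V).map_zero
    have h' := (derivExtₗ W).map_zero
    simp only [derivExtₗ_apply] at this h'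
    rw [this, h', add_zero]
  | add x y hx hy => simp only [derivExt_add, hx, hy]; abel
  | ι_mul x m hx =>
    change derivExt V (derivExt W (ι ℂ m * x)) = derivExt W (derivExt V (ι ℂ m * x)) +
        derivExt (V * W - W * V) (ι ℂ m * x)
    simp only [derivExt_ι_mul, derivExt_add, hx, Matrix.mulVec_mulVec, Matrix.sub_mulVec, map_sub,
      mul_add]
    noncomm_ring

lemma derivExt_mem {m : ℕ} (V : Matrix (Fin n) (Fin n) ℂ) {Y : Ext n}
    (hY : Y ∈ ⋀[ℂ]^m (Fin n → ℂ)) : derivExt V Y ∈ ⋀[ℂ]^m (Fin n → ℂ) := by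
  rw [← span_wedge_stdVec] at hY
  induction hY using Submodule.span_induction with
  | mem x hx =>
    obtain ⟨α, rfl, rfl⟩ := hx
    have key : ∀ l : List (Fin n), derivExt V (l.map fun j => ι ℂ (stdVec n j)).prod ∈
          ⋀[ℂ]^l.length (Fin n → ℂ) ∧ (l.map fun j => ι ℂ (stdVec n j)).prod ∈
          ⋀[ℂ]^l.length (Fin n → ℂ) := by
      intro l
      induction l with
      | nil =>
        simp only [List.map_nil, List.prod_nil, derivExt_one, List.length_nil]
        exact ⟨Submodule.zero_mem _, SetLike.GradedOne.one_mem⟩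
      | cons a l ih =>
        simp only [List.map_cons, List.prod_cons, derivExt_ι_mul, List.length_cons, add_comm _ 1]
        exact ⟨Submodule.add_mem _ (mul_mem_ext (ι_mem_ext _) ih.2)
          (mul_mem_ext (ι_mem_ext _) ih.1), mul_mem_ext (ι_mem_ext _) ih.2⟩
    have := (key (α.sort (· ≤ ·))).1
    rwa [Finset.length_sort] at this
  | zero =>
    have := (derivExtₗ V).map_zero
    rw [derivExtₗ_apply] at this
    rw [this]
    exact Submodule.zero_mem _
  | add x y _ _ hx hy => rw [derivExt_add]; exact Submodule.add_mem _ hx hy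
  | smul a x _ hx => rw [derivExt_smul]; exact Submodule.smul_mem _ _ hx

/-- On the top degree the derivation is multiplication by the trace. -/
lemma derivExt_of_mem_top (V : Matrix (Fin n) (Fin n) ℂ) {Y : Ext n}
    (hY : Y ∈ ⋀[ℂ]^n (Fin n → ℂ)) : derivExt V Y = V.trace • Y := by
  have h : ∀ i j : Fin n, ι ℂ (stdVec n i) * contract (LinearMap.proj j) Y =
      (if i = j then (1 : ℂ) else 0) • Y := by
    intro i j
    have h0 : ι ℂ (stdVec n i) * Y = 0 := by
      apply eq_zero_of_mem_succ
      rw [add_comm]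
      exact mul_mem_ext (ι_mem_ext _) hY
    have h1 := contract_ι_mul (LinearMap.proj j) (stdVec n i) Y
    rw [h0, map_zero] at h1
    rw [← sub_eq_zero.mp h1.symm]
    simp [stdVec, Pi.single_apply, eq_comm]
  simp only [derivExt_eq, h]
  simp [Matrix.trace, sum_smul]

lemma topCoeff_derivExt (V : Matrix (Fin n) (Fin n) ℂ) (Y : Ext n) :
    topCoeff n (derivExt V Y) = V.trace * topCoeff n Y := by
  have : (topCoeff n).comp (derivExtₗ V) = V.trace • topCoeff n := by
    refine (extBasis n).ext fun α => ?_
    simp only [LinearMap.comp_apply, derivExtₗ_apply, LinearMap.smul_apply, smul_eq_mul]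
    rw [← wedge_stdVec]
    have hm := wedge_mem (stdVec n) α
    by_cases h : α.card = n
    · rw [h] at hm
      rw [derivExt_of_mem_top V hm, map_smul, smul_eq_mul]
    · rw [topCoeff_of_mem h hm, topCoeff_of_mem h (derivExt_mem V hm), mul_zero]
  exact LinearMap.congr_fun this Y

/-- A product of eigenvectors is an eigenvector of the derivation. -/
lemma derivExt_wedge_eigen (V : Matrix (Fin n) (Fin n) ℂ) (u : Fin n → Fin n → ℂ)
    (r : Fin n → ℂ) (hu : ∀ j, V.mulVec (u j) = r j • u j) (α : Finset (Fin n)) :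
    derivExt V (wedge u α) = (∑ j ∈ α, r j) • wedge u α := by
  have key : ∀ l : List (Fin n), derivExt V (l.map fun j => ι ℂ (u j)).prod =
        (l.map r).sum • (l.map fun j => ι ℂ (u j)).prod := by
    intro l
    induction l with
    | nil => simp [derivExt_one]
    | cons a l ih =>
      simp only [List.map_cons, List.prod_cons, derivExt_ι_mul, ih, hu, map_smul, List.sum_cons,
        add_smul, smul_mul_assoc, mul_smul_comm]
  rw [wedge, key]
  congr 1
  rw [← List.sum_toFinset _ (Finset.sort_nodup _ _), Finset.sort_toFinset]

lemma wedge_univ_filter_succ (u : Fin n → Fin n → ℂ) (k : Fin n) :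
    wedge u (Finset.univ.filter (·.val < k.val + 1)) =
      wedge u (Finset.univ.filter (·.val < k.val)) * ι ℂ (u k) := by
  have h : (Finset.univ.filter fun j : Fin n => j.val < k.val + 1).sort (· ≤ ·) =
      (Finset.univ.filter fun j : Fin n => j.val < k.val).sort (· ≤ ·) ++ [k] := by
    refine List.Perm.eq_of_pairwise' (r := (· ≤ ·)) (Finset.pairwise_sort _ _) ?_ ?_
    · rw [List.pairwise_append]
      refine ⟨Finset.pairwise_sort _ _, by simp, ?_⟩
      intro a ha b hb
      simp only [mem_sort, mem_filter, Finset.mem_univ, true_and, List.mem_singleton] at ha hb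
      subst hb
      exact ha.le
    · rw [List.perm_ext_iff_of_nodup (Finset.sort_nodup _ _)]
      · intro a
        simp only [mem_sort, mem_filter, Finset.mem_univ, true_and,
          List.mem_append, List.mem_singleton, Fin.ext_iff]
        omega
      · rw [List.nodup_append]
        refine ⟨Finset.sort_nodup _ _, by simp, ?_⟩
        intro a ha b hb
        simp only [mem_sort, mem_filter, Finset.mem_univ, true_and, List.mem_singleton] at ha hb
        subst hb
        exact fun h => absurd (h ▸ ha) (lt_irrefl _)
  rw [wedge, h, List.map_append, List.prod_append]
  simp [wedge]

/-- The concatenation of an initial and of a final segment. -/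
lemma wedge_initial_mul_final (u v : Fin n → Fin n → ℂ) (k : Fin n) :
    topCoeff n (wedge u (Finset.univ.filter (·.val < k.val)) *
      wedge v (Finset.univ.filter (k ≤ ·))) =
      (ofCols fun j => if j < k then u j else v j).det := by
  rw [← topCoeff_wedge_univ]
  have h : (Finset.univ : Finset (Fin n)).sort (· ≤ ·) =
      (Finset.univ.filter fun j : Fin n => j.val < k.val).sort (· ≤ ·) ++
        (Finset.univ.filter fun j : Fin n => k ≤ j).sort (· ≤ ·) := by
    refine List.Perm.eq_of_pairwise' (r := (· ≤ ·)) (Finset.pairwise_sort _ _) ?_ ?_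
    · rw [List.pairwise_append]
      refine ⟨Finset.pairwise_sort _ _, Finset.pairwise_sort _ _, ?_⟩
      intro a ha b hb
      simp only [mem_sort, mem_filter, Finset.mem_univ, true_and] at ha hb
      exact (Fin.lt_def.mpr ha).le.trans hb
    · rw [List.perm_ext_iff_of_nodup (Finset.sort_nodup _ _)]
      · intro a
        simp only [mem_sort, mem_filter, Finset.mem_univ, true_and, List.mem_append, true_iff]
        exact lt_or_ge _ _
      · rw [List.nodup_append]
        refine ⟨Finset.sort_nodup _ _, Finset.sort_nodup _ _, ?_⟩
        intro a ha b hb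
        simp only [mem_sort, mem_filter, Finset.mem_univ, true_and] at ha hb
        rintro rfl
        exact absurd ha (not_lt.mpr hb)
  congr 1
  rw [wedge.eq_def _ Finset.univ, h, List.map_append, List.prod_append, wedge, wedge]
  congr 2
  · apply List.map_congr_left
    intro a ha
    simp only [mem_sort, mem_filter, Finset.mem_univ, true_and] at ha
    rw [if_pos (Fin.lt_def.mpr ha)]
  · apply List.map_congr_left
    intro a ha
    simp only [mem_sort, mem_filter, Finset.mem_univ, true_and] at ha
    rw [if_neg (not_lt.mpr ha)]

/-! ### Primitives of locally integrable functions on the half-line -/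

section Primitive

/-- `Y` is, on `(0, ∞)`, a primitive of the locally integrable function `g`. -/
structure PrimOn {E : Type*} [NormedAddCommGroup E] [NormedSpace ℝ E] (Y g : ℝ → E) : Prop where
  integrable : ∀ a b, 0 < a → 0 < b → IntervalIntegrable g volume a b
  eq : ∀ a b, 0 < a → 0 < b → Y b - Y a = ∫ t in a..b, g t

namespace PrimOn

variable {E F : Type*} [NormedAddCommGroup E] [NormedSpace ℝ E] [NormedAddCommGroup F]
  [NormedSpace ℝ F] {Y Z g k : ℝ → E}

lemma continuousOn (h : PrimOn Y g) : ContinuousOn Y (Ioi 0) := by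
  intro x hx
  have hx : 0 < x := hx
  have h1 : ∀ y > 0, Y y = Y (x / 2) + ∫ t in (x / 2)..y, g t := by
    intro y hy
    rw [← h.eq _ _ (half_pos hx) hy]; abel
  have hint := h.integrable (x / 2) (x + 1) (half_pos hx) (by linarith)
  have hc := intervalIntegral.continuousOn_primitive_interval' hint left_mem_uIcc
  have hx2 : uIcc (x / 2) (x + 1) ∈ 𝓝 x := by
    rw [uIcc_of_le (by linarith)]
    exact Icc_mem_nhds (by linarith) (by linarith)
  have hc2 := hc.continuousAt hx2
  have : ContinuousAt Y x := by
    refine (hc2.const_add (Y (x / 2))).congr ?_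
    filter_upwards [lt_mem_nhds hx] with y hy using (h1 y hy).symm
  exact this.continuousWithinAt

lemma add (h1 : PrimOn Y g) (h2 : PrimOn Z k) :
    PrimOn (fun t => Y t + Z t) (fun t => g t + k t) where
  integrable a b ha hb := (h1.integrable a b ha hb).add (h2.integrable a b ha hb)
  eq a b ha hb := by
    rw [intervalIntegral.integral_add (h1.integrable a b ha hb) (h2.integrable a b ha hb),
      ← h1.eq a b ha hb, ← h2.eq a b ha hb]
    abel

lemma sub (h1 : PrimOn Y g) (h2 : PrimOn Z k) :
    PrimOn (fun t => Y t - Z t) (fun t => g t - k t) where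
  integrable a b ha hb := (h1.integrable a b ha hb).sub (h2.integrable a b ha hb)
  eq a b ha hb := by
    rw [intervalIntegral.integral_sub (h1.integrable a b ha hb) (h2.integrable a b ha hb),
      ← h1.eq a b ha hb, ← h2.eq a b ha hb]
    abel

lemma sum {ι : Type*} (s : Finset ι) {Y g : ι → ℝ → E} (h : ∀ i ∈ s, PrimOn (Y i) (g i)) :
    PrimOn (fun t => ∑ i ∈ s, Y i t) (fun t => ∑ i ∈ s, g i t) where
  integrable a b ha hb := by
    have := IntervalIntegrable.sum s (f := g) fun i hi => (h i hi).integrable a b ha hb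
    rwa [show (fun t => ∑ i ∈ s, g i t) = ∑ i ∈ s, g i from by funext t; simp]
  eq a b ha hb := by
    rw [intervalIntegral.integral_finsetSum fun i hi => (h i hi).integrable a b ha hb,
      ← Finset.sum_sub_distrib]
    exact sum_congr rfl fun i hi => (h i hi).eq a b ha hb

lemma congr_ae (h : PrimOn Y g) (hk : ∀ᵐ t, 0 < t → g t = k t) : PrimOn Y k where
  integrable a b ha hb := by
    refine (h.integrable a b ha hb).congr_ae ?_
    rw [EventuallyEq, ae_restrict_iff' measurableSet_uIoc]
    filter_upwards [hk] with t ht hm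
    exact ht (lt_of_le_of_lt (le_min ha.le hb.le) hm.1)
  eq a b ha hb := by
    rw [h.eq a b ha hb]
    refine intervalIntegral.integral_congr_ae ?_
    filter_upwards [hk] with t ht hm
    exact ht (lt_of_le_of_lt (le_min ha.le hb.le) hm.1)

lemma congr_left (h : PrimOn Y g) (hZ : ∀ t > 0, Y t = Z t) : PrimOn Z g where
  integrable := h.integrable
  eq a b ha hb := by rw [← hZ a ha, ← hZ b hb, h.eq a b ha hb]

lemma clm [CompleteSpace E] [CompleteSpace F] (h : PrimOn Y g) (L : E →L[ℝ] F) :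
    PrimOn (fun t => L (Y t)) (fun t => L (g t)) where
  integrable a b ha hb := by
    have h1 := h.integrable a b ha hb
    exact ⟨L.integrable_comp h1.1, L.integrable_comp h1.2⟩
  eq a b ha hb := by
    rw [L.intervalIntegral_comp_comm (h.integrable a b ha hb), ← h.eq a b ha hb, map_sub]

lemma of_hasDerivAt [CompleteSpace E] (hd : ∀ t > 0, HasDerivAt Y (g t) t)
    (hg : ContinuousOn g (Ioi 0)) : PrimOn Y g := by
  have hint : ∀ a b, 0 < a → 0 < b → IntervalIntegrable g volume a b := fun a b ha hb =>
    (hg.mono fun t ht => lt_of_lt_of_le (lt_min ha hb) ht.1).intervalIntegrable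
  refine ⟨hint, fun a b ha hb => ?_⟩
  rw [intervalIntegral.integral_eq_sub_of_hasDerivAt
    (fun t ht => hd t (lt_of_lt_of_le (lt_min ha hb) ht.1)) (hint a b ha hb)]

lemma eq_of_zero (h : PrimOn Y fun _ => 0) {a b : ℝ} (ha : 0 < a) (hb : 0 < b) : Y a = Y b := by
  have := h.eq a b ha hb
  rw [intervalIntegral.integral_zero, sub_eq_zero] at this
  exact this.symm

/-- The product rule for primitives. The difference of the two sides is absolutely continuous with
derivative zero almost everywhere. -/
lemma mul {𝒜 : Type*} [NormedRing 𝒜] [NormedAlgebra ℝ 𝒜] [CompleteSpace 𝒜]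
    {Y Z g k : ℝ → 𝒜} (hY : PrimOn Y g) (hZ : PrimOn Z k) :
    PrimOn (fun t => Y t * Z t) (fun t => g t * Z t + Y t * k t) := by
  have hint : ∀ a b, 0 < a → 0 < b →
      IntervalIntegrable (fun t => g t * Z t + Y t * k t) volume a b := by
    intro a b ha hb
    have hsub : uIcc a b ⊆ Ioi 0 := fun t ht => lt_of_lt_of_le (lt_min ha hb) ht.1
    exact ((hY.integrable a b ha hb).mul_continuousOn (hZ.continuousOn.mono hsub)).add
      ((hZ.integrable a b ha hb).continuousOn_mul (hY.continuousOn.mono hsub))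
  have key : ∀ a b, 0 < a → a ≤ b → Y b * Z b - Y a * Z a =
      ∫ t in a..b, (g t * Z t + Y t * k t) := by
    intro a b ha hab
    have hb : 0 < b := ha.trans_le hab
    have hsub : uIcc a b ⊆ Ioi 0 := fun t ht => lt_of_lt_of_le (lt_min ha hb) ht.1
    set w : ℝ → 𝒜 := fun t => g t * Z t + Y t * k t with hw
    set D : ℝ → 𝒜 := fun x => Y x * Z x - ∫ t in a..x, w t with hD
    obtain ⟨M, hM⟩ := isCompact_uIcc.exists_bound_of_continuousOn (hY.continuousOn.mono hsub)
    obtain ⟨N, hN⟩ := isCompact_uIcc.exists_bound_of_continuousOn (hZ.continuousOn.mono hsub)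
    have hM0 : 0 ≤ M := (norm_nonneg _).trans (hM a left_mem_uIcc)
    have hN0 : 0 ≤ N := (norm_nonneg _).trans (hN a left_mem_uIcc)
    set f : ℝ → ℝ := fun t => N * ‖g t‖ + M * ‖k t‖ + ‖w t‖ with hf
    have hfi : ∀ x y, 0 < x → 0 < y → IntervalIntegrable f volume x y := fun x y hx hy =>
      (((hY.integrable x y hx hy).norm.const_mul N).add
        ((hZ.integrable x y hx hy).norm.const_mul M)).add (hint x y hx hy).norm
    -- the increments of `D` are dominated by those of a primitive of `f`
    have hdom : ∀ x ∈ uIcc a b, ∀ y ∈ uIcc a b, x ≤ y → dist (D x) (D y) ≤ ∫ t in x..y, f t := by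
      intro x hx y hy hxy
      have hx0 : 0 < x := hsub hx
      have hy0 : 0 < y := hsub hy
      have e1 : D y - D x = (Y y - Y x) * Z y + Y x * (Z y - Z x) - ∫ t in x..y, w t := by
        have : (∫ t in a..y, w t) = (∫ t in a..x, w t) + ∫ t in x..y, w t :=
          (intervalIntegral.integral_add_adjacent_intervals (hint a x ha hx0)
            (hint x y hx0 hy0)).symm
        simp only [hD, this]
        noncomm_ring
      rw [dist_comm, dist_eq_norm, e1]
      have b1 : ‖Y y - Y x‖ ≤ ∫ t in x..y, ‖g t‖ := by
        rw [hY.eq x y hx0 hy0]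
        exact intervalIntegral.norm_integral_le_integral_norm hxy
      have b2 : ‖Z y - Z x‖ ≤ ∫ t in x..y, ‖k t‖ := by
        rw [hZ.eq x y hx0 hy0]
        exact intervalIntegral.norm_integral_le_integral_norm hxy
      have b3 : ‖∫ t in x..y, w t‖ ≤ ∫ t in x..y, ‖w t‖ :=
        intervalIntegral.norm_integral_le_integral_norm hxy
      have e2 : (∫ t in x..y, f t) = N * (∫ t in x..y, ‖g t‖) + M * (∫ t in x..y, ‖k t‖) +
          ∫ t in x..y, ‖w t‖ := by
        simp only [hf]
        rw [intervalIntegral.integral_add (((hY.integrable x y hx0 hy0).norm.const_mul N).add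
          ((hZ.integrable x y hx0 hy0).norm.const_mul M)) (hint x y hx0 hy0).norm,
          intervalIntegral.integral_add ((hY.integrable x y hx0 hy0).norm.const_mul N)
          ((hZ.integrable x y hx0 hy0).norm.const_mul M), intervalIntegral.integral_const_mul,
          intervalIntegral.integral_const_mul]
      rw [e2]
      refine (norm_sub_le _ _).trans (add_le_add ((norm_add_le _ _).trans (add_le_add ?_ ?_)) b3)
      · refine (norm_mul_le _ _).trans ?_
        rw [mul_comm]
        exact mul_le_mul (hN y hy) b1 (norm_nonneg _) hN0
      · refine (norm_mul_le _ _).trans ?_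
        exact mul_le_mul (hM x hx) b2 (norm_nonneg _) hM0
    have hH : AbsolutelyContinuousOnInterval (fun x => ∫ t in a..x, f t) a b :=
      (hfi a b ha hb).absolutelyContinuousOnInterval_intervalIntegral left_mem_uIcc
    have hDac : AbsolutelyContinuousOnInterval D a b := by
      refine squeeze_zero' (.of_forall fun _ => sum_nonneg fun _ _ =>
        dist_nonneg) ?_ hH
      have : ∀ᶠ E in (AbsolutelyContinuousOnInterval.totalLengthFilter ⊓
          𝓟 (AbsolutelyContinuousOnInterval.disjWithin a b)),
          E ∈ AbsolutelyContinuousOnInterval.disjWithin a b :=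
        mem_inf_of_right (mem_principal_self _)
      filter_upwards [this] with E hE
      refine sum_le_sum fun i hi => ?_
      have hx := hE.1 i hi
      have hd : ∀ x ∈ uIcc a b, ∀ y ∈ uIcc a b, dist (D x) (D y) ≤
          dist (∫ t in a..x, f t) (∫ t in a..y, f t) := by
        intro x hx y hy
        wlog hxy : x ≤ y generalizing x y
        · rw [dist_comm, dist_comm (∫ t in a..x, f t)]
          exact this y hy x hx (le_of_not_ge hxy)
        refine (hdom x hx y hy hxy).trans ?_
        rw [dist_comm, Real.dist_eq, intervalIntegral.integral_interval_sub_left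
          (hfi a y ha (hsub hy)) (hfi a x ha (hsub hx))]
        exact le_abs_self _
      exact hd _ hx.1 _ hx.2
    have hder : ∀ᵐ x, x ∈ uIcc a b → HasDerivAt D 0 x := by
      filter_upwards [(hY.integrable a b ha hb).ae_hasDerivAt_integral,
        (hZ.integrable a b ha hb).ae_hasDerivAt_integral,
        (hint a b ha hb).ae_hasDerivAt_integral,
        (measure_eq_zero_iff_ae_notMem.mp (measure_singleton (μ := volume) a)),
        (measure_eq_zero_iff_ae_notMem.mp (measure_singleton (μ := volume) b))]
        with x h1 h2 h3 _ _ hx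
      have h1 := h1 hx a left_mem_uIcc
      have h2 := h2 hx a left_mem_uIcc
      have h3 := h3 hx a left_mem_uIcc
      have hx0 : 0 < x := hsub hx
      have d1 : HasDerivAt Y (g x) x := by
        refine (h1.const_add (Y a)).congr_of_eventuallyEq ?_
        filter_upwards [lt_mem_nhds hx0] with y hy
        rw [← hY.eq a y ha hy]; abel
      have d2 : HasDerivAt Z (k x) x := by
        refine (h2.const_add (Z a)).congr_of_eventuallyEq ?_
        filter_upwards [lt_mem_nhds hx0] with y hy
        rw [← hZ.eq a y ha hy]; abel
      have := (d1.mul d2).sub h3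
      rw [sub_self] at this
      exact this
    obtain ⟨C, hC⟩ := hDac.const_of_ae_hasDerivAt_zero hder
    have e := (hC b right_mem_uIcc).trans (hC a left_mem_uIcc).symm
    simp only [hD, intervalIntegral.integral_same, sub_zero] at e
    rw [← e]; abel
  refine ⟨hint, fun a b ha hb => ?_⟩
  rcases le_total a b with h | h
  · exact key a b ha h
  · rw [intervalIntegral.integral_symm, ← key b a hb h]; abel

end PrimOn

end Primitive

/-! ### Volterra equations on the half-line -/

section Volterra

/-- The set of the values `t` over which the Volterra integrals at `x` extend: `(x, ∞)` for the
equations of the tensors `F_k` (`up = true`), `(0, x)` for those of the tensors `T_k`. -/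
def region (up : Bool) (x : ℝ) : Set ℝ := if up then Ioi x else Ioo 0 x

lemma measurableSet_region (up : Bool) (x : ℝ) : MeasurableSet (region up x) := by
  cases up <;> simp [region]

lemma region_subset_Ioi (up : Bool) {x : ℝ} (hx : 0 ≤ x) : region up x ⊆ Ioi 0 := by
  cases up
  · intro t ht; exact ht.1
  · intro t ht; exact lt_of_le_of_lt hx ht

lemma region_subset (up : Bool) {x t : ℝ} (ht : t ∈ region up x) : region up t ⊆ region up x := by
  cases up
  · intro s hs; exact ⟨hs.1, hs.2.trans ht.2⟩
  · intro s hs; exact lt_trans (show x < t from ht) hs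

lemma eventually_mem_region (up : Bool) {x t : ℝ} (ht : t ∈ region up x) :
    ∀ᶠ y in 𝓝 x, t ∈ region up y := by
  cases up
  · filter_upwards [lt_mem_nhds ht.2] with y hy using ⟨ht.1, hy⟩
  · exact gt_mem_nhds (show x < t from ht)

lemma eventually_not_mem_region (up : Bool) {x t : ℝ} (ht : t ∉ region up x) (h0 : 0 < t)
    (hne : x ≠ t) : ∀ᶠ y in 𝓝 x, t ∉ region up y := by
  cases up
  · have : x < t := lt_of_le_of_ne (not_lt.mp fun h => ht ⟨h0, h⟩) hne
    filter_upwards [gt_mem_nhds this] with y hy h using absurd h.2 (not_lt.mpr hy.le)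
  · have : t < x := lt_of_le_of_ne (not_lt.mp fun h => ht h) hne.symm
    filter_upwards [lt_mem_nhds this] with y hy h
    exact absurd (show y < t from h) (not_lt.mpr hy.le)

/-- The integral of `g` over the region. -/
def mass (up : Bool) (g : ℝ → ℝ) (x : ℝ) : ℝ := ∫ t in region up x, g t

section Mass

variable {up : Bool} {g : ℝ → ℝ}

lemma integrableOn_region (hg : IntegrableOn g (Ioi 0)) {x : ℝ} (hx : 0 ≤ x) :
    IntegrableOn g (region up x) := hg.mono_set (region_subset_Ioi up hx)

lemma mass_nonneg (h0 : ∀ t, 0 ≤ g t) (x : ℝ) : 0 ≤ mass up g x :=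
  setIntegral_nonneg (measurableSet_region up x) fun t _ => h0 t

lemma mass_mono (h0 : ∀ t, 0 ≤ g t) (hg : IntegrableOn g (Ioi 0)) {x t : ℝ} (hx : 0 ≤ x)
    (ht : t ∈ region up x) : mass up g t ≤ mass up g x :=
  setIntegral_mono_set (integrableOn_region hg hx) (.of_forall h0)
    (LE.le.eventuallyLE (region_subset up ht))

lemma mass_le (h0 : ∀ t, 0 ≤ g t) (hg : IntegrableOn g (Ioi 0)) {x : ℝ} (hx : 0 ≤ x) :
    mass up g x ≤ ∫ t in Ioi 0, g t :=
  setIntegral_mono_set hg (.of_forall h0) (LE.le.eventuallyLE (region_subset_Ioi up hx))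

lemma primOn_mass (hg : IntegrableOn g (Ioi 0)) :
    PrimOn (mass up g) (fun t => (if up then -1 else 1) * g t) where
  integrable a b ha hb := by
    refine IntervalIntegrable.const_mul ?_ _
    rw [intervalIntegrable_iff]
    exact hg.mono_set fun t ht => lt_of_le_of_lt (le_min ha.le hb.le) ht.1
  eq a b ha hb := by
    have hi : ∀ a b, 0 ≤ a → 0 ≤ b → IntervalIntegrable g volume a b := fun a b ha hb =>
      intervalIntegrable_iff.mpr (hg.mono_set fun t ht => lt_of_le_of_lt (le_min ha hb) ht.1)
    rw [intervalIntegral.integral_const_mul]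
    cases up
    · have : ∀ x > 0, mass false g x = ∫ t in (0 : ℝ)..x, g t := by
        intro x hx
        rw [intervalIntegral.integral_of_le hx.le, integral_Ioc_eq_integral_Ioo]
        rfl
      rw [this a ha, this b hb, intervalIntegral.integral_interval_sub_left (hi 0 b le_rfl hb.le)
        (hi 0 a le_rfl ha.le)]
      simp
    · have := intervalIntegral.integral_Ioi_sub_Ioi' (hg.mono_set (Ioi_subset_Ioi ha.le))
        (hg.mono_set (Ioi_subset_Ioi hb.le))
      simp only [mass, region, if_true]
      rw [← this]; ring

lemma primOn_mass_pow (hg : IntegrableOn g (Ioi 0)) (k : ℕ) :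
    PrimOn (fun t => mass up g t ^ (k + 1))
      (fun t => (k + 1) * (mass up g t ^ k * ((if up then -1 else 1) * g t))) := by
  induction k with
  | zero => simpa using primOn_mass hg
  | succ k ih =>
    have := ih.mul (primOn_mass (up := up) hg)
    refine (this.congr_left fun t _ => (pow_succ (mass up g t) (k + 1)).symm).congr_ae
      (.of_forall fun t _ => ?_)
    push_cast
    ring

lemma integrableOn_mul_mass_pow (h0 : ∀ t, 0 ≤ g t) (hg : IntegrableOn g (Ioi 0)) (k : ℕ) :
    IntegrableOn (fun t => g t * mass up g t ^ k) (Ioi 0) := by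
  refine Integrable.mul_bdd (c := (∫ t in Ioi 0, g t) ^ k) hg ?_ ?_
  · exact (((primOn_mass hg).continuousOn.pow k).aestronglyMeasurable measurableSet_Ioi)
  · rw [ae_restrict_iff' measurableSet_Ioi]
    refine .of_forall fun t ht => ?_
    rw [norm_pow, norm_of_nonneg (mass_nonneg h0 t)]
    exact pow_le_pow_left₀ (mass_nonneg h0 t) (mass_le h0 hg (le_of_lt ht)) k

/-- The estimate behind the factorial decay of the iterates of a Volterra operator. -/
lemma integral_mul_mass_pow_le (h0 : ∀ t, 0 ≤ g t) (hg : IntegrableOn g (Ioi 0)) (k : ℕ)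
    {x : ℝ} (hx : 0 ≤ x) :
    ∫ t in region up x, g t * mass up g t ^ k ≤ mass up g x ^ (k + 1) / (k + 1) := by
  have hk : (0 : ℝ) < k + 1 := by positivity
  have hint := integrableOn_mul_mass_pow (up := up) h0 hg k
  have key : ∀ a b, 0 < a → a ≤ b → region up a ⊆ region up x → region up b ⊆ region up x →
      ∫ t in Ioc a b, g t * mass up g t ^ k ≤ mass up g x ^ (k + 1) / (k + 1) := by
    intro a b ha hab hax hbx
    have h1 := (primOn_mass_pow (up := up) hg k).eq a b ha (ha.trans_le hab)
    have h2 : (∫ t in a..b, (k + 1) * (mass up g t ^ k * ((if up then -1 else 1) * g t))) =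
        (if up then -1 else 1) * ((k + 1) * ∫ t in Ioc a b, g t * mass up g t ^ k) := by
      rw [← intervalIntegral.integral_of_le hab, ← intervalIntegral.integral_const_mul,
        ← intervalIntegral.integral_const_mul]
      congr 1
      ext t
      ring
    rw [h2] at h1
    rw [le_div_iff₀ hk]
    have hm : ∀ y, region up y ⊆ region up x → mass up g y ^ (k + 1) ≤ mass up g x ^ (k + 1) :=
      fun y hy => pow_le_pow_left₀ (mass_nonneg h0 y) (setIntegral_mono_set
        (integrableOn_region hg hx) (.of_forall h0) (LE.le.eventuallyLE hy)) (k + 1)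
    have pa := pow_nonneg (mass_nonneg (up := up) h0 a) (k + 1)
    have pb := pow_nonneg (mass_nonneg (up := up) h0 b) (k + 1)
    have := hm a hax
    have := hm b hbx
    cases up <;> simp only [if_true, Bool.false_eq_true, if_false] at h1 <;> linarith
  have hint := hint.mono_set (region_subset_Ioi up hx)
  cases up
  · rcases hx.eq_or_lt with rfl | hx
    · simp [region, mass]
    have hc : AECover (volume.restrict (Ioo 0 x)) (𝓝[>] 0) fun r : ℝ => Ioc r (x - r) :=
      aecover_Ioo_of_Ioc nhdsWithin_le_nhds (tendsto_nhdsWithin_of_tendsto_nhds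
        (by simpa using (continuous_sub_left x).tendsto 0))
    refine le_of_tendsto (hc.integral_tendsto_of_countably_generated hint) ?_
    filter_upwards [Ioo_mem_nhdsGT (half_pos hx)] with r hr
    rw [Measure.restrict_restrict measurableSet_Ioc, inter_eq_left.mpr fun t ht =>
      mem_Ioo.mpr ⟨hr.1.trans ht.1, ht.2.trans_lt (by linarith [hr.1])⟩]
    exact key _ _ hr.1 (by linarith [hr.2]) (Ioo_subset_Ioo_right (by linarith [hr.1, hr.2]))
      (Ioo_subset_Ioo_right (by linarith [hr.1]))
  · have hc : AECover (volume.restrict (Ioi x)) atTop fun r : ℝ => Ioi (x + r⁻¹) ∩ Iic (x + r) :=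
      (aecover_Ioi_of_Ioi (by simpa using tendsto_inv_atTop_zero.const_add x)).inter
        (aecover_Iic (tendsto_atTop_add_const_left _ x tendsto_id))
    refine le_of_tendsto (hc.integral_tendsto_of_countably_generated hint) ?_
    filter_upwards [eventually_ge_atTop 1] with r hr
    have hr0 : 0 < r⁻¹ := by positivity
    have hr1 := inv_le_one_of_one_le₀ hr
    rw [Ioi_inter_Iic, Measure.restrict_restrict measurableSet_Ioc, inter_eq_left.mpr fun t ht =>
      mem_Ioi.mpr (lt_trans (by linarith) ht.1)]
    exact key _ _ (by linarith) (by linarith) (Ioi_subset_Ioi (by linarith))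
      (Ioi_subset_Ioi (by linarith))

/-- Gronwall's lemma for Volterra inequalities. The inequality for `ψ` is stated through integrable
majorants, so that `ψ` need not be measurable. -/
lemma gronwall_region (h0 : ∀ t, 0 ≤ g t) (hg : IntegrableOn g (Ioi 0)) {ψ : ℝ → ℝ}
    {x₀ A M : ℝ} (hx₀ : 0 ≤ x₀) (hA : 0 ≤ A) (hM0 : 0 ≤ M)
    (hM : ∀ x ∈ insert x₀ (region up x₀), ψ x ≤ M)
    (hψ : ∀ x ∈ insert x₀ (region up x₀), ∀ b : ℝ → ℝ,
      IntegrableOn (fun t => g t * b t) (region up x) → (∀ t ∈ region up x, ψ t ≤ b t) →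
        ψ x ≤ A + ∫ t in region up x, g t * b t) :
    ψ x₀ ≤ A * Real.exp (∫ t in Ioi 0, g t) := by
  have hnn : ∀ x ∈ insert x₀ (region up x₀), 0 ≤ x := by
    rintro x (rfl | hx)
    · exact hx₀
    · exact le_of_lt (region_subset_Ioi up hx₀ hx)
  set P : ℕ → ℝ → ℝ := fun j x => mass up g x ^ j / (j.factorial : ℝ) with hP
  have hPi : ∀ (k : ℕ) (x : ℝ), 0 ≤ x → IntegrableOn (fun t => g t * P k t) (region up x) := by
    intro k x hx
    have := ((integrableOn_mul_mass_pow (up := up) h0 hg k).mono_set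
      (region_subset_Ioi up hx)).div_const (k.factorial : ℝ)
    simpa only [IntegrableOn, hP, mul_div_assoc] using this
  have hPle : ∀ (k : ℕ) (x : ℝ), 0 ≤ x → ∫ t in region up x, g t * P k t ≤ P (k + 1) x := by
    intro k x hx
    have h1 := integral_mul_mass_pow_le (up := up) h0 hg k hx
    simp only [hP, ← mul_div_assoc, integral_div]
    rw [div_le_iff₀ (by positivity), Nat.factorial_succ]
    refine h1.trans (le_of_eq ?_)
    push_cast
    field_simp
  have step : ∀ k : ℕ, ∀ x ∈ insert x₀ (region up x₀),
      ψ x ≤ A * (∑ j ∈ Finset.range k, P j x) + M * P k x := by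
    intro k
    induction k with
    | zero => intro x hx; simpa [hP] using hM x hx
    | succ k ih =>
      intro x hx
      have hx0 := hnn x hx
      have e : (fun t => g t * (A * (∑ j ∈ Finset.range k, P j t) + M * P k t)) =
          fun t => A * (∑ j ∈ Finset.range k, g t * P j t) + M * (g t * P k t) := by
        ext t
        rw [← mul_sum]; ring
      have i1 : IntegrableOn (fun t => ∑ j ∈ Finset.range k, g t * P j t) (region up x) :=
        integrable_finsetSum _ fun j _ => hPi j x hx0
      have hb := hψ x hx (fun t => A * (∑ j ∈ Finset.range k, P j t) + M * P k t)
        (by rw [e]; exact (i1.const_mul A).add ((hPi k x hx0).const_mul M))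
        (fun t ht => ih t (Or.inr (by
          rcases hx with rfl | hx
          · exact ht
          · exact region_subset up hx ht)))
      rw [e, integral_add (i1.const_mul A) ((hPi k x hx0).const_mul M), integral_const_mul,
        integral_const_mul, integral_finsetSum _ fun j _ => hPi j x hx0] at hb
      refine hb.trans ?_
      rw [Finset.sum_range_succ']
      have h2 : ∑ j ∈ Finset.range k, ∫ t in region up x, g t * P j t ≤
          ∑ j ∈ Finset.range k, P (j + 1) x := sum_le_sum fun j _ => hPle j x hx0
      have h3 : P 0 x = 1 := by simp [hP]
      rw [h3]
      have h4 := mul_le_mul_of_nonneg_left h2 hA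
      have h5 := mul_le_mul_of_nonneg_left (hPle k x hx0) hM0
      linarith
  have hlim : Tendsto (fun k : ℕ => A * Real.exp (mass up g x₀) + M * P k x₀) atTop
      (𝓝 (A * Real.exp (mass up g x₀) + M * 0)) :=
    ((FloorSemiring.tendsto_pow_div_factorial_atTop (mass up g x₀)).const_mul M).const_add _
  rw [mul_zero, add_zero] at hlim
  have h1 : ψ x₀ ≤ A * Real.exp (mass up g x₀) := by
    refine ge_of_tendsto' hlim fun k => (step k x₀ (mem_insert _ _)).trans ?_
    gcongr
    exact Real.sum_le_exp_of_nonneg (mass_nonneg h0 _) k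
  refine h1.trans ?_
  gcongr
  exact mass_le h0 hg hx₀

end Mass

section Kernel

variable {S : Type*} [TopologicalSpace S] {V : Type*} [NormedAddCommGroup V] [NormedSpace ℂ V]

/-- Bounded and continuous kernels of Volterra operators. -/
structure IsVolterraKernel (up : Bool) (κ : ℝ≥0 → ℝ → S → V →L[ℂ] V) (C : ℝ) : Prop where
  nonneg : 0 ≤ C
  bound : ∀ (x : ℝ≥0), ∀ t ∈ region up x, ∀ ρ, ‖κ x t ρ‖ ≤ C
  continuousOn : ∀ (x : ℝ≥0) ρ, ContinuousOn (fun t => κ x t ρ) (region up x)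
  continuousAt : ∀ (x : ℝ≥0) (t : ℝ) (ρ : S), t ∈ region up x →
    ContinuousAt (fun p : ℝ≥0 × S => κ p.1 t p.2) (x, ρ)

/-- The Volterra operator with the kernel `κ(x, t, ρ) Q(t)`. -/
def volterra (up : Bool) (κ : ℝ≥0 → ℝ → S → V →L[ℂ] V) (Q : ℝ → V →L[ℂ] V)
    (v : ℝ≥0 → S → V) (x : ℝ≥0) (ρ : S) : V :=
  ∫ t in region up x, κ x t ρ (Q t (v t.toNNReal ρ))

variable {up : Bool} {κ : ℝ≥0 → ℝ → S → V →L[ℂ] V} {C : ℝ} {Q : ℝ → V →L[ℂ] V}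

namespace IsVolterraKernel

lemma aestronglyMeasurable (hκ : IsVolterraKernel up κ C) (hQ : IntegrableOn Q (Ioi 0))
    {x : ℝ≥0} {ρ : S} {v : ℝ → V} (hv : ContinuousOn v (region up x)) :
    AEStronglyMeasurable (fun t => κ x t ρ (Q t (v t))) (volume.restrict (region up x)) := by
  have h1 : AEStronglyMeasurable v (volume.restrict (region up x)) :=
    hv.aestronglyMeasurable_of_isSeparable (measurableSet_region up x)
      (TopologicalSpace.IsSeparable.of_separableSpace _)
  have h2 : AEStronglyMeasurable (fun t => κ x t ρ) (volume.restrict (region up x)) :=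
    (hκ.continuousOn x ρ).aestronglyMeasurable_of_isSeparable (measurableSet_region up x)
      (TopologicalSpace.IsSeparable.of_separableSpace _)
  have h3 : AEStronglyMeasurable Q (volume.restrict (region up x)) :=
    (hQ.mono_set (region_subset_Ioi up x.2)).aestronglyMeasurable
  have hc : Continuous fun p : (V →L[ℂ] V) × V => p.1 p.2 := isBoundedBilinearMap_apply.continuous
  exact hc.comp_aestronglyMeasurable (h2.prodMk (hc.comp_aestronglyMeasurable (h3.prodMk h1)))

lemma norm_apply_le (hκ : IsVolterraKernel up κ C) {x : ℝ≥0} {t : ℝ} (ht : t ∈ region up x)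
    (ρ : S) (w : V) {b : ℝ} (hb : ‖w‖ ≤ b) : ‖κ x t ρ (Q t w)‖ ≤ C * ‖Q t‖ * b := by
  refine ((κ x t ρ).le_opNorm _).trans ?_
  have h1 := (Q t).le_opNorm_of_le hb
  rw [mul_assoc]
  exact mul_le_mul (hκ.bound x t ht ρ) h1 (norm_nonneg _) hκ.nonneg

lemma integrableOn (hκ : IsVolterraKernel up κ C) (hQ : IntegrableOn Q (Ioi 0))
    {x : ℝ≥0} {ρ : S} {v : ℝ → V} (hv : ContinuousOn v (region up x)) {M : ℝ}
    (hM : ∀ t ∈ region up x, ‖v t‖ ≤ M) :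
    IntegrableOn (fun t => κ x t ρ (Q t (v t))) (region up x) := by
  refine Integrable.mono' (((hQ.mono_set (region_subset_Ioi up x.2)).norm.const_mul C).mul_const M)
    (hκ.aestronglyMeasurable hQ hv) ?_
  rw [ae_restrict_iff' (measurableSet_region up x)]
  exact .of_forall fun t ht => hκ.norm_apply_le ht ρ _ (hM t ht)

lemma norm_integral_le (hκ : IsVolterraKernel up κ C)
    {x : ℝ≥0} {ρ : S} {v : ℝ → V} {b : ℝ → ℝ} (hb : ∀ t ∈ region up x, ‖v t‖ ≤ b t)
    (hbi : IntegrableOn (fun t => C * ‖Q t‖ * b t) (region up x)) :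
    ‖∫ t in region up x, κ x t ρ (Q t (v t))‖ ≤ ∫ t in region up x, C * ‖Q t‖ * b t := by
  refine norm_integral_le_of_norm_le hbi ?_
  rw [ae_restrict_iff' (measurableSet_region up x)]
  exact .of_forall fun t ht => hκ.norm_apply_le ht ρ _ (hb t ht)

/-- Uniqueness for locally bounded solutions of the homogeneous equation. -/
lemma eq_zero (hκ : IsVolterraKernel up κ C) (hQ : IntegrableOn Q (Ioi 0)) {ρ : S}
    {y : ℝ → V} {x₀ : ℝ} (hx₀ : 0 < x₀) {M : ℝ}
    (hM : ∀ x ∈ insert x₀ (region up x₀), ‖y x‖ ≤ M)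
    (hy : ∀ x > 0, y x = ∫ t in region up x, κ x.toNNReal t ρ (Q t (y t))) : y x₀ = 0 := by
  have h := gronwall_region (up := up) (g := fun t => C * ‖Q t‖) (ψ := fun x => ‖y x‖)
    (fun t => mul_nonneg hκ.nonneg (norm_nonneg _)) (hQ.norm.const_mul C) hx₀.le le_rfl
    ((norm_nonneg _).trans (hM x₀ (mem_insert _ _))) hM (by
      intro x hx b hbi hb
      have hx0 : 0 < x := by
        rcases hx with rfl | hx
        · exact hx₀
        · exact region_subset_Ioi up hx₀.le hx
      rw [hy x hx0, zero_add]
      have hxx : ((x.toNNReal : ℝ≥0) : ℝ) = x := coe_toNNReal x hx0.le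
      have := hκ.norm_integral_le (Q := Q) (x := x.toNNReal) (ρ := ρ) (v := y) (b := b)
        (by rw [hxx]; exact hb) (by rw [hxx]; exact hbi)
      rwa [hxx] at this)
  rw [zero_mul] at h
  exact norm_eq_zero.mp (le_antisymm h (norm_nonneg _))

/-- The pointwise estimate for solutions of the inhomogeneous equation. -/
lemma norm_le (hκ : IsVolterraKernel up κ C) (hQ : IntegrableOn Q (Ioi 0)) {ρ : S}
    {y f : ℝ≥0 → V} (hf : Continuous f) {M : ℝ} (hyM : ∀ x, ‖y x‖ ≤ M)
    {N : ℝ} (hfN : ∀ x, ‖f x‖ ≤ N)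
    (hy : ∀ x : ℝ≥0, y x = f x + ∫ t in region up x, κ x t ρ (Q t (y t.toNNReal))) (x₀ : ℝ≥0) :
    ‖y x₀‖ ≤ ‖f x₀‖ + C * Real.exp (C * ∫ t in Ioi 0, ‖Q t‖) *
      ∫ t in Ioi 0, ‖Q t‖ * ‖f t.toNNReal‖ := by
  have hQC : IntegrableOn (fun t => C * ‖Q t‖) (Ioi 0) := hQ.norm.const_mul C
  have hg0 : ∀ t, 0 ≤ C * ‖Q t‖ := fun t => mul_nonneg hκ.nonneg (norm_nonneg _)
  have hfi : IntegrableOn (fun t => C * ‖Q t‖ * ‖f t.toNNReal‖) (Ioi 0) := by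
    refine Integrable.mul_bdd (c := N) hQC ?_ (.of_forall fun t => ?_)
    · exact (hf.comp continuous_real_toNNReal).norm.aestronglyMeasurable
    · rw [norm_norm]; exact hfN _
  have hfA : 0 ≤ ∫ t in Ioi 0, C * ‖Q t‖ * ‖f t.toNNReal‖ :=
    setIntegral_nonneg measurableSet_Ioi fun t _ => mul_nonneg (hg0 t) (norm_nonneg _)
  have h := gronwall_region (up := up) (g := fun t => C * ‖Q t‖) (x₀ := x₀)
    (ψ := fun x => ‖y x.toNNReal - f x.toNNReal‖) (M := M + N)
    hg0 hQC x₀.2 hfA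
    (add_nonneg ((norm_nonneg _).trans (hyM 0)) ((norm_nonneg _).trans (hfN 0)))
    (fun x _ => (norm_sub_le _ _).trans (add_le_add (hyM _) (hfN _))) (by
      intro x hx b hbi hb
      have hx0 : 0 ≤ x := by
        rcases hx with rfl | hx
        · exact x₀.2
        · exact le_of_lt (region_subset_Ioi up x₀.2 hx)
      have hxx : ((x.toNNReal : ℝ≥0) : ℝ) = x := coe_toNNReal x hx0
      have hfx := hfi.mono_set (region_subset_Ioi up hx0)
      have h2 := hκ.norm_integral_le (Q := Q) (x := x.toNNReal) (ρ := ρ)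
        (v := fun t => y t.toNNReal)
        (b := fun t => ‖f t.toNNReal‖ + b t) (by
          rw [hxx]
          intro t ht
          have h3 := hb t ht
          have h4 := norm_add_le (f t.toNNReal) (y t.toNNReal - f t.toNNReal)
          rw [add_sub_cancel] at h4
          linarith) (by
          rw [hxx]
          simp only [mul_add]
          exact hfx.add hbi)
      have e : y x.toNNReal - f x.toNNReal =
          ∫ t in region up (x.toNNReal : ℝ), κ x.toNNReal t ρ (Q t (y t.toNNReal)) := by
        rw [hy x.toNNReal]; abel
      rw [e]
      refine h2.trans ?_
      rw [hxx]
      simp only [mul_add]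
      rw [integral_add hfx hbi]
      gcongr
      · exact .of_forall fun t => mul_nonneg (hg0 t) (norm_nonneg _)
      · exact region_subset_Ioi up hx0)
  simp only [Real.toNNReal_coe, mul_assoc, integral_const_mul] at h
  have h4 := norm_add_le (f x₀) (y x₀ - f x₀)
  rw [add_sub_cancel] at h4
  refine h4.trans ?_
  simp only [mul_assoc] at h ⊢
  linarith [h, mul_comm (∫ t in Ioi 0, ‖Q t‖ * ‖f t.toNNReal‖) (Real.exp (C * ∫ t in Ioi 0, ‖Q t‖))]

lemma continuous_volterra [FirstCountableTopology S] (hκ : IsVolterraKernel up κ C)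
    (hQ : IntegrableOn Q (Ioi 0))
    {v : ℝ≥0 → S → V} (hv : Continuous fun p : ℝ≥0 × S => v p.1 p.2) {M : ℝ}
    (hM : ∀ x ρ, ‖v x ρ‖ ≤ M) :
    Continuous fun p : ℝ≥0 × S => volterra up κ Q v p.1 p.2 := by
  have hsub : ∀ p : ℝ≥0 × S, region up p.1 ⊆ Ioi 0 := fun p => region_subset_Ioi up p.1.2
  have e : (fun p : ℝ≥0 × S => volterra up κ Q v p.1 p.2) = fun p : ℝ≥0 × S => ∫ t in Ioi 0,
      (region up p.1).indicator (fun t => κ p.1 t p.2 (Q t (v t.toNNReal p.2))) t := by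
    ext p
    rw [volterra, integral_indicator (measurableSet_region up _), Measure.restrict_restrict
      (measurableSet_region up _), inter_eq_left.mpr (hsub p)]
  have hvt : ∀ ρ, Continuous fun t : ℝ => v t.toNNReal ρ := fun ρ =>
    hv.comp (continuous_real_toNNReal.prodMk continuous_const)
  have hM0 : ∀ ρ : S, 0 ≤ M := fun ρ => (norm_nonneg _).trans (hM 0 ρ)
  rw [e, continuous_iff_continuousAt]
  rintro ⟨x, ρ⟩
  refine continuousAt_of_dominated (bound := fun t => C * ‖Q t‖ * M) ?_ ?_
    ((hQ.norm.const_mul C).mul_const M) ?_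
  · refine .of_forall fun p => ?_
    rw [aestronglyMeasurable_indicator_iff (measurableSet_region up _), Measure.restrict_restrict
      (measurableSet_region up _), inter_eq_left.mpr (hsub p)]
    exact hκ.aestronglyMeasurable hQ (hvt p.2).continuousOn
  · refine .of_forall fun p => .of_forall fun t => ?_
    by_cases ht : t ∈ region up p.1
    · rw [indicator_of_mem ht]
      exact hκ.norm_apply_le ht p.2 _ (hM _ _)
    · rw [indicator_of_notMem ht, norm_zero]
      exact mul_nonneg (mul_nonneg hκ.nonneg (norm_nonneg _)) (hM0 ρ)
  · have hne : ∀ᵐ t : ℝ, t ≠ x := by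
      simpa using (measure_eq_zero_iff_ae_notMem.mp (measure_singleton (μ := volume) (x : ℝ)))
    rw [ae_restrict_iff' measurableSet_Ioi]
    filter_upwards [hne] with t hne ht
    have hfst : Tendsto (fun p : ℝ≥0 × S => (p.1 : ℝ)) (𝓝 (x, ρ)) (𝓝 (x : ℝ)) :=
      (NNReal.continuous_coe.comp continuous_fst).tendsto (x, ρ)
    by_cases hr : t ∈ region up x
    · have h1 : ContinuousAt (fun p : ℝ≥0 × S => κ p.1 t p.2 (Q t (v t.toNNReal p.2))) (x, ρ) := by
        refine (hκ.continuousAt x t ρ hr).clm_apply ?_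
        exact (Q t).continuous.continuousAt.comp
          (hv.comp (continuous_const.prodMk continuous_snd)).continuousAt
      refine h1.congr ?_
      filter_upwards [hfst.eventually (eventually_mem_region up hr)] with p hp
      rw [indicator_of_mem hp]
    · have h1 := hfst.eventually (eventually_not_mem_region up hr ht hne.symm)
      refine (continuousAt_const (y := (0 : V))).congr ?_
      filter_upwards [h1] with p hp
      rw [indicator_of_notMem hp]

/-- The Volterra operator on bounded continuous functions. -/
def volterraL [FirstCountableTopology S] (hκ : IsVolterraKernel up κ C)
    (hQ : IntegrableOn Q (Ioi 0)) :
    (ℝ≥0 × S →ᵇ V) →L[ℂ] (ℝ≥0 × S →ᵇ V) :=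
  have hbd : ∀ (v : ℝ≥0 × S →ᵇ V) (p : ℝ≥0 × S),
      ‖volterra up κ Q (fun x ρ => v (x, ρ)) p.1 p.2‖ ≤ (C * ∫ t in Ioi 0, ‖Q t‖) * ‖v‖ := by
    intro v p
    have hi : IntegrableOn (fun t => C * ‖Q t‖ * ‖v‖) (Ioi 0) :=
      (hQ.norm.const_mul C).mul_const ‖v‖
    refine (hκ.norm_integral_le (b := fun _ => ‖v‖) (fun t _ => v.norm_coe_le_norm _)
      (hi.mono_set (region_subset_Ioi up p.1.2))).trans ?_
    refine (setIntegral_mono_set hi (.of_forall fun t => mul_nonneg (mul_nonneg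
      hκ.nonneg (norm_nonneg _)) (norm_nonneg _))
      (LE.le.eventuallyLE (region_subset_Ioi up p.1.2))).trans (le_of_eq ?_)
    rw [integral_mul_const, integral_const_mul]
  have hint : ∀ (v : ℝ≥0 × S →ᵇ V) (p : ℝ≥0 × S), IntegrableOn
      (fun t => κ p.1 t p.2 (Q t (v (t.toNNReal, p.2)))) (region up p.1) := fun v p =>
    hκ.integrableOn hQ (v := fun t => v (t.toNNReal, p.2))
      (v.continuous.comp (continuous_real_toNNReal.prodMk continuous_const)).continuousOn
      (fun t _ => v.norm_coe_le_norm _)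
  LinearMap.mkContinuous
    { toFun := fun v => BoundedContinuousFunction.ofNormedAddCommGroup
        (fun p => volterra up κ Q (fun x ρ => v (x, ρ)) p.1 p.2)
        (hκ.continuous_volterra hQ v.continuous fun x ρ => v.norm_coe_le_norm (x, ρ)) _ (hbd v)
      map_add' := by
        intro v w
        ext p
        simp only [BoundedContinuousFunction.coe_ofNormedAddCommGroup,
          BoundedContinuousFunction.coe_add, Pi.add_apply, volterra, map_add]
        exact integral_add (hint v p) (hint w p)
      map_smul' := by
        intro c v
        ext p
        simp only [BoundedContinuousFunction.coe_ofNormedAddCommGroup,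
          BoundedContinuousFunction.coe_smul, volterra, map_smul, RingHom.id_apply]
        exact integral_smul c _ }
    (C * ∫ t in Ioi 0, ‖Q t‖) fun v => by
      refine BoundedContinuousFunction.norm_ofNormedAddCommGroup_le _ ?_ (hbd v)
      exact mul_nonneg (mul_nonneg hκ.nonneg (integral_nonneg fun t => norm_nonneg _))
        (norm_nonneg _)

lemma volterraL_apply [FirstCountableTopology S] (hκ : IsVolterraKernel up κ C)
    (hQ : IntegrableOn Q (Ioi 0))
    (v : ℝ≥0 × S →ᵇ V) (p : ℝ≥0 × S) :
    hκ.volterraL hQ v p = volterra up κ Q (fun x ρ => v (x, ρ)) p.1 p.2 := rfl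

/-- The Volterra equation has a bounded continuous solution: the Neumann series converges. -/
lemma exists_solution [FirstCountableTopology S] [CompleteSpace V] (hκ : IsVolterraKernel up κ C)
    (hQ : IntegrableOn Q (Ioi 0))
    (B : ℝ≥0 × S →ᵇ V) :
    ∃ Y : ℝ≥0 × S →ᵇ V, ∀ p, Y p = B p + volterra up κ Q (fun x ρ => Y (x, ρ)) p.1 p.2 := by
  set K := hκ.volterraL hQ with hK
  set g : ℝ → ℝ := fun t => C * ‖Q t‖ with hg
  have hg0 : ∀ t, 0 ≤ g t := fun t => mul_nonneg hκ.nonneg (norm_nonneg _)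
  have hgi : IntegrableOn g (Ioi 0) := hQ.norm.const_mul C
  have hit : ∀ (k : ℕ) (p : ℝ≥0 × S),
      ‖(K ^ k) B p‖ ≤ mass up g p.1 ^ k / (k.factorial : ℝ) * ‖B‖ := by
    intro k
    induction k with
    | zero => intro p; simpa using B.norm_coe_le_norm p
    | succ k ih =>
      intro p
      rw [pow_succ', mul_apply_eq_comp, hK, volterraL_apply, volterra]
      have hmul := integrableOn_mul_mass_pow (up := up) hg0 hgi k
      have hi : IntegrableOn (fun t => C * ‖Q t‖ *
          (mass up g t ^ k / (k.factorial : ℝ) * ‖B‖)) (region up p.1) := by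
        have := ((hmul.mono_set (region_subset_Ioi up p.1.2)).div_const
          (k.factorial : ℝ)).mul_const ‖B‖
        refine this.congr (.of_forall fun t => ?_)
        simp only [hg]; ring
      refine (hκ.norm_integral_le (Q := Q) (v := fun t => (K ^ k) B (t.toNNReal, p.2))
        (b := fun t => mass up g t ^ k / (k.factorial : ℝ) * ‖B‖) ?_ hi).trans ?_
      · intro t ht
        have := ih (t.toNNReal, p.2)
        rwa [coe_toNNReal t (le_of_lt (region_subset_Ioi up p.1.2 ht))] at this
      · have e : ∀ t, C * ‖Q t‖ * (mass up g t ^ k / (k.factorial : ℝ) * ‖B‖) =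
            (g t * mass up g t ^ k) * (‖B‖ / (k.factorial : ℝ)) := by
          intro t; simp only [hg]; ring
        simp only [e]
        rw [integral_mul_const]
        refine (mul_le_mul_of_nonneg_right (integral_mul_mass_pow_le (up := up) hg0 hgi k p.1.2)
          (by positivity)).trans (le_of_eq ?_)
        rw [Nat.factorial_succ]
        push_cast
        field_simp
        exact mul_comm _ _
  set N := ∫ t in Ioi 0, g t with hN
  have hnorm : ∀ k, ‖(K ^ k) B‖ ≤ N ^ k / (k.factorial : ℝ) * ‖B‖ := by
    intro k
    have hN0 : 0 ≤ N := setIntegral_nonneg measurableSet_Ioi fun t _ => hg0 t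
    refine (BoundedContinuousFunction.norm_le (by positivity)).mpr fun p => (hit k p).trans ?_
    gcongr
    · exact mass_nonneg hg0 _
    · exact mass_le hg0 hgi p.1.2
  have hsum : Summable fun k => (K ^ k) B :=
    Summable.of_norm_bounded ((Real.summable_pow_div_factorial N).mul_right ‖B‖) hnorm
  refine ⟨∑' k, (K ^ k) B, fun p => ?_⟩
  have h1 : K (∑' k, (K ^ k) B) = ∑' k, (K ^ (k + 1)) B := by
    rw [ContinuousLinearMap.map_tsum K hsum]
    simp only [pow_succ', mul_apply_eq_comp]
  have h2 : (∑' k, (K ^ k) B) = B + K (∑' k, (K ^ k) B) := by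
    rw [h1, hsum.tsum_eq_zero_add]
    simp
  have h3 := congrArg (fun v : ℝ≥0 × S →ᵇ V => v p) h2
  simp only [BoundedContinuousFunction.coe_add, Pi.add_apply] at h3
  rw [h3, hK, volterraL_apply]

end IsVolterraKernel

end Kernel

end Volterra

/-! ### Oscillatory integrals -/

section Oscillatory

open scoped FourierTransform SchwartzMap

/-- On `L¹ ∩ L²` the Fourier integral represents the Fourier transform of `L²`; in particular it
does not increase the `L²` norm. -/
lemma eLpNorm_fourier_le {f : ℝ → ℂ} (hf : Integrable f) (hf2 : MemLp f 2) :
    eLpNorm (𝓕 f) 2 volume ≤ eLpNorm f 2 volume := by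
  set F2 : Lp ℂ 2 (volume : Measure ℝ) := hf2.toLp f with hF2
  set g : Lp ℂ 2 (volume : Measure ℝ) := 𝓕 F2 with hg
  have hcont : Continuous (𝓕 f) :=
    VectorFourier.fourierIntegral_continuous Real.continuous_fourierChar (by fun_prop) hf
  have hae : 𝓕 f =ᵐ[volume] g := by
    refine ae_eq_of_integral_contDiff_smul_eq hcont.locallyIntegrable
      ((Lp.memLp g).locallyIntegrable (by norm_num)) fun φ hφ hφc => ?_
    set Φ : 𝓢(ℝ, ℂ) := HasCompactSupport.toSchwartzMap (f := fun x => (φ x : ℂ))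
      (hφc.comp_left (g := fun x : ℝ => (x : ℂ)) (by simp)) (by
        exact Complex.ofRealCLM.contDiff.comp hφ) with hΦ
    have hΦa : ∀ x, Φ x = (φ x : ℂ) := fun x => rfl
    have e1 : ∫ x, Φ x • g x = ∫ x, (𝓕 Φ) x • F2 x := by
      have h1 := Lp.fourier_toTemperedDistribution_eq F2
      have h2 := DFunLike.congr_fun h1 Φ
      rw [TemperedDistribution.fourier_apply, Lp.toTemperedDistribution_apply,
        Lp.toTemperedDistribution_apply] at h2
      exact h2.symm
    have e2 : ∫ x, (𝓕 Φ) x • F2 x = ∫ x, (𝓕 Φ) x • f x := by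
      refine integral_congr_ae ?_
      filter_upwards [hf2.coeFn_toLp] with x hx
      rw [hF2, hx]
    have e3 : ∫ x, (𝓕 Φ) x • f x = ∫ x, Φ x • (𝓕 f) x := by
      simpa using! VectorFourier.integral_fourierIntegral_smul_eq_flip (μ := volume)
        (ν := volume) (L := innerₗ ℝ) Real.continuous_fourierChar continuous_inner
        (f := fun x => Φ x) (g := f) Φ.integrable hf
    simp only [hΦa] at e1 e2 e3
    have : ∀ h : ℝ → ℂ, ∫ x, φ x • h x = ∫ x, (φ x : ℂ) • h x := fun h => by
      simp
    rw [this, this, e1, e2, e3]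
  rw [eLpNorm_congr_ae hae]
  have h1 : ‖g‖ = ‖F2‖ := Lp.norm_fourier_eq F2
  rw [Lp.norm_def, Lp.norm_def, ENNReal.toReal_eq_toReal_iff' (Lp.eLpNorm_ne_top _)
    (Lp.eLpNorm_ne_top _)] at h1
  rw [h1, hF2, eLpNorm_congr_ae hf2.coeFn_toLp]

lemma lintegral_comp_mul_left' (f : ℝ → ℝ≥0∞) {a : ℝ} (ha : a ≠ 0) :
    ∫⁻ r, f (a * r) = ofReal |a⁻¹| * ∫⁻ r, f r := by
  have h1 := (Homeomorph.mulLeft₀ a ha).measurableEmbedding.lintegral_map (μ := volume) f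
  simp only [Homeomorph.coe_mulLeft₀] at h1
  rw [Real.map_volume_mul_left ha, lintegral_smul_measure] at h1
  exact h1.symm

lemma lintegral_Ioi_comp_mul_left (f : ℝ → ℝ≥0∞) {a : ℝ} (ha : 0 < a) :
    ∫⁻ r in Ioi 0, f (a * r) = ofReal a⁻¹ * ∫⁻ r in Ioi 0, f r := by
  rw [← lintegral_indicator measurableSet_Ioi, ← lintegral_indicator measurableSet_Ioi,
    ← abs_of_pos (inv_pos.mpr ha), ← lintegral_comp_mul_left' _ ha.ne']
  congr 1
  ext r
  simp only [indicator, mem_Ioi, mul_pos_iff_of_pos_left ha]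

/-- The majorant `min (1, 1 / u)` of all damping factors. -/
def damp (u : ℝ) : ℝ := min 1 u⁻¹

lemma damp_nonneg {u : ℝ} (hu : 0 ≤ u) : 0 ≤ damp u := le_min zero_le_one (inv_nonneg.mpr hu)

lemma damp_le_one (u : ℝ) : damp u ≤ 1 := min_le_left _ _

lemma measurable_damp : Measurable damp := measurable_const.min measurable_inv

/-- The constant of the Schur test for the kernel `damp (r t)`. -/
def dampConst : ℝ≥0∞ := ∫⁻ u in Ioi 0, ofReal (damp u * u ^ (-(1 / 2) : ℝ))

lemma dampConst_ne_top : dampConst ≠ ⊤ := by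
  have h1 : IntegrableOn (fun u : ℝ => u ^ (-(1 / 2) : ℝ)) (Ioc 0 1) := by
    have := intervalIntegral.intervalIntegrable_rpow' (a := 0) (b := 1) (r := -(1 / 2))
      (by norm_num)
    rwa [intervalIntegrable_iff_integrableOn_Ioc_of_le zero_le_one] at this
  have h2 : IntegrableOn (fun u : ℝ => u ^ (-(3 / 2) : ℝ)) (Ioi 1) :=
    integrableOn_Ioi_rpow_of_lt (by norm_num) one_pos
  rw [dampConst, ← Ioc_union_Ioi_eq_Ioi (zero_le_one (α := ℝ))]
  refine ne_top_of_le_ne_top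
    (ENNReal.add_ne_top.mpr ⟨h1.lintegral_lt_top.ne, h2.lintegral_lt_top.ne⟩)
    ((lintegral_union_le _ _ _).trans (add_le_add
      (setLIntegral_mono' measurableSet_Ioc fun u hu => ofReal_le_ofReal ?_)
      (setLIntegral_mono' measurableSet_Ioi fun u hu => ofReal_le_ofReal ?_)))
  · exact mul_le_of_le_one_left (Real.rpow_nonneg hu.1.le _) (damp_le_one u)
  · have hu0 : 0 < u := one_pos.trans hu
    have e : u ^ (-(3 / 2) : ℝ) = u⁻¹ * u ^ (-(1 / 2) : ℝ) := by
      rw [← Real.rpow_neg_one, ← Real.rpow_add hu0]; norm_num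
    rw [e]
    exact mul_le_mul_of_nonneg_right (min_le_right _ _) (Real.rpow_nonneg hu0.le _)

lemma lintegral_damp_mul_rpow {r : ℝ} (hr : 0 < r) :
    ∫⁻ t in Ioi 0, ofReal (damp (r * t) * t ^ (-(1 / 2) : ℝ)) =
      ofReal (r ^ (-(1 / 2) : ℝ)) * dampConst := by
  have h := lintegral_Ioi_comp_mul_left (fun u => ofReal (damp u * u ^ (-(1 / 2) : ℝ))) hr
  have e : ∫⁻ t in Ioi 0, ofReal (damp (r * t) * t ^ (-(1 / 2) : ℝ)) = ofReal (r ^ (1 / 2 : ℝ)) *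
        ∫⁻ t in Ioi 0, ofReal (damp (r * t) * (r * t) ^ (-(1 / 2) : ℝ)) := by
    rw [← lintegral_const_mul' _ _ ofReal_ne_top]
    refine setLIntegral_congr_fun measurableSet_Ioi fun t ht => ?_
    have ht : 0 < t := ht
    rw [← ofReal_mul (Real.rpow_nonneg hr.le _), Real.mul_rpow hr.le ht.le]
    congr 1
    have : r ^ (1 / 2 : ℝ) * r ^ (-(1 / 2) : ℝ) = 1 := by
      rw [← Real.rpow_add hr]; norm_num
    linear_combination (-(damp (r * t) * t ^ (-(1 / 2) : ℝ))) * this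
  rw [e, h, ← mul_assoc, ← ofReal_mul (Real.rpow_nonneg hr.le _), dampConst]
  congr 2
  rw [← Real.rpow_neg_one, ← Real.rpow_add hr]; norm_num

/-- The Cauchy–Schwarz inequality with a weight. -/
lemma lintegral_mul_sq_le {α : Type*} [MeasurableSpace α] {m : Measure α} {g f : α → ℝ≥0∞}
    (hg : AEMeasurable g m) (hf : AEMeasurable f m) :
    (∫⁻ t, g t * f t ∂m) ^ 2 ≤ (∫⁻ t, g t ∂m) * ∫⁻ t, g t * f t ^ 2 ∂m := by
  have h := ENNReal.lintegral_mul_le_Lp_mul_Lq m Real.HolderConjugate.two_two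
    (f := fun t => g t ^ (1 / 2 : ℝ)) (g := fun t => g t ^ (1 / 2 : ℝ) * f t)
    (hg.pow_const _) ((hg.pow_const _).mul hf)
  have e0 : ∀ a : ℝ≥0∞, a ^ (1 / 2 : ℝ) * a ^ (1 / 2 : ℝ) = a := fun a => by
    rw [← ENNReal.rpow_add_of_nonneg _ _ (by norm_num) (by norm_num)]; norm_num
  have e1 : ∀ a : ℝ≥0∞, (a ^ (1 / 2 : ℝ)) ^ (2 : ℝ) = a := fun a => by
    rw [← ENNReal.rpow_mul]; norm_num
  have e2 : ∀ t, (g t ^ (1 / 2 : ℝ) * f t) ^ (2 : ℝ) = g t * f t ^ 2 := fun t => by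
    rw [ENNReal.mul_rpow_of_nonneg _ _ (by norm_num), e1, ENNReal.rpow_two]
  simp only [Pi.mul_apply, e1, e2, ← mul_assoc, e0] at h
  calc (∫⁻ t, g t * f t ∂m) ^ 2
      ≤ ((∫⁻ t, g t ∂m) ^ (1 / 2 : ℝ) * (∫⁻ t, g t * f t ^ 2 ∂m) ^ (1 / 2 : ℝ)) ^ 2 := by
        gcongr
    _ = _ := by rw [← ENNReal.rpow_two, ENNReal.mul_rpow_of_nonneg _ _ (by norm_num), e1, e1]

/-- The Schur test for the kernel `damp (r t)`. -/
lemma lintegral_damp_sq_le {f : ℝ → ℝ≥0∞} (hf : AEMeasurable f (volume.restrict (Ioi 0))) :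
    ∫⁻ r in Ioi 0, (∫⁻ t in Ioi 0, ofReal (damp (r * t)) * f t) ^ 2 ≤
      dampConst ^ 2 * ∫⁻ t in Ioi 0, f t ^ 2 := by
  set w : ℝ → ℝ≥0∞ := fun t => ofReal (t ^ (1 / 2 : ℝ)) with hw
  have hwm : Measurable w := (measurable_id.pow_const _).ennreal_ofReal
  -- the Cauchy-Schwarz inequality with the weight `t ^ (-1/2)`
  have cs : ∀ r > 0, (∫⁻ t in Ioi 0, ofReal (damp (r * t)) * f t) ^ 2 ≤
      dampConst * ∫⁻ t in Ioi 0, ofReal (r ^ (-(1 / 2) : ℝ)) *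
        (ofReal (damp (r * t)) * w t * f t ^ 2) := by
    intro r hr
    set A : ℝ → ℝ≥0∞ := fun t => ofReal (damp (r * t) * t ^ (-(1 / 2) : ℝ)) with hA
    have hAm : AEMeasurable A (volume.restrict (Ioi 0)) :=
      (((measurable_damp.comp (measurable_const_mul r)).mul
        (measurable_id.pow_const _)).ennreal_ofReal).aemeasurable
    have hAw : ∀ t > 0, A t * w t = ofReal (damp (r * t)) := fun t ht => by
      simp only [hA, hw]
      rw [← ofReal_mul (mul_nonneg (damp_nonneg (mul_pos hr ht).le) (Real.rpow_nonneg ht.le _)),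
        mul_assoc, ← Real.rpow_add ht]
      norm_num
    have h := lintegral_mul_sq_le hAm (hwm.aemeasurable.mul hf)
    simp only [Pi.mul_apply] at h
    have e1 : ∫⁻ t in Ioi 0, A t * (w t * f t) = ∫⁻ t in Ioi 0, ofReal (damp (r * t)) * f t :=
      setLIntegral_congr_fun measurableSet_Ioi fun t ht => by simp only [← mul_assoc, hAw t ht]
    have e2 : ∫⁻ t in Ioi 0, A t * (w t * f t) ^ 2 =
        ∫⁻ t in Ioi 0, ofReal (damp (r * t)) * w t * f t ^ 2 :=
      setLIntegral_congr_fun measurableSet_Ioi fun t ht => by simp only [← hAw t ht]; ring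
    rw [e1, e2] at h
    refine h.trans (le_of_eq ?_)
    rw [hA, lintegral_damp_mul_rpow hr, lintegral_const_mul' _ _ ofReal_ne_top]
    ring
  calc ∫⁻ r in Ioi 0, (∫⁻ t in Ioi 0, ofReal (damp (r * t)) * f t) ^ 2
      ≤ ∫⁻ r in Ioi 0, dampConst * ∫⁻ t in Ioi 0, ofReal (r ^ (-(1 / 2) : ℝ)) *
        (ofReal (damp (r * t)) * w t * f t ^ 2) :=
        setLIntegral_mono' measurableSet_Ioi fun r hr => cs r hr
    _ = dampConst * ∫⁻ t in Ioi 0, ∫⁻ r in Ioi 0, ofReal (r ^ (-(1 / 2) : ℝ)) *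
        (ofReal (damp (r * t)) * w t * f t ^ 2) := by
        rw [lintegral_const_mul' _ _ dampConst_ne_top]
        congr 1
        refine lintegral_lintegral_swap ?_
        have m1 : Measurable fun p : ℝ × ℝ => ofReal (p.1 ^ (-(1 / 2) : ℝ)) :=
          (measurable_fst.pow_const _).ennreal_ofReal
        have m2 : Measurable fun p : ℝ × ℝ => ofReal (damp (p.1 * p.2)) :=
          (measurable_damp.comp (measurable_fst.mul measurable_snd)).ennreal_ofReal
        exact m1.aemeasurable.mul ((m2.aemeasurable.mul (hwm.comp measurable_snd).aemeasurable).mul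
          ((hf.comp_snd).pow_const 2))
    _ = dampConst * ∫⁻ t in Ioi 0, dampConst * f t ^ 2 := by
        congr 1
        refine setLIntegral_congr_fun measurableSet_Ioi fun t ht => ?_
        have ht : 0 < t := ht
        have e1 : ∫⁻ r in Ioi 0, ofReal (r ^ (-(1 / 2) : ℝ)) *
            (ofReal (damp (r * t)) * w t * f t ^ 2) =
            (∫⁻ r in Ioi 0, ofReal (damp (t * r) * r ^ (-(1 / 2) : ℝ))) * (w t * f t ^ 2) := by
          rw [← lintegral_mul_const]
          · refine setLIntegral_congr_fun measurableSet_Ioi fun r hr => ?_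
            have hr : 0 < r := hr
            rw [ofReal_mul (damp_nonneg (mul_pos ht hr).le), mul_comm t r]
            ring
          · exact ((measurable_damp.comp (measurable_const_mul t)).mul
              (measurable_id.pow_const _)).ennreal_ofReal
        rw [e1, lintegral_damp_mul_rpow ht]
        have h1 : ofReal (t ^ (-(1 / 2) : ℝ)) * w t = 1 := by
          rw [hw, ← ofReal_mul (Real.rpow_nonneg ht.le _), ← Real.rpow_add ht]; norm_num
        calc _ = dampConst * f t ^ 2 * (ofReal (t ^ (-(1 / 2) : ℝ)) * w t) := by ring
          _ = _ := by rw [h1, mul_one]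
    _ = _ := by
        rw [lintegral_const_mul' _ _ dampConst_ne_top]
        ring

end Oscillatory

section OscillatoryBounds

open scoped FourierTransform ContDiff

lemma lintegral_enorm_sq {α E : Type*} [MeasurableSpace α] [NormedAddCommGroup E]
    (f : α → E) (m : Measure α) : ∫⁻ x, ‖f x‖ₑ ^ 2 ∂m = eLpNorm f 2 m ^ 2 := by
  have h := eLpNorm_nnreal_pow_eq_lintegral (f := f) (μ := m) (p := 2) two_ne_zero
  simpa using h.symm

/-- The exponential factor `exp (ρ ((x - t) a + t b))`. -/
def phase (a b ρ : ℂ) (x t : ℝ) : ℂ := exp (ρ * ((x - t) * a + t * b))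

lemma continuous_phase (a b ρ : ℂ) (x : ℝ) : Continuous (phase a b ρ x) := by
  unfold phase; fun_prop

lemma norm_phase (a b ρ : ℂ) (x t : ℝ) :
    ‖phase a b ρ x t‖ = Real.exp ((x - t) * (ρ * a).re + t * (ρ * b).re) := by
  rw [phase, norm_exp]
  congr 1
  have : ρ * ((x - t) * a + t * b) =
      ((x - t : ℝ) : ℂ) * (ρ * a) + ((t : ℝ) : ℂ) * (ρ * b) := by push_cast; ring
  rw [this, Complex.add_re, re_ofReal_mul, re_ofReal_mul]

/-- The sign conditions under which the exponential factors are bounded on the region. -/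
def Admissible (up : Bool) (a b ρ : ℂ) : Prop :=
  if up then 0 ≤ (ρ * a).re ∧ b = 0 else (ρ * a).re ≤ 0 ∧ (ρ * b).re ≤ 0

lemma Admissible.norm_phase_le {up : Bool} {a b ρ : ℂ} (h : Admissible up a b ρ) {x t : ℝ}
    (ht : t ∈ closure (region up x)) : ‖phase a b ρ x t‖ ≤ 1 := by
  rw [norm_phase, Real.exp_le_one_iff]
  cases up
  · obtain ⟨h1, h2⟩ : (ρ * a).re ≤ 0 ∧ (ρ * b).re ≤ 0 := by simpa [Admissible] using h
    have ht' : t ∈ Icc 0 x := closure_minimal Ioo_subset_Icc_self isClosed_Icc ht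
    nlinarith [ht'.1, ht'.2, mul_nonneg (sub_nonneg.mpr ht'.2) (neg_nonneg.mpr h1),
      mul_nonneg ht'.1 (neg_nonneg.mpr h2)]
  · obtain ⟨h1, rfl⟩ : 0 ≤ (ρ * a).re ∧ b = 0 := by simpa [Admissible] using h
    have ht' : t ∈ Ici x := closure_minimal Ioi_subset_Ici_self isClosed_Ici ht
    have ht' : x ≤ t := ht'
    simp only [mul_zero, Complex.zero_re, add_zero]
    nlinarith [mul_nonneg (sub_nonneg.mpr ht') h1]

/-- The oscillatory integral `∫ exp (ρ ((x - t) a + t b)) q(t) dt` over the region. -/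
def osc (up : Bool) (a b : ℂ) (q : ℝ → ℂ) (x : ℝ) (ρ : ℂ) : ℂ :=
  ∫ t in region up x, phase a b ρ x t * q t

variable {up : Bool} {a b : ℂ}

lemma integrableOn_phase_mul {q : ℝ → ℂ} (hq : IntegrableOn q (Ioi 0)) {ρ : ℂ}
    (h : Admissible up a b ρ) {x : ℝ} (hx : 0 ≤ x) :
    IntegrableOn (fun t => phase a b ρ x t * q t) (region up x) := by
  refine Integrable.bdd_mul (c := 1) (hq.mono_set (region_subset_Ioi up hx))
    (continuous_phase a b ρ x).aestronglyMeasurable ?_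
  rw [ae_restrict_iff' (measurableSet_region up x)]
  exact .of_forall fun t ht => h.norm_phase_le (subset_closure ht)

lemma enorm_osc_le {q : ℝ → ℂ} {ρ : ℂ} (h : Admissible up a b ρ) {x : ℝ} (hx : 0 ≤ x) :
    ‖osc up a b q x ρ‖ₑ ≤ ∫⁻ t in Ioi 0, ‖q t‖ₑ := by
  refine (enorm_integral_le_lintegral_enorm _).trans
    ((setLIntegral_mono' (measurableSet_region up x) fun t ht => ?_).trans
      (lintegral_mono_set (region_subset_Ioi up hx)))
  rw [enorm_mul]
  refine mul_le_of_le_one_left' ?_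
  have := h.norm_phase_le (subset_closure ht)
  rw [← ofReal_norm]
  exact ENNReal.ofReal_le_one.mpr this

lemma osc_sub {q g : ℝ → ℂ} (hq : IntegrableOn q (Ioi 0)) (hg : IntegrableOn g (Ioi 0)) {ρ : ℂ}
    (h : Admissible up a b ρ) {x : ℝ} (hx : 0 ≤ x) :
    osc up a b (q - g) x ρ = osc up a b q x ρ - osc up a b g x ρ := by
  rw [osc, osc, osc, ← integral_sub (integrableOn_phase_mul hq h hx)
    (integrableOn_phase_mul hg h hx)]
  congr 1
  ext t
  simp only [Pi.sub_apply]; ring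

/-- Integration by parts. -/
lemma norm_intervalIntegral_phase_le {g : ℝ → ℂ} (hg : ContDiff ℝ 1 g) {M : ℝ}
    (hM : ∀ t, ‖g t‖ ≤ M) (hgi : Integrable (deriv g)) {ρ : ℂ} (hρ : ρ ≠ 0) (hab : a ≠ b)
      {x u v : ℝ}
    (huv : u ≤ v) (hP : ∀ t ∈ Icc u v, ‖phase a b ρ x t‖ ≤ 1) :
    ‖∫ t in u..v, phase a b ρ x t * g t‖ ≤ (2 * M + ∫ t, ‖deriv g t‖) / (‖ρ‖ * ‖b - a‖) := by
  set l : ℂ := ρ * (b - a) with hl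
  have hl0 : l ≠ 0 := mul_ne_zero hρ (sub_ne_zero.mpr hab.symm)
  have hder : ∀ t, HasDerivAt (phase a b ρ x) (l * phase a b ρ x t) t := by
    intro t
    have h1 : HasDerivAt (fun t : ℝ => ρ * (((x : ℂ) - t) * a + t * b)) (ρ * ((0 - 1) * a + 1 * b))
      t := by
      have h0 := (hasDerivAt_id t).ofReal_comp
      exact ((((hasDerivAt_const t (x : ℂ)).sub h0).mul_const a).add (h0.mul_const b)).const_mul ρ
    have h2 := h1.cexp
    refine h2.congr_deriv ?_
    rw [phase, hl]; ring
  have hgd : ∀ t, HasDerivAt g (deriv g t) t := fun t =>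
    (hg.differentiable one_ne_zero t).hasDerivAt
  have hgc : Continuous (deriv g) := hg.continuous_deriv le_rfl
  have hPc := continuous_phase a b ρ x
  have hibp := intervalIntegral.integral_mul_deriv_eq_deriv_mul (a := u) (b := v)
    (fun t _ => hgd t) (fun t _ => hder t) (hgc.intervalIntegrable _ _)
    ((hPc.const_mul l).intervalIntegrable _ _)
  have e : (∫ t in u..v, g t * (l * phase a b ρ x t)) = l * ∫ t in u..v, phase a b ρ x t * g t := by
    rw [← intervalIntegral.integral_const_mul]
    congr 1; ext t; ring
  rw [e] at hibp
  have b1 : ‖g v * phase a b ρ x v‖ ≤ M := by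
    rw [norm_mul]
    exact (mul_le_of_le_one_right (norm_nonneg _) (hP v (right_mem_Icc.mpr huv))).trans (hM v)
  have b2 : ‖g u * phase a b ρ x u‖ ≤ M := by
    rw [norm_mul]
    exact (mul_le_of_le_one_right (norm_nonneg _) (hP u (left_mem_Icc.mpr huv))).trans (hM u)
  have b3 : ‖∫ t in u..v, deriv g t * phase a b ρ x t‖ ≤ ∫ t, ‖deriv g t‖ := by
    rw [intervalIntegral.integral_of_le huv]
    refine (norm_integral_le_of_norm_le (g := fun t => ‖deriv g t‖) hgi.norm.integrableOn ?_).trans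
      (setIntegral_le_integral hgi.norm (.of_forall fun t => norm_nonneg _))
    rw [ae_restrict_iff' measurableSet_Ioc]
    refine .of_forall fun t ht => ?_
    rw [norm_mul]
    exact mul_le_of_le_one_right (norm_nonneg _) (hP t (Ioc_subset_Icc_self ht))
  have hn : ‖l‖ = ‖ρ‖ * ‖b - a‖ := norm_mul _ _
  rw [le_div_iff₀ (by rw [← hn]; exact norm_pos_iff.mpr hl0), ← hn, mul_comm, ← norm_mul, hibp]
  have := norm_sub_le (g v * phase a b ρ x v - g u * phase a b ρ x u)
    (∫ t in u..v, deriv g t * phase a b ρ x t)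
  have := norm_sub_le (g v * phase a b ρ x v) (g u * phase a b ρ x u)
  linarith

lemma norm_osc_le_of_smooth (up : Bool) (hab : a ≠ b) {g : ℝ → ℂ} (hg : ContDiff ℝ 1 g)
    (hgs : HasCompactSupport g) : ∃ K, 0 ≤ K ∧ ∀ (x : ℝ) (ρ : ℂ),
      0 ≤ x → ρ ≠ 0 → Admissible up a b ρ →
      ‖osc up a b g x ρ‖ ≤ K / ‖ρ‖ := by
  obtain ⟨M, hM⟩ := hg.continuous.bounded_above_of_compact_support hgs
  have hgi : Integrable (deriv g) :=
    (hg.continuous_deriv le_rfl).integrable_of_hasCompactSupport hgs.deriv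
  have hK' : 0 ≤ 2 * M + ∫ t, ‖deriv g t‖ := by
    have : 0 ≤ M := (norm_nonneg _).trans (hM 0)
    have : 0 ≤ ∫ t, ‖deriv g t‖ := integral_nonneg fun t => norm_nonneg _
    positivity
  have hK : 0 ≤ (2 * M + ∫ t, ‖deriv g t‖) / ‖b - a‖ := div_nonneg hK' (norm_nonneg _)
  refine ⟨(2 * M + ∫ t, ‖deriv g t‖) / ‖b - a‖, hK, fun x ρ hx hρ h => ?_⟩
  rw [div_div, mul_comm ‖b - a‖]
  cases up
  · have : osc false a b g x ρ = ∫ t in (0 : ℝ)..x, phase a b ρ x t * g t := by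
      rw [intervalIntegral.integral_of_le hx, integral_Ioc_eq_integral_Ioo]; rfl
    rw [this]
    rcases hx.eq_or_lt with rfl | hx'
    · simp only [intervalIntegral.integral_same, norm_zero]
      exact div_nonneg hK' (by positivity)
    refine norm_intervalIntegral_phase_le hg hM hgi hρ hab hx fun t ht => h.norm_phase_le ?_
    change t ∈ closure (Ioo 0 x)
    rwa [closure_Ioo hx'.ne]
  · obtain ⟨R, hR⟩ := hgs.isCompact.isBounded.subset_closedBall 0
    have hz : ∀ t, R < t → g t = 0 := by
      intro t ht
      by_contra h0
      have := hR (subset_tsupport g h0)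
      rw [mem_closedBall_zero_iff, Real.norm_eq_abs] at this
      exact absurd ((le_abs_self t).trans this) (not_le.mpr ht)
    set y := max x R with hy
    have : osc true a b g x ρ = ∫ t in x..y, phase a b ρ x t * g t := by
      rw [intervalIntegral.integral_of_le (le_max_left _ _)]
      change ∫ t in Ioi x, _ = _
      refine setIntegral_eq_of_subset_of_forall_sdiff_eq_zero measurableSet_Ioi
        Ioc_subset_Ioi_self fun t ht => ?_
      have : y < t := not_le.mp fun hle => ht.2 ⟨ht.1, hle⟩
      rw [hz t ((le_max_right _ _).trans_lt this), mul_zero]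
    rw [this]
    refine norm_intervalIntegral_phase_le hg hM hgi hρ hab (le_max_left _ _)
      fun t ht => h.norm_phase_le ?_
    change t ∈ closure (Ioi x)
    rw [closure_Ioi]
    exact ht.1

/-- The Riemann-Lebesgue lemma, uniformly in `x` and in the admissible values of `ρ`. -/
lemma osc_decay (up : Bool) (hab : a ≠ b) {q : ℝ → ℂ} (hq : IntegrableOn q (Ioi 0)) {ε : ℝ}
    (hε : 0 < ε) : ∃ R, ∀ (x : ℝ) (ρ : ℂ), 0 ≤ x → R ≤ ‖ρ‖ → Admissible up a b ρ →
      ‖osc up a b q x ρ‖ ≤ ε := by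
  obtain ⟨g, hgs, hg, hqg⟩ := MemLp.exist_eLpNorm_sub_le ENNReal.one_ne_top le_rfl
    (memLp_one_iff_integrable.mpr hq) (half_pos hε)
  have hgi : IntegrableOn g (Ioi 0) :=
    (hg.continuous.integrable_of_hasCompactSupport hgs).integrableOn
  obtain ⟨K, hK0, hK⟩ := norm_osc_le_of_smooth up hab (hg.of_le (by exact_mod_cast le_top)) hgs
  refine ⟨2 * K / ε + 1, fun x ρ hx hR h => ?_⟩
  have hR1 : 0 < ‖ρ‖ := lt_of_lt_of_le (by positivity) hR
  have h1 : ‖osc up a b g x ρ‖ ≤ ε / 2 := by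
    refine (hK x ρ hx (norm_pos_iff.mp hR1) h).trans ?_
    rw [div_le_iff₀ hR1]
    have : 2 * K / ε ≤ ‖ρ‖ := by linarith
    rw [div_le_iff₀ hε] at this
    linarith
  have h2 : ‖osc up a b (q - g) x ρ‖ ≤ ε / 2 := by
    have := (enorm_osc_le (q := q - g) h hx).trans
      ((eLpNorm_one_eq_lintegral_enorm (f := q - g) (μ := halfLine)).symm.le.trans hqg)
    rw [← ofReal_norm] at this
    exact (ENNReal.ofReal_le_ofReal_iff (by positivity)).mp this
  have e : osc up a b q x ρ = osc up a b (q - g) x ρ + osc up a b g x ρ := by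
    rw [osc_sub hq hgi h hx]; ring
  rw [e]
  linarith [norm_add_le (osc up a b (q - g) x ρ) (osc up a b g x ρ)]

lemma exp_neg_le_damp {c u : ℝ} (hc : 0 < c) (hu : 0 < u) :
    Real.exp (-(c * u)) ≤ (1 + c⁻¹) * damp u := by
  unfold damp
  have h1 : Real.exp (-(c * u)) ≤ 1 := Real.exp_le_one_iff.mpr (by nlinarith [mul_pos hc hu])
  have h2 : Real.exp (-(c * u)) ≤ c⁻¹ * u⁻¹ := by
    rw [Real.exp_neg, ← mul_inv]
    exact inv_anti₀ (mul_pos hc hu) (by linarith [Real.add_one_le_exp (c * u)])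
  have hc' := inv_pos.mpr hc
  have hu' := inv_pos.mpr hu
  rcases min_choice 1 u⁻¹ with h | h <;> rw [h]
  · linarith
  · nlinarith

/-- The `L²` bound for exponentially damped integrals. -/
lemma lintegral_sq_le_of_exp {c : ℝ} (hc : 0 < c) {g : ℝ → ℝ≥0∞}
    (hg : AEMeasurable g (volume.restrict (Ioi 0))) {F : ℝ → ℂ}
    (hF : ∀ r > 0, ‖F r‖ₑ ≤ ∫⁻ s in Ioi 0, ofReal (Real.exp (-(r * s * c))) * g s) :
    ∫⁻ r in Ioi 0, ‖F r‖ₑ ^ 2 ≤ (ofReal (1 + c⁻¹) * dampConst) ^ 2 * ∫⁻ t in Ioi 0, g t ^ 2 := by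
  calc ∫⁻ r in Ioi 0, ‖F r‖ₑ ^ 2
      ≤ ∫⁻ r in Ioi 0, ofReal (1 + c⁻¹) ^ 2 * (∫⁻ t in Ioi 0, ofReal (damp (r * t)) * g t) ^ 2 := by
        refine setLIntegral_mono' measurableSet_Ioi fun r hr => ?_
        rw [← mul_pow, ← lintegral_const_mul' _ _ ofReal_ne_top]
        refine pow_le_pow_left' ((hF r hr).trans
          (setLIntegral_mono' measurableSet_Ioi fun s hs => ?_)) 2
        rw [← mul_assoc, ← ofReal_mul (by positivity)]
        refine mul_le_mul_left (ofReal_le_ofReal ?_) _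
        rw [mul_comm (r * s)]
        exact exp_neg_le_damp hc (mul_pos hr hs)
    _ ≤ _ := by
        rw [lintegral_const_mul' _ _ (by finiteness), mul_pow, mul_assoc]
        exact mul_le_mul_right (lintegral_damp_sq_le hg) _

/-- The `L²` bound for Fourier integrals. -/
lemma lintegral_sq_le_of_fourier {c : ℝ} (hc : c ≠ 0) {g : ℝ → ℂ} (hg : Integrable g)
    (hg2 : MemLp g 2) {F : ℝ → ℂ}
    (hF : ∀ r > 0, ‖F r‖ = ‖∫ t : ℝ, exp (r * (t * (c * Complex.I))) * g t‖) :
    ∫⁻ r in Ioi 0, ‖F r‖ₑ ^ 2 ≤ ofReal |(-c / (2 * Real.pi))⁻¹| * ∫⁻ t, ‖g t‖ₑ ^ 2 := by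
  have hd : -c / (2 * Real.pi) ≠ 0 := div_ne_zero (neg_ne_zero.mpr hc) (by positivity)
  have e : ∀ r > 0, ‖F r‖ₑ = ‖𝓕 g (-c / (2 * Real.pi) * r)‖ₑ := by
    intro r hr
    rw [← ofReal_norm, ← ofReal_norm, hF r hr, Real.fourier_eq']
    congr 3
    ext t
    rw [smul_eq_mul]
    congr 2
    simp only [RCLike.inner_apply, conj_trivial]
    push_cast
    field_simp
  calc ∫⁻ r in Ioi 0, ‖F r‖ₑ ^ 2 = ∫⁻ r in Ioi 0, ‖𝓕 g (-c / (2 * Real.pi) * r)‖ₑ ^ 2 :=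
        setLIntegral_congr_fun measurableSet_Ioi fun r hr => by simp only [e r hr]
    _ ≤ ∫⁻ r, ‖𝓕 g (-c / (2 * Real.pi) * r)‖ₑ ^ 2 := setLIntegral_le_lintegral _ _
    _ = ofReal |(-c / (2 * Real.pi))⁻¹| * ∫⁻ r, ‖𝓕 g r‖ₑ ^ 2 :=
        lintegral_comp_mul_left' (fun s => ‖𝓕 g s‖ₑ ^ 2) hd
    _ ≤ _ := by
        refine mul_le_mul_right ?_ _
        rw [lintegral_enorm_sq, lintegral_enorm_sq]
        exact pow_le_pow_left' (eLpNorm_fourier_le hg hg2) 2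

lemma admissible_mul {ρ : ℂ} (h : Admissible up a b ρ) {r : ℝ} (hr : 0 ≤ r) :
    Admissible up a b (r * ρ) := by
  have e : ∀ w : ℂ, ((r : ℂ) * ρ * w).re = r * (ρ * w).re := fun w => by
    rw [mul_assoc, re_ofReal_mul]
  cases up
  · obtain ⟨h1, h2⟩ : (ρ * a).re ≤ 0 ∧ (ρ * b).re ≤ 0 := by simpa [Admissible] using h
    simp only [Admissible, Bool.false_eq_true, if_false, e]
    exact ⟨mul_nonpos_of_nonneg_of_nonpos hr h1, mul_nonpos_of_nonneg_of_nonpos hr h2⟩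
  · obtain ⟨h1, h2⟩ : 0 ≤ (ρ * a).re ∧ b = 0 := by simpa [Admissible] using h
    simp only [Admissible, if_true, e]
    exact ⟨mul_nonneg hr h1, h2⟩

/-- On every ray the oscillatory integrals are bounded in `L²`, uniformly in `x`. -/
lemma exists_lintegral_osc_sq_le (up : Bool) (hab : a ≠ b) {z : ℂ} (hz : z ≠ 0)
    (h : Admissible up a b z) : ∃ K : ℝ≥0∞, K ≠ ⊤ ∧ ∀ (q : ℝ → ℂ) (x : ℝ), 0 ≤ x →
      IntegrableOn q (Ioi 0) → MemLp q 2 halfLine →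
      ∫⁻ r in Ioi (0 : ℝ), ‖osc up a b q x (r * z)‖ₑ ^ 2 ≤ K * ∫⁻ t in Ioi 0, ‖q t‖ₑ ^ 2 := by
  have hosc : ∀ (q : ℝ → ℂ) (x r : ℝ), ‖osc up a b q x (r * z)‖ₑ ≤ ∫⁻ t in region up x, ofReal
        (Real.exp (r * ((x - t) * (z * a).re + t * (z * b).re))) * ‖q t‖ₑ := by
    intro q x r
    refine (enorm_integral_le_lintegral_enorm _).trans (le_of_eq ?_)
    congr 1; ext t
    rw [enorm_mul, ← ofReal_norm (phase _ _ _ _ _), norm_phase, mul_assoc (r : ℂ),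
      mul_assoc (r : ℂ), re_ofReal_mul, re_ofReal_mul]
    congr 3
    ring
  -- the case of purely imaginary exponents
  have hfour : (z * a).re = 0 → (z * b).re = 0 → ∃ K : ℝ≥0∞, K ≠ ⊤ ∧ ∀ (q : ℝ → ℂ) (x : ℝ), 0 ≤ x →
      IntegrableOn q (Ioi 0) → MemLp q 2 halfLine →
      ∫⁻ r in Ioi (0 : ℝ), ‖osc up a b q x (r * z)‖ₑ ^ 2 ≤ K * ∫⁻ t in Ioi 0, ‖q t‖ₑ ^ 2 := by
    intro ha hb
    have ha' : z * a = (z * a).im * Complex.I := by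
      conv_lhs => rw [← Complex.re_add_im (z * a), ha]
      simp
    have hb' : z * b = (z * b).im * Complex.I := by
      conv_lhs => rw [← Complex.re_add_im (z * b), hb]
      simp
    have hc : (z * b).im - (z * a).im ≠ 0 := by
      intro h0
      rw [sub_eq_zero] at h0
      apply hab
      have : z * a = z * b := by rw [ha', hb', h0]
      exact mul_left_cancel₀ hz this
    refine ⟨ofReal |(-((z * b).im - (z * a).im) / (2 * Real.pi))⁻¹|,
      ofReal_ne_top, fun q x hx hq hq2 => ?_⟩
    have hm := measurableSet_region up x
    have hqi : Integrable ((region up x).indicator q) :=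
      (integrable_indicator_iff hm).mpr (hq.mono_set (region_subset_Ioi up hx))
    have hq2i : MemLp ((region up x).indicator q) 2 :=
      (memLp_indicator_iff_restrict hm).mpr
        (hq2.mono_measure (Measure.restrict_mono (region_subset_Ioi up hx) le_rfl))
    refine (lintegral_sq_le_of_fourier hc hqi hq2i fun r hr => ?_).trans ?_
    · have hu : ‖exp (r * (x * (z * a)))‖ = 1 := by
        rw [norm_exp, re_ofReal_mul, re_ofReal_mul, ha]; simp
      rw [← one_mul ‖∫ t, _‖, ← hu, ← norm_mul, ← integral_const_mul, osc, ← integral_indicator hm]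
      congr 2; ext t
      by_cases ht : t ∈ region up x
      · simp only [ht, indicator_of_mem]
        rw [phase, ← mul_assoc, ← exp_add]
        congr 2
        push_cast
        linear_combination (r : ℂ) * t * hb' - (r : ℂ) * t * ha'
      · simp only [ht, indicator_of_notMem, not_false_eq_true, mul_zero]
    · refine mul_le_mul_right ?_ _
      rw [← lintegral_indicator measurableSet_Ioi]
      refine lintegral_mono fun t => ?_
      by_cases ht : t ∈ region up x
      · simp [ht, region_subset_Ioi up hx ht]
      · simp [ht]
  -- the case of an exponent with negative real part, in which the integral over the region is a
  -- damped integral over the half-line after the substitution `t = T s`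
  have hexp : ∀ c > 0, ∀ T : ℝ → ℝ → ℝ, (∀ (x : ℝ) (F : ℝ → ℝ≥0∞), ∫⁻ s, F (T x s) = ∫⁻ t, F t) →
      (∀ x, Measure.QuasiMeasurePreserving (T x) volume volume) →
      (∀ x s : ℝ, T x s ∈ region up x → 0 < s ∧ ∀ r > 0,
        r * ((x - T x s) * (z * a).re + T x s * (z * b).re) ≤ -(r * s * c)) →
      ∃ K : ℝ≥0∞, K ≠ ⊤ ∧ ∀ (q : ℝ → ℂ) (x : ℝ), 0 ≤ x →
        IntegrableOn q (Ioi 0) → MemLp q 2 halfLine →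
        ∫⁻ r in Ioi (0 : ℝ), ‖osc up a b q x (r * z)‖ₑ ^ 2 ≤ K * ∫⁻ t in Ioi 0, ‖q t‖ₑ ^ 2 := by
    intro c hc T hT hTm hTe
    refine ⟨(ofReal (1 + c⁻¹) * dampConst) ^ 2,
      pow_ne_top (mul_ne_top ofReal_ne_top dampConst_ne_top), fun q x hx hq _ => ?_⟩
    set Q : ℝ → ℝ≥0∞ := (Ioi 0).indicator fun t => ‖q t‖ₑ with hQ
    have hQm : AEMeasurable Q :=
      (aemeasurable_indicator_iff measurableSet_Ioi).mpr hq.aestronglyMeasurable.enorm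
    refine (lintegral_sq_le_of_exp (g := fun s => Q (T x s)) hc
      (hQm.comp_quasiMeasurePreserving (hTm x)).restrict fun r hr => ?_).trans
        (mul_le_mul_right ?_ _)
    · refine (hosc q x r).trans ?_
      rw [← lintegral_indicator (measurableSet_region up x),
        ← lintegral_indicator measurableSet_Ioi,
        ← hT x]
      refine lintegral_mono fun s => ?_
      by_cases hs : T x s ∈ region up x
      · obtain ⟨h1, h2⟩ := hTe x s hs
        rw [indicator_of_mem hs, indicator_of_mem (mem_Ioi.mpr h1), hQ,
          indicator_of_mem (region_subset_Ioi up hx hs)]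
        exact mul_le_mul_left (ofReal_le_ofReal (Real.exp_le_exp.mpr (h2 r hr))) _
      · rw [indicator_of_notMem hs]
        exact zero_le
    · refine (setLIntegral_le_lintegral _ _).trans (le_of_eq ?_)
      rw [hT x fun t => Q t ^ 2, ← lintegral_indicator measurableSet_Ioi]
      congr 1; ext t
      by_cases ht : t ∈ Ioi (0 : ℝ) <;> simp [hQ, ht]
  cases up
  · obtain ⟨h1, h2⟩ : (z * a).re ≤ 0 ∧ (z * b).re ≤ 0 := by simpa [Admissible] using h
    rcases h1.eq_or_lt with ha | ha
    · rcases h2.eq_or_lt with hb | hb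
      · exact hfour ha hb
      · refine hexp _ (neg_pos.mpr hb) (fun _ s => s) (fun _ _ => rfl) (fun _ => .id _)
          fun x s hs => ⟨hs.1, fun r hr => le_of_eq ?_⟩
        rw [ha]
        ring
    · refine hexp _ (neg_pos.mpr ha) (fun x s => x - s) (fun x F => lintegral_sub_left_eq_self F x)
        (fun x => (Measure.measurePreserving_sub_left volume x).quasiMeasurePreserving)
        fun x s hs => ⟨by linarith [hs.2], fun r hr => ?_⟩
      nlinarith [mul_nonneg hr.le (mul_nonneg hs.1.le (neg_nonneg.mpr h2))]
  · obtain ⟨h1, rfl⟩ : 0 ≤ (z * a).re ∧ b = 0 := by simpa [Admissible] using h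
    rcases h1.eq_or_lt with ha | ha
    · exact hfour ha.symm (by simp)
    · refine hexp _ ha (fun x s => x + s) (fun x F => lintegral_add_left_eq_self F x)
        (fun x => (measurePreserving_add_left volume x).quasiMeasurePreserving)
        fun x s hs => ⟨by linarith [show x < x + s from hs], fun r hr => le_of_eq ?_⟩
      simp only [mul_zero, Complex.zero_re]
      ring

lemma enorm_add_sq_le {E : Type*} [SeminormedAddCommGroup E] (u v : E) :
    ‖u + v‖ₑ ^ 2 ≤ 2 * ‖u‖ₑ ^ 2 + 2 * ‖v‖ₑ ^ 2 := by
  have h : ‖u + v‖₊ ^ 2 ≤ 2 * ‖u‖₊ ^ 2 + 2 * ‖v‖₊ ^ 2 := by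
    rw [← NNReal.coe_le_coe]
    push_cast
    have := pow_le_pow_left₀ (norm_nonneg _) (norm_add_le u v) 2
    nlinarith [sq_nonneg (‖u‖ - ‖v‖)]
  simp only [enorm_eq_nnnorm]
  exact_mod_cast h

/-- On every ray the oscillatory integrals have small `L²` tails, uniformly in `x`. -/
lemma exists_lintegral_osc_tail_le (up : Bool) (hab : a ≠ b) {z : ℂ} (hz : z ≠ 0)
    (h : Admissible up a b z) {q : ℝ → ℂ} (hq : IntegrableOn q (Ioi 0)) (hq2 : MemLp q 2 halfLine)
    {ε : ℝ≥0∞} (hε : ε ≠ 0) : ∃ R : ℝ, 0 ≤ R ∧ ∀ x : ℝ, 0 ≤ x →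
      ∫⁻ r in Ioi R, ‖osc up a b q x (r * z)‖ₑ ^ 2 ≤ ε := by
  obtain ⟨K, hK, hKq⟩ := exists_lintegral_osc_sq_le up hab hz h
  obtain ⟨δ, hδ, hKδ⟩ : ∃ δ : ℝ, 0 < δ ∧ 2 * (K * ofReal δ ^ 2) ≤ ε / 2 := by
    have h1 : Tendsto (fun δ : ℝ => 2 * (K * ofReal δ ^ 2)) (𝓝[>] 0) (𝓝 0) := by
      have : Continuous fun δ : ℝ => 2 * (K * ofReal δ ^ 2) := by
        refine (ENNReal.continuous_const_mul (by norm_num)).comp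
          ((ENNReal.continuous_const_mul hK).comp ?_)
        exact (ENNReal.continuous_pow 2).comp ENNReal.continuous_ofReal
      have h2 := (this.tendsto 0).mono_left (nhdsWithin_le_nhds (s := Ioi 0))
      simpa using h2
    have h3 := h1.eventually (ge_mem_nhds (ENNReal.half_pos hε))
    obtain ⟨δ, h4, h5⟩ := (h3.and self_mem_nhdsWithin).exists
    exact ⟨δ, h5, h4⟩
  obtain ⟨g, hgs, hg, hqg⟩ := MemLp.exist_eLpNorm_sub_le (by norm_num) (by norm_num) hq2 hδ
  have hgi : IntegrableOn g (Ioi 0) :=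
    (hg.continuous.integrable_of_hasCompactSupport hgs).integrableOn
  have hg2 : MemLp g 2 halfLine := hg.continuous.memLp_of_hasCompactSupport hgs
  obtain ⟨L, hL0, hL⟩ := norm_osc_le_of_smooth up hab (hg.of_le (by exact_mod_cast le_top)) hgs
  -- the tail of the square of `L / (r |z|)`
  set P : ℝ → ℝ := fun r => (L / ‖z‖) ^ 2 * r ^ (-2 : ℝ) with hP
  have hPi : ∀ R > 0, IntegrableOn P (Ioi R) := fun R hR =>
    (integrableOn_Ioi_rpow_of_lt (by norm_num) hR).const_mul _
  have hPv : ∀ R > 0, ∫ r in Ioi R, P r = (L / ‖z‖) ^ 2 * R⁻¹ := by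
    intro R hR
    rw [hP, integral_const_mul, integral_Ioi_rpow_of_lt (by norm_num) hR]
    norm_num
    left
    rw [Real.rpow_neg_one]
  obtain ⟨R, hR, hRε⟩ : ∃ R : ℝ, 0 < R ∧ 2 * ofReal ((L / ‖z‖) ^ 2 * R⁻¹) ≤ ε / 2 := by
    have h1 : Tendsto (fun R : ℝ => 2 * ofReal ((L / ‖z‖) ^ 2 * R⁻¹)) atTop (𝓝 0) := by
      have h2 := (ENNReal.tendsto_ofReal (tendsto_inv_atTop_zero.const_mul ((L / ‖z‖) ^ 2)))
      have h3 := ENNReal.Tendsto.const_mul (a := 2) h2 (Or.inr (by norm_num))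
      simpa using h3
    have h3 := h1.eventually (ge_mem_nhds (ENNReal.half_pos hε))
    obtain ⟨R, h4, h5⟩ := (h3.and (eventually_gt_atTop 0)).exists
    exact ⟨R, h5, h4⟩
  refine ⟨R, hR.le, fun x hx => ?_⟩
  have hPm : Measurable fun r : ℝ => 2 * ofReal (P r) :=
    (((measurable_id.pow_const (-2 : ℝ)).const_mul _).ennreal_ofReal).const_mul _
  calc ∫⁻ r in Ioi R, ‖osc up a b q x (r * z)‖ₑ ^ 2
      ≤ ∫⁻ r in Ioi R, (2 * ‖osc up a b (q - g) x (r * z)‖ₑ ^ 2 + 2 * ofReal (P r)) := by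
        refine setLIntegral_mono' measurableSet_Ioi fun r hr => ?_
        have hr0 : 0 < r := hR.trans hr
        have had := admissible_mul h hr0.le
        have e : osc up a b q x (r * z) = osc up a b (q - g) x (r * z) + osc up a b g x
          (r * z) := by
          rw [osc_sub hq hgi had hx]; ring
        rw [e]
        refine (enorm_add_sq_le _ _).trans (add_le_add_right (mul_le_mul_right ?_ _) _)
        rw [← ofReal_norm, ← ofReal_pow (norm_nonneg _)]
        refine ofReal_le_ofReal ?_
        have hrz : (r : ℂ) * z ≠ 0 := mul_ne_zero (by exact_mod_cast hr0.ne') hz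
        refine (pow_le_pow_left₀ (norm_nonneg _) (hL x _ hx hrz had) 2).trans (le_of_eq ?_)
        rw [hP, norm_mul, norm_real, norm_of_nonneg hr0.le]
        simp only
        rw [show (-2 : ℝ) = ((-2 : ℤ) : ℝ) by norm_num, Real.rpow_intCast]
        have := norm_pos_iff.mpr hz
        field_simp
    _ = 2 * (∫⁻ r in Ioi R, ‖osc up a b (q - g) x (r * z)‖ₑ ^ 2) +
        2 * ofReal ((L / ‖z‖) ^ 2 * R⁻¹) := by
        rw [lintegral_add_right _ hPm, lintegral_const_mul' _ _ (by norm_num),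
          lintegral_const_mul' _ _ (by norm_num), ← hPv R hR,
          ← ofReal_integral_eq_lintegral_ofReal (hPi R hR)]
        rw [EventuallyLE, ae_restrict_iff' measurableSet_Ioi]
        refine .of_forall fun r hr => ?_
        have hr0 : 0 < r := hR.trans hr
        simp only [hP, Pi.zero_apply]
        positivity
    _ ≤ 2 * (K * ofReal δ ^ 2) + ε / 2 := by
        refine add_le_add (mul_le_mul_right ?_ _) hRε
        refine (lintegral_mono_set (Ioi_subset_Ioi hR.le)).trans ((hKq (q - g) x hx (hq.sub hgi)
          (hq2.sub hg2)).trans (mul_le_mul_right ?_ _))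
        rw [lintegral_enorm_sq]
        exact pow_le_pow_left' hqg 2
    _ ≤ ε / 2 + ε / 2 := add_le_add_left hKδ _
    _ = ε := ENNReal.add_halves ε

/-! ### Weakly damped integrals -/

/-- The integral `∫ min (1, 1 / (r t)) |q(t)| dt`. -/
def weakMass (q : ℝ → ℂ) (r : ℝ) : ℝ := ∫ t in Ioi 0, damp (r * t) * ‖q t‖

lemma integrableOn_damp_mul {q : ℝ → ℂ} (hq : IntegrableOn q (Ioi 0)) {r : ℝ} (hr : 0 ≤ r) :
    IntegrableOn (fun t => damp (r * t) * ‖q t‖) (Ioi 0) := by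
  refine Integrable.bdd_mul (c := 1) hq.norm
    (measurable_damp.comp (measurable_const_mul r)).aestronglyMeasurable ?_
  rw [ae_restrict_iff' measurableSet_Ioi]
  refine .of_forall fun t ht => ?_
  rw [norm_of_nonneg (damp_nonneg (mul_nonneg hr (le_of_lt ht)))]
  exact damp_le_one _

lemma weakMass_nonneg (q : ℝ → ℂ) {r : ℝ} (hr : 0 ≤ r) : 0 ≤ weakMass q r :=
  setIntegral_nonneg measurableSet_Ioi fun _ ht =>
    mul_nonneg (damp_nonneg (mul_nonneg hr (le_of_lt ht))) (norm_nonneg _)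

lemma tendsto_weakMass {q : ℝ → ℂ} (hq : IntegrableOn q (Ioi 0)) :
    Tendsto (weakMass q) atTop (𝓝 0) := by
  have h0 : (0 : ℝ) = ∫ t in Ioi (0 : ℝ), (0 : ℝ) := by simp
  rw [h0]
  refine tendsto_integral_filter_of_dominated_convergence (fun t => ‖q t‖) ?_ ?_ hq.norm ?_
  · filter_upwards [eventually_ge_atTop (0 : ℝ)] with r hr using
      (integrableOn_damp_mul hq hr).aestronglyMeasurable
  · filter_upwards [eventually_ge_atTop (0 : ℝ)] with r hr
    rw [ae_restrict_iff' measurableSet_Ioi]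
    refine .of_forall fun t ht => ?_
    rw [norm_of_nonneg (mul_nonneg (damp_nonneg (mul_nonneg hr (le_of_lt ht))) (norm_nonneg _))]
    exact mul_le_of_le_one_left (norm_nonneg _) (damp_le_one _)
  · rw [ae_restrict_iff' measurableSet_Ioi]
    refine .of_forall fun t ht => ?_
    have ht : 0 < t := ht
    have h1 : Tendsto (fun r : ℝ => (r * t)⁻¹ * ‖q t‖) atTop (𝓝 0) := by
      simpa using (tendsto_inv_atTop_zero.comp (tendsto_id.atTop_mul_const ht)).mul_const ‖q t‖
    refine squeeze_zero' ?_ ?_ h1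
    · filter_upwards [eventually_ge_atTop (0 : ℝ)] with r hr
      exact mul_nonneg (damp_nonneg (mul_nonneg hr ht.le)) (norm_nonneg _)
    · exact .of_forall fun r =>
        mul_le_mul_of_nonneg_right (min_le_right _ _) (norm_nonneg _)

lemma enorm_weakMass {q : ℝ → ℂ} (hq : IntegrableOn q (Ioi 0)) {r : ℝ} (hr : 0 ≤ r) :
    ‖weakMass q r‖ₑ = ∫⁻ t in Ioi 0, ofReal (damp (r * t)) * ‖q t‖ₑ := by
  rw [Real.enorm_of_nonneg (weakMass_nonneg q hr), weakMass,
    ofReal_integral_eq_lintegral_ofReal (integrableOn_damp_mul hq hr)]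
  · refine setLIntegral_congr_fun measurableSet_Ioi fun t ht => ?_
    rw [ofReal_mul (damp_nonneg (mul_nonneg hr (le_of_lt ht))), ofReal_norm]
  · rw [EventuallyLE, ae_restrict_iff' measurableSet_Ioi]
    exact .of_forall fun t ht =>
      mul_nonneg (damp_nonneg (mul_nonneg hr (le_of_lt ht))) (norm_nonneg _)

lemma lintegral_weakMass_sq_le {q : ℝ → ℂ} (hq : IntegrableOn q (Ioi 0)) :
    ∫⁻ r in Ioi 0, ‖weakMass q r‖ₑ ^ 2 ≤ dampConst ^ 2 * ∫⁻ t in Ioi 0, ‖q t‖ₑ ^ 2 := by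
  refine le_trans (le_of_eq (setLIntegral_congr_fun measurableSet_Ioi fun r hr => ?_))
    (lintegral_damp_sq_le hq.aestronglyMeasurable.enorm)
  rw [enorm_weakMass hq (le_of_lt hr)]

lemma exists_lintegral_tail_le {F : ℝ → ℝ≥0∞} (hF : ∫⁻ r in Ioi 0, F r ≠ ⊤) {ε : ℝ≥0∞}
    (hε : ε ≠ 0) : ∃ R : ℝ, 0 ≤ R ∧ ∫⁻ r in Ioi R, F r ≤ ε := by
  set ν := (volume : Measure ℝ).withDensity F with hν
  have h1 : ∀ R : ℝ, ν (Ioi R) = ∫⁻ r in Ioi R, F r := fun R =>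
    withDensity_apply _ measurableSet_Ioi
  have h2 : Tendsto (ν ∘ fun k : ℕ => Ioi (k : ℝ)) atTop (𝓝 (ν (⋂ k : ℕ, Ioi (k : ℝ)))) := by
    refine tendsto_measure_iInter_atTop (fun k => measurableSet_Ioi.nullMeasurableSet)
      (fun i j hij => Ioi_subset_Ioi (by exact_mod_cast hij)) ⟨0, ?_⟩
    simpa [h1] using hF
  have h3 : ⋂ k : ℕ, Ioi (k : ℝ) = ∅ := by
    refine eq_empty_of_forall_notMem fun x hx => ?_
    obtain ⟨k, hk⟩ := exists_nat_ge x
    exact absurd (mem_iInter.mp hx k) (not_lt.mpr hk)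
  rw [h3, measure_empty] at h2
  obtain ⟨k, hk⟩ := (h2.eventually (ge_mem_nhds (pos_iff_ne_zero.mpr hε))).exists
  exact ⟨k, Nat.cast_nonneg k, by rw [← h1]; exact hk⟩

end OscillatoryBounds

/-! ### A norm on the exterior algebra -/

section Norm

/-- The norm of an element of the exterior algebra is the operator norm of the matrix of the left
multiplication by it. -/
@[reducible] def extNormedRing : NormedRing (Ext n) :=
  letI : NormedRing (Matrix (Finset (Fin n)) (Finset (Fin n)) ℂ) := Matrix.linftyOpNormedRing
  NormedRing.induced (Ext n) (Matrix (Finset (Fin n)) (Finset (Fin n)) ℂ)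
    (Algebra.leftMulMatrix (extBasis n)) (Algebra.leftMulMatrix_injective (extBasis n))

attribute [local instance] extNormedRing

@[reducible] def extNormedAlgebra : NormedAlgebra ℂ (Ext n) :=
  letI : NormedRing (Matrix (Finset (Fin n)) (Finset (Fin n)) ℂ) := Matrix.linftyOpNormedRing
  letI : NormedAlgebra ℂ (Matrix (Finset (Fin n)) (Finset (Fin n)) ℂ) :=
    Matrix.linftyOpNormedAlgebra
  NormedAlgebra.induced ℂ (Ext n) (Matrix (Finset (Fin n)) (Finset (Fin n)) ℂ)
    (Algebra.leftMulMatrix (extBasis n))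

attribute [local instance] extNormedAlgebra

lemma extFiniteDimensional : FiniteDimensional ℂ (Ext n) := Module.Finite.of_basis (extBasis n)

lemma extComplete : CompleteSpace (Ext n) :=
  haveI : FiniteDimensional ℂ (Ext n) := extFiniteDimensional
  FiniteDimensional.complete ℂ (Ext n)

attribute [local instance] extFiniteDimensional extComplete

/-- The linear map `topCoeff` as a continuous map. -/
def topL (n : ℕ) : Ext n →L[ℂ] ℂ := LinearMap.toContinuousLinearMap (topCoeff n)

@[simp] lemma topL_apply (Z : Ext n) : topL n Z = topCoeff n Z := rfl

/-- The operator `V^{(m)}` as a continuous map. -/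
def derivL (V : Matrix (Fin n) (Fin n) ℂ) : Ext n →L[ℂ] Ext n :=
  LinearMap.toContinuousLinearMap (derivExtₗ V)

@[simp] lemma derivL_apply (V : Matrix (Fin n) (Fin n) ℂ) (Z : Ext n) :
    derivL V Z = derivExt V Z := rfl

/-- The embedding of `ℂⁿ` into the exterior algebra as a continuous map. -/
def ιL (n : ℕ) : (Fin n → ℂ) →L[ℂ] Ext n :=
  LinearMap.toContinuousLinearMap (ι ℂ)

@[simp] lemma ιL_apply (v : Fin n → ℂ) : ιL n v = ι ℂ v := rfl

lemma continuous_wedge (α : Finset (Fin n)) :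
    Continuous fun u : Fin n → Fin n → ℂ => wedge u α := by
  unfold wedge
  exact continuous_list_prod _ fun j _ => (ιL n).continuous.comp (continuous_apply j)

lemma derivL_eq_sum (V : Matrix (Fin n) (Fin n) ℂ) :
    derivL V = ∑ i, ∑ j, V i j • derivL (Matrix.single i j 1) := by
  conv_lhs => rw [Matrix.matrix_eq_sum_single V]
  ext Z
  simp only [derivL_apply, sum_apply, smul_apply]
  rw [← derivExtₗ_apply, map_sum, LinearMap.sum_apply]
  refine sum_congr rfl fun i _ => ?_
  rw [map_sum, LinearMap.sum_apply]
  refine sum_congr rfl fun j _ => ?_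
  have : Matrix.single i j (V i j) = V i j • Matrix.single i j (1 : ℂ) := by
    rw [Matrix.smul_single, smul_eq_mul, mul_one]
  rw [this, map_smul]
  rfl

/-- Products of solutions of a linear system solve the induced system. -/
lemma hasDerivWithinAt_wedge {u : Fin n → ℂ → Fin n → ℂ} {L : Matrix (Fin n) (Fin n) ℂ}
    {s : Set ℂ} {x : ℂ} (hu : ∀ j, HasDerivWithinAt (u j) (L.mulVec (u j x)) s x)
    (α : Finset (Fin n)) :
    HasDerivWithinAt (fun x => wedge (fun j => u j x) α)
      (derivExt L (wedge (fun j => u j x) α)) s x := by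
  unfold wedge
  induction α.sort (· ≤ ·) with
  | nil => simpa [derivExt_one] using hasDerivWithinAt_const x s (1 : Ext n)
  | cons a l ih =>
    simp only [List.map_cons, List.prod_cons]
    rw [derivExt_ι_mul]
    exact HasDerivWithinAt.mul (((ιL n).hasFDerivAt (x := u a x)).comp_hasDerivWithinAt x (hu a)) ih

end Norm

attribute [local instance] extNormedRing extNormedAlgebra extFiniteDimensional extComplete

/-! ### Sectors and powers -/

section Sector

variable {ω h : ℝ}

/-- The rotation that takes the bisector of the sector to the positive half-axis. -/
def rot (ω : ℝ) (ξ : ℂ) : ℂ := ξ * exp (-(ω * Complex.I))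

lemma rot_ne_zero {ξ : ℂ} (hξ : ξ ≠ 0) : rot ω ξ ≠ 0 := mul_ne_zero hξ (exp_ne_zero _)

lemma continuous_rot : Continuous (rot ω) := by unfold rot; fun_prop

lemma rot_mul (a ξ : ℂ) : rot ω (a * ξ) = a * rot ω ξ := by unfold rot; ring

lemma rot_bisector (r : ℂ) : rot ω (r * exp (ω * Complex.I)) = r := by
  rw [rot, mul_assoc, ← exp_add, add_neg_cancel, exp_zero, mul_one]

lemma mul_mem_sector {ξ : ℂ} {t : ℝ} (ht : 0 < t) (hξ : ξ ∈ sector ω h) :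
    (t : ℂ) * ξ ∈ sector ω h := by
  refine ⟨mul_ne_zero (by exact_mod_cast ht.ne') hξ.1, ?_⟩
  change |(rot ω (t * ξ)).arg| < h
  rw [rot_mul, Complex.arg_real_mul _ ht]
  exact hξ.2

lemma bisector_mem_sector (hpos : 0 < h) {r : ℝ} (hr : 0 < r) :
    (r : ℂ) * exp (ω * Complex.I) ∈ sector ω h := by
  refine ⟨mul_ne_zero (by exact_mod_cast hr.ne') (exp_ne_zero _), ?_⟩
  change |(rot ω _).arg| < h
  rw [rot_bisector, Complex.arg_ofReal_of_nonneg hr.le, abs_zero]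
  exact hpos

lemma zero_mem_closedSector (hpos : 0 < h) : (0 : ℂ) ∈ closedSector ω h := by
  have h1 : Continuous fun r : ℝ => (r : ℂ) * exp (ω * Complex.I) := by fun_prop
  have h2 := (h1.tendsto 0).mono_left (nhdsWithin_le_nhds (s := Ioi 0))
  simp only [Complex.ofReal_zero, zero_mul] at h2
  refine mem_closure_of_tendsto h2 ?_
  filter_upwards [self_mem_nhdsWithin] with r hr using bisector_mem_sector hpos hr

lemma mul_mem_closedSector (hpos : 0 < h) {ξ : ℂ} {t : ℝ} (ht : 0 ≤ t)
    (hξ : ξ ∈ closedSector ω h) : (t : ℂ) * ξ ∈ closedSector ω h := by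
  rcases ht.eq_or_lt with rfl | ht
  · simpa using zero_mem_closedSector hpos
  · exact map_mem_closure (continuous_const.mul continuous_id) hξ fun ξ hξ => mul_mem_sector ht hξ

lemma mul_mem_closedSector' (hpos : 0 < h) {ξ : ℂ} {t : ℝ} (ht : 0 ≤ t)
    (hξ : ξ ∈ closedSector ω h) : ξ * (t : ℂ) ∈ closedSector ω h := by
  rw [mul_comm]; exact mul_mem_closedSector hpos ht hξ

lemma rot_mem_slitPlane (hle : h ≤ Real.pi / 2) {ξ : ℂ} (hξ : ξ ∈ closedSector ω h)
    (h0 : ξ ≠ 0) : rot ω ξ ∈ Complex.slitPlane := by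
  have h1 : closedSector ω h ⊆ {ξ | 0 ≤ (rot ω ξ).re} :=
    closure_minimal (fun ξ hξ => Complex.abs_arg_le_pi_div_two_iff.mp (hξ.2.le.trans hle))
      (isClosed_le continuous_const (Complex.continuous_re.comp continuous_rot))
  have h3 : 0 ≤ (rot ω ξ).re := h1 hξ
  rcases h3.eq_or_lt with h2 | h2
  · exact Or.inr fun h3 => rot_ne_zero h0 (Complex.ext h2.symm h3)
  · exact Or.inl h2

lemma isOpen_sector (hle : h ≤ Real.pi / 2) : IsOpen (sector ω h) := by
  have h1 : sector ω h = rot ω ⁻¹' (Complex.slitPlane ∩ (fun z => |z.arg|) ⁻¹' Iio h) := by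
    ext ξ
    refine ⟨fun hξ => ⟨rot_mem_slitPlane hle (subset_closure hξ) hξ.1, hξ.2⟩, fun hξ => ⟨?_, hξ.2⟩⟩
    rintro rfl
    have := hξ.1
    simp [rot] at this
  rw [h1]
  refine IsOpen.preimage continuous_rot (ContinuousOn.isOpen_inter_preimage ?_
    Complex.isOpen_slitPlane isOpen_Iio)
  exact fun z hz => (Complex.continuousAt_arg hz).abs.continuousWithinAt

lemma isPreconnected_sector (hle : h ≤ Real.pi / 2) : IsPreconnected (sector ω h) := by
  have h1 : sector ω h = (fun p : ℝ × ℝ => (p.1 : ℂ) * exp (p.2 * Complex.I) *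
      exp (ω * Complex.I)) '' (Ioi 0 ×ˢ Ioo (-h) h) := by
    ext ξ
    constructor
    · intro hξ
      refine ⟨(‖rot ω ξ‖, (rot ω ξ).arg), ⟨norm_pos_iff.mpr (rot_ne_zero hξ.1), abs_lt.mp hξ.2⟩, ?_⟩
      simp only [Complex.norm_mul_exp_arg_mul_I]
      rw [rot, mul_assoc, ← exp_add, neg_add_cancel, exp_zero, mul_one]
    · rintro ⟨⟨r, θ⟩, ⟨hr, hθ⟩, rfl⟩
      have hr : 0 < r := hr
      refine ⟨mul_ne_zero (mul_ne_zero (by exact_mod_cast hr.ne') (exp_ne_zero _))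
        (exp_ne_zero _), ?_⟩
      change |(rot ω _).arg| < h
      have hθ : -h < θ ∧ θ < h := hθ
      rw [rot_bisector, Complex.exp_mul_I, Complex.arg_mul_cos_add_sin_mul_I hr
        ⟨by linarith [Real.pi_pos], by linarith [Real.pi_pos]⟩]
      exact abs_lt.mpr hθ
  rw [h1]
  refine IsPreconnected.image (isPreconnected_Ioi.prod isPreconnected_Ioo) _ ?_
  fun_prop

lemma sectorPow_eq (ξ ν : ℂ) : sectorPow ω ξ ν =
    exp (ν * (Complex.log (rot ω ξ) + ω * Complex.I)) := rfl

lemma sectorPow_ne_zero (ξ ν : ℂ) : sectorPow ω ξ ν ≠ 0 := exp_ne_zero _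

lemma sectorPow_add (ξ ν ν' : ℂ) :
    sectorPow ω ξ (ν + ν') = sectorPow ω ξ ν * sectorPow ω ξ ν' := by
  rw [sectorPow, sectorPow, sectorPow, add_mul, exp_add]

@[simp] lemma sectorPow_zero (ξ : ℂ) : sectorPow ω ξ 0 = 1 := by
  rw [sectorPow, zero_mul, exp_zero]

lemma sectorPow_sub (ξ ν ν' : ℂ) :
    sectorPow ω ξ (ν - ν') = sectorPow ω ξ ν / sectorPow ω ξ ν' := by
  rw [eq_div_iff (sectorPow_ne_zero _ _), ← sectorPow_add, sub_add_cancel]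

lemma sectorPow_sum {ι : Type*} (ξ : ℂ) (s : Finset ι) (ν : ι → ℂ) :
    sectorPow ω ξ (∑ i ∈ s, ν i) = ∏ i ∈ s, sectorPow ω ξ (ν i) := by
  simp only [sectorPow, sum_mul, exp_sum]

lemma sectorPow_mul {ξ : ℂ} (hξ : ξ ≠ 0) {t : ℝ} (ht : 0 < t) (ν : ℂ) :
    sectorPow ω (t * ξ) ν = (t : ℂ) ^ ν * sectorPow ω ξ ν := by
  rw [sectorPow_eq, sectorPow_eq, rot_mul, Complex.log_ofReal_mul ht (rot_ne_zero hξ),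
    Complex.cpow_def_of_ne_zero (by exact_mod_cast ht.ne'), ← exp_add,
    Complex.ofReal_log ht.le]
  congr 1; ring

lemma continuousOn_sectorPow (hle : h ≤ Real.pi / 2) (ν : ℂ) :
    ContinuousOn (fun ξ => sectorPow ω ξ ν) (closedSector ω h \ {0}) := by
  intro ξ hξ
  refine ContinuousAt.continuousWithinAt ?_
  have h1 : ContinuousAt (fun ξ => Complex.log (rot ω ξ)) ξ :=
    (continuousAt_clog (rot_mem_slitPlane hle hξ.1 hξ.2)).comp continuous_rot.continuousAt
  exact Complex.continuous_exp.continuousAt.comp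
    (continuousAt_const.mul (h1.add continuousAt_const))

/-- The power `ξ ^ ν` with its limit at the vertex when `ν = 0` or `Re ν > 0`. -/
def vertexPow (ω : ℝ) (ξ ν : ℂ) : ℂ :=
  if ξ = 0 then (if ν = 0 then 1 else 0) else sectorPow ω ξ ν

lemma vertexPow_of_ne {ξ : ℂ} (hξ : ξ ≠ 0) (ν : ℂ) : vertexPow ω ξ ν = sectorPow ω ξ ν :=
  if_neg hξ

@[simp] lemma vertexPow_zero_right (ξ : ℂ) : vertexPow ω ξ 0 = 1 := by simp [vertexPow]

lemma continuousOn_of_ne_zero {E : Type*} [TopologicalSpace E] {f : ℂ → E}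
    (h1 : ContinuousOn f (closedSector ω h \ {0}))
    (h2 : Tendsto f (𝓝[closedSector ω h \ {0}] 0) (𝓝 (f 0))) :
    ContinuousOn f (closedSector ω h) := by
  intro ξ hξ
  rcases eq_or_ne ξ 0 with rfl | h0
  · have : ContinuousWithinAt f (closedSector ω h \ {0}) 0 := h2
    exact continuousWithinAt_sdiff_self.mp this
  · refine (h1 ξ ⟨hξ, h0⟩).mono_of_mem_nhdsWithin ?_
    rw [sdiff_eq]
    exact inter_mem_nhdsWithin _ (isOpen_compl_singleton.mem_nhds h0)

lemma continuousOn_vertexPow (hle : h ≤ Real.pi / 2) {ν : ℂ} (hν : ν = 0 ∨ 0 < ν.re) :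
    ContinuousOn (fun ξ => vertexPow ω ξ ν) (closedSector ω h) := by
  rcases hν with rfl | hν
  · simpa using continuousOn_const
  have hne : ν ≠ 0 := by rintro rfl; simp at hν
  refine continuousOn_of_ne_zero ?_ ?_
  · exact (continuousOn_sectorPow hle ν).congr fun ξ hξ => vertexPow_of_ne hξ.2 ν
  · have h1 := tendsto_zero_iff_norm_tendsto_zero.mpr (tendsto_norm_sectorPow ω h hν)
    have h2 : vertexPow ω 0 ν = 0 := by simp [vertexPow, hne]
    rw [h2]
    refine h1.congr' ?_
    filter_upwards [self_mem_nhdsWithin] with ξ hξ using (vertexPow_of_ne hξ.2 ν).symm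

/-- A continuous function on the closed sector is bounded if it is bounded far from the vertex. -/
lemma exists_bound_of_continuousOn {E : Type*} [SeminormedAddCommGroup E] {f : ℂ → E}
    (hf : ContinuousOn f (closedSector ω h)) {M : ℝ}
    (hM : ∀ ξ ∈ closedSector ω h, 1 ≤ ‖ξ‖ → ‖f ξ‖ ≤ M) :
    ∃ C, 0 ≤ C ∧ ∀ ξ ∈ closedSector ω h, ‖f ξ‖ ≤ C := by
  have hc : IsCompact (closedSector ω h ∩ Metric.closedBall 0 1) :=
    (isCompact_closedBall (0 : ℂ) 1).inter_left isClosed_closure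
  obtain ⟨C, hC⟩ := hc.exists_bound_of_continuousOn (hf.mono inter_subset_left)
  refine ⟨max (max C M) 0, le_max_right _ _, fun ξ hξ => ?_⟩
  refine le_trans ?_ (le_max_left _ _)
  rcases le_total ‖ξ‖ 1 with h1 | h1
  · exact (hC ξ ⟨hξ, by simpa using h1⟩).trans (le_max_left _ _)
  · exact (hM ξ hξ h1).trans (le_max_right _ _)

/-- A function with zero derivative on the closed sector without its vertex is constant. -/
lemma exists_const_of_hasDerivWithinAt_zero (hle : h ≤ Real.pi / 2) {f : ℂ → ℂ}
    (hf : ∀ ξ ∈ closedSector ω h, ξ ≠ 0 → HasDerivWithinAt f 0 (closedSector ω h) ξ) :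
    ∃ a, ∀ ξ ∈ closedSector ω h, ξ ≠ 0 → f ξ = a := by
  have hs : sector ω h ⊆ closedSector ω h \ {0} := fun ξ hξ => ⟨subset_closure hξ, hξ.1⟩
  have hd : ∀ ξ ∈ sector ω h, HasDerivAt f 0 ξ := fun ξ hξ =>
    (hf ξ (subset_closure hξ) hξ.1).hasDerivAt
      (Filter.mem_of_superset ((isOpen_sector hle).mem_nhds hξ) subset_closure)
  obtain ⟨a, ha⟩ := (isOpen_sector (ω := ω) hle).exists_is_const_of_deriv_eq_zero
    (isPreconnected_sector hle)
    (fun ξ hξ => (hd ξ hξ).differentiableAt.differentiableWithinAt) (fun ξ hξ => (hd ξ hξ).deriv)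
  have h1 : EqOn f (fun _ => a) (closedSector ω h \ {0}) := by
    refine EqOn.of_subset_closure (s := sector ω h) ha ?_ continuousOn_const hs
      (sdiff_subset.trans le_rfl)
    exact fun ξ hξ => (hf ξ hξ.1 hξ.2).continuousWithinAt.mono sdiff_subset
  exact ⟨a, fun ξ hξ h0 => h1 ⟨hξ, h0⟩⟩

/-- A sector that avoids a line through its vertex lies in a half-plane. -/
lemma le_pi_div_two_of_disjoint {b : Fin n → ℂ} {j k : Fin n} (hjk : j ≠ k)
    (hS : Disjoint (sector ω h) (singularLines b)) (hb : b j ≠ b k) : h ≤ Real.pi / 2 := by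
  by_contra! hlt
  set d := b j - b k with hd
  have hd0 : d ≠ 0 := sub_ne_zero.mpr hb
  have key : ∀ s : ℝ, s ≠ 0 → 0 ≤ (rot ω (s * (Complex.I * (starRingEnd ℂ) d))).re → False := by
    intro s hs hre
    have hx0 : (s : ℂ) * (Complex.I * (starRingEnd ℂ) d) ≠ 0 :=
      mul_ne_zero (by exact_mod_cast hs) (mul_ne_zero Complex.I_ne_zero (by simpa using hd0))
    have h1 : (s : ℂ) * (Complex.I * (starRingEnd ℂ) d) ∈ sector ω h :=
      ⟨hx0, (Complex.abs_arg_le_pi_div_two_iff.mpr hre).trans_lt hlt⟩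
    refine disjoint_left.mp hS h1 ⟨j, k, hjk, ?_⟩
    have h2 : ((s : ℂ) * (Complex.I * (starRingEnd ℂ) d) * d).re = 0 := by
      have : (s : ℂ) * (Complex.I * (starRingEnd ℂ) d) * d = s *
        (Complex.I * (d * (starRingEnd ℂ) d)) := by
        ring
      rw [this, Complex.mul_conj, re_ofReal_mul]
      simp
    have h3 : (s : ℂ) * (Complex.I * (starRingEnd ℂ) d) * d =
      (s : ℂ) * (Complex.I * (starRingEnd ℂ) d) * b j -
        (s : ℂ) * (Complex.I * (starRingEnd ℂ) d) * b k := by rw [hd]; ring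
    rw [h3, sub_re] at h2
    linarith
  rcases le_total 0 (rot ω (Complex.I * (starRingEnd ℂ) d)).re with h1 | h1
  · exact key 1 one_ne_zero (by simpa using h1)
  · refine key (-1) (by norm_num) ?_
    rw [rot_mul, re_ofReal_mul]
    linarith

end Sector

/-! ### The unperturbed system -/

section Combinatorics

/-- The first (`up = true`) or the last `m` indices. -/
def star (n : ℕ) (up : Bool) (m : ℕ) : Finset (Fin n) :=
  if up then Finset.univ.filter (·.val < m) else Finset.univ.filter (n - m ≤ ·.val)

lemma card_star (up : Bool) {m : ℕ} (hm : m ≤ n) : (star n up m).card = m := by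
  cases up
  · have h1 : star n false m = (Finset.univ.filter fun i : Fin n => i.val < n - m)ᶜ := by
      ext i; simp [star]
    rw [h1, Finset.card_compl, Fin.card_filter_val_lt, Fintype.card_fin]
    omega
  · simp only [star, if_true, Fin.card_filter_val_lt]
    omega

lemma sum_le_sum_of_exchange {ι : Type*} [DecidableEq ι] {s α : Finset ι} (hc : s.card = α.card)
    {a : ι → ℝ} (h : ∀ i ∈ s, ∀ j ∉ s, a i ≤ a j) : ∑ i ∈ s, a i ≤ ∑ i ∈ α, a i := by
  have hcard : (s \ α).card = (α \ s).card := Finset.card_sdiff_comm hc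
  have e := Finset.equivOfCardEq hcard
  have h1 := Finset.sum_inter_add_sum_sdiff s α a
  have h2 := Finset.sum_inter_add_sum_sdiff α s a
  rw [Finset.inter_comm] at h2
  have h3 : ∑ i ∈ s \ α, a i ≤ ∑ i ∈ α \ s, a i := by
    rw [← Finset.sum_coe_sort (s \ α), ← Finset.sum_coe_sort (α \ s), ← e.sum_comp]
    exact sum_le_sum fun i _ => h _ (Finset.mem_sdiff.mp i.2).1 _ (Finset.mem_sdiff.mp (e i).2).2
  linarith

lemma sum_lt_sum_of_exchange {ι : Type*} [DecidableEq ι] {s α : Finset ι} (hc : s.card = α.card)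
    (hne : α ≠ s) {a : ι → ℝ} (h : ∀ i ∈ s, ∀ j ∉ s, a i < a j) :
    ∑ i ∈ s, a i < ∑ i ∈ α, a i := by
  have hcard : (s \ α).card = (α \ s).card := Finset.card_sdiff_comm hc
  have e := Finset.equivOfCardEq hcard
  have h1 := Finset.sum_inter_add_sum_sdiff s α a
  have h2 := Finset.sum_inter_add_sum_sdiff α s a
  rw [Finset.inter_comm] at h2
  have hnon : (s \ α).Nonempty := by
    rw [Finset.sdiff_nonempty]
    exact fun hs => hne (Finset.eq_of_subset_of_card_le hs hc.ge).symm
  have h3 : ∑ i ∈ s \ α, a i < ∑ i ∈ α \ s, a i := by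
    rw [← Finset.sum_coe_sort (s \ α), ← Finset.sum_coe_sort (α \ s), ← e.sum_comp]
    have : (Finset.univ : Finset {x // x ∈ s \ α}).Nonempty :=
      Finset.univ_nonempty_iff.mpr hnon.to_subtype
    exact Finset.sum_lt_sum_of_nonempty this fun i _ => h _ (Finset.mem_sdiff.mp i.2).1 _
      (Finset.mem_sdiff.mp (e i).2).2
  linarith

/-- Among the sets of `m` indices, the first ones minimise the sum of an increasing sequence, the
last ones maximise it. -/
lemma sum_star_le {a : Fin n → ℝ} (ha : Monotone a) (up : Bool) {m : ℕ} (hm : m ≤ n)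
    {α : Finset (Fin n)} (hα : α.card = m) :
    if up then ∑ i ∈ star n up m, a i ≤ ∑ i ∈ α, a i
      else ∑ i ∈ α, a i ≤ ∑ i ∈ star n up m, a i := by
  have hc : (star n up m).card = α.card := by rw [card_star up hm, hα]
  cases up
  · simp only [Bool.false_eq_true, if_false]
    have := sum_le_sum_of_exchange hc (a := fun i => -a i) fun i hi j hj => by
      simp only [star, Bool.false_eq_true, if_false, mem_filter, Finset.mem_univ, true_and] at hi hj
      exact neg_le_neg (ha (Fin.le_def.mpr (by omega)))
    simpa using this
  · simp only [if_true]
    refine sum_le_sum_of_exchange hc fun i hi j hj => ?_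
    simp only [star, if_true, mem_filter, Finset.mem_univ, true_and] at hi hj
    exact ha (Fin.le_def.mpr (by omega))

lemma sum_star_lt {a : Fin n → ℝ} (ha : StrictMono a) (up : Bool) {m : ℕ} (hm : m ≤ n)
    {α : Finset (Fin n)} (hα : α.card = m) (hne : α ≠ star n up m) :
    if up then ∑ i ∈ star n up m, a i < ∑ i ∈ α, a i
      else ∑ i ∈ α, a i < ∑ i ∈ star n up m, a i := by
  have hc : (star n up m).card = α.card := by rw [card_star up hm, hα]
  cases up
  · simp only [Bool.false_eq_true, if_false]
    have := sum_lt_sum_of_exchange hc hne (a := fun i => -a i) fun i hi j hj => by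
      simp only [star, Bool.false_eq_true, if_false, mem_filter, Finset.mem_univ, true_and] at hi hj
      exact neg_lt_neg (ha (Fin.lt_def.mpr (by omega)))
    simpa using this
  · simp only [if_true]
    refine sum_lt_sum_of_exchange hc hne fun i hi j hj => ?_
    simp only [star, if_true, mem_filter, Finset.mem_univ, true_and] at hi hj
    exact ha (Fin.lt_def.mpr (by omega))

end Combinatorics

section WedgeBounds

lemma exists_wedge_bound (α : Finset (Fin n)) (r : ℝ) :
    ∃ C, 0 ≤ C ∧ ∀ u : Fin n → Fin n → ℂ, ‖u‖ ≤ r → ‖wedge u α‖ ≤ C := by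
  obtain ⟨C, hC⟩ := (isCompact_closedBall (0 : Fin n → Fin n → ℂ) r).exists_bound_of_continuousOn
    (continuous_wedge α).continuousOn
  exact ⟨max C 0, le_max_right _ _, fun u hu => (hC u (by simpa using hu)).trans (le_max_left _ _)⟩

lemma exists_wedge_lipschitz (α : Finset (Fin n)) (r : ℝ) :
    ∃ C, 0 ≤ C ∧ ∀ u v : Fin n → Fin n → ℂ, ‖u‖ ≤ r → ‖v‖ ≤ r →
      ‖wedge u α - wedge v α‖ ≤ C * ‖u - v‖ := by
  unfold wedge
  induction α.sort (· ≤ ·) with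
  | nil => exact ⟨0, le_rfl, fun u v _ _ => by simp⟩
  | cons a l ih =>
    obtain ⟨C, hC, ih⟩ := ih
    obtain ⟨M, hM⟩ := (isCompact_closedBall (0 : Fin n → Fin n → ℂ) r).exists_bound_of_continuousOn
      (f := fun u => (l.map fun j => ι ℂ (u j)).prod)
      (continuous_list_prod _ fun j _ =>
        (ιL n).continuous.comp (continuous_apply j)).continuousOn
    refine ⟨‖ιL n‖ * |r| * C + ‖ιL n‖ * |M|, by positivity, fun u v hu hv => ?_⟩
    simp only [List.map_cons, List.prod_cons]
    set U := (l.map fun j => ι ℂ (u j)).prod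
    set V := (l.map fun j => ι ℂ (v j)).prod with hV
    have e : ι ℂ (u a) * U - ι ℂ (v a) * V = ιL n (u a) * (U - V) + ιL n (u a - v a) * V := by
      simp only [map_sub, ιL_apply]; noncomm_ring
    rw [e, add_mul]
    have h1 : ‖ιL n (u a)‖ ≤ ‖ιL n‖ * |r| :=
      (ιL n).le_opNorm_of_le (((norm_le_pi_norm u a).trans hu).trans (le_abs_self r))
    have h2 : ‖ιL n (u a - v a)‖ ≤ ‖ιL n‖ * ‖u - v‖ :=
      (ιL n).le_opNorm_of_le (norm_le_pi_norm (u - v) a)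
    have h3 : ‖V‖ ≤ |M| := (hM v (by simpa using hv)).trans (le_abs_self M)
    refine (norm_add_le _ _).trans (add_le_add ?_ ?_)
    · refine (norm_mul_le _ _).trans ?_
      rw [mul_assoc]
      exact mul_le_mul h1 (ih u v hu hv) (norm_nonneg _) (by positivity)
    · refine (norm_mul_le _ _).trans ?_
      calc _ ≤ ‖ιL n‖ * ‖u - v‖ * |M| := mul_le_mul h2 h3 (norm_nonneg _) (by positivity)
        _ = _ := by ring

end WedgeBounds

/-- The data of the unperturbed system: the matrices, a sector contained in a half-plane, the
fundamental matrices and the weights. -/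
structure Setup (n : ℕ) where
  A : Matrix (Fin n) (Fin n) ℂ
  b : Fin n → ℂ
  μ : Fin n → ℂ
  ω : ℝ
  h : ℝ
  σ : Equiv.Perm (Fin n)
  chat : Fin n → ℂ → Fin n → ℂ
  e : Fin n → ℂ → Fin n → ℂ
  ψ : Fin n → ℂ → Fin n → ℂ
  W : Fin n → ℂ → ℂ
  condA : ConditionA A μ
  condB : ConditionB b
  pos : 0 < h
  le_half : h ≤ Real.pi / 2
  ordered : ∀ x ∈ sector ω h, StrictMono fun k => (b (σ k) * x).re
  frobenius : IsFrobenius A b μ ω h chat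
  jost : IsJost A b ω h σ e
  condI : ConditionI μ ω h chat e
  weyl : IsWeylZero A b μ ω h σ ψ
  weight : IsWeight b μ ω h σ W

namespace Setup

variable (S : Setup n)

/-- The closed sector. -/
abbrev D : Set ℂ := closedSector S.ω S.h

/-- The numbers `R_k`. -/
def R (k : Fin n) : ℂ := S.b (S.σ k)

/-- The columns `c_k`. -/
def c (k : Fin n) : ℂ → Fin n → ℂ := frob S.ω S.μ S.chat k

/-- The coefficient matrix of the unperturbed system. -/
def L (ξ : ℂ) : Matrix (Fin n) (Fin n) ℂ := ξ⁻¹ • S.A + Matrix.diagonal S.b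

/-- Sums of the exponents over index sets. -/
def muSum (α : Finset (Fin n)) : ℂ := ∑ j ∈ α, S.μ j

/-- Sums of the numbers `R_j` over index sets. -/
def RSum (α : Finset (Fin n)) : ℂ := ∑ j ∈ α, S.R j

variable {S}

lemma zero_mem : (0 : ℂ) ∈ S.D := zero_mem_closedSector S.pos

lemma trace_L (ξ : ℂ) : (S.L ξ).trace = 0 := by
  have h1 : S.A.trace = 0 := sum_eq_zero fun i _ => S.condA.offDiag i
  rw [L, Matrix.trace_add, Matrix.trace_smul, h1, Matrix.trace_diagonal, S.condB.sum_eq_zero]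
  simp

lemma sum_R : ∑ k, S.R k = 0 := by
  unfold R
  rw [Equiv.sum_comp S.σ S.b, S.condB.sum_eq_zero]

variable (S) in
/-- A reference point of the sector. -/
def ref : ℂ := exp (S.ω * Complex.I)

lemma ref_ne_zero : S.ref ≠ 0 := exp_ne_zero _

lemma mul_ref_mem_sector {r : ℝ} (hr : 0 < r) : (r : ℂ) * S.ref ∈ sector S.ω S.h :=
  bisector_mem_sector S.pos hr

lemma ref_mem : S.ref ∈ S.D := by
  have := subset_closure (mul_ref_mem_sector (S := S) one_pos)
  simpa using this

lemma norm_ref : ‖S.ref‖ = 1 := Complex.norm_exp_ofReal_mul_I _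

/-- The families of solutions of the unperturbed system. -/
def IsSol (S : Setup n) (u : Fin n → ℂ → Fin n → ℂ) : Prop :=
  ∀ k, SolvesUnperturbed S.A S.b S.ω S.h (u k)

lemma isSol_c : S.IsSol S.c := S.frobenius.solves

lemma isSol_e : S.IsSol S.e := S.jost.solves

lemma isSol_ψ : S.IsSol S.ψ := S.weyl.solves

lemma IsSol.continuousOn {u : Fin n → ℂ → Fin n → ℂ} (hu : S.IsSol u) (k : Fin n) :
    ContinuousOn (u k) (S.D \ {0}) :=
  fun ξ hξ => (hu k ξ hξ.1 hξ.2).continuousWithinAt.mono sdiff_subset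

/-- Wronskians are constant, because the coefficient matrix has trace zero. -/
lemma IsSol.wronskian {u v : Fin n → ℂ → Fin n → ℂ} (hu : S.IsSol u) (hv : S.IsSol v)
    (α β : Finset (Fin n)) {ξ : ℂ} (hξ : ξ ∈ S.D) (h0 : ξ ≠ 0) :
    topCoeff n (wedge (fun j => u j ξ) α * wedge (fun j => v j ξ) β) =
      topCoeff n (wedge (fun j => u j S.ref) α * wedge (fun j => v j S.ref) β) := by
  obtain ⟨a, ha⟩ := exists_const_of_hasDerivWithinAt_zero (ω := S.ω) (h := S.h) S.le_half
    (f := fun ξ => topCoeff n (wedge (fun j => u j ξ) α * wedge (fun j => v j ξ) β))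
    (fun ξ hξ h0 => by
      have h1 := hasDerivWithinAt_wedge (fun j => hu j ξ hξ h0) α
      have h2 := hasDerivWithinAt_wedge (fun j => hv j ξ hξ h0) β
      have h3 := (topL n).hasFDerivAt.comp_hasDerivWithinAt ξ (h1.mul h2)
      refine h3.congr_deriv ?_
      rw [← derivExt_mul, topL_apply, topCoeff_derivExt]
      change (S.L ξ).trace * _ = 0
      rw [trace_L, zero_mul])
  rw [ha ξ hξ h0, ha _ ref_mem ref_ne_zero]

lemma IsSol.det {u : Fin n → ℂ → Fin n → ℂ} (hu : S.IsSol u) {ξ : ℂ} (hξ : ξ ∈ S.D)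
    (h0 : ξ ≠ 0) : (ofCols fun j => u j ξ).det = (ofCols fun j => u j S.ref).det := by
  have := hu.wronskian hu Finset.univ ∅ hξ h0
  simpa only [wedge_empty, mul_one, topCoeff_wedge_univ] using this

lemma det_c {ξ : ℂ} (hξ : ξ ∈ S.D) (h0 : ξ ≠ 0) : (ofCols fun j => S.c j ξ).det = 1 :=
  S.frobenius.det_eq_one ξ hξ h0

lemma ofCols_mul (u : Fin n → Fin n → ℂ) (M : Matrix (Fin n) (Fin n) ℂ) :
    ofCols u * M = ofCols fun k => ∑ j, M j k • u j := by
  ext i k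
  simp [ofCols, Matrix.mul_apply, Finset.sum_apply, mul_comm]

lemma ofCols_mulVec (u : Fin n → Fin n → ℂ) (v : Fin n → ℂ) :
    (ofCols u).mulVec v = ∑ j, v j • u j := by
  ext i
  simp [ofCols, Matrix.mulVec, dotProduct, Finset.sum_apply, mul_comm]

/-- Every family of solutions is a combination, with constant coefficients, of a fundamental
matrix. -/
lemma IsSol.exists_matrix {u v : Fin n → ℂ → Fin n → ℂ} (hu : S.IsSol u)
    (hdet : (ofCols fun j => u j S.ref).det ≠ 0) (hv : S.IsSol v) :
    ∃ P : Matrix (Fin n) (Fin n) ℂ, ∀ ξ ∈ S.D, ξ ≠ 0 →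
      (ofCols fun j => v j ξ) = (ofCols fun j => u j ξ) * P := by
  set d := (ofCols fun j => u j S.ref).det with hd
  refine ⟨Matrix.of fun j k => d⁻¹ * (ofCols
    (Function.update (fun i => u i S.ref) j (v k S.ref))).det,
    fun ξ hξ h0 => ?_⟩
  have key : ∀ j k, (ofCols (Function.update (fun i => u i ξ) j (v k ξ))).det =
      (ofCols (Function.update (fun i => u i S.ref) j (v k S.ref))).det := by
    intro j k
    have h1 : S.IsSol (Function.update u j (v k)) := by
      intro i
      rcases eq_or_ne i j with rfl | hij
      · simpa using hv k
      · simpa [hij] using hu i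
    have h2 := h1.det hξ h0
    have h3 : ∀ η, (fun i => Function.update u j (v k) i η) =
        Function.update (fun i => u i η) j (v k η) := by
      intro η
      ext1 i
      rcases eq_or_ne i j with rfl | hij <;> simp [*]
    rwa [h3, h3] at h2
  have hup : ∀ j k, (ofCols (Function.update (fun i => u i ξ) j (v k ξ))) =
      (ofCols fun i => u i ξ).updateCol j (v k ξ) := by
    intro j k
    ext i l
    rcases eq_or_ne l j with rfl | hlj <;> simp [ofCols, *]
  ext i k
  have h4 := congrFun (Matrix.mulVec_cramer (ofCols fun i => u i ξ) (v k ξ)) i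
  rw [hu.det hξ h0, ← hd] at h4
  have h5 : (ofCols fun j => v j ξ) i k = v k ξ i := rfl
  rw [h5, Matrix.mul_apply]
  rw [Matrix.mulVec, dotProduct] at h4
  simp only [Matrix.cramer_apply, Pi.smul_apply, smul_eq_mul, ← hup, key] at h4
  simp only [Matrix.of_apply]
  have h6 : v k ξ i = d⁻¹ * (d * v k ξ i) := by rw [← mul_assoc, inv_mul_cancel₀ hdet, one_mul]
  rw [h6, ← h4, mul_sum]
  refine sum_congr rfl fun j _ => ?_
  ring

lemma wedge_smul (a : Fin n → ℂ) (u : Fin n → Fin n → ℂ) (α : Finset (Fin n)) :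
    wedge (fun j => a j • u j) α = (∏ j ∈ α, a j) • wedge u α := by
  have key : ∀ l : List (Fin n), (l.map fun j => ι ℂ (a j • u j)).prod =
      (l.map a).prod • (l.map fun j => ι ℂ (u j)).prod := by
    intro l
    induction l with
    | nil => simp
    | cons x l ih =>
      simp only [List.map_cons, List.prod_cons]
      rw [ih, map_smul, smul_mul_smul_comm]
  rw [wedge, key]
  congr 1
  rw [Finset.prod_eq_multiset_prod, ← Multiset.prod_coe, ← Multiset.map_coe, Finset.sort_eq]

lemma wedge_c (ξ : ℂ) (α : Finset (Fin n)) : wedge (fun j => S.c j ξ) α =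
      sectorPow S.ω ξ (S.muSum α) • wedge (fun j => S.chat j ξ) α := by
  rw [muSum, sectorPow_sum]
  exact wedge_smul _ _ _

lemma det_chat_zero_ne_zero : (ofCols fun j => S.chat j 0).det ≠ 0 := by
  have h1 : LinearIndependent ℂ fun j => S.chat j 0 :=
    Module.End.eigenvectors_linearIndependent' (Matrix.toLin' S.A) S.μ
      (fun j k hjk => S.condA.ordered.injective (congrArg Complex.re hjk)) _
      S.frobenius.eigenvector
  have h2 : IsUnit (ofCols fun j => S.chat j 0) := Matrix.linearIndependent_cols_iff_isUnit.mp h1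
  exact isUnit_iff_ne_zero.mp ((Matrix.isUnit_iff_isUnit_det _).mp h2)

lemma muSum_univ : S.muSum Finset.univ = 0 := by
  have h1 : S.A * (ofCols fun j => S.chat j 0) =
      (ofCols fun j => S.chat j 0) * Matrix.diagonal S.μ := by
    ext i k
    have := congrFun (S.frobenius.eigenvector k).apply_eq_smul i
    rw [Matrix.toLin'_apply] at this
    rw [Matrix.mul_diagonal]
    simp only [ofCols, Matrix.of_apply, Matrix.mul_apply]
    simpa [Matrix.mulVec, dotProduct, mul_comm] using this
  have hu : IsUnit (ofCols fun j => S.chat j 0).det :=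
    isUnit_iff_ne_zero.mpr det_chat_zero_ne_zero
  have h2 : S.A = (ofCols fun j => S.chat j 0) * Matrix.diagonal S.μ *
      (ofCols fun j => S.chat j 0)⁻¹ := by
    rw [← h1, Matrix.mul_assoc, Matrix.mul_nonsing_inv _ hu, mul_one]
  have h3 : S.A.trace = 0 := sum_eq_zero fun i _ => S.condA.offDiag i
  rw [h2, Matrix.trace_mul_comm, ← Matrix.mul_assoc, Matrix.nonsing_inv_mul _ hu, one_mul,
    Matrix.trace_diagonal] at h3
  exact h3

lemma continuous_chat (k : Fin n) : Continuous (S.chat k) := (S.frobenius.entire k).continuous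

lemma continuous_wedge_chat (α : Finset (Fin n)) :
    Continuous fun ξ => wedge (fun j => S.chat j ξ) α :=
  (continuous_wedge α).comp (continuous_pi continuous_chat)

lemma det_chat {ξ : ℂ} (hξ : ξ ∈ S.D) : (ofCols fun j => S.chat j ξ).det = 1 := by
  have hc : Continuous fun ξ => (ofCols fun j => S.chat j ξ).det := by
    simp only [← topCoeff_wedge_univ]
    exact (topL n).continuous.comp (continuous_wedge_chat _)
  have h1 : closedSector S.ω S.h ⊆ {ξ | (ofCols fun j => S.chat j ξ).det = 1} := by
    refine closure_minimal (fun ξ hξ => ?_) (isClosed_eq hc continuous_const)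
    have h2 := det_c (S := S) (subset_closure hξ) hξ.1
    rw [← topCoeff_wedge_univ, wedge_c, muSum_univ, sectorPow_zero, one_smul,
      topCoeff_wedge_univ] at h2
    exact h2
  exact h1 hξ

lemma shuffleSign_eq (α : Finset (Fin n)) :
    topCoeff n (wedge (fun j => S.chat j 0) α * wedge (fun j => S.chat j 0) αᶜ) =
      shuffleSign α := by
  rw [topCoeff_wedge_mul_compl, det_chat zero_mem, mul_one]

variable (S) in
/-- The vectors `𝔣_k`. -/
def fvec (k : Fin n) : Fin n → ℂ := Pi.single (S.σ k) 1

variable (S) in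
/-- The functions `exp (-ξ R_k) e_k(ξ)`. -/
def ehat (k : Fin n) (ξ : ℂ) : Fin n → ℂ := exp (-(ξ * S.R k)) • S.e k ξ

lemma e_eq (k : Fin n) (ξ : ℂ) : S.e k ξ = exp (ξ * S.R k) • S.ehat k ξ := by
  rw [ehat, smul_smul, ← exp_add, add_neg_cancel, exp_zero, one_smul]

lemma wedge_e (ξ : ℂ) (α : Finset (Fin n)) : wedge (fun j => S.e j ξ) α =
      exp (ξ * S.RSum α) • wedge (fun j => S.ehat j ξ) α := by
  rw [RSum, mul_sum, exp_sum, ← wedge_smul]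
  simp only [← e_eq]

lemma exists_ehat_sub_le : ∃ M, 0 ≤ M ∧ ∀ ξ ∈ S.D, 1 ≤ ‖ξ‖ →
    ‖(fun j => S.ehat j ξ) - S.fvec‖ ≤ M * ‖ξ‖⁻¹ := by
  choose M hM using S.jost.asymp
  refine ⟨∑ k, |M k|, sum_nonneg fun _ _ => abs_nonneg _, fun ξ hξ h1 => ?_⟩
  rw [pi_norm_le_iff_of_nonneg (mul_nonneg (sum_nonneg fun _ _ => abs_nonneg _) (by positivity))]
  intro k
  refine (hM k ξ hξ h1).trans (mul_le_mul_of_nonneg_right ?_ (by positivity))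
  exact (le_abs_self _).trans
    (single_le_sum (f := fun k => |M k|) (fun _ _ => abs_nonneg _) (Finset.mem_univ k))

lemma exists_ehat_bound : ∃ M, 0 ≤ M ∧ ‖S.fvec‖ ≤ M ∧ ∀ ξ ∈ S.D, 1 ≤ ‖ξ‖ →
    ‖fun j => S.ehat j ξ‖ ≤ M := by
  obtain ⟨M, hM0, hM⟩ := exists_ehat_sub_le (S := S)
  refine ⟨M + ‖S.fvec‖, by positivity, by linarith [norm_nonneg S.fvec], fun ξ hξ h1 => ?_⟩
  have h2 := norm_add_le ((fun j => S.ehat j ξ) - S.fvec) S.fvec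
  rw [sub_add_cancel] at h2
  have h3 := hM ξ hξ h1
  have h4 : M * ‖ξ‖⁻¹ ≤ M := mul_le_of_le_one_right hM0 (inv_le_one_of_one_le₀ h1)
  linarith

lemma det_fvec_ne_zero : (ofCols S.fvec).det ≠ 0 := by
  have : ofCols S.fvec = (Equiv.Perm.permMatrix ℂ S.σ⁻¹)  := by
    ext i j
    simp only [ofCols, fvec, Matrix.of_apply, Pi.single_apply, Equiv.Perm.permMatrix,
      PEquiv.toMatrix_apply, Equiv.toPEquiv_apply]
    simp only [Equiv.Perm.inv_def, Option.mem_some_iff]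
    exact if_congr (by rw [Equiv.symm_apply_eq]) rfl rfl
  rw [this, Matrix.det_permutation]
  simp

/-- Families of solutions with the asymptotics of the Jost solutions are fundamental. -/
lemma IsSol.det_ne_zero {u : Fin n → ℂ → Fin n → ℂ} (hu : S.IsSol u)
    (h : ∀ k, Tendsto (fun r : ℝ => exp (-((r * S.ref) * S.R k)) • u k (r * S.ref)) atTop
      (𝓝 (S.fvec k))) : (ofCols fun j => u j S.ref).det ≠ 0 := by
  have h1 : Tendsto (fun r : ℝ => topCoeff n (wedge (fun k =>
      exp (-((r * S.ref) * S.R k)) • u k (r * S.ref)) Finset.univ)) atTop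
      (𝓝 (topCoeff n (wedge S.fvec Finset.univ))) :=
    (((topL n).continuous.comp (continuous_wedge Finset.univ)).tendsto _).comp
      (tendsto_pi_nhds.mpr h)
  have h2 : ∀ᶠ r : ℝ in atTop, topCoeff n (wedge (fun k =>
      exp (-((r * S.ref) * S.R k)) • u k (r * S.ref)) Finset.univ) =
      (ofCols fun j => u j S.ref).det := by
    filter_upwards [eventually_gt_atTop 0] with r hr
    have hm := mul_ref_mem_sector (S := S) hr
    rw [wedge_smul, ← exp_sum, Finset.sum_neg_distrib, ← mul_sum, sum_R, mul_zero,
      neg_zero, exp_zero, one_smul, topCoeff_wedge_univ, hu.det (subset_closure hm) hm.1]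
  have h3 := tendsto_nhds_unique (h1.congr' h2) tendsto_const_nhds
  rw [← h3, topCoeff_wedge_univ]
  exact det_fvec_ne_zero

lemma norm_mul_ref {r : ℝ} (hr : 0 ≤ r) : ‖(r : ℂ) * S.ref‖ = r := by
  rw [norm_mul, norm_ref, mul_one, norm_real, norm_of_nonneg hr]

lemma det_e_ne_zero : (ofCols fun j => S.e j S.ref).det ≠ 0 := by
  refine isSol_e.det_ne_zero fun k => ?_
  obtain ⟨M, hM⟩ := S.jost.asymp k
  rw [tendsto_iff_norm_sub_tendsto_zero]
  refine squeeze_zero' (.of_forall fun _ => norm_nonneg _) ?_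
    (g := fun r : ℝ => M * r⁻¹) (by simpa using tendsto_inv_atTop_zero.const_mul M)
  filter_upwards [eventually_ge_atTop 1] with r hr
  have h0 : (0 : ℝ) < r := by linarith
  have := hM _ (subset_closure (mul_ref_mem_sector (S := S) h0)) (by rwa [norm_mul_ref h0.le])
  rwa [norm_mul_ref h0.le] at this

lemma tendsto_ψ {ξ : ℂ} (hξ : ξ ∈ sector S.ω S.h) (k : Fin n) :
    Tendsto (fun r : ℝ => exp (-((r * ξ) * S.R k)) • S.ψ k (r * ξ)) atTop (𝓝 (S.fvec k)) := by
  have := S.weyl.infty k ξ hξ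
  simp only [mul_comm ξ] at this
  exact this

lemma ref_mem_sector : S.ref ∈ sector S.ω S.h := by
  have := mul_ref_mem_sector (S := S) one_pos
  simpa using this

lemma det_ψ_ne_zero : (ofCols fun j => S.ψ j S.ref).det ≠ 0 :=
  isSol_ψ.det_ne_zero fun k => tendsto_ψ ref_mem_sector k

lemma monotone_re {ξ : ℂ} (hξ : ξ ∈ S.D) : Monotone fun k => (ξ * S.R k).re := by
  intro j k hjk
  have h1 : S.D ⊆ {ξ | (ξ * S.R j).re ≤ (ξ * S.R k).re} := by
    refine closure_minimal (fun ξ hξ => ?_) (isClosed_le (by fun_prop) (by fun_prop))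
    have := (S.ordered ξ hξ).monotone hjk
    change (ξ * S.R j).re ≤ (ξ * S.R k).re
    simpa only [R, mul_comm ξ] using this
  exact h1 hξ

lemma re_mul_RSum (ξ : ℂ) (α : Finset (Fin n)) : (ξ * S.RSum α).re = ∑ j ∈ α, (ξ * S.R j).re := by
  rw [RSum, mul_sum, re_sum]

lemma re_RSum_star {ξ : ℂ} (hξ : ξ ∈ S.D) (up : Bool) {m : ℕ} (hm : m ≤ n)
    {α : Finset (Fin n)} (hα : α.card = m) :
    if up then 0 ≤ (ξ * (S.RSum α - S.RSum (star n up m))).re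
      else (ξ * (S.RSum α - S.RSum (star n up m))).re ≤ 0 := by
  have := sum_star_le (monotone_re hξ) up hm hα
  rw [mul_sub, sub_re, re_mul_RSum, re_mul_RSum]
  cases up
  · simpa using this
  · simpa using this

lemma re_muSum_star (up : Bool) {m : ℕ} (hm : m ≤ n) {α : Finset (Fin n)} (hα : α.card = m)
    (hne : α ≠ star n up m) :
    if up then 0 < (S.muSum α - S.muSum (star n up m)).re
      else (S.muSum α - S.muSum (star n up m)).re < 0 := by
  have := sum_star_lt S.condA.ordered up hm hα hne
  rw [muSum, muSum, sub_re, re_sum, re_sum]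
  cases up
  · simpa using this
  · simpa using this

/-! ### Weights -/

variable (S) in
/-- Products of weights. -/
def wt (α : Finset (Fin n)) (ξ : ℂ) : ℂ := ∏ k ∈ α, S.W k ξ

variable (S) in
/-- The quotient of the weight and of the power, with its limit `1` at the vertex. -/
def what (α : Finset (Fin n)) (ξ : ℂ) : ℂ :=
  if ξ = 0 then 1 else S.wt α ξ / sectorPow S.ω ξ (S.muSum α)

lemma wt_ne_zero {ξ : ℂ} (hξ : ξ ∈ S.D) (h0 : ξ ≠ 0) (α : Finset (Fin n)) : S.wt α ξ ≠ 0 :=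
  Finset.prod_ne_zero_iff.mpr fun k _ => S.weight.ne_zero k ξ hξ h0

lemma what_zero (α : Finset (Fin n)) : S.what α 0 = 1 := if_pos rfl

lemma what_of_ne {ξ : ℂ} (h0 : ξ ≠ 0) (α : Finset (Fin n)) :
    S.what α ξ = S.wt α ξ / sectorPow S.ω ξ (S.muSum α) := if_neg h0

lemma what_ne_zero {ξ : ℂ} (hξ : ξ ∈ S.D) (α : Finset (Fin n)) : S.what α ξ ≠ 0 := by
  rcases eq_or_ne ξ 0 with rfl | h0
  · simp [what_zero]
  · rw [what_of_ne h0]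
    exact div_ne_zero (wt_ne_zero hξ h0 α) (sectorPow_ne_zero _ _)

lemma wt_eq {ξ : ℂ} (h0 : ξ ≠ 0) (α : Finset (Fin n)) :
    S.wt α ξ = S.what α ξ * sectorPow S.ω ξ (S.muSum α) := by
  rw [what_of_ne h0, div_mul_cancel₀ _ (sectorPow_ne_zero _ _)]

lemma continuousOn_wt (α : Finset (Fin n)) : ContinuousOn (S.wt α) (S.D \ {0}) :=
  continuousOn_finsetProd _ fun k _ => S.weight.continuousOn k

lemma continuousOn_what (α : Finset (Fin n)) : ContinuousOn (S.what α) S.D := by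
  refine continuousOn_of_ne_zero ?_ ?_
  · refine ((continuousOn_wt α).div (continuousOn_sectorPow S.le_half (S.muSum α))
      fun ξ _ => sectorPow_ne_zero _ _).congr fun ξ hξ => what_of_ne hξ.2 α
  · rw [what_zero]
    have h1 : Tendsto (fun ξ => ∏ k ∈ α, S.W k ξ / sectorPow S.ω ξ (S.μ k))
        (𝓝[closedSector S.ω S.h \ {0}] 0) (𝓝 (∏ k ∈ α, (1 : ℂ))) :=
      tendsto_finsetProd _ fun k _ => S.weight.zero k
    rw [Finset.prod_const_one] at h1
    refine h1.congr' ?_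
    filter_upwards [self_mem_nhdsWithin] with ξ hξ
    rw [what_of_ne hξ.2, wt, muSum, sectorPow_sum, Finset.prod_div_distrib]

lemma W_eq_exp {ξ : ℂ} (hξ : ξ ∈ S.D) (h1 : 1 ≤ ‖ξ‖) (k : Fin n) : S.W k ξ = exp (ξ * S.R k) := by
  have h0 : ξ ≠ 0 := norm_pos_iff.mp (by linarith)
  have hc : Tendsto (fun t : ℝ => (t : ℂ) * ξ) (𝓝[>] 1) (𝓝[S.D \ {0}] ξ) := by
    refine tendsto_nhdsWithin_iff.mpr ⟨?_, ?_⟩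
    · have : Continuous fun t : ℝ => (t : ℂ) * ξ := by fun_prop
      simpa using (this.tendsto 1).mono_left (nhdsWithin_le_nhds (s := Ioi 1))
    · filter_upwards [self_mem_nhdsWithin] with t ht
      have ht : (0 : ℝ) < t := one_pos.trans ht
      exact ⟨mul_mem_closedSector S.pos ht.le hξ, mul_ne_zero (by exact_mod_cast ht.ne') h0⟩
  have h2 : Tendsto (fun t : ℝ => S.W k (t * ξ)) (𝓝[>] 1) (𝓝 (S.W k ξ)) :=
    Tendsto.comp (S.weight.continuousOn k ξ ⟨hξ, h0⟩) hc
  have h3 : Tendsto (fun t : ℝ => S.W k (t * ξ)) (𝓝[>] 1) (𝓝 (exp (ξ * S.R k))) := by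
    have h4 : Tendsto (fun t : ℝ => exp ((t * ξ) * S.R k)) (𝓝[>] 1) (𝓝 (exp (ξ * S.R k))) := by
      have : Continuous fun t : ℝ => exp ((t * ξ) * S.R k) := by fun_prop
      simpa using (this.tendsto 1).mono_left (nhdsWithin_le_nhds (s := Ioi 1))
    refine h4.congr' ?_
    filter_upwards [self_mem_nhdsWithin] with t ht
    have ht : (1 : ℝ) < t := ht
    rw [S.weight.eq_exp k _ (mul_mem_closedSector S.pos (by linarith) hξ), mul_comm (S.b _)]
    · rfl
    · rw [norm_mul, norm_real, norm_of_nonneg (by linarith)]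
      nlinarith
  exact tendsto_nhds_unique h2 h3

lemma wt_eq_exp {ξ : ℂ} (hξ : ξ ∈ S.D) (h1 : 1 ≤ ‖ξ‖) (α : Finset (Fin n)) :
    S.wt α ξ = exp (ξ * S.RSum α) := by
  rw [wt, RSum, mul_sum, exp_sum]
  exact Finset.prod_congr rfl fun k _ => W_eq_exp hξ h1 k

lemma what_univ {ξ : ℂ} (hξ : ξ ∈ S.D) (h1 : 1 ≤ ‖ξ‖) : S.what Finset.univ ξ = 1 := by
  have h0 : ξ ≠ 0 := norm_pos_iff.mp (by linarith)
  rw [what_of_ne h0, wt_eq_exp hξ h1, muSum_univ, sectorPow_zero, div_one, RSum, sum_R, mul_zero,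
    exp_zero]

lemma what_univ_eq {ξ : ℂ} (h0 : ξ ≠ 0) : S.what Finset.univ ξ = S.wt Finset.univ ξ := by
  rw [what_of_ne h0, muSum_univ, sectorPow_zero, div_one]

end Setup

/-! ### Normalised tensors and kernels of the unperturbed system -/

lemma transfer_of_mem_of_ne {m k : ℕ} (hm : m ≤ n) (hk : k ≠ m) (u v : Fin n → Fin n → ℂ)
    {f : Ext n} (hf : f ∈ ⋀[ℂ]^k (Fin n → ℂ)) : transfer m u v f = 0 := by
  refine sum_eq_zero fun α hα => ?_
  have hα' : αᶜ.card = n - m := by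
    rw [Finset.card_compl, Fintype.card_fin, (mem_powersetCard.mp hα).2]
  have h1 := mul_mem_ext hf (wedge_mem u αᶜ)
  rw [hα'] at h1
  rw [topCoeff_of_mem (by omega) h1, mul_zero, zero_smul]

lemma transfer_add (m : ℕ) (u v : Fin n → Fin n → ℂ) (f g : Ext n) :
    transfer m u v (f + g) = transfer m u v f + transfer m u v g := by
  simp only [transfer, add_mul, map_add, mul_add, add_smul, sum_add_distrib]

lemma transfer_smul (m : ℕ) (u v : Fin n → Fin n → ℂ) (a : ℂ) (f : Ext n) :
    transfer m u v (a • f) = a • transfer m u v f := by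
  simp only [transfer, smul_mul_assoc, map_smul, smul_eq_mul, smul_sum, smul_smul]
  refine sum_congr rfl fun α _ => ?_
  congr 1; ring

lemma transfer_sum {ι : Type*} (s : Finset ι) (m : ℕ) (u v : Fin n → Fin n → ℂ) (f : ι → Ext n) :
    transfer m u v (∑ i ∈ s, f i) = ∑ i ∈ s, transfer m u v (f i) := by
  induction s using Finset.cons_induction with
  | empty => simp [transfer]
  | cons a s ha ih => rw [Finset.sum_cons, transfer_add, ih, Finset.sum_cons]

/-- Two fundamental matrices that differ by a constant factor on the right define the same
transfer operators, up to the factor `det`. -/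
lemma transfer_change_basis {m : ℕ} (hm : m ≤ n) {u v u' v' : Fin n → Fin n → ℂ}
    (P : Matrix (Fin n) (Fin n) ℂ) (hu : (ofCols u).det = 1) (hu' : (ofCols u').det ≠ 0)
    (h1 : ofCols u' = ofCols u * P) (h2 : ofCols v' = ofCols v * P) (f : Ext n) :
    transfer m u v f = ((ofCols u').det)⁻¹ • transfer m u' v' f := by
  have hP : IsUnit P.det := by
    rw [h1, Matrix.det_mul] at hu'
    exact isUnit_iff_ne_zero.mpr (right_ne_zero_of_mul hu')
  have hbasis : ∀ α : Finset (Fin n), transfer m u v (extBasis n α) =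
      ((ofCols u').det)⁻¹ • transfer m u' v' (extBasis n α) := by
    intro α
    rw [← wedge_stdVec]
    have hmem := wedge_mem (stdVec n) α
    by_cases hα : α.card = m
    · rw [hα] at hmem
      rw [transfer_eq_map (by rw [hu]; exact one_ne_zero) hmem, transfer_eq_map hu' hmem, smul_smul,
        inv_mul_cancel₀ hu', hu, one_smul, one_smul, h1, h2, Matrix.mul_inv_rev]
      have : ofCols v * P * (P⁻¹ * (ofCols u)⁻¹) = ofCols v * (ofCols u)⁻¹ := by
        rw [Matrix.mul_assoc, ← Matrix.mul_assoc P, Matrix.mul_nonsing_inv _ hP, Matrix.one_mul]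
      rw [this]
    · rw [transfer_of_mem_of_ne hm hα _ _ hmem, transfer_of_mem_of_ne hm hα _ _ hmem, smul_zero]
  rw [← (extBasis n).sum_repr f, transfer_sum, transfer_sum, smul_sum]
  refine sum_congr rfl fun α _ => ?_
  rw [transfer_smul, transfer_smul, hbasis, smul_comm]

namespace Setup

variable {S : Setup n}

variable (S) in
/-- The unperturbed solutions whose products are the leading terms of the tensors `F` (`up`) and
`T`. -/
def sol (up : Bool) : Fin n → ℂ → Fin n → ℂ := if up then S.e else S.c

lemma isSol_sol (up : Bool) : S.IsSol (S.sol up) := by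
  cases up
  · exact isSol_c
  · exact isSol_e

variable (S) in
/-- The coefficients of the leading term in the expansion by the products of the `c_k`. -/
def coeffC (up : Bool) (m : ℕ) (γ : Finset (Fin n)) : ℂ :=
  shuffleSign γ * topCoeff n (wedge (fun j => S.sol up j S.ref) (star n up m) *
    wedge (fun j => S.c j S.ref) γᶜ)

variable (S) in
/-- The coefficients of the leading term in the expansion by the products of the `e_k`. -/
def coeffE (up : Bool) (m : ℕ) (γ : Finset (Fin n)) : ℂ :=
  ((ofCols fun j => S.e j S.ref).det)⁻¹ *
    (shuffleSign γ * topCoeff n (wedge (fun j => S.sol up j S.ref) (star n up m) *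
      wedge (fun j => S.e j S.ref) γᶜ))

lemma coeffC_false {m : ℕ} (hm : m ≤ n) {γ : Finset (Fin n)} (hγ : γ.card = m) :
    S.coeffC false m γ = if γ = star n false m then 1 else 0 := by
  unfold coeffC
  change _ * topCoeff n (wedge (fun j => S.c j S.ref) _ * _) = _
  split_ifs with h
  · rw [h, topCoeff_wedge_mul_compl, det_c ref_mem ref_ne_zero, mul_one, shuffleSign_mul_self]
  · rw [wedge_mul_compl_of_ne _ (hγ.trans (card_star false hm).symm) (Ne.symm h), map_zero,
      mul_zero]

lemma coeffE_true {m : ℕ} (hm : m ≤ n) {γ : Finset (Fin n)} (hγ : γ.card = m) :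
    S.coeffE true m γ = if γ = star n true m then 1 else 0 := by
  unfold coeffE
  change _ * (_ * topCoeff n (wedge (fun j => S.e j S.ref) _ * _)) = _
  split_ifs with h
  · rw [h, topCoeff_wedge_mul_compl, ← mul_assoc (shuffleSign _), shuffleSign_mul_self, one_mul,
      inv_mul_cancel₀ det_e_ne_zero]
  · rw [wedge_mul_compl_of_ne _ (hγ.trans (card_star true hm).symm) (Ne.symm h), map_zero, mul_zero,
      mul_zero]

lemma wedge_sol_mem (up : Bool) {m : ℕ} (hm : m ≤ n) (ξ : ℂ) :
    wedge (fun j => S.sol up j ξ) (star n up m) ∈ ⋀[ℂ]^m (Fin n → ℂ) := by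
  have := wedge_mem (fun j => S.sol up j ξ) (star n up m)
  rwa [card_star up hm] at this

lemma wedge_sol_eq_c (up : Bool) {m : ℕ} (hm : m ≤ n) {ξ : ℂ} (hξ : ξ ∈ S.D) (h0 : ξ ≠ 0) :
    wedge (fun j => S.sol up j ξ) (star n up m) = ∑ γ ∈ Finset.powersetCard m .univ,
        S.coeffC up m γ • wedge (fun j => S.c j ξ) γ := by
  have h1 := transfer_self (u := fun j => S.c j ξ) (by rw [det_c hξ h0]; exact one_ne_zero)
    (wedge_sol_mem (S := S) up hm ξ)
  rw [det_c hξ h0, one_smul] at h1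
  rw [← h1, transfer]
  refine sum_congr rfl fun γ _ => ?_
  rw [(isSol_sol up).wronskian isSol_c _ _ hξ h0]
  rfl

lemma wedge_sol_eq_e (up : Bool) {m : ℕ} (hm : m ≤ n) {ξ : ℂ} (hξ : ξ ∈ S.D) (h0 : ξ ≠ 0) :
    wedge (fun j => S.sol up j ξ) (star n up m) = ∑ γ ∈ Finset.powersetCard m .univ,
        S.coeffE up m γ • wedge (fun j => S.e j ξ) γ := by
  have hd := isSol_e.det (S := S) hξ h0
  have h1 := transfer_self (u := fun j => S.e j ξ) (by rw [hd]; exact det_e_ne_zero)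
    (wedge_sol_mem (S := S) up hm ξ)
  have h2 := congrArg (fun Z => ((ofCols fun j => S.e j S.ref).det)⁻¹ • Z) h1
  simp only [hd, smul_smul, inv_mul_cancel₀ det_e_ne_zero, one_smul] at h2
  rw [← h2, transfer, smul_sum]
  refine sum_congr rfl fun γ _ => ?_
  rw [(isSol_sol up).wronskian isSol_e _ _ hξ h0, smul_smul]
  rfl

variable (S) in
/-- The normalised leading term of the tensors `F` (`up`) and `T`; the formula makes sense at the
vertex, too. -/
def base (up : Bool) (m : ℕ) (ξ : ℂ) : Ext n :=
  (S.what (star n up m) ξ)⁻¹ • ∑ γ ∈ Finset.powersetCard m .univ,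
    (S.coeffC up m γ * vertexPow S.ω ξ (S.muSum γ - S.muSum (star n up m))) •
      wedge (fun j => S.chat j ξ) γ

lemma base_eq (up : Bool) {m : ℕ} (hm : m ≤ n) {ξ : ℂ} (hξ : ξ ∈ S.D) (h0 : ξ ≠ 0) :
    S.base up m ξ = (S.wt (star n up m) ξ)⁻¹ • wedge (fun j => S.sol up j ξ) (star n up m) := by
  rw [base, wedge_sol_eq_c up hm hξ h0, wt_eq h0, mul_inv, mul_smul]
  congr 1
  rw [smul_sum]
  refine sum_congr rfl fun γ _ => ?_
  rw [vertexPow_of_ne h0, sectorPow_sub, wedge_c, smul_smul, smul_smul]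
  congr 1
  field_simp

lemma base_eq_far (up : Bool) {m : ℕ} (hm : m ≤ n) {ξ : ℂ} (hξ : ξ ∈ S.D) (h1 : 1 ≤ ‖ξ‖) :
    S.base up m ξ = ∑ γ ∈ Finset.powersetCard m .univ,
      (S.coeffE up m γ * exp (ξ * (S.RSum γ - S.RSum (star n up m)))) •
        wedge (fun j => S.ehat j ξ) γ := by
  have h0 : ξ ≠ 0 := norm_pos_iff.mp (by linarith)
  rw [base_eq up hm hξ h0, wedge_sol_eq_e up hm hξ h0, smul_sum, wt_eq_exp hξ h1]
  refine sum_congr rfl fun γ _ => ?_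
  rw [wedge_e, smul_smul, smul_smul, ← exp_neg, mul_sub, sub_eq_add_neg, exp_add]
  congr 1; ring

lemma continuousOn_base (up : Bool) {m : ℕ} (hm : m ≤ n) : ContinuousOn (S.base up m) S.D := by
  refine ((continuousOn_what _).inv₀ fun ξ hξ => what_ne_zero hξ _).smul
    (continuousOn_finsetSum _ fun γ hγ => ?_)
  have hγ := (mem_powersetCard.mp hγ).2
  suffices h : ContinuousOn (fun ξ => S.coeffC up m γ *
      vertexPow S.ω ξ (S.muSum γ - S.muSum (star n up m))) S.D from
    h.smul (continuous_wedge_chat γ).continuousOn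
  by_cases hs : γ = star n up m
  · subst hs
    simp only [sub_self, vertexPow_zero_right]
    exact continuousOn_const
  · cases up
    · simp only [coeffC_false hm hγ, hs, if_false, zero_mul]
      exact continuousOn_const
    · have := re_muSum_star (S := S) true hm hγ hs
      exact continuousOn_const.mul (continuousOn_vertexPow S.le_half (Or.inr (by simpa using this)))

/-- The exponents in the expansion of the leading term by the products of the `e_k` are
nonpositive. -/
lemma re_le_of_coeffE_ne_zero {up : Bool} {m : ℕ} (hm : m ≤ n) {γ : Finset (Fin n)}
    (hγ : γ.card = m) (hg : S.coeffE up m γ ≠ 0) {ξ : ℂ} (hξ : ξ ∈ S.D) :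
    (ξ * (S.RSum γ - S.RSum (star n up m))).re ≤ 0 := by
  cases up
  · simpa using re_RSum_star hξ false hm hγ
  · rw [coeffE_true hm hγ] at hg
    have : γ = star n true m := by by_contra h; simp [h] at hg
    simp [this]

lemma exists_wedge_ehat_bound : ∃ C, 0 ≤ C ∧ ∀ ξ ∈ S.D, 1 ≤ ‖ξ‖ → ∀ γ : Finset (Fin n),
    ‖wedge (fun j => S.ehat j ξ) γ‖ ≤ C := by
  obtain ⟨M, -, -, hM⟩ := exists_ehat_bound (S := S)
  choose C hC0 hC using fun γ : Finset (Fin n) => exists_wedge_bound γ M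
  refine ⟨∑ γ, C γ, sum_nonneg fun γ _ => hC0 γ, fun ξ hξ h1 γ => ?_⟩
  exact (hC γ _ (hM ξ hξ h1)).trans (single_le_sum (f := C) (fun γ _ => hC0 γ) (Finset.mem_univ γ))

lemma norm_exp_le_one {w : ℂ} (h : w.re ≤ 0) : ‖exp w‖ ≤ 1 := by
  rw [norm_exp]; exact Real.exp_le_one_iff.mpr h

lemma exists_base_bound (up : Bool) {m : ℕ} (hm : m ≤ n) :
    ∃ C, 0 ≤ C ∧ ∀ ξ ∈ S.D, ‖S.base up m ξ‖ ≤ C := by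
  obtain ⟨C, hC0, hC⟩ := exists_wedge_ehat_bound (S := S)
  refine exists_bound_of_continuousOn (continuousOn_base up hm)
    (M := ∑ γ ∈ Finset.powersetCard m .univ, ‖S.coeffE up m γ‖ * C)
    fun ξ hξ h1 => ?_
  rw [base_eq_far up hm hξ h1]
  refine norm_sum_le_of_le _ fun γ hγ => ?_
  rw [norm_smul, norm_mul]
  refine mul_le_mul ?_ (hC ξ hξ h1 γ) (norm_nonneg _) (norm_nonneg _)
  by_cases hg : S.coeffE up m γ = 0
  · simp [hg]
  · exact mul_le_of_le_one_right (norm_nonneg _) (norm_exp_le_one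
      (re_le_of_coeffE_ne_zero hm (mem_powersetCard.mp hγ).2 hg hξ))

/-- The functional `f ↦ |f ∧ w|`. -/
def topMul (n : ℕ) : Ext n →L[ℂ] Ext n →L[ℂ] ℂ :=
  (ContinuousLinearMap.compL ℂ (Ext n) (Ext n) ℂ (topL n)).comp
    (ContinuousLinearMap.mul ℂ (Ext n)).flip

@[simp] lemma topMul_apply (w f : Ext n) : topMul n w f = topCoeff n (f * w) := rfl

variable (S) in
/-- The normalised kernel: the weights turn the operator `G_m(x, t, ρ)` into a bounded operator,
given by a formula that makes sense for `x = 0` and for `ρ = 0`, too. -/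
def kernel (up : Bool) (m : ℕ) (x t : ℝ) (ρ : ℂ) : Ext n →L[ℂ] Ext n :=
  ∑ α ∈ Finset.powersetCard m .univ,
    (shuffleSign α * (S.what (star n up m) (ρ * t) / S.what (star n up m) (ρ * x)) *
      ((x / t : ℝ) : ℂ) ^ (S.muSum α - S.muSum (star n up m))) •
      (topMul n (wedge (fun j => S.chat j (ρ * t)) αᶜ)).smulRight
        (wedge (fun j => S.chat j (ρ * x)) α)

lemma kernel_apply (up : Bool) (m : ℕ) (x t : ℝ) (ρ : ℂ) (f : Ext n) :
    S.kernel up m x t ρ f = ∑ α ∈ Finset.powersetCard m .univ,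
    (shuffleSign α * (S.what (star n up m) (ρ * t) / S.what (star n up m) (ρ * x)) *
      ((x / t : ℝ) : ℂ) ^ (S.muSum α - S.muSum (star n up m)) *
      topCoeff n (f * wedge (fun j => S.chat j (ρ * t)) αᶜ)) •
        wedge (fun j => S.chat j (ρ * x)) α := by
  rw [kernel, sum_apply]
  refine sum_congr rfl fun α _ => ?_
  rw [smul_apply, ContinuousLinearMap.smulRight_apply, smul_smul, topMul_apply]

lemma green_eq_transfer (m : ℕ) (x t : ℝ) (ρ : ℂ) (f : Ext n) : green S.μ S.ω S.chat m x t ρ f =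
      transfer m (fun j => S.c j (ρ * t)) (fun j => S.c j (ρ * x)) f := by
  unfold green transfer
  refine sum_congr rfl fun α _ => ?_
  rw [shuffleSign_eq]
  rfl

lemma muSum_compl (α : Finset (Fin n)) : S.muSum αᶜ = -S.muSum α := by
  have h : S.muSum α + S.muSum αᶜ = S.muSum Finset.univ := Finset.sum_add_sum_compl α S.μ
  rw [muSum_univ] at h
  linear_combination h

lemma mul_mem_D {ρ : ℂ} (hρ : ρ ∈ S.D) {x : ℝ} (hx : 0 ≤ x) : ρ * x ∈ S.D :=
  mul_mem_closedSector' S.pos hx hρ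

lemma mul_ofReal_ne_zero {ρ : ℂ} (hρ : ρ ≠ 0) {x : ℝ} (hx : 0 < x) : ρ * (x : ℂ) ≠ 0 :=
  mul_ne_zero hρ (by exact_mod_cast hx.ne')

lemma kernel_eq_green (up : Bool) (m : ℕ) {x t : ℝ} (hx : 0 < x) (ht : 0 < t) {ρ : ℂ}
    (h0 : ρ ≠ 0) (f : Ext n) :
    S.kernel up m x t ρ f = (S.wt (star n up m) (ρ * t) / S.wt (star n up m) (ρ * x)) •
      green S.μ S.ω S.chat m x t ρ f := by
  have hpow : ∀ ν : ℂ, sectorPow S.ω (ρ * x) ν = ((x / t : ℝ) : ℂ) ^ ν * sectorPow S.ω (ρ * t)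
    ν := by
    intro ν
    rw [← sectorPow_mul (mul_ofReal_ne_zero h0 ht) (div_pos hx ht)]
    congr 1
    push_cast
    have : (t : ℂ) ≠ 0 := by exact_mod_cast ht.ne'
    field_simp
  have hne : ∀ ν : ℂ, ((x / t : ℝ) : ℂ) ^ ν ≠ 0 := fun ν => by
    rw [Complex.cpow_def_of_ne_zero (by exact_mod_cast (div_pos hx ht).ne')]
    exact exp_ne_zero _
  rw [kernel_apply, green_eq_transfer, transfer, smul_sum]
  refine sum_congr rfl fun α _ => ?_
  rw [wedge_c, wedge_c, mul_smul_comm, map_smul, smul_smul, smul_smul, smul_eq_mul,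
    wt_eq (mul_ofReal_ne_zero h0 ht), wt_eq (mul_ofReal_ne_zero h0 hx), muSum_compl, hpow, hpow,
    Complex.cpow_sub _ _ (by exact_mod_cast (div_pos hx ht).ne')]
  have e : sectorPow S.ω (ρ * t) (-S.muSum α) = (sectorPow S.ω (ρ * t) (S.muSum α))⁻¹ := by
    rw [← zero_sub, sectorPow_sub, sectorPow_zero, one_div]
  rw [e]
  have p1 := sectorPow_ne_zero (ω := S.ω) (ρ * t) (S.muSum α)
  have p2 := sectorPow_ne_zero (ω := S.ω) (ρ * t) (S.muSum (star n up m))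
  have p3 := hne (S.muSum (star n up m))
  congr 1
  rw [mul_div_mul_comm]
  field_simp

lemma transfer_transfer (m : ℕ) {u v w : Fin n → Fin n → ℂ} (hv : (ofCols v).det = 1)
    (f : Ext n) : transfer m v w (transfer m u v f) = transfer m u w f := by
  conv_lhs => rw [transfer.eq_def m u v, transfer_sum]
  rw [transfer.eq_def m u w]
  refine sum_congr rfl fun α hα => ?_
  rw [transfer_smul, transfer_wedge _ _ (mem_powersetCard.mp hα).2, hv, one_smul]

lemma kernel_kernel (up : Bool) (m : ℕ) {x s t : ℝ} (hx : 0 < x) (hs : 0 < s) (ht : 0 < t)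
    {ρ : ℂ} (hρ : ρ ∈ S.D) (h0 : ρ ≠ 0) (f : Ext n) :
    S.kernel up m x s ρ (S.kernel up m s t ρ f) = S.kernel up m x t ρ f := by
  rw [kernel_eq_green up m hs ht h0, map_smul, kernel_eq_green up m hx hs h0,
    kernel_eq_green up m hx ht h0, green_eq_transfer, green_eq_transfer, green_eq_transfer,
    transfer_transfer m (det_c (mul_mem_D hρ hs.le) (mul_ofReal_ne_zero h0 hs)), smul_smul]
  congr 1
  have := wt_ne_zero (S := S) (mul_mem_D hρ hs.le) (mul_ofReal_ne_zero h0 hs) (star n up m)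
  field_simp

/-- Far from the vertex the kernel is given by the Jost solutions. -/
lemma kernel_eq_far (up : Bool) {m : ℕ} (hm : m ≤ n) {x t : ℝ} (hx : 0 < x) (ht : 0 < t) {ρ : ℂ}
    (hρ : ρ ∈ S.D) (h0 : ρ ≠ 0) (hx1 : 1 ≤ ‖ρ * x‖) (ht1 : 1 ≤ ‖ρ * t‖) (f : Ext n) :
    S.kernel up m x t ρ f = ∑ α ∈ Finset.powersetCard m .univ,
      (((ofCols fun j => S.e j S.ref).det)⁻¹ * shuffleSign α *
        exp (ρ * ((x - t) * (S.RSum α - S.RSum (star n up m)))) *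
        topCoeff n (f * wedge (fun j => S.ehat j (ρ * t)) αᶜ)) •
          wedge (fun j => S.ehat j (ρ * x)) α := by
  have mx := mul_mem_D (S := S) hρ hx.le
  have mt := mul_mem_D (S := S) hρ ht.le
  have zx := mul_ofReal_ne_zero h0 hx
  have zt := mul_ofReal_ne_zero h0 ht
  obtain ⟨P, hP⟩ := isSol_c.exists_matrix (S := S) (v := S.e)
    (by rw [det_c ref_mem ref_ne_zero]; exact one_ne_zero) isSol_e
  have hde := isSol_e.det (S := S) mt zt
  rw [kernel_eq_green up m hx ht h0, green_eq_transfer, transfer_change_basis hm P (det_c mt zt)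
    (by rw [hde]; exact det_e_ne_zero) (hP _ mt zt) (hP _ mx zx), hde, transfer, smul_smul,
    smul_sum]
  refine sum_congr rfl fun α _ => ?_
  have hR : S.RSum αᶜ = -S.RSum α := by
    have h : S.RSum α + S.RSum αᶜ = 0 := by
      rw [RSum, RSum, Finset.sum_add_sum_compl, sum_R]
    linear_combination h
  rw [wedge_e, wedge_e, mul_smul_comm, map_smul, smul_smul, smul_smul, smul_eq_mul,
    wt_eq_exp mx hx1, wt_eq_exp mt ht1, hR]
  congr 1
  have e : exp (ρ * ((x - t) * (S.RSum α - S.RSum (star n up m)))) =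
      exp (ρ * t * S.RSum (star n up m)) / exp (ρ * x * S.RSum (star n up m)) *
        (exp (ρ * t * -S.RSum α) * exp (ρ * x * S.RSum α)) := by
    rw [← Complex.exp_sub, ← exp_add, ← exp_add]
    congr 1; ring
  rw [e]; ring

lemma norm_shuffleSign (α : Finset (Fin n)) : ‖shuffleSign α‖ = 1 := by
  have h := congrArg norm (shuffleSign_mul_self α)
  rw [norm_mul, norm_one] at h
  nlinarith [norm_nonneg (shuffleSign α)]

lemma norm_relPow_le (up : Bool) {m : ℕ} (hm : m ≤ n) {α : Finset (Fin n)} (hα : α.card = m)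
    {x t : ℝ} (hx : 0 ≤ x) (ht : t ∈ region up x) :
    ‖((x / t : ℝ) : ℂ) ^ (S.muSum α - S.muSum (star n up m))‖ ≤ 1 := by
  have ht0 : 0 < t := region_subset_Ioi up hx ht
  by_cases hs : α = star n up m
  · simp [hs]
  have hre := re_muSum_star (S := S) up hm hα hs
  rcases hx.eq_or_lt with rfl | hx
  · have hν : S.muSum α - S.muSum (star n up m) ≠ 0 := by
      intro h0
      rw [h0] at hre
      cases up <;> simp at hre
    simp [Complex.zero_cpow hν]
  rw [Complex.norm_cpow_eq_rpow_re_of_pos (div_pos hx ht0)]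
  cases up
  · have : t < x := ht.2
    exact Real.rpow_le_one_of_one_le_of_nonpos ((one_le_div ht0).mpr this.le)
      (le_of_lt (by simpa using hre))
  · have : x < t := ht
    exact Real.rpow_le_one (div_nonneg hx.le ht0.le) ((div_le_one ht0).mpr this.le)
      (le_of_lt (by simpa using hre))

lemma exists_near_bound (up : Bool) (m : ℕ) : ∃ C, 0 ≤ C ∧ ∀ ξ ∈ S.D, ‖ξ‖ ≤ 1 →
    ‖S.what (star n up m) ξ‖ ≤ C ∧ ‖(S.what (star n up m) ξ)⁻¹‖ ≤ C ∧
      ∀ α, ‖wedge (fun j => S.chat j ξ) α‖ ≤ C := by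
  have hc : IsCompact (S.D ∩ Metric.closedBall 0 1) :=
    (isCompact_closedBall (0 : ℂ) 1).inter_left isClosed_closure
  obtain ⟨C1, h1⟩ := hc.exists_bound_of_continuousOn
    ((continuousOn_what (star n up m)).mono inter_subset_left)
  obtain ⟨C2, h2⟩ := hc.exists_bound_of_continuousOn
    (((continuousOn_what (star n up m)).inv₀ fun ξ hξ => what_ne_zero hξ _).mono inter_subset_left)
  choose C3 h3 using fun α : Finset (Fin n) => hc.exists_bound_of_continuousOn
    (continuous_wedge_chat (S := S) α).continuousOn
  have hs : 0 ≤ ∑ α, |C3 α| := sum_nonneg fun _ _ => abs_nonneg _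
  refine ⟨|C1| + |C2| + ∑ α, |C3 α|, by positivity, fun ξ hξ hn => ?_⟩
  have hm : ξ ∈ S.D ∩ Metric.closedBall 0 1 := ⟨hξ, by simpa using hn⟩
  refine ⟨?_, ?_, fun α => ?_⟩
  · linarith [h1 ξ hm, le_abs_self C1, abs_nonneg C2]
  · have h2' : ‖(S.what (star n up m) ξ)⁻¹‖ ≤ C2 := h2 ξ hm
    linarith [le_abs_self C2, abs_nonneg C1]
  · linarith [h3 α ξ hm, le_abs_self (C3 α), abs_nonneg C1, abs_nonneg C2,
      single_le_sum (f := fun α => |C3 α|) (fun _ _ => abs_nonneg _) (Finset.mem_univ α)]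

/-- The kernel is continuous in the endpoint and in the spectral parameter. -/
lemma continuousAt_kernel (up : Bool) {m : ℕ} (hm : m ≤ n) (x : ℝ≥0) (t : ℝ) (ρ : S.D)
    (ht : t ∈ region up x) :
    ContinuousAt (fun p : ℝ≥0 × S.D => S.kernel up m p.1 t p.2) (x, ρ) := by
  have ht0 : 0 < t := region_subset_Ioi up x.2 ht
  have hw : Continuous (S.D.domRestrict (S.what (star n up m))) :=
    continuousOn_iff_continuous_domRestrict.mp (continuousOn_what _)
  have c1 : Continuous fun p : ℝ≥0 × S.D => S.what (star n up m) (p.2 * t) :=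
    hw.comp (f := fun p : ℝ≥0 × S.D => (⟨p.2 * t, mul_mem_D p.2.2 ht0.le⟩ : S.D)) (by fun_prop)
  have c2 : Continuous fun p : ℝ≥0 × S.D => S.what (star n up m) (p.2 * (p.1 : ℝ)) :=
    hw.comp (f := fun p : ℝ≥0 × S.D => (⟨p.2 * (p.1 : ℝ), mul_mem_D p.2.2 p.1.2⟩ : S.D))
      (by fun_prop)
  refine tendsto_finsetSum _ fun α hα => ?_
  have hα := (mem_powersetCard.mp hα).2
  have c3 : ContinuousAt (fun p : ℝ≥0 × S.D =>
      (((p.1 : ℝ) / t : ℝ) : ℂ) ^ (S.muSum α - S.muSum (star n up m))) (x, ρ) := by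
    by_cases hs : α = star n up m
    · simp only [hs, sub_self, Complex.cpow_zero]
      exact continuousAt_const
    have hre := re_muSum_star (S := S) up hm hα hs
    have h1 : ContinuousAt (fun y : ℝ => (y : ℂ) ^ (S.muSum α - S.muSum (star n up m)))
        ((x : ℝ) / t) := by
      refine Complex.continuousAt_ofReal_cpow_const _ _ ?_
      cases up
      · exact Or.inr (div_pos (ht0.trans ht.2) ht0).ne'
      · exact Or.inl (by simpa using hre)
    exact ContinuousAt.comp (f := fun p : ℝ≥0 × S.D => (p.1 : ℝ) / t) (x := (x, ρ)) h1 (by fun_prop)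
  refine Tendsto.smul ?_ ?_
  · exact (continuousAt_const.mul (c1.continuousAt.div c2.continuousAt
      (what_ne_zero (mul_mem_D ρ.2 x.2) _))).mul c3
  · have c4 : Continuous fun p : ℝ≥0 × S.D => topMul n (wedge (fun j => S.chat j (p.2 * t)) αᶜ) :=
      (topMul n).continuous.comp ((continuous_wedge_chat _).comp (by fun_prop))
    have c5 : Continuous fun p : ℝ≥0 × S.D => wedge (fun j => S.chat j (p.2 * (p.1 : ℝ))) α :=
      (continuous_wedge_chat _).comp (by fun_prop)
    exact (((ContinuousLinearMap.smulRightL ℂ (Ext n) (Ext n)).continuous.comp c4).clm_apply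
      c5).continuousAt

lemma continuousOn_kernel (up : Bool) {m : ℕ} (x : ℝ≥0) (ρ : S.D) :
    ContinuousOn (fun t => S.kernel up m x t ρ) (region up x) := by
  have hr : ∀ t ∈ region up x, 0 < t := fun t ht => region_subset_Ioi up x.2 ht
  refine continuousOn_finsetSum _ fun α hα => ?_
  have c1 : ContinuousOn (fun t : ℝ => S.what (star n up m) (ρ * t)) (region up x) :=
    (continuousOn_what _).comp (by fun_prop) fun t ht => mul_mem_D ρ.2 (hr t ht).le
  have c3 : ContinuousOn (fun t : ℝ =>
      (((x : ℝ) / t : ℝ) : ℂ) ^ (S.muSum α - S.muSum (star n up m))) (region up x) := by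
    rcases eq_or_ne x 0 with rfl | hx
    · simpa using continuousOn_const
    · intro t ht
      have h1 : ContinuousAt (fun y : ℝ => (y : ℂ) ^ (S.muSum α - S.muSum (star n up m)))
          ((x : ℝ) / t) := Complex.continuousAt_ofReal_cpow_const _ _
            (Or.inr (div_ne_zero (by exact_mod_cast hx) (hr t ht).ne'))
      exact (ContinuousAt.comp (f := fun t : ℝ => (x : ℝ) / t) h1
        (continuousAt_const.div continuousAt_id (hr t ht).ne')).continuousWithinAt
  have c0 := (continuousOn_const (c := shuffleSign α).mul (c1.div (continuousOn_const
    (c := S.what (star n up m) (ρ * (x : ℝ))))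
      fun t _ => what_ne_zero (mul_mem_D ρ.2 x.2) _)).mul c3
  refine c0.smul ?_
  · have c4 : Continuous fun t : ℝ => topMul n (wedge (fun j => S.chat j (ρ * t)) αᶜ) :=
      (topMul n).continuous.comp ((continuous_wedge_chat _).comp (by fun_prop))
    exact (((ContinuousLinearMap.smulRightL ℂ (Ext n) (Ext n)).continuous.comp c4).clm_apply
      continuous_const).continuousOn

/-- The normalised kernel is bounded: near the vertex by the formula that defines it, far from the
vertex by the asymptotics of the Jost solutions; the mixed case follows by composition. -/
lemma exists_kernel_bound (up : Bool) {m : ℕ} (hm : m ≤ n) : ∃ C, 0 ≤ C ∧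
    ∀ (x : ℝ≥0), ∀ t ∈ region up x, ∀ ρ : S.D, ‖S.kernel up m x t ρ‖ ≤ C := by
  obtain ⟨C1, hC1, h1⟩ := exists_near_bound (S := S) up m
  obtain ⟨C2, hC2, h2⟩ := exists_wedge_ehat_bound (S := S)
  set N : ℝ := ((Finset.powersetCard m (Finset.univ : Finset (Fin n))).card : ℝ) with hN
  set d := ‖((ofCols fun j => S.e j S.ref).det)⁻¹‖ with hd
  set K1 := N * (C1 * C1 * (‖topMul n‖ * C1 * C1)) with hK1
  set K2 := N * (d * (‖topMul n‖ * C2 * C2)) with hK2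
  have near : ∀ (x : ℝ≥0), ∀ t ∈ region up x, ∀ ρ : S.D, ‖(ρ : ℂ) * x‖ ≤ 1 → ‖(ρ : ℂ) * t‖ ≤ 1 →
      ‖S.kernel up m x t ρ‖ ≤ K1 := by
    intro x t ht ρ hx1 ht1
    have ht0 : 0 < t := region_subset_Ioi up x.2 ht
    obtain ⟨-, b1, b2⟩ := h1 _ (mul_mem_D ρ.2 x.2) hx1
    obtain ⟨b3, -, b4⟩ := h1 _ (mul_mem_D ρ.2 ht0.le) ht1
    rw [hK1, hN, ← nsmul_eq_mul]
    refine (norm_sum_le _ _).trans (Finset.sum_le_card_nsmul _ _ _ fun α hα => ?_)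
    have hα := (mem_powersetCard.mp hα).2
    rw [norm_smul, ContinuousLinearMap.norm_smulRight_apply, norm_mul, norm_mul, norm_shuffleSign,
      one_mul, div_eq_mul_inv, norm_mul]
    have b5 := norm_relPow_le (S := S) up hm hα x.2 ht
    have b6 : ‖topMul n (wedge (fun j => S.chat j (ρ * t)) αᶜ)‖ ≤ ‖topMul n‖ * C1 :=
      (topMul n).le_opNorm_of_le (b4 _)
    refine mul_le_mul ?_ (mul_le_mul b6 (b2 α) (norm_nonneg _) (by positivity)) (by positivity)
      (by positivity)
    calc _ ≤ (C1 * C1) * 1 := mul_le_mul (mul_le_mul b3 b1 (norm_nonneg _) hC1) b5 (norm_nonneg _)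
          (by positivity)
      _ = _ := mul_one _
  have far : ∀ (x : ℝ≥0), ∀ t ∈ region up x, ∀ ρ : S.D, 1 ≤ ‖(ρ : ℂ) * x‖ → 1 ≤ ‖(ρ : ℂ) * t‖ →
      ‖S.kernel up m x t ρ‖ ≤ K2 := by
    intro x t ht ρ hx1 ht1
    have ht0 : 0 < t := region_subset_Ioi up x.2 ht
    have h0 : (ρ : ℂ) ≠ 0 := by rintro h0; rw [h0] at ht1; simp at ht1; linarith
    have hx0 : (0 : ℝ) < x := by
      rcases x.2.eq_or_lt with h | h
      · change (0 : ℝ) = x at h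
        rw [← h] at hx1; simp at hx1; linarith
      · exact h
    refine ContinuousLinearMap.opNorm_le_bound _ (by positivity) fun f => ?_
    rw [kernel_eq_far up hm hx0 ht0 ρ.2 h0 hx1 ht1, hK2, hN, mul_assoc, ← nsmul_eq_mul]
    refine (norm_sum_le _ _).trans (Finset.sum_le_card_nsmul _ _ _ fun α hα => ?_)
    have hα := (mem_powersetCard.mp hα).2
    rw [norm_smul, norm_mul, norm_mul, norm_mul, norm_shuffleSign, mul_one]
    have b1 : ‖topCoeff n (f * wedge (fun j => S.ehat j (ρ * t)) αᶜ)‖ ≤ ‖topMul n‖ * C2 * ‖f‖ := by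
      rw [← topMul_apply]
      exact (topMul n).le_of_opNorm₂_le_of_le le_rfl (h2 _ (mul_mem_D ρ.2 ht0.le) ht1 _) le_rfl
    have b2 := h2 _ (mul_mem_D ρ.2 x.2) hx1 α
    have b3 : ‖exp (ρ * ((x - t) * (S.RSum α - S.RSum (star n up m))))‖ ≤ 1 := by
      refine norm_exp_le_one ?_
      have e : (ρ : ℂ) * (((x : ℝ) - t) * (S.RSum α - S.RSum (star n up m))) =
          ((x - t : ℝ) : ℂ) * (ρ * (S.RSum α - S.RSum (star n up m))) := by push_cast; ring
      have hre := re_RSum_star ρ.2 up hm hα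
      change ((ρ : ℂ) * (((x : ℝ) - t) * (S.RSum α - S.RSum (star n up m)))).re ≤ 0
      rw [e, re_ofReal_mul]
      cases up
      · exact mul_nonpos_of_nonneg_of_nonpos (sub_nonneg.mpr ht.2.le) (by simpa using hre)
      · have : (x : ℝ) < t := ht
        exact mul_nonpos_of_nonpos_of_nonneg (sub_nonpos.mpr this.le) (by simpa using hre)
    calc _ ≤ d * 1 * (‖topMul n‖ * C2 * ‖f‖) * C2 :=
          mul_le_mul (mul_le_mul (mul_le_mul_of_nonneg_left b3 (norm_nonneg _)) b1 (norm_nonneg _)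
            (by positivity)) b2 (norm_nonneg _) (by positivity)
      _ = _ := by ring
  have hK1' : 0 ≤ K1 := by positivity
  have hK2' : 0 ≤ K2 := by positivity
  have pos : ∀ (x : ℝ≥0), 0 < x → ∀ t ∈ region up x, ∀ ρ : S.D,
      ‖S.kernel up m x t ρ‖ ≤ K1 + K2 + K1 * K2 := by
    intro x hx t ht ρ
    have hx : (0 : ℝ) < x := hx
    have ht0 : 0 < t := region_subset_Ioi up x.2 ht
    have hK12 : 0 ≤ K1 * K2 := by positivity
    have cross : ∀ K K' : ℝ, 0 ≤ K → K * K' = K1 * K2 →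
        (‖(ρ : ℂ) * x‖ < 1 ∧ 1 < ‖(ρ : ℂ) * t‖) ∨ (1 < ‖(ρ : ℂ) * x‖ ∧ ‖(ρ : ℂ) * t‖ < 1) →
        (∀ s : ℝ≥0, (s : ℝ) ∈ region up x → ‖(ρ : ℂ) * s‖ = 1 → ‖S.kernel up m x s ρ‖ ≤ K) →
        (∀ s : ℝ≥0, t ∈ region up s → ‖(ρ : ℂ) * s‖ = 1 → ‖S.kernel up m s t ρ‖ ≤ K') →
        ‖S.kernel up m x t ρ‖ ≤ K1 * K2 := by
      intro K K' hK hKK hxt hl hr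
      have h0 : (ρ : ℂ) ≠ 0 := by rintro h0; norm_num [h0] at hxt
      have hn := norm_pos_iff.mpr h0
      set s : ℝ≥0 := ⟨‖(ρ : ℂ)‖⁻¹, by positivity⟩
      have hs : 0 < s := inv_pos.mpr hn
      have hs1 : ‖(ρ : ℂ)‖ * s = 1 := mul_inv_cancel₀ hn.ne'
      have hs1' : ‖(ρ : ℂ) * s‖ = 1 := by
        rw [norm_mul, norm_real, norm_of_nonneg s.coe_nonneg, hs1]
      rw [norm_mul, norm_mul, norm_real, norm_real, norm_of_nonneg x.coe_nonneg,
        norm_of_nonneg ht0.le, ← hs1] at hxt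
      simp only [mul_lt_mul_iff_right₀ hn] at hxt
      have hsr : (s : ℝ) ∈ region up x ∧ t ∈ region up s := by
        cases up <;> rcases hxt with h | h
        · exact absurd ht.2 (h.1.trans h.2).not_gt
        · exact ⟨⟨hs, h.1⟩, ht0, h.2⟩
        · exact h
        · exact absurd (show (x : ℝ) < t from ht) (h.2.trans h.1).not_gt
      refine le_trans (ContinuousLinearMap.opNorm_le_bound _ (by positivity) fun f => ?_)
        ((mul_le_mul (hl s hsr.1 hs1') (hr s hsr.2 hs1') (norm_nonneg _) hK).trans_eq hKK)
      rw [← kernel_kernel up m hx hs ht0 ρ.2 h0, mul_assoc]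
      exact (S.kernel up m x s ρ).le_opNorm_of_le ((S.kernel up m s t ρ).le_opNorm f)
    rcases le_total ‖(ρ : ℂ) * x‖ 1 with hx1 | hx1 <;> rcases le_total ‖(ρ : ℂ) * t‖ 1 with ht1 |
      ht1
    · linarith [near x t ht ρ hx1 ht1]
    · rcases hx1.eq_or_lt with hx2 | hx2
      · linarith [far x t ht ρ hx2.ge ht1]
      rcases ht1.eq_or_lt with ht2 | ht2
      · linarith [near x t ht ρ hx1 ht2.ge]
      linarith [cross K1 K2 hK1' rfl (.inl ⟨hx2, ht2⟩) (fun s h hs => near x s h ρ hx1 hs.le)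
        fun s h hs => far s t h ρ hs.ge ht1]
    · rcases hx1.eq_or_lt with hx2 | hx2
      · linarith [near x t ht ρ hx2.ge ht1]
      rcases ht1.eq_or_lt with ht2 | ht2
      · linarith [far x t ht ρ hx1 ht2.ge]
      linarith [cross K2 K1 hK2' (mul_comm _ _) (.inr ⟨hx2, ht2⟩)
        (fun s h hs => far x s h ρ hx1 hs.ge) fun s h hs => near s t h ρ hs.le ht1]
    · linarith [far x t ht ρ hx1 ht1]
  refine ⟨K1 + K2 + K1 * K2, by positivity, fun x t ht ρ => ?_⟩
  rcases eq_or_lt_of_le (zero_le : 0 ≤ x) with rfl | hx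
  · -- the bound for `x = 0` follows by continuity
    have h1 := continuousAt_kernel (S := S) up hm 0 t ρ ht
    have h2 : Tendsto (fun x : ℝ≥0 => S.kernel up m x t ρ) (𝓝[>] 0)
      (𝓝 (S.kernel up m (0 : ℝ≥0) t ρ)) :=
      (ContinuousAt.comp (f := fun x : ℝ≥0 => (x, ρ)) (x := 0) h1 (by fun_prop)).mono_left
        nhdsWithin_le_nhds
    refine le_of_tendsto h2.norm ?_
    have h3 : ∀ᶠ x : ℝ≥0 in 𝓝[>] 0, t ∈ region up x := by
      have : Tendsto (fun x : ℝ≥0 => (x : ℝ)) (𝓝[>] 0) (𝓝 ((0 : ℝ≥0) : ℝ)) :=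
        (NNReal.continuous_coe.tendsto 0).mono_left nhdsWithin_le_nhds
      exact this.eventually (eventually_mem_region up ht)
    filter_upwards [h3, self_mem_nhdsWithin] with x hx1 hx2 using pos x hx2 t hx1 ρ
  · exact pos x hx t ht ρ

/-- The sign of the integral term. -/
def sgn (up : Bool) : ℂ := if up then -1 else 1

lemma norm_sgn (up : Bool) : ‖sgn up‖ = 1 := by cases up <;> simp [sgn]

/-- The normalised kernel, with the sign of the integral term, is a Volterra kernel. -/
lemma exists_isVolterraKernel (S : Setup n) (up : Bool) {m : ℕ} (hm : m ≤ n) :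
    ∃ C, IsVolterraKernel up (fun (x : ℝ≥0) (t : ℝ) (ρ : S.D) => sgn up • S.kernel up m x t ρ)
      C := by
  obtain ⟨C, hC, h⟩ := exists_kernel_bound (S := S) up hm
  refine ⟨C, hC, fun x t ht ρ => ?_, fun x ρ => ?_, fun x t ρ ht => ?_⟩
  · rw [norm_smul, norm_sgn, one_mul]; exact h x t ht ρ
  · exact (continuousOn_kernel up x ρ).const_smul (sgn up)
  · exact (continuousAt_kernel up hm x t ρ ht).const_smul (sgn up)

end Setup

/-! ### The first-order term -/

section FirstOrder

/-- An entry of a nonnegative array is at most the sum of all entries. -/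
lemma le_double_sum {f : Fin n → Fin n → ℝ} (h0 : ∀ i j, 0 ≤ f i j) (i j : Fin n) :
    f i j ≤ ∑ i, ∑ j, f i j :=
  (single_le_sum (f := f i) (fun _ _ => h0 i _) (Finset.mem_univ j)).trans
    (single_le_sum (f := fun i => ∑ j, f i j) (fun i _ => sum_nonneg fun j _ => h0 i j)
      (Finset.mem_univ i))

/-- A finite family of numbers is bounded. -/
lemma exists_forall_le_of_finite {ι : Type*} [Finite ι] (f : ι → ℝ) :
    ∃ C, 0 ≤ C ∧ ∀ i, f i ≤ C := by
  obtain ⟨C, hC⟩ := (Set.finite_range f).bddAbove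
  exact ⟨max C 0, le_max_right _ _, fun i => (hC (mem_range_self i)).trans (le_max_left _ _)⟩

lemma exists_norm_derivL_single_le (n : ℕ) :
    ∃ C, 0 ≤ C ∧ ∀ i j, ‖derivL (n := n) (Matrix.single i j 1)‖ ≤ C := by
  obtain ⟨C, h0, h⟩ := exists_forall_le_of_finite
    fun p : Fin n × Fin n => ‖derivL (n := n) (Matrix.single p.1 p.2 1)‖
  refine ⟨C, h0, fun i j => ?_⟩
  have := h (i, j)
  dsimp only at this
  exact this

/-- The operators `q(t)^{(m)}` of the matrix function with the entries `v i j`. -/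
def potOp (v : Fin n → Fin n → ℝ → ℂ) (t : ℝ) : Ext n →L[ℂ] Ext n :=
  ∑ i, ∑ j, v i j t • derivL (Matrix.single i j 1)

lemma potOp_eq (v : Fin n → Fin n → ℝ → ℂ) (t : ℝ) :
    potOp v t = derivL (Matrix.of fun i j => v i j t) := (derivL_eq_sum _).symm

variable {v : Fin n → Fin n → ℝ → ℂ}

lemma integrableOn_double_sum_smul {E : Type*} [NormedAddCommGroup E] [NormedSpace ℂ E]
    (hv : ∀ i j, IntegrableOn (v i j) (Ioi 0)) (X : Fin n → Fin n → E) :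
    IntegrableOn (fun t => ∑ i, ∑ j, v i j t • X i j) (Ioi 0) :=
  integrable_finsetSum _ fun i _ => integrable_finsetSum _ fun j _ =>
    Integrable.smul_const (hv i j) (X i j)

lemma integrableOn_potOp (hv : ∀ i j, IntegrableOn (v i j) (Ioi 0)) :
    IntegrableOn (potOp v) (Ioi 0) :=
  integrableOn_double_sum_smul hv fun i j => derivL (Matrix.single i j 1)

/-- The norm of the potential operators is controlled by the entries. -/
lemma exists_norm_potOp_le (n : ℕ) : ∃ C, 0 ≤ C ∧ ∀ (v : Fin n → Fin n → ℝ → ℂ) (t : ℝ),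
    ‖potOp v t‖ ≤ C * ∑ i, ∑ j, ‖v i j t‖ := by
  obtain ⟨C, hC, hC'⟩ := exists_norm_derivL_single_le n
  refine ⟨C, hC, fun v t => ?_⟩
  rw [mul_sum]
  refine (norm_sum_le _ _).trans (sum_le_sum fun i _ => ?_)
  rw [mul_sum]
  refine (norm_sum_le _ _).trans (sum_le_sum fun j _ => ?_)
  rw [norm_smul, mul_comm]
  exact mul_le_mul_of_nonneg_right (hC' i j) (norm_nonneg _)

lemma one_le_damp {u : ℝ} (hu : 0 < u) (h1 : u ≤ 1) : 1 ≤ damp u :=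
  le_min le_rfl ((one_le_inv₀ hu).mpr h1)

/-- The integral over the part of the half-line near the vertex is weakly damped. -/
lemma setIntegral_norm_le_weakMass {q : ℝ → ℂ} (hq : IntegrableOn q (Ioi 0)) {r : ℝ}
    (hr : 0 < r) {s : Set ℝ} (hs : MeasurableSet s) (hs0 : s ⊆ Ioc 0 r⁻¹) :
    ∫ t in s, ‖q t‖ ≤ weakMass q r := by
  have hi : s ⊆ Ioi 0 := fun t ht => (hs0 ht).1
  refine le_trans (setIntegral_mono_on (IntegrableOn.mono_set hq.norm hi)
    ((integrableOn_damp_mul hq hr.le).mono_set hi) hs fun t ht => ?_)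
    (setIntegral_mono_set (integrableOn_damp_mul hq hr.le) ?_ (LE.le.eventuallyLE hi))
  · have h1 := hs0 ht
    refine le_mul_of_one_le_left (norm_nonneg _) (one_le_damp (mul_pos hr h1.1) ?_)
    calc r * t ≤ r * r⁻¹ := mul_le_mul_of_nonneg_left h1.2 hr.le
      _ = 1 := mul_inv_cancel₀ hr.ne'
  · rw [EventuallyLE, ae_restrict_iff' measurableSet_Ioi]
    exact .of_forall fun t ht =>
      mul_nonneg (damp_nonneg (mul_nonneg hr.le (le_of_lt ht))) (norm_nonneg _)

/-- The sum of the weakly damped integrals of the entries. -/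
def weakSum (v : Fin n → Fin n → ℝ → ℂ) (r : ℝ) : ℝ := ∑ i, ∑ j, weakMass (v i j) r

lemma weakMass_le_weakSum (v : Fin n → Fin n → ℝ → ℂ) {r : ℝ} (hr : 0 ≤ r) (i j : Fin n) :
    weakMass (v i j) r ≤ weakSum v r :=
  le_double_sum (f := fun i j => weakMass (v i j) r) (fun _ _ => weakMass_nonneg _ hr) i j

lemma weakSum_nonneg (v : Fin n → Fin n → ℝ → ℂ) {r : ℝ} (hr : 0 ≤ r) : 0 ≤ weakSum v r :=
  sum_nonneg fun _ _ => sum_nonneg fun _ _ => weakMass_nonneg _ hr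

namespace Setup

variable {S : Setup n}

lemma exists_wedge_ehat_sub_le : ∃ C, 0 ≤ C ∧ ∀ ξ ∈ S.D, 1 ≤ ‖ξ‖ → ∀ γ : Finset (Fin n),
    ‖wedge (fun j => S.ehat j ξ) γ - wedge S.fvec γ‖ ≤ C * ‖ξ‖⁻¹ := by
  obtain ⟨M, hM0, hMf, hM⟩ := exists_ehat_bound (S := S)
  obtain ⟨K, hK0, hK⟩ := exists_ehat_sub_le (S := S)
  choose C hC0 hC using fun γ : Finset (Fin n) => exists_wedge_lipschitz γ M
  refine ⟨(∑ γ, C γ) * K, mul_nonneg (sum_nonneg fun γ _ => hC0 γ) hK0, fun ξ hξ h1 γ => ?_⟩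
  refine (hC γ _ _ (hM ξ hξ h1) hMf).trans ?_
  rw [mul_assoc]
  exact mul_le_mul (single_le_sum (f := C) (fun γ _ => hC0 γ) (Finset.mem_univ γ))
    (hK ξ hξ h1) (norm_nonneg _) (sum_nonneg fun γ _ => hC0 γ)

variable (S) in
/-- The matrix elements of the operator that shifts the basis vector `j` to `i`, in the basis of
the products of the `exp (-ξ R_k) e_k(ξ)`. -/
def elem (i j : Fin n) (α γ : Finset (Fin n)) (ξ : ℂ) : ℂ :=
  topCoeff n (derivExt (Matrix.single i j 1) (wedge (fun k => S.ehat k ξ) γ) *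
    wedge (fun k => S.ehat k ξ) αᶜ)

variable (S) in
/-- The limits of the matrix elements as `ξ → ∞`. -/
def elemLim (i j : Fin n) (α γ : Finset (Fin n)) : ℂ :=
  topCoeff n (derivExt (Matrix.single i j 1) (wedge S.fvec γ) * wedge S.fvec αᶜ)

lemma exists_elem_bound : ∃ C, 0 ≤ C ∧ ∀ ξ ∈ S.D, 1 ≤ ‖ξ‖ → ∀ i j α γ,
    ‖S.elem i j α γ ξ‖ ≤ C ∧ ‖S.elem i j α γ ξ - S.elemLim i j α γ‖ ≤ C * ‖ξ‖⁻¹ := by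
  obtain ⟨C1, hC1, h1⟩ := exists_wedge_ehat_bound (S := S)
  obtain ⟨C2, hC2, h2⟩ := exists_wedge_ehat_sub_le (S := S)
  obtain ⟨C3, hC3, h3⟩ := exists_forall_le_of_finite fun γ : Finset (Fin n) => ‖wedge S.fvec γ‖
  obtain ⟨C4, hC4, h4⟩ := exists_norm_derivL_single_le n
  set N := ‖topMul n‖
  refine ⟨N * C1 * (C4 * C1) + (N * C1 * (C4 * C2) + N * C2 * (C4 * C3)), by positivity,
    fun ξ hξ hn i j α γ => ⟨?_, ?_⟩⟩
  · have e : S.elem i j α γ ξ = topMul n (wedge (fun k => S.ehat k ξ) αᶜ)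
        (derivL (Matrix.single i j 1) (wedge (fun k => S.ehat k ξ) γ)) := by
      simp only [topMul_apply, derivL_apply, elem]
    have b : ‖S.elem i j α γ ξ‖ ≤ N * C1 * (C4 * C1) :=
      e ▸ (topMul n).le_of_opNorm₂_le_of_le le_rfl (h1 ξ hξ hn αᶜ)
        ((derivL (Matrix.single i j 1)).le_of_opNorm_le_of_le (h4 i j) (h1 ξ hξ hn γ))
    have : 0 ≤ N * C1 * (C4 * C2) + N * C2 * (C4 * C3) := by positivity
    linarith
  · have e : S.elem i j α γ ξ - S.elemLim i j α γ =
        topMul n (wedge (fun k => S.ehat k ξ) αᶜ) (derivL (Matrix.single i j 1)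
          (wedge (fun k => S.ehat k ξ) γ - wedge S.fvec γ)) +
        topMul n (wedge (fun k => S.ehat k ξ) αᶜ - wedge S.fvec αᶜ)
          (derivL (Matrix.single i j 1) (wedge S.fvec γ)) := by
      simp only [map_sub, sub_apply, topMul_apply, derivL_apply, elem, elemLim]
      ring
    rw [e]
    have b1 : ‖topMul n (wedge (fun k => S.ehat k ξ) αᶜ) (derivL (Matrix.single i j 1)
        (wedge (fun k => S.ehat k ξ) γ - wedge S.fvec γ))‖ ≤ N * C1 * (C4 * (C2 * ‖ξ‖⁻¹)) :=
      (topMul n).le_of_opNorm₂_le_of_le le_rfl (h1 ξ hξ hn αᶜ)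
        ((derivL (Matrix.single i j 1)).le_of_opNorm_le_of_le (h4 i j) (h2 ξ hξ hn γ))
    have b2 : ‖topMul n (wedge (fun k => S.ehat k ξ) αᶜ - wedge S.fvec αᶜ)
        (derivL (Matrix.single i j 1) (wedge S.fvec γ))‖ ≤ N * (C2 * ‖ξ‖⁻¹) * (C4 * C3) :=
      (topMul n).le_of_opNorm₂_le_of_le le_rfl (h2 ξ hξ hn αᶜ)
        ((derivL (Matrix.single i j 1)).le_of_opNorm_le_of_le (h4 i j) (h3 γ))
    have b3 : 0 ≤ N * C1 * (C4 * C1) * ‖ξ‖⁻¹ := by positivity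
    refine (norm_add_le _ _).trans ((add_le_add b1 b2).trans ?_)
    linarith

lemma continuousOn_elem (i j : Fin n) (α γ : Finset (Fin n)) :
    ContinuousOn (S.elem i j α γ) (S.D \ {0}) := by
  have h1 : ∀ β : Finset (Fin n), ContinuousOn (fun ξ => wedge (fun k => S.ehat k ξ) β)
    (S.D \ {0}) :=
    fun β => (continuous_wedge β).comp_continuousOn (continuousOn_pi.mpr fun k => by
      have h2 : Continuous fun ξ : ℂ => exp (-(ξ * S.R k)) := by fun_prop
      have h3 := h2.continuousOn (s := S.D \ {0})
      exact h3.smul (isSol_e.continuousOn k))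
  exact (topL n).continuous.comp_continuousOn
    (((derivL (Matrix.single i j 1)).continuous.comp_continuousOn (h1 γ)).mul (h1 αᶜ))

/-- The vectors `𝔣_k` are eigenvectors of `B`. -/
lemma derivExt_B_wedge_fvec (γ : Finset (Fin n)) :
    derivExt (Matrix.diagonal S.b) (wedge S.fvec γ) = S.RSum γ • wedge S.fvec γ := by
  refine derivExt_wedge_eigen _ _ _ (fun k => ?_) γ
  ext i
  simp only [fvec, Matrix.mulVec_diagonal, Pi.single_apply, Pi.smul_apply, smul_eq_mul, R]
  split_ifs with h
  · rw [h]
  · simp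

/-- The operator that shifts the basis vector `j` to `i` changes the exponent by `b_i - b_j`. -/
lemma RSum_sub_of_elemLim_ne_zero {i j : Fin n} {α γ : Finset (Fin n)}
    (h : S.elemLim i j α γ ≠ 0) : S.RSum α - S.RSum γ = S.b i - S.b j := by
  set B := Matrix.diagonal S.b
  set X := derivExt (Matrix.single i j 1) (wedge S.fvec γ) with hX
  have hcomm : B * Matrix.single i j 1 - Matrix.single i j 1 * B =
      (S.b i - S.b j) • Matrix.single i j (1 : ℂ) := by
    ext k l
    simp only [B, Matrix.sub_apply, Matrix.diagonal_mul, Matrix.mul_diagonal, Matrix.smul_apply,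
      Matrix.single_apply, smul_eq_mul]
    split_ifs with h1
    · rw [h1.1, h1.2]; ring
    · ring
  have h1 : derivExt B X = (S.RSum γ + (S.b i - S.b j)) • X := by
    rw [hX, derivExt_comm, derivExt_B_wedge_fvec, derivExt_smul, hcomm,
      ← derivExtₗ_apply ((_ : ℂ) • _),
      map_smul, LinearMap.smul_apply, derivExtₗ_apply, add_smul]
  have h2 : topCoeff n (derivExt B (X * wedge S.fvec αᶜ)) = 0 := by
    rw [topCoeff_derivExt, Matrix.trace_diagonal, S.condB.sum_eq_zero, zero_mul]
  rw [derivExt_mul, h1, derivExt_B_wedge_fvec, smul_mul_assoc, mul_smul_comm, ← add_smul, map_smul,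
    smul_eq_mul, mul_eq_zero] at h2
  have h3 := h2.resolve_right h
  have hR : S.RSum α + S.RSum αᶜ = 0 := by
    rw [RSum, RSum, Finset.sum_add_sum_compl, sum_R]
  linear_combination hR - h3

/-- Indices `(α, i, j, γ)` of the terms of the first-order approximation. -/
abbrev Quad (n : ℕ) := Finset (Fin n) × Fin n × Fin n × Finset (Fin n)

/-- The indices with `|α| = |γ| = m`. -/
def quads (n m : ℕ) : Finset (Quad n) :=
  Finset.powersetCard m .univ ×ˢ (.univ ×ˢ (.univ ×ˢ Finset.powersetCard m .univ))

variable (S) in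
/-- The terms of the first-order approximation that oscillate. -/
def IsActive (up : Bool) (m : ℕ) (i j : Fin n) (α γ : Finset (Fin n)) : Prop :=
  i ≠ j ∧ α.card = m ∧ γ.card = m ∧ S.coeffE up m γ ≠ 0 ∧ S.elemLim i j α γ ≠ 0

variable (S) in
/-- The differences of the exponents from the leading one. -/
def dR (up : Bool) (m : ℕ) (α : Finset (Fin n)) : ℂ := S.RSum α - S.RSum (star n up m)

lemma IsActive.dR_ne {up : Bool} {m : ℕ} {i j : Fin n} {α γ : Finset (Fin n)}
    (h : S.IsActive up m i j α γ) : S.dR up m α ≠ S.dR up m γ := by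
  intro h0
  have h1 := RSum_sub_of_elemLim_ne_zero h.2.2.2.2
  have h2 : S.RSum α = S.RSum γ := by unfold dR at h0; linear_combination h0
  rw [h2, sub_self] at h1
  exact h.1 (S.condB.injective (sub_eq_zero.mp h1.symm))

lemma admissible_dR {up : Bool} {m : ℕ} (hm : m ≤ n) {α γ : Finset (Fin n)}
    (hα : α.card = m) (hγ : γ.card = m) (hg : S.coeffE up m γ ≠ 0) {ρ : ℂ} (hρ : ρ ∈ S.D) :
    Admissible up (S.dR up m α) (S.dR up m γ) ρ := by
  have h1 := re_RSum_star hρ up hm hα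
  have h2 := re_le_of_coeffE_ne_zero hm hγ hg hρ
  cases up
  · exact ⟨h1, h2⟩
  · refine ⟨h1, ?_⟩
    rw [coeffE_true hm hγ] at hg
    have : γ = star n true m := by by_contra h; simp [h] at hg
    simp [dR, this]

open scoped Classical in
variable (S) in
/-- The sum of the oscillatory integrals of the first-order approximation. -/
def oscSum (up : Bool) (m : ℕ) (v : Fin n → Fin n → ℝ → ℂ) (x : ℝ) (ρ : ℂ) : ℝ :=
  ∑ p : Quad n,
    if S.IsActive up m p.2.1 p.2.2.1 p.1 p.2.2.2 then
      ‖osc up (S.dR up m p.1) (S.dR up m p.2.2.2) (v p.2.1 p.2.2.1) x ρ‖ else 0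

lemma oscSum_nonneg (up : Bool) (m : ℕ) (v : Fin n → Fin n → ℝ → ℂ) (x : ℝ) (ρ : ℂ) :
    0 ≤ S.oscSum up m v x ρ :=
  sum_nonneg fun p _ => by split_ifs <;> positivity

lemma norm_osc_le_oscSum {up : Bool} {m : ℕ} {i j : Fin n} {α γ : Finset (Fin n)}
    (h : S.IsActive up m i j α γ) (v : Fin n → Fin n → ℝ → ℂ) (x : ℝ) (ρ : ℂ) :
    ‖osc up (S.dR up m α) (S.dR up m γ) (v i j) x ρ‖ ≤ S.oscSum up m v x ρ := by
  classical
  refine le_trans (le_of_eq ?_) (single_le_sum (fun p _ => ?_) (Finset.mem_univ (α, i, j, γ)))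
  · simp [h]
  · split_ifs <;> positivity

/-- The kernel applied to the leading term, far from the vertex. -/
lemma kernel_potOp_base (up : Bool) {m : ℕ} (hm : m ≤ n) (v : Fin n → Fin n → ℝ → ℂ) {x t : ℝ}
    (hx : 0 < x) (ht : 0 < t) {ρ : ℂ} (hρ : ρ ∈ S.D) (h0 : ρ ≠ 0) (hx1 : 1 ≤ ‖ρ * x‖)
    (ht1 : 1 ≤ ‖ρ * t‖) :
    S.kernel up m x t ρ (potOp v t (S.base up m (ρ * t))) =
      ∑ p ∈ quads n m,
        (phase (S.dR up m p.1) (S.dR up m p.2.2.2) ρ x t * v p.2.1 p.2.2.1 t *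
          S.elem p.2.1 p.2.2.1 p.1 p.2.2.2 (ρ * t)) •
        (((ofCols fun j => S.e j S.ref).det)⁻¹ * shuffleSign p.1 * S.coeffE up m p.2.2.2) •
          wedge (fun j => S.ehat j (ρ * x)) p.1 := by
  rw [kernel_eq_far up hm hx ht hρ h0 hx1 ht1, quads, Finset.sum_product]
  refine sum_congr rfl fun α _ => ?_
  have e : topCoeff n (potOp v t (S.base up m (ρ * t)) * wedge (fun j => S.ehat j (ρ * t)) αᶜ) =
      ∑ i, ∑ j, ∑ γ ∈ Finset.powersetCard m .univ,
        v i j t * (S.coeffE up m γ * exp (ρ * t * S.dR up m γ)) * S.elem i j α γ (ρ * t) := by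
    rw [base_eq_far up hm (mul_mem_D hρ ht.le) ht1, potOp]
    simp only [sum_apply, smul_apply, map_sum, map_smul, sum_mul, smul_mul_assoc,
      smul_sum, smul_smul, derivL_apply, smul_eq_mul]
    rw [Finset.sum_comm]
    refine sum_congr rfl fun i _ => ?_
    rw [Finset.sum_comm]
    refine sum_congr rfl fun j _ => sum_congr rfl fun γ _ => ?_
    unfold elem dR
    ring
  rw [e, mul_sum, sum_smul, Finset.sum_product]
  refine sum_congr rfl fun i _ => ?_
  rw [mul_sum, sum_smul, Finset.sum_product]
  refine sum_congr rfl fun j _ => ?_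
  rw [mul_sum, sum_smul]
  refine sum_congr rfl fun γ _ => ?_
  rw [smul_smul]
  congr 1
  have : phase (S.dR up m α) (S.dR up m γ) ρ x t =
      exp (ρ * ((x - t) * S.dR up m α)) * exp (ρ * t * S.dR up m γ) := by
    rw [phase, ← exp_add]; congr 1; ring
  rw [this]
  unfold dR
  ring

set_option maxHeartbeats 1000000 in
/-- The part of the first-order term that comes from `|ρ t| ≥ 1`, for `|ρ x| ≥ 1`. -/
lemma exists_farPart_le (S : Setup n) (up : Bool) {m : ℕ} (hm : m ≤ n) : ∃ C, 0 ≤ C ∧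
    ∀ v : Fin n → Fin n → ℝ → ℂ, (∀ i j, IntegrableOn (v i j) (Ioi 0)) → (∀ i t, v i i t = 0) →
    ∀ (x : ℝ) (ρ : ℂ) (B : ℝ), ρ ∈ S.D → ρ ≠ 0 → ‖ρ‖⁻¹ ≤ x → (∀ i j α γ, S.IsActive up m i j α γ →
      ‖∫ t in region up x ∩ Ici ‖ρ‖⁻¹, phase (S.dR up m α) (S.dR up m γ) ρ x t * v i j t‖ ≤ B) →
    0 ≤ B →
    ‖∫ t in region up x ∩ Ici ‖ρ‖⁻¹, S.kernel up m x t ρ (potOp v t (S.base up m (ρ * t)))‖ ≤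
      C * (weakSum v ‖ρ‖ + B) := by
  obtain ⟨C1, hC1, h1⟩ := exists_wedge_ehat_bound (S := S)
  obtain ⟨C2, hC2, h2⟩ := exists_elem_bound (S := S)
  obtain ⟨E, hE0, hE⟩ := exists_forall_le_of_finite
    fun p : Quad n =>
      ‖S.elemLim p.2.1 p.2.2.1 p.1 p.2.2.2‖
  set K : Quad n → ℂ := fun p =>
    ((ofCols fun j => S.e j S.ref).det)⁻¹ * shuffleSign p.1 * S.coeffE up m p.2.2.2 with hK
  refine ⟨∑ p ∈ quads n m, (C2 + E) * (‖K p‖ * C1), sum_nonneg fun p _ => by positivity,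
    fun v hv hv0 x ρ B hρ h0 hx hB hB0 => ?_⟩
  have hr : 0 < ‖ρ‖ := norm_pos_iff.mpr h0
  have hs : 0 < ‖ρ‖⁻¹ := inv_pos.mpr hr
  have hx0 : 0 < x := hs.trans_le hx
  have hfar : ∀ t : ℝ, ‖ρ‖⁻¹ ≤ t → 1 ≤ ‖ρ * t‖ := by
    intro t ht
    rw [norm_mul, norm_real, norm_of_nonneg (hs.le.trans ht)]
    calc 1 = ‖ρ‖ * ‖ρ‖⁻¹ := (mul_inv_cancel₀ hr.ne').symm
      _ ≤ _ := mul_le_mul_of_nonneg_left ht hr.le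
  set A := region up x ∩ Ici ‖ρ‖⁻¹ with hA
  have hAm : MeasurableSet A := (measurableSet_region up x).inter measurableSet_Ici
  have hA0 : A ⊆ Ioi 0 := fun t ht => hs.trans_le ht.2
  have hWS := weakSum_nonneg v hr.le
  set P : Quad n → ℝ → ℂ := fun p t =>
    phase (S.dR up m p.1) (S.dR up m p.2.2.2) ρ x t * v p.2.1 p.2.2.1 t with hP
  -- each summand is estimated separately; the matrix elements are replaced by their limits
  have term : ∀ p ∈ quads n m, S.coeffE up m p.2.2.2 ≠ 0 →
      IntegrableOn (fun t => P p t * S.elem p.2.1 p.2.2.1 p.1 p.2.2.2 (ρ * t)) A ∧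
      ‖∫ t in A, P p t * S.elem p.2.1 p.2.2.1 p.1 p.2.2.2 (ρ * t)‖ ≤
        (C2 + E) * (weakSum v ‖ρ‖ + B) := by
    rintro ⟨α, i, j, γ⟩ hp hg
    simp only [quads, Finset.mem_product, mem_powersetCard, Finset.mem_univ, true_and] at hp
    have hα := hp.1.2
    have hγ := hp.2.2
    simp only at hg
    have had := admissible_dR hm hα hγ hg hρ
    have hPi : IntegrableOn (P (α, i, j, γ)) A :=
      (integrableOn_phase_mul (hv i j) had hx0.le).mono_set inter_subset_left
    have hPn : ∀ t ∈ A, ‖P (α, i, j, γ) t‖ ≤ ‖v i j t‖ := by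
      intro t ht
      simp only [hP, norm_mul]
      exact mul_le_of_le_one_left (norm_nonneg _) (had.norm_phase_le (subset_closure ht.1))
    have hec : ContinuousOn (fun t : ℝ => S.elem i j α γ (ρ * t)) A :=
      (continuousOn_elem i j α γ).comp (Continuous.continuousOn (by fun_prop)) fun t ht =>
        ⟨mul_mem_D hρ (hA0 ht).le, mul_ofReal_ne_zero h0 (hA0 ht)⟩
    have heb : ∀ t ∈ A, ‖S.elem i j α γ (ρ * t)‖ ≤ C2 ∧
        ‖S.elem i j α γ (ρ * t) - S.elemLim i j α γ‖ ≤ C2 * damp (‖ρ‖ * t) := by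
      intro t ht
      have ht0 : 0 < t := hA0 ht
      have h3 := h2 _ (mul_mem_D hρ ht0.le) (hfar t ht.2) i j α γ
      have h4 : ‖ρ * t‖ = ‖ρ‖ * t := by
        rw [norm_mul, norm_real, norm_of_nonneg ht0.le]
      have h5 := hfar t ht.2
      rw [h4] at h3 h5
      refine ⟨h3.1, h3.2.trans (le_of_eq ?_)⟩
      rw [damp, min_eq_right (inv_le_one_of_one_le₀ h5)]
    have hPe : IntegrableOn (fun t => P (α, i, j, γ) t * S.elem i j α γ (ρ * t)) A := by
      refine Integrable.mul_bdd (c := C2) hPi (hec.aestronglyMeasurable hAm) ?_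
      rw [ae_restrict_iff' hAm]
      exact .of_forall fun t ht => (heb t ht).1
    refine ⟨hPe, ?_⟩
    have hdi : IntegrableOn (fun t => C2 * (damp (‖ρ‖ * t) * ‖v i j t‖)) (Ioi 0) :=
      (integrableOn_damp_mul (hv i j) hr.le).const_mul C2
    have e : ∫ t in A, P (α, i, j, γ) t * S.elem i j α γ (ρ * t) =
        (∫ t in A, P (α, i, j, γ) t * (S.elem i j α γ (ρ * t) - S.elemLim i j α γ)) +
          (∫ t in A, P (α, i, j, γ) t) * S.elemLim i j α γ := by
      rw [← integral_mul_const, ← integral_add]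
      · congr 1; ext t; ring
      · refine (hPe.sub (hPi.mul_const (S.elemLim i j α γ))).congr (.of_forall fun t => ?_)
        simp only [Pi.sub_apply]; ring
      · exact hPi.mul_const _
    have b1 : ‖∫ t in A, P (α, i, j, γ) t * (S.elem i j α γ (ρ * t) - S.elemLim i j α γ)‖ ≤
        C2 * weakMass (v i j) ‖ρ‖ := by
      rw [weakMass, ← integral_const_mul]
      refine (norm_integral_le_of_norm_le (hdi.mono_set hA0) ?_).trans
        (setIntegral_mono_set hdi ?_ (LE.le.eventuallyLE hA0))
      · rw [ae_restrict_iff' hAm]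
        refine .of_forall fun t ht => ?_
        rw [norm_mul]
        calc _ ≤ ‖v i j t‖ * (C2 * damp (‖ρ‖ * t)) :=
              mul_le_mul (hPn t ht) (heb t ht).2 (norm_nonneg _) (norm_nonneg _)
          _ = _ := by ring
      · rw [EventuallyLE, ae_restrict_iff' measurableSet_Ioi]
        exact .of_forall fun t ht => mul_nonneg hC2
          (mul_nonneg (damp_nonneg (mul_nonneg hr.le (le_of_lt ht))) (norm_nonneg _))
    have b2 : ‖(∫ t in A, P (α, i, j, γ) t) * S.elemLim i j α γ‖ ≤ E * B := by
      by_cases hz : S.elemLim i j α γ = 0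
      · rw [hz, mul_zero, norm_zero]; positivity
      by_cases hij : i = j
      · have : ∀ t, P (α, i, j, γ) t = 0 := fun t => by simp [hP, hij, hv0]
        simp only [this, integral_zero, zero_mul, norm_zero]; positivity
      rw [norm_mul, mul_comm]
      exact mul_le_mul (hE (α, i, j, γ)) (hB i j α γ ⟨hij, hα, hγ, hg, hz⟩) (norm_nonneg _) hE0
    rw [e]
    refine (norm_add_le _ _).trans ((add_le_add b1 b2).trans ?_)
    have b3 := weakMass_le_weakSum v hr.le i j
    nlinarith [mul_le_mul_of_nonneg_left b3 hC2, mul_nonneg hE0 hWS, mul_nonneg hC2 hB0]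
  have hint : ∀ p ∈ quads n m, IntegrableOn
    (fun t => (P p t * S.elem p.2.1 p.2.2.1 p.1 p.2.2.2 (ρ * t)) •
      K p • wedge (fun j => S.ehat j (ρ * x)) p.1) A := by
    intro p hp
    by_cases hg : S.coeffE up m p.2.2.2 = 0
    · have : K p = 0 := by simp [hK, hg]
      simp only [this, zero_smul, smul_zero]
      exact integrableOn_zero
    · exact (term p hp hg).1.smul_const _
  have e : ∫ t in A, S.kernel up m x t ρ (potOp v t (S.base up m (ρ * t))) =
      ∑ p ∈ quads n m, (∫ t in A, P p t * S.elem p.2.1 p.2.2.1 p.1 p.2.2.2 (ρ * t)) •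
        K p • wedge (fun j => S.ehat j (ρ * x)) p.1 := by
    simp only [← integral_smul_const]
    rw [← integral_finsetSum _ hint]
    refine setIntegral_congr_fun hAm fun t ht => ?_
    exact kernel_potOp_base up hm v hx0 (hA0 ht) hρ h0 (hfar x hx) (hfar t ht.2)
  rw [e, sum_mul]
  refine norm_sum_le_of_le _ fun p hp => ?_
  by_cases hg : S.coeffE up m p.2.2.2 = 0
  · have : K p = 0 := by simp [hK, hg]
    rw [this, zero_smul, smul_zero, norm_zero]
    simp
  · rw [norm_smul, norm_smul]
    calc _ ≤ ((C2 + E) * (weakSum v ‖ρ‖ + B)) * (‖K p‖ * C1) :=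
          mul_le_mul (term p hp hg).2 (mul_le_mul_of_nonneg_left
            (h1 _ (mul_mem_D hρ hx0.le) (hfar x hx) _) (norm_nonneg _)) (by positivity)
            (by positivity)
      _ = _ := by ring

end Setup

end FirstOrder

/-! ### The bound of the first-order term -/

section FirstOrderBound

namespace Setup

variable {S : Setup n} {v : Fin n → Fin n → ℝ → ℂ}

variable (S) in
/-- The signed normalised kernel of the integral equations. -/
def skernel (up : Bool) (m : ℕ) (x : ℝ≥0) (t : ℝ) (ρ : S.D) : Ext n →L[ℂ] Ext n :=
  sgn up • S.kernel up m x t ρ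

variable (S) in
/-- The integrand of the first-order term. -/
def foIntegrand (up : Bool) (m : ℕ) (v : Fin n → Fin n → ℝ → ℂ) (x : ℝ≥0) (ρ : S.D) (t : ℝ) :
    Ext n :=
  S.kernel up m x t ρ (potOp v t (S.base up m (ρ * t)))

variable (S) in
/-- The first-order term of the solution of the integral equation. -/
def firstOrder (up : Bool) (m : ℕ) (v : Fin n → Fin n → ℝ → ℂ) (x : ℝ≥0) (ρ : S.D) : Ext n :=
  volterra up (S.skernel up m) (potOp v) (fun x ρ => S.base up m (ρ * (x : ℝ))) x ρ

lemma sgn_mul_self (up : Bool) : sgn up * sgn up = 1 := by cases up <;> simp [sgn]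

lemma continuous_base_mul (up : Bool) {m : ℕ} (hm : m ≤ n) :
    Continuous fun p : ℝ≥0 × S.D => S.base up m (p.2 * (p.1 : ℝ)) :=
  (continuousOn_base up hm).comp_continuous (by fun_prop) fun p => mul_mem_D p.2.2 p.1.coe_nonneg

lemma integrableOn_foIntegrand (up : Bool) {m : ℕ} (hm : m ≤ n)
    (hv : ∀ i j, IntegrableOn (v i j) (Ioi 0)) (x : ℝ≥0) (ρ : S.D) :
    IntegrableOn (S.foIntegrand up m v x ρ) (region up x) := by
  obtain ⟨C, hC⟩ := exists_isVolterraKernel S up hm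
  obtain ⟨M, -, hM⟩ := exists_base_bound (S := S) up hm
  have hpos : ∀ t ∈ region up (x : ℝ), 0 ≤ t := fun t ht =>
    le_of_lt (region_subset_Ioi up x.coe_nonneg ht)
  have h1 := hC.integrableOn (integrableOn_potOp hv) (x := x) (ρ := ρ)
    (v := fun t => S.base up m (ρ * t))
    ((continuousOn_base up hm).comp (Continuous.continuousOn (by fun_prop)) fun t ht =>
      mul_mem_D ρ.2 (hpos t ht)) (M := M) fun t ht => hM _ (mul_mem_D ρ.2 (hpos t ht))
  refine (Integrable.smul (sgn up) h1).congr (.of_forall fun t => ?_)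
  simp only [Pi.smul_apply, smul_apply, smul_smul, sgn_mul_self, one_smul]
  rfl

lemma firstOrder_eq (up : Bool) {m : ℕ} (x : ℝ≥0) (ρ : S.D) :
    S.firstOrder up m v x ρ = sgn up • ∫ t in region up x, S.foIntegrand up m v x ρ t := by
  rw [firstOrder, volterra, ← integral_smul]
  refine setIntegral_congr_fun (measurableSet_region up x) fun t ht => ?_
  have h0 : 0 < t := region_subset_Ioi up x.coe_nonneg ht
  simp only [skernel, smul_apply, foIntegrand, coe_toNNReal t h0.le]

lemma continuous_firstOrder (up : Bool) {m : ℕ} (hm : m ≤ n)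
    (hv : ∀ i j, IntegrableOn (v i j) (Ioi 0)) :
    Continuous fun p : ℝ≥0 × S.D => S.firstOrder up m v p.1 p.2 := by
  obtain ⟨C, hC⟩ := exists_isVolterraKernel S up hm
  obtain ⟨M, -, hM⟩ := exists_base_bound (S := S) up hm
  exact hC.continuous_volterra (integrableOn_potOp hv) (v := fun x ρ => S.base up m (ρ * (x : ℝ)))
    (continuous_base_mul up hm) (M := M) fun x ρ => hM _ (mul_mem_D ρ.2 x.coe_nonneg)

/-- The part of the first-order term that comes from `|ρ t| ≤ 1`. -/
lemma exists_nearPart_le (S : Setup n) (up : Bool) {m : ℕ} (hm : m ≤ n) : ∃ C, 0 ≤ C ∧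
    ∀ v : Fin n → Fin n → ℝ → ℂ, (∀ i j, IntegrableOn (v i j) (Ioi 0)) →
    ∀ (x : ℝ≥0) (ρ : S.D), (ρ : ℂ) ≠ 0 → ∀ s : Set ℝ, MeasurableSet s → s ⊆ region up x →
      s ⊆ Ioc 0 ‖(ρ : ℂ)‖⁻¹ →
    ‖∫ t in s, S.foIntegrand up m v x ρ t‖ ≤ C * weakSum v ‖(ρ : ℂ)‖ := by
  obtain ⟨C1, hC1, h1⟩ := exists_kernel_bound (S := S) up hm
  obtain ⟨C2, hC2, h2⟩ := exists_base_bound (S := S) up hm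
  obtain ⟨C3, hC3, h3⟩ := exists_norm_potOp_le n
  refine ⟨C1 * (C3 * C2), by positivity, fun v hv x ρ h0 s hs hsx hs0 => ?_⟩
  have hr : 0 < ‖(ρ : ℂ)‖ := norm_pos_iff.mpr h0
  have hsi : s ⊆ Ioi 0 := fun t ht => (hs0 ht).1
  have hi : ∀ i j, IntegrableOn (fun t => ‖v i j t‖) s := fun i j =>
    IntegrableOn.mono_set (hv i j).norm hsi
  have hi2 : IntegrableOn (fun t => ∑ i, ∑ j, ‖v i j t‖) s :=
    integrable_finsetSum _ fun i _ => integrable_finsetSum _ fun j _ => hi i j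
  have b : ‖∫ t in s, S.foIntegrand up m v x ρ t‖ ≤
      ∫ t in s, C1 * (C3 * C2) * ∑ i, ∑ j, ‖v i j t‖ := by
    refine norm_integral_le_of_norm_le (hi2.const_mul _) ?_
    rw [ae_restrict_iff' hs]
    refine .of_forall fun t ht => ?_
    have e1 : ‖potOp v t (S.base up m (ρ * t))‖ ≤ C3 * (∑ i, ∑ j, ‖v i j t‖) * C2 :=
      (potOp v t).le_of_opNorm_le_of_le (h3 v t) (h2 _ (mul_mem_D ρ.2 (hsi ht).le))
    have e2 : ‖S.foIntegrand up m v x ρ t‖ ≤ C1 * (C3 * (∑ i, ∑ j, ‖v i j t‖) * C2) :=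
      (S.kernel up m x t ρ).le_of_opNorm_le_of_le (h1 x t (hsx ht) ρ) e1
    refine e2.trans (le_of_eq ?_)
    ring
  refine b.trans ?_
  rw [integral_const_mul]
  refine mul_le_mul_of_nonneg_left ?_ (by positivity)
  rw [integral_finsetSum _ fun i _ => integrable_finsetSum _ fun j _ => hi i j]
  refine sum_le_sum fun i _ => ?_
  rw [integral_finsetSum _ fun j _ => hi i j]
  exact sum_le_sum fun j _ => setIntegral_norm_le_weakMass (hv i j) hr hs hs0

/-- Removing the part with `|ρ t| ≤ 1` from an oscillatory integral. -/
lemma norm_integral_phase_le {a b ρ : ℂ} {up : Bool} (had : Admissible up a b ρ) (h0 : ρ ≠ 0)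
    {q : ℝ → ℂ} (hq : IntegrableOn q (Ioi 0)) {x : ℝ} (hx : 0 ≤ x) :
    ‖∫ t in region up x ∩ Ici ‖ρ‖⁻¹, phase a b ρ x t * q t‖ ≤
      ‖osc up a b q x ρ‖ + weakMass q ‖ρ‖ := by
  have hr : 0 < ‖ρ‖ := norm_pos_iff.mpr h0
  have hi := integrableOn_phase_mul hq had hx
  have hsp := integral_inter_add_sdiff (measurableSet_Ici (a := ‖ρ‖⁻¹)) hi
  have hm : MeasurableSet (region up x \ Ici ‖ρ‖⁻¹) :=
    (measurableSet_region up x).diff measurableSet_Ici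
  have hs0 : region up x \ Ici ‖ρ‖⁻¹ ⊆ Ioc 0 ‖ρ‖⁻¹ := fun t ht =>
    ⟨region_subset_Ioi up hx ht.1, (not_le.mp ht.2).le⟩
  have hb : ‖∫ t in region up x \ Ici ‖ρ‖⁻¹, phase a b ρ x t * q t‖ ≤ weakMass q ‖ρ‖ := by
    refine le_trans ?_ (setIntegral_norm_le_weakMass hq hr hm hs0)
    refine norm_integral_le_of_norm_le (IntegrableOn.mono_set hq.norm fun t ht => (hs0 ht).1) ?_
    rw [ae_restrict_iff' hm]
    refine .of_forall fun t ht => ?_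
    rw [norm_mul]
    exact mul_le_of_le_one_left (norm_nonneg _) (had.norm_phase_le (subset_closure ht.1))
  have e : ∫ t in region up x ∩ Ici ‖ρ‖⁻¹, phase a b ρ x t * q t =
      osc up a b q x ρ - ∫ t in region up x \ Ici ‖ρ‖⁻¹, phase a b ρ x t * q t := by
    rw [osc, ← hsp]; ring
  rw [e]
  exact (norm_sub_le _ _).trans (by gcongr)

/-- The oscillatory integral over `t > s` where `|ρ s| = 1`. -/
lemma norm_integral_phase_tail_le {a ρ : ℂ} (had : Admissible true a 0 ρ) (h0 : ρ ≠ 0)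
    {q : ℝ → ℂ} (hq : IntegrableOn q (Ioi 0)) :
    ‖∫ t in region true ‖ρ‖⁻¹ ∩ Ici ‖ρ‖⁻¹, phase a 0 ρ ‖ρ‖⁻¹ t * q t‖ ≤
      Real.exp ‖a‖ * (‖osc true a 0 q 0 ρ‖ + weakMass q ‖ρ‖) := by
  have hr : 0 < ‖ρ‖ := norm_pos_iff.mpr h0
  have hs : 0 < ‖ρ‖⁻¹ := inv_pos.mpr hr
  have e1 : ∫ t in region true ‖ρ‖⁻¹ ∩ Ici ‖ρ‖⁻¹, phase a 0 ρ ‖ρ‖⁻¹ t * q t =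
      exp (ρ * ‖ρ‖⁻¹ * a) * ∫ t in region true 0 ∩ Ici ‖ρ‖⁻¹, phase a 0 ρ 0 t * q t := by
    rw [← integral_const_mul]
    have h1 : region true ‖ρ‖⁻¹ ∩ Ici ‖ρ‖⁻¹ = Ioi ‖ρ‖⁻¹ :=
      inter_eq_left.mpr Ioi_subset_Ici_self
    have h2 : region true 0 ∩ Ici ‖ρ‖⁻¹ = Ici ‖ρ‖⁻¹ :=
      inter_eq_right.mpr fun t ht => hs.trans_le ht
    rw [h1, h2, integral_Ici_eq_integral_Ioi]
    refine setIntegral_congr_fun measurableSet_Ioi fun t _ => ?_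
    simp only [phase]
    rw [← mul_assoc, ← exp_add]
    congr 2
    push_cast
    ring
  have e2 : ‖exp (ρ * ‖ρ‖⁻¹ * a)‖ ≤ Real.exp ‖a‖ := by
    rw [norm_exp, Real.exp_le_exp]
    refine (Complex.re_le_norm _).trans (le_of_eq ?_)
    rw [norm_mul, norm_mul, norm_real, norm_inv, norm_norm, mul_inv_cancel₀ hr.ne', one_mul]
  rw [e1, norm_mul]
  exact mul_le_mul e2 (norm_integral_phase_le had h0 hq le_rfl) (norm_nonneg _) (Real.exp_pos _).le

/-- The first-order term is controlled by oscillatory integrals of the entries of the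
potential. -/
lemma exists_firstOrder_le (S : Setup n) (up : Bool) {m : ℕ} (hm : m ≤ n) : ∃ C, 0 ≤ C ∧
    ∀ v : Fin n → Fin n → ℝ → ℂ, (∀ i j, IntegrableOn (v i j) (Ioi 0)) → (∀ i t, v i i t = 0) →
    ∀ (x : ℝ≥0) (ρ : S.D), (ρ : ℂ) ≠ 0 → ‖S.firstOrder up m v x ρ‖ ≤
      C * (weakSum v ‖(ρ : ℂ)‖ + S.oscSum up m v x ρ + S.oscSum up m v 0 ρ) := by
  obtain ⟨C1, hC1, h1⟩ := exists_nearPart_le S up hm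
  obtain ⟨C2, hC2, h2⟩ := exists_farPart_le S up hm
  obtain ⟨C3, hC3, h3⟩ := exists_kernel_bound (S := S) up hm
  obtain ⟨E, hE0, hE⟩ := exists_forall_le_of_finite fun α => Real.exp ‖S.dR up m α‖
  set C := C1 + C2 * 2 + C3 * (C2 * (1 + E)) with hC
  refine ⟨C, by positivity, fun v hv hv0 x ρ h0 => ?_⟩
  have hr : 0 < ‖(ρ : ℂ)‖ := norm_pos_iff.mpr h0
  have hs : 0 < ‖(ρ : ℂ)‖⁻¹ := inv_pos.mpr hr
  set s := ‖(ρ : ℂ)‖⁻¹ with hsdef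
  have hW := weakSum_nonneg v hr.le
  set w := weakSum v ‖(ρ : ℂ)‖
  have hO := fun x : ℝ => oscSum_nonneg (S := S) up m v x ρ
  -- the part with `|ρ t| ≤ 1`
  have near : ∀ x : ℝ≥0, ‖∫ t in region up x \ Ici s, S.foIntegrand up m v x ρ t‖ ≤ C1 * w :=
    fun x => h1 v hv x ρ h0 _ ((measurableSet_region up x).diff measurableSet_Ici) sdiff_subset
      fun t ht => ⟨region_subset_Ioi up x.coe_nonneg ht.1, (not_le.mp ht.2).le⟩
  have split : ∀ x : ℝ≥0, ‖S.firstOrder up m v x ρ‖ ≤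
      ‖∫ t in region up x ∩ Ici s, S.foIntegrand up m v x ρ t‖ + C1 * w := by
    intro x
    rw [firstOrder_eq up, norm_smul, norm_sgn, one_mul,
      ← integral_inter_add_sdiff (measurableSet_Ici (a := s))
        (integrableOn_foIntegrand up hm hv x ρ)]
    exact (norm_add_le _ _).trans (by gcongr; exact near x)
  rcases le_or_gt s x with hx | hx
  · have far : ‖∫ t in region up x ∩ Ici s, S.foIntegrand up m v x ρ t‖ ≤
        C2 * (w + (S.oscSum up m v x ρ + w)) := by
      refine h2 v hv hv0 x ρ _ ρ.2 h0 hx (fun i j α γ hact => ?_) (by have := hO x; positivity)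
      refine (norm_integral_phase_le (admissible_dR hm hact.2.1 hact.2.2.1 hact.2.2.2.1 ρ.2) h0
        (hv i j) x.coe_nonneg).trans ?_
      gcongr
      · exact norm_osc_le_oscSum hact v x ρ
      · exact weakMass_le_weakSum v hr.le i j
    refine (split x).trans ((add_le_add_left far _).trans ?_)
    have h5 := mul_nonneg hC1 (hO x)
    have h6 := mul_nonneg hC2 (hO x)
    have h7 : 0 ≤ C3 * (C2 * (1 + E)) * (w + S.oscSum up m v x ρ + S.oscSum up m v 0 ρ) := by
      have := hO x; have := hO 0; positivity
    have h8 : 0 ≤ (C1 + C2 * 2) * S.oscSum up m v 0 ρ := by have := hO 0; positivity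
    rw [hC]
    linarith
  · -- near the vertex: the kernel is transported from the point `s`
    have key : ∀ y : ℝ≥0, 0 < y → (y : ℝ) < s →
        ‖∫ t in region up y ∩ Ici s, S.foIntegrand up m v y ρ t‖ ≤
          C3 * (C2 * (w + E * (S.oscSum up m v 0 ρ + w))) := by
      intro y hy hys
      have hR : 0 ≤ C3 * (C2 * (w + E * (S.oscSum up m v 0 ρ + w))) := by
        have := hO 0; positivity
      cases up
      · have : region false (y : ℝ) ∩ Ici s = ∅ := by
          ext t
          simp only [region, Bool.false_eq_true, if_false, mem_inter_iff, mem_Ioo, mem_Ici,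
            mem_empty_iff_false, iff_false, not_and, not_le]
          exact fun h => h.2.trans hys
        rw [this, setIntegral_empty, norm_zero]
        exact hR
      have hset : region true (y : ℝ) ∩ Ici s = Ici s :=
        inter_eq_right.mpr fun t ht => hys.trans_le ht
      have hset2 : region true s ∩ Ici s = Ioi s := inter_eq_left.mpr Ioi_subset_Ici_self
      obtain ⟨s', hsn⟩ : ∃ s' : ℝ≥0, (s' : ℝ) = s := ⟨⟨s, hs.le⟩, rfl⟩
      have far : ‖∫ t in region true s ∩ Ici s, S.foIntegrand true m v s' ρ t‖ ≤
          C2 * (w + E * (S.oscSum true m v 0 ρ + w)) := by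
        have hB : ∀ i j α γ, S.IsActive true m i j α γ →
            ‖∫ t in region true s ∩ Ici s, phase (S.dR true m α) (S.dR true m γ) ρ s t * v i j t‖ ≤
              E * (S.oscSum true m v 0 ρ + w) := by
          intro i j α γ hact
          have had := admissible_dR hm hact.2.1 hact.2.2.1 hact.2.2.2.1 ρ.2
          have hb : S.dR true m γ = 0 := had.2
          have h5 := norm_osc_le_oscSum hact v 0 ρ
          rw [hb] at had h5 ⊢
          refine (norm_integral_phase_tail_le had h0 (hv i j)).trans ?_
          exact mul_le_mul (hE α) (add_le_add h5 (weakMass_le_weakSum v hr.le i j))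
            (add_nonneg (norm_nonneg _) (weakMass_nonneg _ hr.le)) hE0
        have h5 := h2 v hv hv0 s ρ _ ρ.2 h0 le_rfl hB (by have := hO 0; positivity)
        simp only [foIntegrand, hsn]
        exact h5
      have hint := integrableOn_foIntegrand (S := S) true hm hv s' ρ
      have e : ∫ t in region true (y : ℝ) ∩ Ici s, S.foIntegrand true m v y ρ t =
          S.kernel true m y s ρ (∫ t in region true s ∩ Ici s, S.foIntegrand true m v s' ρ t) := by
        have hint' : IntegrableOn (S.foIntegrand true m v s' ρ) (Ioi s) := by rw [← hsn]; exact hint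
        rw [hset, hset2, integral_Ici_eq_integral_Ioi,
          ← ContinuousLinearMap.integral_comp_comm _ hint']
        refine setIntegral_congr_fun measurableSet_Ioi fun t ht => ?_
        simp only [foIntegrand, hsn]
        exact (kernel_kernel true m hy hs (hs.trans ht) ρ.2 h0 _).symm
      rw [e]
      exact (S.kernel true m y s ρ).le_of_opNorm_le_of_le (h3 y s hys ρ) far
    have key2 : ∀ y : ℝ≥0, (y : ℝ) < s →
        ‖S.firstOrder up m v y ρ‖ ≤ C3 * (C2 * (w + E * (S.oscSum up m v 0 ρ + w))) + C1 * w := by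
      intro y hy
      rcases eq_or_lt_of_le (zero_le : 0 ≤ y) with h | h
      · -- at the vertex the bound follows by continuity
        have hc : Continuous fun y : ℝ≥0 => S.firstOrder up m v y ρ :=
          (continuous_firstOrder up hm hv).comp (by fun_prop : Continuous fun y : ℝ≥0 => (y, ρ))
        have hT : Tendsto (fun k : ℕ => ‖S.firstOrder up m v (1 / ((k : ℝ≥0) + 1)) ρ‖) atTop
            (𝓝 ‖S.firstOrder up m v 0 ρ‖) :=
          (hc.norm.tendsto 0).comp tendsto_one_div_add_atTop_nhds_zero_nat
        have hev : ∀ᶠ k : ℕ in atTop, ((1 / ((k : ℝ≥0) + 1) : ℝ≥0) : ℝ) < s := by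
          have := (NNReal.continuous_coe.tendsto 0).comp
            (tendsto_one_div_add_atTop_nhds_zero_nat (𝕜 := ℝ≥0))
          exact this.eventually (gt_mem_nhds hs)
        rw [← h]
        refine le_of_tendsto hT (hev.mono fun k hk => ?_)
        exact (split _).trans (add_le_add_left (key _ (by positivity) hk) _)
      · exact (split y).trans (add_le_add_left (key y h hy) _)
    refine (key2 x hx).trans ?_
    have h5 : 0 ≤ (C1 + C2 * 2) * S.oscSum up m v 0 ρ + C2 * 2 * w + C3 * C2 * S.oscSum up m v 0 ρ
      := by have := hO 0; positivity
    have h6 : 0 ≤ C * S.oscSum up m v x ρ := by have := hO x; positivity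
    have e : C * (w + S.oscSum up m v x ρ + S.oscSum up m v 0 ρ) =
      C3 * (C2 * (w + E * (S.oscSum up m v 0 ρ + w))) + C1 * w + C * S.oscSum up m v x ρ +
      ((C1 + C2 * 2) * S.oscSum up m v 0 ρ + C2 * 2 * w + C3 * C2 * S.oscSum up m v 0 ρ) := by
      rw [hC]; ring
    linarith

end Setup

end FirstOrderBound

/-! ### Potentials -/

section InterpolationL2

variable {α : Type*} [MeasurableSpace α] {m : Measure α}

/-- `L_1 ∩ L_p ⊂ L_2` for `p > 2`, with a quantitative bound. -/
lemma lintegral_enorm_sq_le_of_ne_top {p : ℝ≥0∞} (hp : 2 < p) (hp' : p ≠ ⊤) {u : α → ℂ}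
    (hu : AEStronglyMeasurable u m) :
    ∫⁻ t, ‖u t‖ₑ ^ 2 ∂m ≤ eLpNorm u 1 m + eLpNorm u p m ^ p.toReal := by
  have hp0 : p ≠ 0 := (two_pos.trans hp).ne'
  have hp2 : 2 ≤ p.toReal := by
    have := ENNReal.toReal_mono hp' hp.le
    simpa using this
  have h1 : eLpNorm u p m ^ p.toReal = ∫⁻ t, ‖u t‖ₑ ^ p.toReal ∂m := by
    rw [eLpNorm_eq_lintegral_rpow_enorm_toReal hp0 hp', ← ENNReal.rpow_mul, one_div,
      inv_mul_cancel₀ (by linarith), ENNReal.rpow_one]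
  rw [h1, eLpNorm_one_eq_lintegral_enorm]
  rw [← lintegral_add_left' hu.enorm]
  refine lintegral_mono fun t => ?_
  rcases le_total ‖u t‖ₑ 1 with h | h
  · refine le_add_right ?_
    calc ‖u t‖ₑ ^ 2 = ‖u t‖ₑ * ‖u t‖ₑ := sq _
      _ ≤ ‖u t‖ₑ * 1 := by gcongr
      _ = _ := mul_one _
  · refine le_add_left ?_
    rw [← ENNReal.rpow_two]
    exact ENNReal.rpow_le_rpow_of_exponent_le h hp2

lemma lintegral_enorm_sq_le_of_top {u : α → ℂ} (hu : AEStronglyMeasurable u m) :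
    ∫⁻ t, ‖u t‖ₑ ^ 2 ∂m ≤ eLpNorm u ⊤ m * eLpNorm u 1 m := by
  rw [eLpNorm_one_eq_lintegral_enorm, eLpNorm_exponent_top]
  rw [← lintegral_const_mul'' _ hu.enorm]
  refine lintegral_mono_ae ?_
  filter_upwards [enorm_ae_le_eLpNormEssSup u m] with t ht
  rw [sq]
  gcongr

end InterpolationL2

namespace Potential

variable {p : ℝ≥0∞} [Fact (1 ≤ p)]

/-- The entries of a potential, with zeros on the diagonal everywhere. -/
def ent (q : Potential n p) (i j : Fin n) (t : ℝ) : ℂ := if i = j then 0 else q.mat t i j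

lemma ent_self (q : Potential n p) (i : Fin n) (t : ℝ) : q.ent i i t = 0 := if_pos rfl

lemma ent_eq_ae (q : Potential n p) (i j : Fin n) :
    q.ent i j =ᵐ[halfLine] fun t => q.mat t i j := by
  rcases eq_or_ne i j with rfl | h
  · have h1 : (q.1 i i).1 = 0 := by rw [q.2.2 i]; rfl
    have h2 : ⇑(q.1 i i).1 =ᵐ[halfLine] 0 := by rw [h1]; exact Lp.coeFn_zero _ _ _
    filter_upwards [h2] with t ht
    rw [ent_self]
    exact ht.symm
  · exact .of_forall fun t => if_neg h

lemma ent_ae (q : Potential n p) :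
    ∀ᵐ t, 0 < t → (Matrix.of fun i j => q.ent i j t) = q.mat t := by
  have h : ∀ i j, ∀ᵐ t, 0 < t → q.ent i j t = q.mat t i j := fun i j =>
    (ae_restrict_iff' measurableSet_Ioi).mp (q.ent_eq_ae i j)
  have h2 := ae_all_iff.mpr fun i => ae_all_iff.mpr fun j => h i j
  filter_upwards [h2] with t ht h0
  ext i j
  exact ht i j h0

lemma ent_ae_one (q : Potential n p) (i j : Fin n) : q.ent i j =ᵐ[halfLine] ⇑(q.1 i j).1 :=
  q.ent_eq_ae i j

lemma integrableOn_ent (q : Potential n p) (i j : Fin n) : IntegrableOn (q.ent i j) (Ioi 0) :=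
  (L1.integrable_coeFn (q.1 i j).1).congr (q.ent_ae_one i j).symm

/-- The entries of the difference of two potentials. -/
def diff (q q' : Potential n p) (i j : Fin n) (t : ℝ) : ℂ := q.ent i j t - q'.ent i j t

lemma integrableOn_diff (q q' : Potential n p) (i j : Fin n) :
    IntegrableOn (q.diff q' i j) (Ioi 0) := (q.integrableOn_ent i j).sub (q'.integrableOn_ent i j)

lemma diff_ae_one (q q' : Potential n p) (i j : Fin n) :
    q.diff q' i j =ᵐ[halfLine] ⇑((q.1 i j).1 - (q'.1 i j).1) := by
  filter_upwards [q.ent_ae_one i j, q'.ent_ae_one i j, Lp.coeFn_sub (q.1 i j).1 (q'.1 i j).1]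
    with t h1 h2 h3
  rw [diff, h1, h2, h3, Pi.sub_apply]

lemma diff_ae_p (q q' : Potential n p) (i j : Fin n) :
    q.diff q' i j =ᵐ[halfLine] ⇑((q.1 i j).2 - (q'.1 i j).2) := by
  filter_upwards [q.ent_ae_one i j, q'.ent_ae_one i j, Lp.coeFn_sub (q.1 i j).2 (q'.1 i j).2,
    q.2.1 i j, q'.2.1 i j] with t h1 h2 h3 h4 h5
  rw [diff, h1, h2, h3, Pi.sub_apply, h4, h5]

lemma continuous_entry (i j : Fin n) : Continuous fun q : Potential n p => q.1 i j :=
  (continuous_apply j).comp ((continuous_apply i).comp continuous_subtype_val)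

lemma tendsto_eLpNorm_diff (q₀ : Potential n p) (i j : Fin n) :
    Tendsto (fun q : Potential n p => eLpNorm (q.diff q₀ i j) 1 halfLine) (𝓝 q₀) (𝓝 0) ∧
      Tendsto (fun q : Potential n p => eLpNorm (q.diff q₀ i j) p halfLine) (𝓝 q₀) (𝓝 0) := by
  constructor
  · have e : ∀ q : Potential n p, eLpNorm (q.diff q₀ i j) 1 halfLine =
        ‖(q.1 i j).1 - (q₀.1 i j).1‖ₑ := fun q => by
      rw [eLpNorm_congr_ae (q.diff_ae_one q₀ i j), Lp.enorm_def]
    simp only [e]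
    have hc : Continuous fun q : Potential n p => ‖(q.1 i j).1 - (q₀.1 i j).1‖ₑ :=
      ((continuous_entry i j).fst.sub continuous_const).enorm
    simpa using hc.tendsto q₀
  · have e : ∀ q : Potential n p, eLpNorm (q.diff q₀ i j) p halfLine =
        ‖(q.1 i j).2 - (q₀.1 i j).2‖ₑ := fun q => by
      rw [eLpNorm_congr_ae (q.diff_ae_p q₀ i j), Lp.enorm_def]
    simp only [e]
    have hc : Continuous fun q : Potential n p => ‖(q.1 i j).2 - (q₀.1 i j).2‖ₑ :=
      ((continuous_entry i j).snd.sub continuous_const).enorm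
    simpa using hc.tendsto q₀

/-- The `L_1` norms of the entries depend continuously on the potential. -/
lemma tendsto_integral_diff (q₀ : Potential n p) (i j : Fin n) :
    Tendsto (fun q : Potential n p => ∫ t in Ioi 0, ‖q.diff q₀ i j t‖) (𝓝 q₀) (𝓝 0) := by
  have h := (ENNReal.tendsto_toReal ENNReal.zero_ne_top).comp (q₀.tendsto_eLpNorm_diff i j).1
  refine h.congr fun q => ?_
  rw [Function.comp_apply, eLpNorm_one_eq_lintegral_enorm,
    integral_norm_eq_lintegral_enorm (q.integrableOn_diff q₀ i j).aestronglyMeasurable]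

/-- For `p > 2`, the `L_2` norms of the entries depend continuously on the potential. -/
lemma tendsto_lintegral_sq_diff (hp : 2 < p) (q₀ : Potential n p) (i j : Fin n) :
    Tendsto (fun q : Potential n p => ∫⁻ t in Ioi 0, ‖q.diff q₀ i j t‖ₑ ^ 2) (𝓝 q₀) (𝓝 0) := by
  obtain ⟨h1, h2⟩ := q₀.tendsto_eLpNorm_diff i j
  rcases eq_or_ne p ⊤ with rfl | hp'
  · refine tendsto_of_tendsto_of_tendsto_of_le_of_le tendsto_const_nhds ?_ (fun _ => zero_le)
      fun q => lintegral_enorm_sq_le_of_top (q.integrableOn_diff q₀ i j).aestronglyMeasurable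
    have := ENNReal.Tendsto.mul h2 (Or.inr ENNReal.zero_ne_top) h1 (Or.inr ENNReal.zero_ne_top)
    simpa using this
  · refine tendsto_of_tendsto_of_tendsto_of_le_of_le tendsto_const_nhds ?_ (fun _ => zero_le)
      fun q => lintegral_enorm_sq_le_of_ne_top hp hp'
        (q.integrableOn_diff q₀ i j).aestronglyMeasurable
    have hp0 : 0 < p.toReal := ENNReal.toReal_pos (two_pos.trans hp).ne' hp'
    have h3 := ((ENNReal.continuous_rpow_const (y := p.toReal)).tendsto 0).comp h2
    rw [ENNReal.zero_rpow_of_pos hp0] at h3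
    simpa using h1.add h3

lemma memLp_two_of_mem {m : Measure ℝ} (hp : 2 < p) {u : ℝ → ℂ} (h1 : MemLp u 1 m)
    (h2 : MemLp u p m) : MemLp u 2 m := by
  refine ⟨h1.1, ?_⟩
  have h3 : ∫⁻ t, ‖u t‖ₑ ^ 2 ∂m < ⊤ := by
    rcases eq_or_ne p ⊤ with rfl | hp'
    · exact (lintegral_enorm_sq_le_of_top h1.1).trans_lt (ENNReal.mul_lt_top h2.2 h1.2)
    · exact (lintegral_enorm_sq_le_of_ne_top hp hp' h1.1).trans_lt
        (ENNReal.add_lt_top.mpr ⟨h1.2, ENNReal.rpow_lt_top_of_nonneg ENNReal.toReal_nonneg h2.2.ne⟩)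
  rw [lintegral_enorm_sq] at h3
  exact (ENNReal.pow_lt_top_iff.mp h3).resolve_right two_ne_zero

lemma memLp_ent (hp : 2 < p) (q : Potential n p) (i j : Fin n) : MemLp (q.ent i j) 2 halfLine :=
  memLp_two_of_mem hp ((Lp.memLp (q.1 i j).1).ae_eq (q.ent_ae_one i j).symm)
    ((Lp.memLp (q.1 i j).2).ae_eq ((q.ent_ae_one i j).trans (q.2.1 i j)).symm)

lemma memLp_diff (hp : 2 < p) (q q' : Potential n p) (i j : Fin n) :
    MemLp (q.diff q' i j) 2 halfLine := (memLp_ent hp q i j).sub (memLp_ent hp q' i j)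

end Potential

section PotentialOperators

variable {p : ℝ≥0∞} [Fact (1 ≤ p)]

lemma double_sum_sub_smul {E : Type*} [AddCommGroup E] [Module ℂ E] (u v : Fin n → Fin n → ℂ)
    (X : Fin n → Fin n → E) : ∑ i, ∑ j, (u i j - v i j) • X i j =
      ∑ i, ∑ j, u i j • X i j - ∑ i, ∑ j, v i j • X i j := by
  simp only [sub_smul, Finset.sum_sub_distrib]

lemma potOp_diff (q q' : Potential n p) (t : ℝ) :
    potOp (q.diff q') t = potOp q.ent t - potOp q'.ent t :=
  double_sum_sub_smul (fun i j => q.ent i j t) (fun i j => q'.ent i j t) _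

lemma tendsto_integral_potOp_diff (q₀ : Potential n p) :
    Tendsto (fun q : Potential n p => ∫ t in Ioi 0, ‖potOp (q.diff q₀) t‖) (𝓝 q₀) (𝓝 0) := by
  obtain ⟨C, hC, h⟩ := exists_norm_potOp_le n
  have hlim : Tendsto (fun q : Potential n p =>
      C * ∑ i, ∑ j, ∫ t in Ioi 0, ‖q.diff q₀ i j t‖) (𝓝 q₀) (𝓝 0) := by
    have := (tendsto_finsetSum Finset.univ fun i _ => tendsto_finsetSum Finset.univ fun j _ =>
      q₀.tendsto_integral_diff i j).const_mul C
    simpa using this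
  refine squeeze_zero (fun q => integral_nonneg fun t => norm_nonneg _) (fun q => ?_) hlim
  have hi : ∀ i j, IntegrableOn (fun t => ‖q.diff q₀ i j t‖) (Ioi 0) := fun i j =>
    (q.integrableOn_diff q₀ i j).norm
  have hi2 : IntegrableOn (fun t => ∑ i, ∑ j, ‖q.diff q₀ i j t‖) (Ioi 0) :=
    integrable_finsetSum _ fun i _ => integrable_finsetSum _ fun j _ => hi i j
  refine (integral_mono (integrableOn_potOp (q.integrableOn_diff q₀)).norm (hi2.const_mul C)
    fun t => h _ t).trans (le_of_eq ?_)
  rw [integral_const_mul, integral_finsetSum _ fun i _ => integrable_finsetSum _ fun j _ => hi i j]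
  congr 1
  exact sum_congr rfl fun i _ => integral_finsetSum _ fun j _ => hi i j

lemma eventually_integral_potOp_le (q₀ : Potential n p) : ∀ᶠ q : Potential n p in 𝓝 q₀,
      ∫ t in Ioi 0, ‖potOp q.ent t‖ ≤ (∫ t in Ioi 0, ‖potOp q₀.ent t‖) + 1 := by
  filter_upwards [(tendsto_integral_potOp_diff q₀).eventually (gt_mem_nhds one_pos)] with q hq
  have h0 := (integrableOn_potOp q₀.integrableOn_ent).norm
  have h1 := (integrableOn_potOp (q.integrableOn_diff q₀)).norm
  have h2 := (integrableOn_potOp q.integrableOn_ent).norm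
  have h3 : ∫ t in Ioi 0, ‖potOp q.ent t‖ ≤
      ∫ t in Ioi 0, (‖potOp q₀.ent t‖ + ‖potOp (q.diff q₀) t‖) := by
    refine integral_mono h2 (h0.add h1) fun t => ?_
    have : potOp q.ent t = potOp q₀.ent t + potOp (q.diff q₀) t := by rw [potOp_diff]; abel
    rw [this]
    exact norm_add_le _ _
  rw [integral_add h0 h1] at h3
  linarith

end PotentialOperators

/-! ### Families of functions that depend on the potential -/

namespace Setup

section Families

variable {S : Setup n} {p : ℝ≥0∞} [Fact (1 ≤ p)]
  {E F G : Type*} [NormedAddCommGroup E] [NormedAddCommGroup F] [NormedAddCommGroup G]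

/-- The points of the ray through `z`. -/
def rayPt {z : ℂ} (hz : z ∈ S.D) (r : ℝ) : S.D :=
  ⟨z * ((r.toNNReal : ℝ≥0) : ℝ), mul_mem_D hz r.toNNReal.coe_nonneg⟩

lemma continuous_rayPt {z : ℂ} (hz : z ∈ S.D) : Continuous (rayPt hz) := by
  unfold rayPt
  fun_prop

lemma norm_rayPt {z : ℂ} (hz : z ∈ S.D) {r : ℝ} (hr : 0 ≤ r) : ‖(rayPt hz r : ℂ)‖ = ‖z‖ * r := by
  simp only [rayPt]
  rw [norm_mul, norm_real, norm_of_nonneg r.toNNReal.coe_nonneg, coe_toNNReal r hr]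

lemma rayPt_eq {z : ℂ} (hz : z ∈ S.D) {r : ℝ} (hr : 0 ≤ r) : (rayPt hz r : ℂ) = r * z := by
  simp only [rayPt]
  rw [coe_toNNReal r hr, mul_comm]

/-- Bounded continuous functions of `(x, ρ)` that depend continuously on the potential. -/
structure IsReg (u : Potential n p → ℝ≥0 → S.D → E) : Prop where
  cont : ∀ q, Continuous fun y : ℝ≥0 × S.D => u q y.1 y.2
  bdd : ∀ q, ∃ M, ∀ x ρ, ‖u q x ρ‖ ≤ M
  qcont : ∀ q₀, ∀ ε > 0, ∀ᶠ q in 𝓝 q₀, ∀ x ρ, ‖u q x ρ - u q₀ x ρ‖ ≤ ε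

/-- Families that vanish as `ρ → ∞`, uniformly in `x`, and whose squares are integrable on rays,
uniformly in `x` and locally uniformly in the potential. -/
structure IsGood (u : Potential n p → ℝ≥0 → S.D → E) : Prop extends IsReg u where
  decay : ∀ q, ∀ ε > 0, ∃ R : ℝ, ∀ x (ρ : S.D), R ≤ ‖(ρ : ℂ)‖ → ‖u q x ρ‖ ≤ ε
  tail : ∀ z (hz : z ∈ S.D), z ≠ 0 → ∀ q₀, ∀ ε : ℝ, 0 < ε → ∃ R : ℝ, 0 ≤ R ∧ ∀ᶠ q in 𝓝 q₀, ∀ x,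
    ∫⁻ r in Ioi R, ‖u q x (rayPt hz r)‖ₑ ^ 2 ≤ ofReal ε

variable {u u' : Potential n p → ℝ≥0 → S.D → E} {w : Potential n p → ℝ≥0 → S.D → F}

lemma IsReg.eventually_bdd (hu : IsReg u) (q₀ : Potential n p) :
    ∃ M, 0 ≤ M ∧ ∀ᶠ q in 𝓝 q₀, ∀ x ρ, ‖u q x ρ‖ ≤ M := by
  obtain ⟨M, hM⟩ := hu.bdd q₀
  refine ⟨|M| + 1, by positivity, (hu.qcont q₀ 1 one_pos).mono fun q hq x ρ => ?_⟩
  have h1 : u q x ρ = u q₀ x ρ + (u q x ρ - u q₀ x ρ) := by abel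
  rw [h1]
  exact (norm_add_le _ _).trans (add_le_add ((hM x ρ).trans (le_abs_self M)) (hq x ρ))

lemma IsReg.bilin [NormedSpace ℂ E] [NormedSpace ℂ F] [NormedSpace ℂ G]
    (L : E →L[ℂ] F →L[ℂ] G) (hu : IsReg u) (hw : IsReg w) :
    IsReg fun q x ρ => L (u q x ρ) (w q x ρ) where
  cont q := by
    have h1 : Continuous fun y : ℝ≥0 × S.D => L (u q y.1 y.2) := L.continuous.comp (hu.cont q)
    exact h1.clm_apply (hw.cont q)
  bdd q := by
    obtain ⟨M, hM⟩ := hu.bdd q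
    obtain ⟨N, hN⟩ := hw.bdd q
    exact ⟨_, fun x ρ => L.le_of_opNorm₂_le_of_le le_rfl (hM x ρ) (hN x ρ)⟩
  qcont q₀ ε hε := by
    obtain ⟨M, hM0, hM⟩ := hu.eventually_bdd q₀
    obtain ⟨N, hN⟩ := hw.bdd q₀
    have hδ : 0 < ε / ((‖L‖ + 1) * (M + |N| + 1)) := by positivity
    filter_upwards [hM, hu.qcont q₀ _ hδ, hw.qcont q₀ _ hδ] with q h1 h2 h3 x ρ
    set δ := ε / ((‖L‖ + 1) * (M + |N| + 1)) with hδe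
    have e : L (u q x ρ) (w q x ρ) - L (u q₀ x ρ) (w q₀ x ρ) =
        L (u q x ρ) (w q x ρ - w q₀ x ρ) + L (u q x ρ - u q₀ x ρ) (w q₀ x ρ) := by
      simp only [map_sub, sub_apply]; abel
    rw [e]
    have b1 := L.le_of_opNorm₂_le_of_le (le_add_of_nonneg_right zero_le_one) (h1 x ρ) (h3 x ρ)
    have b2 := L.le_of_opNorm₂_le_of_le (le_add_of_nonneg_right zero_le_one) (h2 x ρ)
      ((hN x ρ).trans (le_abs_self N))
    refine (norm_add_le _ _).trans ((add_le_add b1 b2).trans ?_)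
    have e2 : (‖L‖ + 1) * (M + |N| + 1) * δ = ε := by rw [hδe]; field_simp
    have : 0 ≤ (‖L‖ + 1) * δ := by positivity
    linarith

lemma IsReg.clm [NormedSpace ℂ E] [NormedSpace ℂ G] (L : E →L[ℂ] G) (hu : IsReg u) : IsReg
    fun q x ρ => L (u q x ρ) where
  cont q := L.continuous.comp (hu.cont q)
  bdd q := by
    obtain ⟨M, hM⟩ := hu.bdd q
    exact ⟨_, fun x ρ => L.le_opNorm_of_le (hM x ρ)⟩
  qcont q₀ ε hε := by
    have hδ : 0 < ε / (‖L‖ + 1) := by positivity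
    filter_upwards [hu.qcont q₀ _ hδ] with q hq x ρ
    rw [← map_sub]
    refine (L.le_of_opNorm_le_of_le (le_add_of_nonneg_right zero_le_one) (hq x ρ)).trans
      (le_of_eq ?_)
    field_simp

lemma IsReg.add (hu : IsReg u) (hu' : IsReg u') : IsReg fun q x ρ => u q x ρ + u' q x ρ where
  cont q := (hu.cont q).add (hu'.cont q)
  bdd q := by
    obtain ⟨M, hM⟩ := hu.bdd q
    obtain ⟨N, hN⟩ := hu'.bdd q
    exact ⟨M + N, fun x ρ => norm_add_le_of_le (hM x ρ) (hN x ρ)⟩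
  qcont q₀ ε hε := by
    filter_upwards [hu.qcont q₀ _ (half_pos hε), hu'.qcont q₀ _ (half_pos hε)] with q h1 h2 x ρ
    rw [add_sub_add_comm]
    exact (norm_add_le_of_le (h1 x ρ) (h2 x ρ)).trans (by linarith)

/-- Functions that do not depend on the potential. -/
lemma isReg_of_continuous {f : ℝ≥0 → S.D → E} (hf : Continuous fun y : ℝ≥0 × S.D => f y.1 y.2)
    {M : ℝ} (hM : ∀ x ρ, ‖f x ρ‖ ≤ M) : IsReg fun (_ : Potential n p) x ρ => f x ρ where
  cont _ := hf
  bdd _ := ⟨M, hM⟩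
  qcont _ ε hε := .of_forall fun _ x ρ => by simpa using hε.le

lemma enorm_sq_le_of_norm_le {a b : ℝ} {x : E} {y : F}
    (h : ‖x‖ ≤ a * ‖y‖) (hab : a ^ 2 ≤ b) : ‖x‖ₑ ^ 2 ≤ ofReal b * ‖y‖ₑ ^ 2 := by
  rw [← ofReal_norm, ← ofReal_norm, ← ofReal_pow (norm_nonneg _),
    ← ofReal_pow (norm_nonneg _), ← ofReal_mul ((sq_nonneg a).trans hab)]
  refine ofReal_le_ofReal ?_
  calc ‖x‖ ^ 2 ≤ (a * ‖y‖) ^ 2 := by gcongr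
    _ = a ^ 2 * ‖y‖ ^ 2 := by ring
    _ ≤ _ := by gcongr

/-- A family dominated by a good one is good. -/
lemma IsGood.of_le (hu : IsGood u) (hw : IsReg w)
    (h : ∀ q₀, ∃ C, 0 ≤ C ∧ ∀ᶠ q in 𝓝 q₀, ∀ x ρ, ‖w q x ρ‖ ≤ C * ‖u q x ρ‖) : IsGood w where
  toIsReg := hw
  decay q ε hε := by
    obtain ⟨C, hC, h1⟩ := h q
    obtain ⟨R, hR⟩ := hu.decay q (ε / (C + 1)) (by positivity)
    refine ⟨R, fun x ρ hρ => (h1.self_of_nhds x ρ).trans ?_⟩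
    calc C * ‖u q x ρ‖ ≤ (C + 1) * (ε / (C + 1)) :=
          mul_le_mul (by linarith) (hR x ρ hρ) (norm_nonneg _) (by positivity)
      _ = ε := by field_simp
  tail z hz h0 q₀ ε hε := by
    obtain ⟨C, hC, h1⟩ := h q₀
    obtain ⟨R, hR0, hR⟩ := hu.tail z hz h0 q₀ (ε / (C ^ 2 + 1)) (by positivity)
    refine ⟨R, hR0, ?_⟩
    filter_upwards [h1, hR] with q h2 h3 x
    calc ∫⁻ r in Ioi R, ‖w q x (rayPt hz r)‖ₑ ^ 2
        ≤ ∫⁻ r in Ioi R, ofReal (C ^ 2 + 1) * ‖u q x (rayPt hz r)‖ₑ ^ 2 :=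
          lintegral_mono fun r => enorm_sq_le_of_norm_le (h2 x _) (by linarith)
      _ = ofReal (C ^ 2 + 1) * ∫⁻ r in Ioi R, ‖u q x (rayPt hz r)‖ₑ ^ 2 :=
          lintegral_const_mul' _ _ ofReal_ne_top
      _ ≤ ofReal (C ^ 2 + 1) * ofReal (ε / (C ^ 2 + 1)) := by
          gcongr; exact h3 x
      _ = ofReal ε := by
          rw [← ofReal_mul (by positivity)]
          congr 1
          field_simp

lemma IsGood.bilin [NormedSpace ℂ E] [NormedSpace ℂ F] [NormedSpace ℂ G]
    (L : E →L[ℂ] F →L[ℂ] G) (hu : IsGood u) (hw : IsReg w) :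
    IsGood fun q x ρ => L (u q x ρ) (w q x ρ) := by
  refine hu.of_le (hu.toIsReg.bilin L hw) fun q₀ => ?_
  obtain ⟨M, hM0, hM⟩ := hw.eventually_bdd q₀
  refine ⟨‖L‖ * M, by positivity, hM.mono fun q hq x ρ => ?_⟩
  refine (L.le_of_opNorm₂_le_of_le le_rfl le_rfl (hq x ρ)).trans (le_of_eq ?_)
  ring

lemma IsGood.bilin_right [NormedSpace ℂ E] [NormedSpace ℂ F] [NormedSpace ℂ G]
    (L : F →L[ℂ] E →L[ℂ] G) (hw : IsReg w) (hu : IsGood u) :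
    IsGood fun q x ρ => L (w q x ρ) (u q x ρ) := hu.bilin L.flip hw

lemma IsGood.clm [NormedSpace ℂ E] [NormedSpace ℂ G] (L : E →L[ℂ] G) (hu : IsGood u) : IsGood
    fun q x ρ => L (u q x ρ) :=
  hu.of_le (hu.toIsReg.clm L) fun _ =>
    ⟨‖L‖, norm_nonneg _, .of_forall fun _ _ _ => L.le_opNorm _⟩

lemma measurable_ray (hu : IsReg u) {z : ℂ} (hz : z ∈ S.D) (q : Potential n p) (x : ℝ≥0) :
    Measurable fun r => ‖u q x (rayPt hz r)‖ₑ ^ 2 := by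
  have h1 : Continuous fun r : ℝ => u q x (rayPt hz r) :=
    (hu.cont q).comp (continuous_const.prodMk (continuous_rayPt hz))
  exact (h1.enorm.measurable).pow_const 2

lemma lintegral_enorm_add_sq_le {f g : ℝ → E} (hf : Measurable fun r => ‖f r‖ₑ ^ 2) (s : Set ℝ) :
    ∫⁻ r in s, ‖f r + g r‖ₑ ^ 2 ≤ 2 * (∫⁻ r in s, ‖f r‖ₑ ^ 2) + 2 * ∫⁻ r in s, ‖g r‖ₑ ^ 2 := by
  rw [← lintegral_const_mul' 2 _ (by simp), ← lintegral_const_mul' 2 _ (by simp),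
    ← lintegral_add_left (hf.const_mul 2)]
  exact lintegral_mono fun r => enorm_add_sq_le _ _

lemma IsGood.add (hu : IsGood u) (hu' : IsGood u') : IsGood fun q x ρ => u q x ρ + u' q x ρ where
  toIsReg := hu.toIsReg.add hu'.toIsReg
  decay q ε hε := by
    obtain ⟨R, hR⟩ := hu.decay q _ (half_pos hε)
    obtain ⟨R', hR'⟩ := hu'.decay q _ (half_pos hε)
    refine ⟨max R R', fun x ρ hρ => ?_⟩
    exact (norm_add_le_of_le (hR x ρ ((le_max_left _ _).trans hρ))
      (hR' x ρ ((le_max_right _ _).trans hρ))).trans (by linarith)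
  tail z hz h0 q₀ ε hε := by
    obtain ⟨R, hR0, hR⟩ := hu.tail z hz h0 q₀ (ε / 4) (by positivity)
    obtain ⟨R', hR0', hR'⟩ := hu'.tail z hz h0 q₀ (ε / 4) (by positivity)
    refine ⟨max R R', hR0.trans (le_max_left _ _), ?_⟩
    filter_upwards [hR, hR'] with q h1 h2 x
    refine (lintegral_enorm_add_sq_le (measurable_ray hu.toIsReg hz q x) _).trans ?_
    have h3 : ∫⁻ r in Ioi (max R R'), ‖u q x (rayPt hz r)‖ₑ ^ 2 ≤ ofReal (ε / 4) :=
      (lintegral_mono_set (Ioi_subset_Ioi (le_max_left _ _))).trans (h1 x)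
    have h4 : ∫⁻ r in Ioi (max R R'), ‖u' q x (rayPt hz r)‖ₑ ^ 2 ≤ ofReal (ε / 4) :=
      (lintegral_mono_set (Ioi_subset_Ioi (le_max_right _ _))).trans (h2 x)
    calc _ ≤ 2 * ofReal (ε / 4) + 2 * ofReal (ε / 4) := by gcongr
      _ = ofReal ε := by
        have h5 : (2 : ℝ≥0∞) = ofReal 2 := by simp
        rw [h5, ← ofReal_mul (by norm_num), ← ofReal_add (by positivity) (by positivity)]
        congr 1
        ring

lemma isGood_zero : IsGood fun (_ : Potential n p) (_ : ℝ≥0) (_ : S.D) => (0 : E) where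
  cont _ := continuous_const
  bdd _ := ⟨0, fun _ _ => by simp⟩
  qcont _ ε hε := .of_forall fun _ _ _ => by simpa using hε.le
  decay _ ε hε := ⟨0, fun _ _ _ => by simpa using hε.le⟩
  tail _ _ _ _ _ _ := ⟨0, le_rfl, .of_forall fun _ _ => by simp⟩

lemma IsGood.sum {ι : Type*} (s : Finset ι) {u : ι → Potential n p → ℝ≥0 → S.D → E}
    (h : ∀ i ∈ s, IsGood (u i)) : IsGood fun q x ρ => ∑ i ∈ s, u i q x ρ := by
  classical
  induction s using Finset.induction_on with
  | empty => simpa using isGood_zero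
  | insert a s ha ih =>
    simp only [Finset.sum_insert ha]
    exact (h a (Finset.mem_insert_self a s)).add (ih fun i hi => h i (Finset.mem_insert_of_mem hi))

/-- By the uniform decay, a good family is continuous in `x` uniformly in `ρ`. -/
lemma IsGood.continuous_x (hu : IsGood u) (q : Potential n p) (x₀ : ℝ≥0) {ε : ℝ} (hε : 0 < ε) :
    ∀ᶠ x in 𝓝 x₀, ∀ ρ, ‖u q x ρ - u q x₀ ρ‖ ≤ ε := by
  obtain ⟨R, hR⟩ := hu.decay q _ (half_pos hε)
  have hK : IsCompact {ρ : S.D | ‖(ρ : ℂ)‖ ≤ R} := by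
    have h1 : IsClosed (S.D : Set ℂ) := isClosed_closure
    have h2 := h1.isClosedEmbedding_subtypeVal.isCompact_preimage (isCompact_closedBall (0 : ℂ) R)
    convert h2 using 1
    ext ρ
    simp
  have ho : IsOpen {y : ℝ≥0 × S.D | ‖u q y.1 y.2 - u q x₀ y.2‖ < ε} := by
    refine isOpen_lt (Continuous.norm ?_) continuous_const
    exact (hu.cont q).sub ((hu.cont q).comp (continuous_const.prodMk continuous_snd))
  obtain ⟨U, V, hU, -, hxU, hKV, hUV⟩ := generalized_tube_lemma (isCompact_singleton (x := x₀)) hK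
    ho
    (by
      rintro ⟨x, ρ⟩ ⟨rfl, -⟩
      simpa using hε)
  filter_upwards [hU.mem_nhds (hxU rfl)] with x hx ρ
  rcases le_total ‖(ρ : ℂ)‖ R with h | h
  · exact le_of_lt (hUV (mk_mem_prod hx (hKV h)))
  · exact (norm_sub_le_of_le (hR x ρ h) (hR x₀ ρ h)).trans (by linarith)

lemma lintegral_ray_le {f : S.D → E} {z : ℂ} (hz : z ∈ S.D) {δ R : ℝ} (hδ : ∀ ρ, ‖f ρ‖ ≤ δ)
    (hR0 : 0 ≤ R) {η : ℝ≥0∞} (hη : ∫⁻ r in Ioi R, ‖f (rayPt hz r)‖ₑ ^ 2 ≤ η) :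
    ∫⁻ r in Ioi 0, ‖f (rayPt hz r)‖ₑ ^ 2 ≤ ofReal (R * δ ^ 2) + η := by
  have hδ0 : 0 ≤ δ := (norm_nonneg _).trans (hδ (rayPt hz 0))
  rw [← Ioc_union_Ioi_eq_Ioi hR0]
  refine (lintegral_union_le _ _ _).trans (add_le_add ?_ hη)
  calc ∫⁻ r in Ioc 0 R, ‖f (rayPt hz r)‖ₑ ^ 2 ≤ ∫⁻ _ in Ioc 0 R, ofReal (δ ^ 2) := by
        refine lintegral_mono fun r => ?_
        rw [← ofReal_norm, ← ofReal_pow (norm_nonneg _)]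
        exact ofReal_le_ofReal (pow_le_pow_left₀ (norm_nonneg _) (hδ _) 2)
    _ = ofReal (R * δ ^ 2) := by
        rw [setLIntegral_const, Real.volume_Ioc, sub_zero, mul_comm, ofReal_mul hR0]

lemma exists_mul_sq_le {R ε : ℝ} (hR : 0 ≤ R) (hε : 0 < ε) : ∃ δ > 0, R * δ ^ 2 ≤ ε := by
  refine ⟨Real.sqrt (ε / (R + 1)), Real.sqrt_pos.mpr (by positivity), ?_⟩
  rw [Real.sq_sqrt (by positivity), mul_div_assoc', div_le_iff₀ (by positivity)]
  nlinarith

lemma IsGood.exists_lintegral_ray_le (hu : IsGood u) {z : ℂ} (hz : z ∈ S.D) (h0 : z ≠ 0)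
    (q : Potential n p) : ∃ N : ℝ, ∀ x, ∫⁻ r in Ioi 0, ‖u q x (rayPt hz r)‖ₑ ^ 2 ≤ ofReal N := by
  obtain ⟨R, hR0, hR⟩ := hu.tail z hz h0 q 1 one_pos
  obtain ⟨M, hM⟩ := hu.bdd q
  refine ⟨R * M ^ 2 + 1, fun x => ?_⟩
  rw [ofReal_add (by positivity) zero_le_one]
  exact lintegral_ray_le hz (hM x) hR0 (hR.self_of_nhds x)

lemma ofReal_quarter {ε : ℝ} (hε : 0 < ε) : 2 * ofReal (ε / 8) + 2 * ofReal (ε / 8) =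
    ofReal (ε / 2) := by
  have h5 : (2 : ℝ≥0∞) = ofReal 2 := by simp
  rw [h5, ← ofReal_mul (by norm_num), ← ofReal_add (by positivity) (by positivity)]
  congr 1
  ring

lemma lintegral_ray_sub_le {f g : S.D → E} {z : ℂ} (hz : z ∈ S.D) {δ R ε : ℝ} (hε : 0 < ε)
    (hf : Measurable fun r => ‖f (rayPt hz r)‖ₑ ^ 2)
    (hδ : ∀ ρ, ‖f ρ - g ρ‖ ≤ δ) (hR0 : 0 ≤ R) (hRδ : R * δ ^ 2 ≤ ε / 2)
    (h1 : ∫⁻ r in Ioi R, ‖f (rayPt hz r)‖ₑ ^ 2 ≤ ofReal (ε / 8))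
    (h2 : ∫⁻ r in Ioi R, ‖g (rayPt hz r)‖ₑ ^ 2 ≤ ofReal (ε / 8)) :
    ∫⁻ r in Ioi 0, ‖f (rayPt hz r) - g (rayPt hz r)‖ₑ ^ 2 ≤ ofReal ε := by
  have h3 : ∫⁻ r in Ioi R, ‖f (rayPt hz r) - g (rayPt hz r)‖ₑ ^ 2 ≤ ofReal (ε / 2) := by
    rw [← ofReal_quarter hε]
    simp only [sub_eq_add_neg]
    refine (lintegral_enorm_add_sq_le hf _).trans ?_
    simp only [enorm_neg]
    gcongr
  refine (lintegral_ray_le (f := fun ρ => f ρ - g ρ) hz hδ hR0 h3).trans ?_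
  rw [← ofReal_add (by positivity) (by positivity)]
  exact ofReal_le_ofReal (by linarith)

/-- A good family is continuous in `x` with values in the square integrable functions on rays. -/
lemma IsGood.eventually_ray_x (hu : IsGood u) {z : ℂ} (hz : z ∈ S.D) (h0 : z ≠ 0)
    (q : Potential n p) (x₀ : ℝ≥0) {ε : ℝ} (hε : 0 < ε) : ∀ᶠ x in 𝓝 x₀,
      ∫⁻ r in Ioi 0, ‖u q x (rayPt hz r) - u q x₀ (rayPt hz r)‖ₑ ^ 2 ≤ ofReal ε := by
  obtain ⟨R, hR0, hR⟩ := hu.tail z hz h0 q (ε / 8) (by positivity)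
  obtain ⟨δ, hδ, hRδ⟩ := exists_mul_sq_le hR0 (half_pos hε)
  filter_upwards [hu.continuous_x q x₀ hδ] with x hx
  exact lintegral_ray_sub_le hz hε (measurable_ray hu.toIsReg hz q x) hx hR0 hRδ
    (hR.self_of_nhds x) (hR.self_of_nhds x₀)

/-- A good family is continuous in the potential, uniformly in `x`, with values in the square
integrable functions on rays. -/
lemma IsGood.eventually_ray_q (hu : IsGood u) {z : ℂ} (hz : z ∈ S.D) (h0 : z ≠ 0)
    (q₀ : Potential n p) {ε : ℝ} (hε : 0 < ε) : ∀ᶠ q in 𝓝 q₀, ∀ x,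
      ∫⁻ r in Ioi 0, ‖u q x (rayPt hz r) - u q₀ x (rayPt hz r)‖ₑ ^ 2 ≤ ofReal ε := by
  obtain ⟨R, hR0, hR⟩ := hu.tail z hz h0 q₀ (ε / 8) (by positivity)
  obtain ⟨δ, hδ, hRδ⟩ := exists_mul_sq_le hR0 (half_pos hε)
  filter_upwards [hR, hu.qcont q₀ δ hδ] with q h1 h2 x
  exact lintegral_ray_sub_le hz hε (measurable_ray hu.toIsReg hz q x) (h2 x) hR0 hRδ
    (h1 x) (hR.self_of_nhds x)

end Families

end Setup

/-! ### Good families belong to the function spaces -/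

namespace Setup

section Spaces

variable {S : Setup n} {p : ℝ≥0∞} [Fact (1 ≤ p)] {u : Potential n p → ℝ≥0 → S.D → ℂ}

lemma tendsto_cocompact_sector {f : S.D → ℂ}
    (h : ∀ ε > 0, ∃ R : ℝ, ∀ ρ : S.D, R ≤ ‖(ρ : ℂ)‖ → ‖f ρ‖ ≤ ε) :
    Tendsto f (cocompact S.D) (𝓝 0) := by
  have h1 : IsClosed (S.D : Set ℂ) := isClosed_closure
  have h2 : Tendsto (fun ρ : S.D => ‖(ρ : ℂ)‖) (cocompact S.D) atTop :=
    (tendsto_norm_cocompact_atTop).comp h1.isClosedEmbedding_subtypeVal.tendsto_cocompact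
  rw [Metric.tendsto_nhds]
  intro ε hε
  obtain ⟨R, hR⟩ := h _ (half_pos hε)
  filter_upwards [h2.eventually_ge_atTop R] with ρ hρ
  rw [dist_zero_right]
  exact (hR ρ hρ).trans_lt (half_lt_self hε)

/-- The values of a good family as functions on the sector. -/
def IsGood.sectorFun (hu : IsGood u) (q : Potential n p) (x : ℝ≥0) : C₀(S.D, ℂ) where
  toFun := u q x
  continuous_toFun := (hu.cont q).comp (continuous_const.prodMk continuous_id)
  zero_at_infty' := tendsto_cocompact_sector fun ε hε => by
    obtain ⟨R, hR⟩ := hu.decay q ε hε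
    exact ⟨R, fun ρ hρ => hR x ρ hρ⟩

lemma dist_zeroAtInfty_le {X : Type*} [TopologicalSpace X] {f g : C₀(X, ℂ)} {ε : ℝ} (hε : 0 ≤ ε)
    (h : ∀ y, ‖f y - g y‖ ≤ ε) : dist f g ≤ ε := by
  rw [← ZeroAtInftyContinuousMap.dist_toBCF_eq_dist]
  refine (BoundedContinuousFunction.dist_le hε).mpr fun y => ?_
  rw [dist_eq_norm]
  exact h y

/-- A bounded continuous function of `x`, from uniform estimates. -/
lemma continuous_of_dist {X Y : Type*} [TopologicalSpace X] [PseudoMetricSpace Y] {f : X → Y}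
    (h : ∀ x₀, ∀ ε > 0, ∀ᶠ x in 𝓝 x₀, dist (f x) (f x₀) ≤ ε) : Continuous f := by
  refine continuous_iff_continuousAt.mpr fun x₀ => Metric.tendsto_nhds.mpr fun ε hε => ?_
  exact (h x₀ _ (half_pos hε)).mono fun x hx => hx.trans_lt (half_lt_self hε)

/-- Continuous functions with values in the bounded continuous functions. -/
lemma exists_continuousMap_bcf {Y : Type*} [PseudoMetricSpace Y] (f : Potential n p → ℝ≥0 → Y)
    (hx : ∀ q x₀, ∀ ε > 0, ∀ᶠ x in 𝓝 x₀, dist (f q x) (f q x₀) ≤ ε)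
    (hb : ∀ q, ∃ C, ∀ x y, dist (f q x) (f q y) ≤ C)
    (hq : ∀ q₀, ∀ ε > 0, ∀ᶠ q in 𝓝 q₀, ∀ x, dist (f q x) (f q₀ x) ≤ ε) :
    ∃ D : C(Potential n p, ℝ≥0 →ᵇ Y), ∀ q x, D q x = f q x := by
  let g : Potential n p → ℝ≥0 →ᵇ Y := fun q =>
    ⟨⟨f q, continuous_of_dist (hx q)⟩, hb q⟩
  refine ⟨⟨g, continuous_of_dist fun q₀ ε hε => (hq q₀ ε hε).mono fun q h => ?_⟩, fun q x => rfl⟩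
  exact (BoundedContinuousFunction.dist_le hε.le).mpr h

lemma IsGood.exists_sectorClass (hu : IsGood u) :
    ∃ d : SectorClass n p S.ω S.h, ∀ q x ρ, d q x ρ = u q x ρ := by
  obtain ⟨d, hd⟩ := exists_continuousMap_bcf hu.sectorFun
    (fun q x₀ ε hε => (hu.continuous_x q x₀ hε).mono fun x hx => dist_zeroAtInfty_le hε.le hx)
    (fun q => by
      obtain ⟨M, hM⟩ := hu.bdd q
      refine ⟨|M| + |M|, fun x y => dist_zeroAtInfty_le (by positivity) fun ρ => ?_⟩
      exact norm_sub_le_of_le ((hM x ρ).trans (le_abs_self M)) ((hM y ρ).trans (le_abs_self M)))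
    (fun q₀ ε hε => (hu.qcont q₀ ε hε).mono fun q hq x => dist_zeroAtInfty_le hε.le (hq x))
  exact ⟨d, fun q x ρ => by rw [hd]; rfl⟩

variable {z : ℂ}

lemma mem_D_of_ray (hz : z ∈ S.D) {ρ : ℂ} (h : ρ ∈ ray z) : ρ ∈ S.D := by
  obtain ⟨t, rfl⟩ := h
  exact mul_mem_D hz t.coe_nonneg

/-- The values of a good family as functions on a ray. -/
def IsGood.rayFun (hu : IsGood u) (hz : z ∈ S.D) (h0 : z ≠ 0) (q : Potential n p) (x : ℝ≥0) :
    C₀(ray z, ℂ) where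
  toFun ρ := u q x ⟨ρ, mem_D_of_ray hz ρ.2⟩
  continuous_toFun := (hu.cont q).comp (continuous_const.prodMk (by fun_prop))
  zero_at_infty' := by
    rw [Metric.tendsto_nhds]
    intro ε hε
    obtain ⟨R, hR⟩ := hu.decay q _ (half_pos hε)
    rw [Filter.Eventually, mem_cocompact]
    have hc : Continuous fun t : ℝ =>
      (⟨z * ((t.toNNReal : ℝ≥0) : ℝ), t.toNNReal, rfl⟩ : ray z) := by
      fun_prop
    refine ⟨_, (isCompact_Icc (a := (0 : ℝ)) (b := R / ‖z‖)).image hc, fun ρ hρ => ?_⟩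
    rw [mem_ofPred_eq, dist_zero_right]
    refine (hR x _ ?_).trans_lt (half_lt_self hε)
    by_contra hlt
    refine hρ ?_
    obtain ⟨ρ, t, rfl⟩ := ρ
    refine ⟨t, ⟨t.coe_nonneg, ?_⟩, ?_⟩
    · rw [le_div_iff₀ (norm_pos_iff.mpr h0)]
      simp only [not_le, norm_mul, norm_real, norm_of_nonneg t.coe_nonneg] at hlt
      linarith
    · simp

lemma lintegral_rayMeasure (hz : z ∈ S.D) {f : S.D → ℂ} (hf : Continuous f) :
    ∫⁻ ρ, ‖f ⟨ρ, mem_D_of_ray hz ρ.2⟩‖ₑ ^ 2 ∂(rayMeasure z) =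
      ofReal ‖z‖ * ∫⁻ r in Ioi 0, ‖f (rayPt hz r)‖ₑ ^ 2 := by
  have hc : Continuous fun t : ℝ => (⟨z * ((t.toNNReal : ℝ≥0) : ℝ), t.toNNReal, rfl⟩ : ray z) := by
    fun_prop
  have hm : Continuous fun ρ : ray z => f ⟨ρ, mem_D_of_ray hz ρ.2⟩ := by fun_prop
  rw [rayMeasure, lintegral_smul_measure, smul_eq_mul,
    lintegral_map (hm.enorm.measurable.pow_const 2) hc.measurable,
      setLIntegral_congr Ioi_ae_eq_Ici.symm]
  rfl

lemma eLpNorm_le_of_lintegral {α : Type*} [MeasurableSpace α] {m : Measure α} {f : α → ℂ} {ε : ℝ}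
    (h : ∫⁻ a, ‖f a‖ₑ ^ 2 ∂m ≤ ofReal (ε ^ 2)) (hε : 0 ≤ ε) :
    eLpNorm f 2 m ≤ ofReal ε := by
  rw [lintegral_enorm_sq, ofReal_pow hε] at h
  exact (ENNReal.pow_le_pow_left_iff two_ne_zero).mp h

lemma IsGood.continuous_ρ (hu : IsGood u) (q : Potential n p) (x : ℝ≥0) : Continuous (u q x) :=
  (hu.cont q).comp (continuous_const.prodMk continuous_id)

lemma IsGood.memLp_rayFun (hu : IsGood u) (hz : z ∈ S.D) (h0 : z ≠ 0) (q : Potential n p)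
    (x : ℝ≥0) : MemLp (hu.rayFun hz h0 q x) 2 (rayMeasure z) := by
  refine ⟨(hu.rayFun hz h0 q x).continuous.aestronglyMeasurable, ?_⟩
  obtain ⟨N, hN⟩ := hu.exists_lintegral_ray_le hz h0 q
  have h1 : ∫⁻ ρ, ‖hu.rayFun hz h0 q x ρ‖ₑ ^ 2 ∂(rayMeasure z) < ⊤ := by
    have h2 := lintegral_rayMeasure hz (hu.continuous_ρ q x)
    refine (h2.trans_le (mul_le_mul_right (hN x) _)).trans_lt ?_
    exact ENNReal.mul_lt_top ENNReal.ofReal_lt_top ENNReal.ofReal_lt_top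
  rw [lintegral_enorm_sq] at h1
  exact (ENNReal.pow_lt_top_iff.mp h1).resolve_right two_ne_zero

/-- The values of a good family in the space of functions on a ray. -/
def IsGood.raySpace (hu : IsGood u) (hz : z ∈ S.D) (h0 : z ≠ 0) (q : Potential n p) (x : ℝ≥0) :
    RaySpace z :=
  ⟨(hu.rayFun hz h0 q x, (hu.memLp_rayFun hz h0 q x).toLp _),
    (hu.memLp_rayFun hz h0 q x).coeFn_toLp⟩

lemma IsGood.dist_raySpace_le (hu : IsGood u) (hz : z ∈ S.D) (h0 : z ≠ 0) (q q' : Potential n p)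
    (x x' : ℝ≥0) {ε : ℝ} (hε : 0 ≤ ε) (h1 : ∀ ρ, ‖u q x ρ - u q' x' ρ‖ ≤ ε)
    (h2 : ∫⁻ r in Ioi 0, ‖u q x (rayPt hz r) - u q' x' (rayPt hz r)‖ₑ ^ 2 ≤ ofReal (ε ^ 2 / ‖z‖)) :
    dist (hu.raySpace hz h0 q x) (hu.raySpace hz h0 q' x') ≤ ε := by
  rw [Subtype.dist_eq, Prod.dist_eq]
  refine max_le (dist_zeroAtInfty_le hε fun ρ => h1 _) ?_
  rw [← ENNReal.ofReal_le_ofReal_iff hε, ← Lp.edist_dist]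
  change edist ((hu.memLp_rayFun hz h0 q x).toLp _) ((hu.memLp_rayFun hz h0 q' x').toLp _) ≤ _
  rw [Lp.edist_toLp_toLp]
  refine eLpNorm_le_of_lintegral ?_ hε
  have h3 := lintegral_rayMeasure hz ((hu.continuous_ρ q x).sub (hu.continuous_ρ q' x'))
  refine (h3.trans_le (mul_le_mul_right h2 _)).trans (le_of_eq ?_)
  rw [← ofReal_mul (norm_nonneg _)]
  congr 1
  have := norm_ne_zero_iff.mpr h0
  field_simp

/-- A good family defines an element of the function class of the sector, and its restrictions to
rays have the required square integrability. -/
lemma IsGood.exists_class (hu : IsGood u) :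
    ∃ d : SectorClass n p S.ω S.h, (∀ q x ρ, d q x ρ = u q x ρ) ∧
      ∀ z ∈ S.D, z ≠ 0 → RestrictsToRay d z := by
  obtain ⟨d, hd⟩ := hu.exists_sectorClass
  refine ⟨d, hd, fun z hz h0 => ?_⟩
  have hz0 : 0 < ‖z‖ := norm_pos_iff.mpr h0
  obtain ⟨D, hD⟩ := exists_continuousMap_bcf (hu.raySpace hz h0) (fun q x₀ ε hε => by
      filter_upwards [hu.continuous_x q x₀ hε,
        hu.eventually_ray_x hz h0 q x₀ (ε := ε ^ 2 / ‖z‖) (by positivity)] with x h1 h2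
      exact hu.dist_raySpace_le hz h0 q q x x₀ hε.le h1 h2)
    (fun q => by
      obtain ⟨M, hM⟩ := hu.bdd q
      obtain ⟨N, hN⟩ := hu.exists_lintegral_ray_le hz h0 q
      set K := |M| + |M| + 1 + ‖z‖ * (4 * |N|) with hK
      have hK1 : 1 ≤ K := by
        have : 0 ≤ ‖z‖ * (4 * |N|) := by positivity
        have := abs_nonneg M
        linarith
      refine ⟨K, fun x y => hu.dist_raySpace_le hz h0 q q x y (by linarith) (fun ρ => ?_) ?_⟩
      · have : 0 ≤ ‖z‖ * (4 * |N|) := by positivity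
        exact (norm_sub_le_of_le ((hM x ρ).trans (le_abs_self M))
          ((hM y ρ).trans (le_abs_self M))).trans (by linarith)
      · simp only [sub_eq_add_neg]
        refine (lintegral_enorm_add_sq_le (measurable_ray hu.toIsReg hz q x) _).trans ?_
        simp only [enorm_neg]
        have hN' : ∀ x, ∫⁻ r in Ioi 0, ‖u q x (rayPt hz r)‖ₑ ^ 2 ≤ ofReal |N| :=
          fun x => (hN x).trans (ofReal_le_ofReal (le_abs_self N))
        have h5 : (2 : ℝ≥0∞) = ofReal 2 := by simp
        calc _ ≤ 2 * ofReal |N| + 2 * ofReal |N| := by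
              gcongr
              · exact hN' x
              · exact hN' y
          _ = ofReal (4 * |N|) := by
              rw [h5, ← ofReal_mul (by norm_num), ← ofReal_add (by positivity)
                (by positivity)]
              congr 1
              ring
          _ ≤ _ := by
              refine ofReal_le_ofReal ((le_div_iff₀ hz0).mpr ?_)
              have : 4 * |N| * ‖z‖ ≤ K := by
                have := abs_nonneg M
                rw [hK]; linarith
              nlinarith)
    (fun q₀ ε hε => by
      filter_upwards [hu.qcont q₀ ε hε,
        hu.eventually_ray_q hz h0 q₀ (ε := ε ^ 2 / ‖z‖) (by positivity)] with q h1 h2 x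
      exact hu.dist_raySpace_le hz h0 q q₀ x x hε.le (h1 x) (h2 x))
  refine ⟨D, fun q x ρ hl hs => ?_⟩
  rw [hD, hd]
  rfl

end Spaces

end Setup

/-! ### The first-order term is a good family -/

section Tails

variable {p : ℝ≥0∞} [Fact (1 ≤ p)]

/-- Functions on a ray whose squares are integrable at infinity, uniformly in `x` and locally
uniformly in the potential. -/
structure IsTail (f : Potential n p → ℝ≥0 → ℝ → ℝ) : Prop where
  meas : ∀ q x, AEMeasurable (f q x) (volume.restrict (Ioi 0))
  tail : ∀ q₀, ∀ ε : ℝ, 0 < ε → ∃ R : ℝ, 0 ≤ R ∧ ∀ᶠ q in 𝓝 q₀, ∀ x,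
    ∫⁻ r in Ioi R, ‖f q x r‖ₑ ^ 2 ≤ ofReal ε

lemma ofReal_two_mul_add_two_mul {ε : ℝ} (hε : 0 < ε) :
    2 * ofReal (ε / 4) + 2 * ofReal (ε / 4) = ofReal ε := by
  have h5 : (2 : ℝ≥0∞) = ofReal 2 := by simp
  rw [h5, ← ofReal_mul (by norm_num), ← ofReal_add (by positivity) (by positivity)]
  congr 1
  ring

lemma lintegral_sq_le_of_add {f g k : ℝ → ℝ} {s : Set ℝ} (hs : MeasurableSet s)
    (hg : AEMeasurable g (volume.restrict s)) (h : ∀ r ∈ s, ‖f r‖ ≤ ‖g r‖ + ‖k r‖) :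
    ∫⁻ r in s, ‖f r‖ₑ ^ 2 ≤ 2 * (∫⁻ r in s, ‖g r‖ₑ ^ 2) + 2 * ∫⁻ r in s, ‖k r‖ₑ ^ 2 := by
  rw [← lintegral_const_mul' 2 _ (by simp), ← lintegral_const_mul' 2 _ (by simp),
    ← lintegral_add_left' ((hg.enorm.pow_const 2).const_mul 2)]
  refine setLIntegral_mono' hs fun r hr => ?_
  have h1 : ‖f r‖ₑ ≤ ‖‖g r‖ + ‖k r‖‖ₑ := by
    rw [← ofReal_norm, ← ofReal_norm, norm_of_nonneg (by positivity : 0 ≤ ‖g r‖ + ‖k r‖)]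
    exact ofReal_le_ofReal (h r hr)
  have h2 := enorm_add_sq_le ‖g r‖ ‖k r‖
  rw [enorm_norm, enorm_norm] at h2
  exact (pow_le_pow_left' h1 2).trans h2

lemma IsTail.of_split {f : Potential n p → ℝ≥0 → ℝ → ℝ}
    (hm : ∀ q x, AEMeasurable (f q x) (volume.restrict (Ioi 0)))
    (h0 : ∀ q, ∀ ε : ℝ, 0 < ε → ∃ R : ℝ, 0 ≤ R ∧ ∀ x, ∫⁻ r in Ioi R, ‖f q x r‖ₑ ^ 2 ≤ ofReal ε)
    (g : Potential n p → Potential n p → ℝ≥0 → ℝ → ℝ)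
    (hle : ∀ q q₀ x r, 0 < r → ‖f q x r‖ ≤ ‖f q₀ x r‖ + ‖g q q₀ x r‖)
    (B : Potential n p → Potential n p → ℝ≥0∞)
    (hg : ∀ q q₀ x, ∫⁻ r in Ioi 0, ‖g q q₀ x r‖ₑ ^ 2 ≤ B q q₀)
    (hB : ∀ q₀, Tendsto (fun q => B q q₀) (𝓝 q₀) (𝓝 0)) : IsTail f := by
  refine ⟨hm, fun q₀ ε hε => ?_⟩
  obtain ⟨R, hR0, hR⟩ := h0 q₀ (ε / 4) (by positivity)
  refine ⟨R, hR0, ?_⟩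
  have hq : (0 : ℝ≥0∞) < ofReal (ε / 4) := by simpa using hε
  filter_upwards [(hB q₀).eventually (gt_mem_nhds hq)] with q hq x
  refine (lintegral_sq_le_of_add measurableSet_Ioi
    ((hm q₀ x).mono_measure (Measure.restrict_mono (Ioi_subset_Ioi hR0) le_rfl))
    fun r hr => hle q q₀ x r (hR0.trans_lt hr)).trans ?_
  rw [← ofReal_two_mul_add_two_mul hε]
  gcongr
  · exact hR x
  · exact ((lintegral_mono_set (Ioi_subset_Ioi hR0)).trans (hg q q₀ x)).trans hq.le

lemma IsTail.add {f g : Potential n p → ℝ≥0 → ℝ → ℝ} (hf : IsTail f) (hg : IsTail g) :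
    IsTail fun q x r => f q x r + g q x r := by
  refine ⟨fun q x => (hf.meas q x).add (hg.meas q x), fun q₀ ε hε => ?_⟩
  obtain ⟨R, hR0, hR⟩ := hf.tail q₀ (ε / 4) (by positivity)
  obtain ⟨R', hR0', hR'⟩ := hg.tail q₀ (ε / 4) (by positivity)
  have hm : 0 ≤ max R R' := hR0.trans (le_max_left _ _)
  refine ⟨max R R', hm, ?_⟩
  filter_upwards [hR, hR'] with q h1 h2 x
  refine (lintegral_sq_le_of_add measurableSet_Ioi
    ((hf.meas q x).mono_measure (Measure.restrict_mono (Ioi_subset_Ioi hm) le_rfl))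
    fun r _ => norm_add_le _ _).trans ?_
  rw [← ofReal_two_mul_add_two_mul hε]
  gcongr
  · exact (lintegral_mono_set (Ioi_subset_Ioi (le_max_left _ _))).trans (h1 x)
  · exact (lintegral_mono_set (Ioi_subset_Ioi (le_max_right _ _))).trans (h2 x)

lemma isTail_zero : IsTail fun (_ : Potential n p) (_ : ℝ≥0) (_ : ℝ) => (0 : ℝ) :=
  ⟨fun _ _ => aemeasurable_const, fun _ _ _ => ⟨0, le_rfl, .of_forall fun _ _ => by simp⟩⟩

lemma IsTail.sum {ι : Type*} (s : Finset ι) {f : ι → Potential n p → ℝ≥0 → ℝ → ℝ}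
    (h : ∀ i ∈ s, IsTail (f i)) : IsTail fun q x r => ∑ i ∈ s, f i q x r := by
  classical
  induction s using Finset.induction_on with
  | empty => simpa using isTail_zero
  | insert a s ha ih =>
    simp only [Finset.sum_insert ha]
    exact (h a (Finset.mem_insert_self a s)).add (ih fun i hi => h i (Finset.mem_insert_of_mem hi))

lemma isTail_weakMass (hp : 2 < p) (i j : Fin n) {c : ℝ} (hc : 0 < c) :
    IsTail fun (q : Potential n p) (_ : ℝ≥0) r => weakMass (q.ent i j) (c * r) := by
  have hcomp : ∀ v : ℝ → ℂ, IntegrableOn v (Ioi 0) → ∫⁻ r in Ioi 0, ‖weakMass v (c * r)‖ₑ ^ 2 ≤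
        ofReal c⁻¹ * (dampConst ^ 2 * ∫⁻ t in Ioi 0, ‖v t‖ₑ ^ 2) := by
    intro v hv
    rw [lintegral_Ioi_comp_mul_left (fun r => ‖weakMass v r‖ₑ ^ 2) hc]
    gcongr
    exact lintegral_weakMass_sq_le hv
  have hmeas : ∀ v : ℝ → ℂ, IntegrableOn v (Ioi 0) →
      AEMeasurable (fun r => weakMass v (c * r)) (volume.restrict (Ioi 0)) := by
    intro v hv
    have h1 : AEStronglyMeasurable (fun y : ℝ × ℝ => damp (c * y.1 * y.2) * ‖v y.2‖)
        ((volume.restrict (Ioi 0)).prod (volume.restrict (Ioi 0))) := by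
      refine AEStronglyMeasurable.mul ?_ hv.aestronglyMeasurable.norm.comp_snd
      exact (measurable_damp.comp (by fun_prop)).aestronglyMeasurable
    exact h1.integral_prod_right'.aemeasurable
  refine IsTail.of_split (fun q _ => hmeas _ (q.integrableOn_ent i j)) (fun q ε hε => ?_)
    (fun q q₀ _ r => weakMass (q.diff q₀ i j) (c * r)) (fun q q₀ _ r hr => ?_)
    (fun q q₀ => ofReal c⁻¹ * (dampConst ^ 2 * ∫⁻ t in Ioi 0, ‖q.diff q₀ i j t‖ₑ ^ 2))
    (fun q q₀ _ => hcomp _ (q.integrableOn_diff q₀ i j)) fun q₀ => ?_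
  · have hfin : ∫⁻ r in Ioi 0, ‖weakMass (q.ent i j) (c * r)‖ₑ ^ 2 ≠ ⊤ := by
      refine ne_top_of_le_ne_top ?_ (hcomp _ (q.integrableOn_ent i j))
      refine mul_ne_top ofReal_ne_top (mul_ne_top (pow_ne_top dampConst_ne_top) ?_)
      rw [lintegral_enorm_sq]
      exact pow_ne_top (Potential.memLp_ent hp q i j).2.ne
    obtain ⟨R, hR0, hR⟩ := exists_lintegral_tail_le hfin (ε := ofReal ε) (by simpa using hε)
    exact ⟨R, hR0, fun _ => hR⟩
  · have hcr : 0 ≤ c * r := (mul_pos hc hr).le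
    rw [norm_of_nonneg (weakMass_nonneg _ hcr), norm_of_nonneg (weakMass_nonneg _ hcr),
      norm_of_nonneg (weakMass_nonneg _ hcr)]
    have i1 := integrableOn_damp_mul (q₀.integrableOn_ent i j) hcr
    have i2 := integrableOn_damp_mul (q.integrableOn_diff q₀ i j) hcr
    unfold weakMass
    rw [← integral_add i1 i2]
    refine setIntegral_mono_on (integrableOn_damp_mul (q.integrableOn_ent i j) hcr) (i1.add i2)
      measurableSet_Ioi fun t ht => ?_
    rw [← mul_add]
    refine mul_le_mul_of_nonneg_left ?_ (damp_nonneg (mul_nonneg hcr (le_of_lt ht)))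
    have : q.ent i j t = q₀.ent i j t + q.diff q₀ i j t := by rw [Potential.diff]; ring
    rw [this]
    exact norm_add_le _ _
  · have h1 := Potential.tendsto_lintegral_sq_diff hp q₀ i j
    have h2 := ENNReal.Tendsto.const_mul (a := dampConst ^ 2) h1
      (Or.inr (pow_ne_top dampConst_ne_top))
    have h3 := ENNReal.Tendsto.const_mul (a := ofReal c⁻¹) h2 (Or.inr ofReal_ne_top)
    simpa using h3

lemma isTail_osc (hp : 2 < p) (i j : Fin n) {up : Bool} {a b z : ℂ} (hab : a ≠ b) (hz : z ≠ 0)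
    (had : Admissible up a b z) (g : ℝ≥0 → ℝ≥0) :
    IsTail fun (q : Potential n p) x r => ‖osc up a b (q.ent i j) (g x) (r * z)‖ := by
  obtain ⟨K, hK, hKb⟩ := exists_lintegral_osc_sq_le up hab hz had
  refine IsTail.of_split (fun q x => ?_) (fun q ε hε => ?_)
    (fun q q₀ x r => ‖osc up a b (q.diff q₀ i j) (g x) (r * z)‖) (fun q q₀ x r hr => ?_)
    (fun q q₀ => K * ∫⁻ t in Ioi 0, ‖q.diff q₀ i j t‖ₑ ^ 2)
    (fun q q₀ x => ?_) fun q₀ => ?_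
  · have hq : IntegrableOn (q.ent i j) (region up (g x)) :=
      (q.integrableOn_ent i j).mono_set (region_subset_Ioi up (g x).coe_nonneg)
    have h1 : AEStronglyMeasurable (fun y : ℝ × ℝ => phase a b (y.1 * z) (g x) y.2 * q.ent i j y.2)
        ((volume.restrict (Ioi 0)).prod (volume.restrict (region up (g x)))) := by
      refine AEStronglyMeasurable.mul ?_ hq.aestronglyMeasurable.comp_snd
      refine Continuous.aestronglyMeasurable ?_
      unfold phase
      fun_prop
    exact h1.integral_prod_right'.norm.aemeasurable
  · obtain ⟨R, hR0, hR⟩ := exists_lintegral_osc_tail_le up hab hz had (q.integrableOn_ent i j)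
      (Potential.memLp_ent hp q i j) (ε := ofReal ε) (by simpa using hε)
    refine ⟨R, hR0, fun x => ?_⟩
    simpa only [enorm_norm] using hR (g x) (g x).coe_nonneg
  · have e : q.ent i j - q₀.ent i j = q.diff q₀ i j := rfl
    have h1 := osc_sub (q.integrableOn_ent i j) (q₀.integrableOn_ent i j)
      (admissible_mul had hr.le) (g x).coe_nonneg
    rw [e] at h1
    have h2 : osc up a b (q.ent i j) (g x) (r * z) = osc up a b (q₀.ent i j) (g x) (r * z) +
        osc up a b (q.diff q₀ i j) (g x) (r * z) := by rw [h1]; ring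
    simp only [norm_norm]
    rw [h2]
    exact norm_add_le _ _
  · simpa only [enorm_norm] using hKb _ (g x) (g x).coe_nonneg (q.integrableOn_diff q₀ i j)
      (Potential.memLp_diff hp q q₀ i j)
  · have h1 := Potential.tendsto_lintegral_sq_diff hp q₀ i j
    have h2 := ENNReal.Tendsto.const_mul (a := K) h1 (Or.inr hK)
    simpa using h2

namespace Setup

variable {S : Setup n}

lemma isTail_oscSum (hp : 2 < p) (up : Bool) {m : ℕ} (hm : m ≤ n) {z : ℂ} (hz : z ∈ S.D)
    (h0 : z ≠ 0) (g : ℝ≥0 → ℝ≥0) :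
    IsTail fun (q : Potential n p) x r => S.oscSum up m q.ent (g x) (r * z) := by
  classical
  unfold oscSum
  refine IsTail.sum _ fun y _ => ?_
  by_cases h : S.IsActive up m y.2.1 y.2.2.1 y.1 y.2.2.2
  · simp only [if_pos h]
    exact isTail_osc hp _ _ h.dR_ne h0 (admissible_dR hm h.2.1 h.2.2.1 h.2.2.2.1 hz) g
  · simp only [if_neg h]
    exact isTail_zero

lemma isTail_weakSum (hp : 2 < p) {c : ℝ} (hc : 0 < c) :
    IsTail fun (q : Potential n p) (_ : ℝ≥0) r => weakSum q.ent (c * r) :=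
  IsTail.sum _ fun i _ => IsTail.sum _ fun j _ => isTail_weakMass hp i j hc

lemma weakSum_decay (q : Potential n p) {ε : ℝ} (hε : 0 < ε) :
    ∃ R : ℝ, ∀ r, R ≤ r → weakSum q.ent r ≤ ε := by
  have h : Tendsto (weakSum q.ent) atTop (𝓝 0) := by
    have := tendsto_finsetSum Finset.univ fun i _ => tendsto_finsetSum Finset.univ fun j _ =>
      tendsto_weakMass (q.integrableOn_ent i j)
    simp only [Finset.sum_const_zero] at this
    exact this
  obtain ⟨R, hR⟩ := eventually_atTop.mp (h.eventually (gt_mem_nhds hε))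
  exact ⟨R, fun r hr => (hR r hr).le⟩

lemma oscSum_decay (up : Bool) {m : ℕ} (hm : m ≤ n) (q : Potential n p) {ε : ℝ} (hε : 0 < ε) :
    ∃ R : ℝ, ∀ (x : ℝ≥0) (ρ : S.D), R ≤ ‖(ρ : ℂ)‖ → S.oscSum up m q.ent x ρ ≤ ε := by
  classical
  set N : ℕ := Fintype.card (Quad n) with hN
  have key : ∀ y : Quad n, ∃ R : ℝ,
      ∀ (x : ℝ≥0) (ρ : S.D), R ≤ ‖(ρ : ℂ)‖ → (if S.IsActive up m y.2.1 y.2.2.1 y.1 y.2.2.2 then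
          ‖osc up (S.dR up m y.1) (S.dR up m y.2.2.2) (q.ent y.2.1 y.2.2.1) x ρ‖ else 0) ≤
          ε / (N + 1) := by
    intro y
    by_cases h : S.IsActive up m y.2.1 y.2.2.1 y.1 y.2.2.2
    · simp only [if_pos h]
      obtain ⟨R, hR⟩ := osc_decay up h.dR_ne (q.integrableOn_ent y.2.1 y.2.2.1)
        (ε := ε / (N + 1)) (by positivity)
      exact ⟨R, fun x ρ hρ => hR x ρ x.coe_nonneg hρ (admissible_dR hm h.2.1 h.2.2.1 h.2.2.2.1 ρ.2)⟩
    · simp only [if_neg h]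
      exact ⟨0, fun _ _ _ => by positivity⟩
  choose R hR using key
  obtain ⟨R', -, hR'⟩ := exists_forall_le_of_finite R
  refine ⟨R', fun x ρ hρ => ?_⟩
  refine (Finset.sum_le_card_nsmul _ _ (ε / (N + 1)) fun y _ => hR y x ρ ((hR' y).trans hρ)).trans
    ?_
  rw [Finset.card_univ, nsmul_eq_mul, ← hN, mul_div_assoc', div_le_iff₀ (by positivity)]
  nlinarith

lemma firstOrder_decay (up : Bool) {m : ℕ} (hm : m ≤ n) (q : Potential n p) {ε : ℝ}
    (hε : 0 < ε) : ∃ R : ℝ, ∀ (x : ℝ≥0) (ρ : S.D), R ≤ ‖(ρ : ℂ)‖ →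
      ‖S.firstOrder up m q.ent x ρ‖ ≤ ε := by
  obtain ⟨C, hC, h⟩ := exists_firstOrder_le S up hm
  have hδ : 0 < ε / (3 * (C + 1)) := by positivity
  obtain ⟨R1, h1⟩ := weakSum_decay q hδ
  obtain ⟨R2, h2⟩ := oscSum_decay (S := S) up hm q hδ
  refine ⟨max (max R1 R2) 1, fun x ρ hρ => ?_⟩
  have hρ1 := (le_max_left _ _).trans ((le_max_left _ _).trans hρ)
  have hρ2 := (le_max_right _ _).trans ((le_max_left _ _).trans hρ)
  have hρ3 : (ρ : ℂ) ≠ 0 := norm_pos_iff.mp (one_pos.trans_le ((le_max_right _ _).trans hρ))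
  refine (h q.ent q.integrableOn_ent q.ent_self x ρ hρ3).trans ?_
  have b1 := h1 _ hρ1
  have b2 := h2 x ρ hρ2
  have b3 := h2 0 ρ hρ2
  rw [NNReal.coe_zero] at b3
  set δ := ε / (3 * (C + 1)) with hδe
  calc _ ≤ (C + 1) * (δ + δ + δ) := by
        refine mul_le_mul (by linarith) (add_le_add (add_le_add b1 b2) b3) ?_ (by positivity)
        exact add_nonneg (add_nonneg (weakSum_nonneg _ (norm_nonneg _)) (oscSum_nonneg _ _ _ _ _))
          (oscSum_nonneg _ _ _ _ _)
    _ = ε := by rw [hδe]; field_simp; norm_num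

lemma firstOrder_tail (hp : 2 < p) (up : Bool) {m : ℕ} (hm : m ≤ n) {z : ℂ} (hz : z ∈ S.D)
    (h0 : z ≠ 0) (q₀ : Potential n p) {ε : ℝ} (hε : 0 < ε) : ∃ R : ℝ, 0 ≤ R ∧ ∀ᶠ q in 𝓝 q₀, ∀ x,
      ∫⁻ r in Ioi R, ‖S.firstOrder up m q.ent x (rayPt hz r)‖ₑ ^ 2 ≤ ofReal ε := by
  obtain ⟨C, hC, h⟩ := exists_firstOrder_le S up hm
  have hz0 : 0 < ‖z‖ := norm_pos_iff.mpr h0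
  have hT := ((isTail_weakSum (n := n) hp hz0).add
    (isTail_oscSum hp up hm hz h0 id)).add (isTail_oscSum hp up hm hz h0 fun _ => 0)
  obtain ⟨R, hR0, hR⟩ := hT.tail q₀ (ε / (C ^ 2 + 1)) (by positivity)
  refine ⟨R, hR0, hR.mono fun q hq x => ?_⟩
  calc ∫⁻ r in Ioi R, ‖S.firstOrder up m q.ent x (rayPt hz r)‖ₑ ^ 2
      ≤ ∫⁻ r in Ioi R, ofReal (C ^ 2 + 1) * ‖weakSum q.ent (‖z‖ * r) +
          S.oscSum up m q.ent (id x : ℝ≥0) (r * z) +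
            S.oscSum up m q.ent (0 : ℝ≥0) (r * z)‖ₑ ^ 2 := by
        refine setLIntegral_mono' measurableSet_Ioi fun r hr => ?_
        have hr0 : 0 < r := hR0.trans_lt hr
        refine enorm_sq_le_of_norm_le (a := C) ?_ (by linarith)
        have hne : (rayPt hz r : ℂ) ≠ 0 := by
          rw [rayPt_eq hz hr0.le]
          exact mul_ne_zero (by exact_mod_cast hr0.ne') h0
        have h2 := h q.ent q.integrableOn_ent q.ent_self x (rayPt hz r) hne
        rw [norm_rayPt hz hr0.le, rayPt_eq hz hr0.le] at h2
        exact h2.trans (mul_le_mul_of_nonneg_left (Real.le_norm_self _) hC)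
    _ = ofReal (C ^ 2 + 1) * ∫⁻ r in Ioi R, ‖weakSum q.ent (‖z‖ * r) +
          S.oscSum up m q.ent (id x : ℝ≥0) (r * z) + S.oscSum up m q.ent (0 : ℝ≥0) (r * z)‖ₑ ^ 2 :=
        lintegral_const_mul' _ _ ofReal_ne_top
    _ ≤ ofReal (C ^ 2 + 1) * ofReal (ε / (C ^ 2 + 1)) := by
        gcongr; exact hq x
    _ = ofReal ε := by
        rw [← ofReal_mul (by positivity)]
        congr 1
        field_simp

end Setup

end Tails

/-! ### Solutions of the integral equations -/

section Solutions

namespace Setup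

variable {S : Setup n} {p : ℝ≥0∞} [Fact (1 ≤ p)]

/-- The leading term as a bounded continuous function. -/
lemma exists_base_bcf (up : Bool) {m : ℕ} (hm : m ≤ n) :
    ∃ B : ℝ≥0 × S.D →ᵇ Ext n, ∀ y, B y = S.base up m (y.2 * (y.1 : ℝ)) := by
  obtain ⟨M, -, hM⟩ := exists_base_bound (S := S) up hm
  exact ⟨BoundedContinuousFunction.ofNormedAddCommGroup _ (continuous_base_mul up hm) M fun y =>
    hM _ (mul_mem_D y.2.2 y.1.coe_nonneg), fun y => rfl⟩

lemma integrableOn_skernel (up : Bool) {m : ℕ} (hm : m ≤ n) {Q : ℝ → Ext n →L[ℂ] Ext n}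
    (hQ : IntegrableOn Q (Ioi 0)) {v : ℝ≥0 → S.D → Ext n}
    (hv : Continuous fun y : ℝ≥0 × S.D => v y.1 y.2) {M : ℝ} (hM : ∀ x ρ, ‖v x ρ‖ ≤ M) (x : ℝ≥0)
    (ρ : S.D) :
    IntegrableOn (fun t => S.skernel up m x t ρ (Q t (v t.toNNReal ρ))) (region up x) := by
  obtain ⟨C, hC⟩ := exists_isVolterraKernel S up hm
  refine hC.integrableOn hQ (v := fun t => v t.toNNReal ρ) ?_ (M := M) fun t _ => hM _ _
  exact (hv.comp (continuous_real_toNNReal.prodMk continuous_const)).continuousOn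

lemma volterra_sub_right (up : Bool) {m : ℕ} (hm : m ≤ n) {Q : ℝ → Ext n →L[ℂ] Ext n}
    (hQ : IntegrableOn Q (Ioi 0)) {v w : ℝ≥0 → S.D → Ext n}
    (hv : Continuous fun y : ℝ≥0 × S.D => v y.1 y.2) {M : ℝ} (hM : ∀ x ρ, ‖v x ρ‖ ≤ M)
    (hw : Continuous fun y : ℝ≥0 × S.D => w y.1 y.2) {N : ℝ} (hN : ∀ x ρ, ‖w x ρ‖ ≤ N)
    (x : ℝ≥0) (ρ : S.D) :
    volterra up (S.skernel up m) Q (fun x ρ => v x ρ - w x ρ) x ρ =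
      volterra up (S.skernel up m) Q v x ρ - volterra up (S.skernel up m) Q w x ρ := by
  unfold volterra
  rw [← integral_sub (integrableOn_skernel up hm hQ hv hM x ρ)
    (integrableOn_skernel up hm hQ hw hN x ρ)]
  simp only [map_sub]

lemma volterra_sub_left (up : Bool) {m : ℕ} (hm : m ≤ n) {Q Q' : ℝ → Ext n →L[ℂ] Ext n}
    (hQ : IntegrableOn Q (Ioi 0)) (hQ' : IntegrableOn Q' (Ioi 0)) {v : ℝ≥0 → S.D → Ext n}
    (hv : Continuous fun y : ℝ≥0 × S.D => v y.1 y.2) {M : ℝ} (hM : ∀ x ρ, ‖v x ρ‖ ≤ M)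
    (x : ℝ≥0) (ρ : S.D) :
    volterra up (S.skernel up m) (fun t => Q t - Q' t) v x ρ =
      volterra up (S.skernel up m) Q v x ρ - volterra up (S.skernel up m) Q' v x ρ := by
  unfold volterra
  rw [← integral_sub (integrableOn_skernel up hm hQ hv hM x ρ)
    (integrableOn_skernel up hm hQ' hv hM x ρ)]
  simp only [sub_apply, map_sub]

lemma norm_volterra_le {up : Bool} {m : ℕ} {C : ℝ}
    (hC : IsVolterraKernel up (S.skernel up m) C) {Q : ℝ → Ext n →L[ℂ] Ext n}
    (hQ : IntegrableOn Q (Ioi 0)) {v : ℝ≥0 → S.D → Ext n} {M : ℝ} (hM : ∀ x ρ, ‖v x ρ‖ ≤ M)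
    (hM0 : 0 ≤ M) (x : ℝ≥0) (ρ : S.D) :
    ‖volterra up (S.skernel up m) Q v x ρ‖ ≤ C * M * ∫ t in Ioi 0, ‖Q t‖ := by
  have hi : IntegrableOn (fun t => C * ‖Q t‖ * M) (Ioi 0) := (hQ.norm.const_mul C).mul_const M
  have hx := region_subset_Ioi up x.coe_nonneg
  refine (hC.norm_integral_le (v := fun t => v t.toNNReal ρ) (b := fun _ => M) (fun t _ => hM _ _)
    (hi.mono_set hx)).trans ((setIntegral_mono_set hi ?_ (LE.le.eventuallyLE hx)).trans
      (le_of_eq ?_))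
  · exact .of_forall fun t => mul_nonneg (mul_nonneg hC.nonneg (norm_nonneg _)) hM0
  · rw [integral_mul_const, integral_const_mul]
    ring

variable (S) in
/-- A family of solutions of the normalised integral equations of the fundamental tensors. -/
structure IsTensorFamily (up : Bool) (m : ℕ) (Y : Potential n p → ℝ≥0 → S.D → Ext n) : Prop where
  cont : ∀ q, Continuous fun y : ℝ≥0 × S.D => Y q y.1 y.2
  bdd : ∀ q, ∃ M, 0 ≤ M ∧ ∀ x ρ, ‖Y q x ρ‖ ≤ M
  eqn : ∀ q x ρ, Y q x ρ = S.base up m (ρ * (x : ℝ)) +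
    volterra up (S.skernel up m) (potOp q.ent) (Y q) x ρ

lemma exists_isTensorFamily (S : Setup n) (up : Bool) {m : ℕ} (hm : m ≤ n) :
    ∃ Y : Potential n p → ℝ≥0 → S.D → Ext n, S.IsTensorFamily up m Y := by
  obtain ⟨C, hC⟩ := exists_isVolterraKernel S up hm
  obtain ⟨B, hB⟩ := exists_base_bcf (S := S) up hm
  choose Y hY using fun q : Potential n p =>
    hC.exists_solution (integrableOn_potOp q.integrableOn_ent) B
  refine ⟨fun q x ρ => Y q (x, ρ), fun q => (Y q).continuous, fun q =>
    ⟨‖Y q‖, norm_nonneg _, fun x ρ => (Y q).norm_coe_le_norm _⟩, fun q x ρ => ?_⟩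
  have h := hY q (x, ρ)
  rw [hB] at h
  exact h

variable {up : Bool} {m : ℕ} {Y : Potential n p → ℝ≥0 → S.D → Ext n}

/-- The perturbation of the leading term. -/
def pert (S : Setup n) (up : Bool) (m : ℕ) (Y : Potential n p → ℝ≥0 → S.D → Ext n)
    (q : Potential n p) (x : ℝ≥0) (ρ : S.D) : Ext n := Y q x ρ - S.base up m (ρ * (x : ℝ))

/-- The perturbation is controlled by the first-order term. -/
lemma IsTensorFamily.exists_pert_le (hm : m ≤ n) (hY : S.IsTensorFamily up m Y)
    (q₀ : Potential n p) : ∃ K, 0 ≤ K ∧ ∀ᶠ q in 𝓝 q₀, ∀ x ρ,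
      ‖S.pert up m Y q x ρ‖ ≤ ‖S.firstOrder up m q.ent x ρ‖ +
        K * ∫ t in Ioi 0, ‖potOp q.ent t‖ * ‖S.firstOrder up m q.ent t.toNNReal ρ‖ := by
  obtain ⟨C, hC⟩ := exists_isVolterraKernel S up hm
  obtain ⟨N, -, hN⟩ := exists_base_bound (S := S) up hm
  refine ⟨C * Real.exp (C * ((∫ t in Ioi 0, ‖potOp q₀.ent t‖) + 1)),
    mul_nonneg hC.nonneg (Real.exp_pos _).le, ?_⟩
  filter_upwards [eventually_integral_potOp_le q₀] with q hq x ρ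
  obtain ⟨M, hM0, hM⟩ := hY.bdd q
  have hQ := integrableOn_potOp q.integrableOn_ent
  have hbb : ∀ (x : ℝ≥0) (ρ : S.D), ‖S.base up m (ρ * (x : ℝ))‖ ≤ N := fun x ρ =>
    hN _ (mul_mem_D ρ.2 x.coe_nonneg)
  have hsub := fun x => volterra_sub_right up hm hQ (hY.cont q) hM (continuous_base_mul up hm) hbb
    x ρ
  have hfc : Continuous fun x => S.firstOrder up m q.ent x ρ :=
    (continuous_firstOrder up hm q.integrableOn_ent).comp (by fun_prop : Continuous fun x : ℝ≥0 =>
      (x, ρ))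
  refine (hC.norm_le hQ (ρ := ρ) (y := fun x => S.pert up m Y q x ρ)
    (f := fun x => S.firstOrder up m q.ent x ρ) hfc (M := M + N)
    (fun x => norm_sub_le_of_le (hM x ρ) (hbb x ρ))
    (fun x => norm_volterra_le hC hQ hbb ((norm_nonneg _).trans (hbb 0 ρ)) x ρ) (fun x => ?_)
      x).trans ?_
  · have h1 := hsub x
    rw [pert, hY.eqn q x ρ, add_sub_cancel_left, ← sub_eq_iff_eq_add']
    exact h1.symm
  · have hC0 := hC.nonneg
    have h0 : 0 ≤ ∫ t in Ioi 0, ‖potOp q.ent t‖ * ‖S.firstOrder up m q.ent t.toNNReal ρ‖ :=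
      integral_nonneg fun t => by positivity
    exact add_le_add_right (mul_le_mul_of_nonneg_right
      (mul_le_mul_of_nonneg_left (Real.exp_le_exp.mpr (mul_le_mul_of_nonneg_left hq hC0)) hC0) h0) _

/-- The difference of two solutions solves an integral equation with a small free term. -/
lemma IsTensorFamily.sub_eqn (hm : m ≤ n) (hY : S.IsTensorFamily up m Y)
    (q q₀ : Potential n p) (x : ℝ≥0) (ρ : S.D) :
    Y q x ρ - Y q₀ x ρ = volterra up (S.skernel up m) (potOp (q.diff q₀)) (Y q₀) x ρ +
      volterra up (S.skernel up m) (potOp q.ent) (fun x ρ => Y q x ρ - Y q₀ x ρ) x ρ := by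
  obtain ⟨M, hM0, hM⟩ := hY.bdd q
  obtain ⟨M₀, hM₀0, hM₀⟩ := hY.bdd q₀
  have hQ := integrableOn_potOp q.integrableOn_ent
  have hQ₀ := integrableOn_potOp q₀.integrableOn_ent
  have e1 := volterra_sub_right up hm hQ (hY.cont q) hM (hY.cont q₀) hM₀ x ρ
  have e2 := volterra_sub_left up hm hQ hQ₀ (hY.cont q₀) hM₀ x ρ
  have e3 : potOp (q.diff q₀) = fun t => potOp q.ent t - potOp q₀.ent t :=
    funext fun t => potOp_diff q q₀ t
  rw [e1, e3, e2, hY.eqn q x ρ, hY.eqn q₀ x ρ]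
  abel

/-- A Gronwall bound for the dependence of the solution on the potential. -/
lemma IsTensorFamily.exists_sub_le (hm : m ≤ n) (hY : S.IsTensorFamily up m Y)
    (q₀ : Potential n p) : ∃ K, 0 ≤ K ∧ ∀ᶠ q in 𝓝 q₀, ∀ x ρ,
      ‖Y q x ρ - Y q₀ x ρ‖ ≤ K * ∫ t in Ioi 0, ‖potOp (q.diff q₀) t‖ := by
  obtain ⟨C, hC⟩ := exists_isVolterraKernel S up hm
  have hC0 := hC.nonneg
  obtain ⟨M₀, hM₀0, hM₀⟩ := hY.bdd q₀
  obtain ⟨I, hI⟩ : ∃ I, I = (∫ t in Ioi 0, ‖potOp q₀.ent t‖) + 1 := ⟨_, rfl⟩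
  have hI0 : 0 ≤ I := by
    rw [hI]
    exact add_nonneg (integral_nonneg fun t => norm_nonneg _) zero_le_one
  refine ⟨C * M₀ * (1 + C * Real.exp (C * I) * I), by positivity, ?_⟩
  filter_upwards [eventually_integral_potOp_le q₀] with q h1 x ρ
  rw [← hI] at h1
  obtain ⟨M, hM0, hM⟩ := hY.bdd q
  have hQ := integrableOn_potOp q.integrableOn_ent
  have hQd := integrableOn_potOp (q.integrableOn_diff q₀)
  have hJ0 : 0 ≤ ∫ t in Ioi 0, ‖potOp (q.diff q₀) t‖ := integral_nonneg fun t => norm_nonneg _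
  have hfb : ∀ x, ‖volterra up (S.skernel up m) (potOp (q.diff q₀)) (Y q₀) x ρ‖ ≤
      C * M₀ * ∫ t in Ioi 0, ‖potOp (q.diff q₀) t‖ :=
    fun x => norm_volterra_le hC hQd hM₀ hM₀0 x ρ
  have hfc : Continuous fun x => volterra up (S.skernel up m) (potOp (q.diff q₀)) (Y q₀) x ρ :=
    (hC.continuous_volterra hQd (hY.cont q₀) hM₀).comp
    (by fun_prop : Continuous fun x : ℝ≥0 => (x, ρ))
  have key := hC.norm_le hQ (ρ := ρ) (y := fun x => Y q x ρ - Y q₀ x ρ) hfc (M := M + M₀)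
    (fun x => norm_sub_le_of_le (hM x ρ) (hM₀ x ρ)) hfb (fun x => hY.sub_eqn hm q q₀ x ρ) x
  refine key.trans ?_
  generalize volterra up (S.skernel up m) (potOp (q.diff q₀)) (Y q₀) = f at hfb
  generalize (∫ t in Ioi 0, ‖potOp (q.diff q₀) t‖) = J at hfb hJ0
  have b1 : ∫ t in Ioi 0, ‖potOp q.ent t‖ * ‖f t.toNNReal ρ‖ ≤ I * (C * M₀ * J) := by
    refine (integral_mono_of_nonneg (.of_forall fun t => by positivity)
      (hQ.norm.mul_const (C * M₀ * J)) (.of_forall fun t =>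
        mul_le_mul_of_nonneg_left (hfb _) (norm_nonneg _))).trans ?_
    rw [integral_mul_const]
    gcongr
  have b2 : C * Real.exp (C * ∫ t in Ioi 0, ‖potOp q.ent t‖) ≤ C * Real.exp (C * I) := by
    gcongr
  have b3 : 0 ≤ ∫ t in Ioi 0, ‖potOp q.ent t‖ * ‖f t.toNNReal ρ‖ :=
    integral_nonneg fun t => by positivity
  calc _ ≤ C * M₀ * J + C * Real.exp (C * I) * (I * (C * M₀ * J)) :=
        add_le_add (hfb x) (mul_le_mul b2 b1 b3 (by positivity))
    _ = _ := by ring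

lemma IsTensorFamily.isReg (hm : m ≤ n) (hY : S.IsTensorFamily up m Y) : IsReg Y where
  cont := hY.cont
  bdd q := by
    obtain ⟨M, -, hM⟩ := hY.bdd q
    exact ⟨M, hM⟩
  qcont q₀ ε hε := by
    obtain ⟨K, hK0, hK⟩ := hY.exists_sub_le hm q₀
    have hδ : 0 < ε / (K + 1) := by positivity
    filter_upwards [hK, (tendsto_integral_potOp_diff q₀).eventually (gt_mem_nhds hδ)] with q h1 h2
      x ρ
    refine (h1 x ρ).trans ?_
    have hJ0 : 0 ≤ ∫ t in Ioi 0, ‖potOp (q.diff q₀) t‖ := integral_nonneg fun t => norm_nonneg _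
    calc _ ≤ (K + 1) * (ε / (K + 1)) := mul_le_mul (by linarith) h2.le hJ0 (by positivity)
      _ = ε := by field_simp

lemma isReg_base (up : Bool) {m : ℕ} (hm : m ≤ n) :
    IsReg fun (_ : Potential n p) (x : ℝ≥0) (ρ : S.D) => S.base up m (ρ * (x : ℝ)) := by
  obtain ⟨N, -, hN⟩ := exists_base_bound (S := S) up hm
  exact isReg_of_continuous (continuous_base_mul up hm) fun x ρ =>
    hN _ (mul_mem_D ρ.2 x.coe_nonneg)

/-- The perturbations of the leading terms of the fundamental tensors form a good family. -/
lemma IsTensorFamily.isGood (hp : 2 < p) (hm : m ≤ n) (hY : S.IsTensorFamily up m Y) :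
    IsGood (S.pert up m Y) where
  toIsReg := by
    have h1 := (hY.isReg hm).add ((isReg_base up hm).clm (-ContinuousLinearMap.id ℂ (Ext n)))
    simp only [neg_apply, ContinuousLinearMap.id_apply, ← sub_eq_add_neg] at h1
    exact h1
  decay q ε hε := by
    obtain ⟨K, hK, h⟩ := hY.exists_pert_le hm q
    set I := ∫ t in Ioi 0, ‖potOp q.ent t‖ with hI
    have hI0 : 0 ≤ I := integral_nonneg fun t => norm_nonneg _
    obtain ⟨R, hR⟩ := firstOrder_decay (S := S) up hm q (ε := ε / (1 + K * I)) (by positivity)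
    refine ⟨R, fun x ρ hρ => (h.self_of_nhds x ρ).trans ?_⟩
    set δ := ε / (1 + K * I) with hδ
    have hδ0 : 0 < δ := by positivity
    have b1 : ∫ t in Ioi 0, ‖potOp q.ent t‖ * ‖S.firstOrder up m q.ent t.toNNReal ρ‖ ≤ I * δ := by
      refine (integral_mono_of_nonneg (.of_forall fun t => by positivity)
        ((integrableOn_potOp q.integrableOn_ent).norm.mul_const δ) (.of_forall fun t =>
          mul_le_mul_of_nonneg_left (hR _ ρ hρ) (norm_nonneg _))).trans ?_
      rw [integral_mul_const]
    calc _ ≤ δ + K * (I * δ) := add_le_add (hR x ρ hρ) (mul_le_mul_of_nonneg_left b1 hK)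
      _ = ε := by rw [hδ]; field_simp
  tail z hz h0 q₀ ε hε := by
    obtain ⟨K, hK, h⟩ := hY.exists_pert_le hm q₀
    set I := (∫ t in Ioi 0, ‖potOp q₀.ent t‖) + 1 with hI
    have hI0 : 0 ≤ ∫ t in Ioi 0, ‖potOp q₀.ent t‖ := integral_nonneg fun t => norm_nonneg _
    set δ := ε / 4 / (1 + K ^ 2 * I ^ 2) with hδ
    have hI1 : 0 ≤ I := by positivity
    have hδ0 : 0 < δ := by positivity
    obtain ⟨R, hR0, hR⟩ := firstOrder_tail hp up hm hz h0 q₀ hδ0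
    refine ⟨R, hR0, ?_⟩
    filter_upwards [h, hR, eventually_integral_potOp_le q₀] with q h1 h2 h3 x
    have hQ := integrableOn_potOp q.integrableOn_ent
    have hfc := continuous_firstOrder (S := S) up hm q.integrableOn_ent
    have hcr : ∀ x : ℝ≥0, Continuous fun r : ℝ => S.firstOrder up m q.ent x (rayPt hz r) :=
      fun x => hfc.comp (continuous_const.prodMk (continuous_rayPt hz))
    -- the integral term, by the Cauchy–Schwarz inequality and Tonelli's theorem
    set g : ℝ → ℝ := fun r =>
      ∫ t in Ioi 0, ‖potOp q.ent t‖ * ‖S.firstOrder up m q.ent t.toNNReal (rayPt hz r)‖ with hg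
    have hIq : ∫⁻ t in Ioi 0, ‖potOp q.ent t‖ₑ ≤ ofReal I := by
      rw [← ofReal_integral_norm_eq_lintegral_enorm hQ]
      exact ofReal_le_ofReal h3
    have hjoint : Continuous fun y : ℝ × ℝ =>
        S.firstOrder up m q.ent y.2.toNNReal (rayPt hz y.1) :=
      hfc.comp ((continuous_real_toNNReal.comp continuous_snd).prodMk
        ((continuous_rayPt hz).comp continuous_fst))
    have hg2 : ∫⁻ r in Ioi R, ‖g r‖ₑ ^ 2 ≤ ofReal (I ^ 2 * δ) := by
      calc ∫⁻ r in Ioi R, ‖g r‖ₑ ^ 2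
          ≤ ∫⁻ r in Ioi R, ofReal I * ∫⁻ t in Ioi 0, ‖potOp q.ent t‖ₑ *
              ‖S.firstOrder up m q.ent t.toNNReal (rayPt hz r)‖ₑ ^ 2 := by
            refine lintegral_mono fun r => ?_
            have e1 : ‖g r‖ₑ ≤ ∫⁻ t in Ioi 0, ‖potOp q.ent t‖ₑ *
                ‖S.firstOrder up m q.ent t.toNNReal (rayPt hz r)‖ₑ := by
              refine (enorm_integral_le_lintegral_enorm _).trans (le_of_eq ?_)
              simp only [enorm_mul, enorm_norm]
            have hrm : AEMeasurable (fun t : ℝ =>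
                ‖S.firstOrder up m q.ent t.toNNReal (rayPt hz r)‖ₑ) (volume.restrict (Ioi 0)) :=
              (hjoint.comp (by fun_prop : Continuous fun t : ℝ => (r, t))).enorm.aemeasurable
            refine (pow_le_pow_left' e1 2).trans ((lintegral_mul_sq_le hQ.aestronglyMeasurable.enorm
              hrm).trans ?_)
            gcongr
        _ = ofReal I * ∫⁻ r in Ioi R, ∫⁻ t in Ioi 0, ‖potOp q.ent t‖ₑ *
              ‖S.firstOrder up m q.ent t.toNNReal (rayPt hz r)‖ₑ ^ 2 :=
            lintegral_const_mul' _ _ ofReal_ne_top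
        _ = ofReal I * ∫⁻ t in Ioi 0, ∫⁻ r in Ioi R, ‖potOp q.ent t‖ₑ *
              ‖S.firstOrder up m q.ent t.toNNReal (rayPt hz r)‖ₑ ^ 2 := by
            rw [lintegral_lintegral_swap]
            exact (hQ.aestronglyMeasurable.comp_snd.enorm).mul
              (hjoint.enorm.measurable.pow_const 2).aemeasurable
        _ ≤ ofReal I * ∫⁻ t in Ioi 0, ‖potOp q.ent t‖ₑ * ofReal δ := by
            gcongr with t
            rw [lintegral_const_mul _ ((hcr _).enorm.measurable.pow_const 2)]
            gcongr
            exact h2 _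
        _ = ofReal I * ((∫⁻ t in Ioi 0, ‖potOp q.ent t‖ₑ) * ofReal δ) := by
            rw [lintegral_mul_const' _ _ ofReal_ne_top]
        _ ≤ ofReal I * (ofReal I * ofReal δ) := by gcongr
        _ = ofReal (I ^ 2 * δ) := by
            rw [← ofReal_mul hI1, ← ofReal_mul hI1]
            congr 1
            ring
    have hKg : ∫⁻ r in Ioi R, ‖K * g r‖ₑ ^ 2 ≤ ofReal (K ^ 2 * (I ^ 2 * δ)) := by
      calc ∫⁻ r in Ioi R, ‖K * g r‖ₑ ^ 2 = ∫⁻ r in Ioi R, ofReal (K ^ 2) * ‖g r‖ₑ ^ 2 := by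
            refine lintegral_congr fun r => ?_
            rw [enorm_mul, mul_pow, ofReal_pow hK, Real.enorm_of_nonneg hK]
        _ = ofReal (K ^ 2) * ∫⁻ r in Ioi R, ‖g r‖ₑ ^ 2 :=
            lintegral_const_mul' _ _ ofReal_ne_top
        _ ≤ _ := by
            rw [ofReal_mul (by positivity)]
            gcongr
    have h5 : ∫⁻ r in Ioi R, ‖‖S.pert up m Y q x (rayPt hz r)‖‖ₑ ^ 2 ≤
        2 * (∫⁻ r in Ioi R, ‖‖S.firstOrder up m q.ent x (rayPt hz r)‖‖ₑ ^ 2) +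
        2 * ∫⁻ r in Ioi R, ‖K * g r‖ₑ ^ 2 := by
      refine lintegral_sq_le_of_add measurableSet_Ioi (hcr x).norm.aemeasurable fun r _ => ?_
      rw [norm_norm, norm_norm]
      refine (h1 x (rayPt hz r)).trans ?_
      gcongr
      exact Real.le_norm_self _
    simp only [enorm_norm] at h5
    refine h5.trans ?_
    calc _ ≤ 2 * ofReal δ + 2 * ofReal (K ^ 2 * (I ^ 2 * δ)) := by
          gcongr
          exact h2 x
      _ ≤ ofReal ε := by
          have e5 : (2 : ℝ≥0∞) = ofReal 2 := by simp
          rw [e5, ← ofReal_mul (by norm_num), ← ofReal_mul (by norm_num),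
            ← ofReal_add (by positivity) (by positivity)]
          refine ofReal_le_ofReal ?_
          have e6 : (1 + K ^ 2 * I ^ 2) * δ = ε / 4 := by rw [hδ]; field_simp
          nlinarith

end Setup

end Solutions

/-! ### The Weyl-type solutions of the unperturbed system -/

section UnperturbedWeyl

namespace Setup

variable {S : Setup n}

/-- Cramer's rule for the coefficients of a linear combination. -/
lemma cramer_ofCols (u : Fin n → Fin n → ℂ) (a : Fin n → ℂ) (j : Fin n) :
    (ofCols u).cramer (∑ i, a i • u i) j = (ofCols u).det * a j := by
  rw [← ofCols_mulVec, Matrix.cramer_eq_adjugate_mulVec, Matrix.mulVec_mulVec,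
    Matrix.adjugate_mul, Matrix.smul_mulVec, Matrix.one_mulVec]
  rfl

lemma continuous_ofCols : Continuous (ofCols : (Fin n → Fin n → ℂ) → _) :=
  continuous_matrix fun i j => by
    simp only [ofCols, Matrix.of_apply]
    fun_prop

lemma tendsto_cramer {α : Type*} {l : Filter α} {u : α → Fin n → Fin n → ℂ} {v : α → Fin n → ℂ}
    {u₀ : Fin n → Fin n → ℂ} {v₀ : Fin n → ℂ} (hu : Tendsto u l (𝓝 u₀)) (hv : Tendsto v l (𝓝 v₀))
    (j : Fin n) :
    Tendsto (fun a => (ofCols (u a)).cramer (v a) j) l (𝓝 ((ofCols u₀).cramer v₀ j)) := by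
  have h1 : Continuous fun y : (Fin n → Fin n → ℂ) × (Fin n → ℂ) => (ofCols y.1).cramer y.2 :=
    (continuous_ofCols.comp continuous_fst).matrix_cramer continuous_snd
  have h2 := (h1.tendsto (u₀, v₀)).comp (hu.prodMk_nhds hv)
  exact tendsto_pi_nhds.mp h2 j

lemma IsSol.exists_expansion {u v : Fin n → ℂ → Fin n → ℂ} (hu : S.IsSol u)
    (hdet : (ofCols fun j => u j S.ref).det ≠ 0) (hv : S.IsSol v) :
    ∃ P : Matrix (Fin n) (Fin n) ℂ, ∀ k, ∀ ξ ∈ S.D, ξ ≠ 0 → v k ξ = ∑ j, P j k • u j ξ := by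
  obtain ⟨P, hP⟩ := hu.exists_matrix hdet hv
  refine ⟨P, fun k ξ hξ h0 => ?_⟩
  have h := hP ξ hξ h0
  rw [ofCols_mul] at h
  ext i
  have := congrFun (congrFun h i) k
  simpa only [ofCols, Matrix.of_apply] using this

lemma neBot_vertex : (𝓝[S.D \ {0}] (0 : ℂ)).NeBot :=
  mem_closure_iff_nhdsWithin_neBot.mp (closure_mono
    (fun _ hξ => ⟨subset_closure hξ, hξ.1⟩ : sector S.ω S.h ⊆ S.D \ {0}) zero_mem)

/-- The behaviour of `ψ_{0k}` at the vertex excludes the more singular `c_j`. -/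
lemma exists_ψ_eq_c : ∃ P : Matrix (Fin n) (Fin n) ℂ,
    (∀ k, ∀ ξ ∈ S.D, ξ ≠ 0 → S.ψ k ξ = ∑ j, P j k • S.c j ξ) ∧ ∀ k, ∀ j < k, P j k = 0 := by
  obtain ⟨P, hP⟩ := isSol_c.exists_expansion (S := S)
    (by rw [det_c ref_mem ref_ne_zero]; exact one_ne_zero) isSol_ψ
  refine ⟨P, hP, fun k j hjk => ?_⟩
  have hν : 0 < (S.μ k - S.μ j).re := by
    rw [sub_re]; exact sub_pos.mpr (S.condA.ordered hjk)
  have h1 : Tendsto (fun ξ => sectorPow S.ω ξ (-S.μ j) • S.ψ k ξ) (𝓝[S.D \ {0}] 0) (𝓝 0) := by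
    obtain ⟨C, hC⟩ := (S.weyl.zero k).bound
    refine squeeze_zero_norm' ?_ (a := fun ξ => C * ‖sectorPow S.ω ξ (S.μ k - S.μ j)‖)
      (by simpa using (tendsto_norm_sectorPow S.ω S.h hν).const_mul C)
    filter_upwards [hC] with ξ hξ
    rw [norm_smul, sub_eq_add_neg, sectorPow_add, norm_mul]
    exact (mul_le_mul_of_nonneg_left hξ (norm_nonneg _)).trans (le_of_eq (by ring))
  have h2 : Tendsto (fun ξ i => S.chat i ξ) (𝓝[S.D \ {0}] 0) (𝓝 fun i => S.chat i 0) :=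
    tendsto_pi_nhds.mpr fun i => ((continuous_chat i).tendsto 0).mono_left nhdsWithin_le_nhds
  have h3 := tendsto_cramer h2 h1 j
  rw [map_zero] at h3
  have := neBot_vertex (S := S)
  refine tendsto_nhds_unique (tendsto_const_nhds.congr' ?_) h3
  filter_upwards [self_mem_nhdsWithin] with ξ hξ
  have e : sectorPow S.ω ξ (-S.μ j) • S.ψ k ξ =
      ∑ i, (P i k * sectorPow S.ω ξ (S.μ i - S.μ j)) • S.chat i ξ := by
    rw [hP k ξ hξ.1 hξ.2, smul_sum]
    refine sum_congr rfl fun i _ => ?_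
    rw [c, frob, smul_smul, smul_smul, sub_eq_add_neg, sectorPow_add]
    congr 1; ring
  rw [e, cramer_ofCols, det_chat hξ.1, one_mul, sub_self, ← vertexPow_of_ne hξ.2,
    vertexPow_zero_right, mul_one]

lemma tendsto_ehat {ρ : ℂ} (hρ : ρ ∈ S.D) (h0 : ρ ≠ 0) (k : Fin n) :
    Tendsto (fun x : ℝ => S.ehat k (ρ * x)) atTop (𝓝 (S.fvec k)) := by
  obtain ⟨M, -, hM⟩ := exists_ehat_sub_le (S := S)
  have hn : Tendsto (fun x : ℝ => ‖ρ * x‖) atTop atTop := by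
    simp only [norm_mul, norm_real]
    exact (tendsto_norm_atTop_atTop).const_mul_atTop (norm_pos_iff.mpr h0)
  rw [tendsto_iff_norm_sub_tendsto_zero]
  refine squeeze_zero' (.of_forall fun _ => norm_nonneg _) ?_ (g := fun x : ℝ => M * ‖ρ * x‖⁻¹)
    (by simpa using (tendsto_inv_atTop_zero.comp hn).const_mul M)
  filter_upwards [hn.eventually_ge_atTop 1, eventually_ge_atTop 0] with x hx h
  exact (norm_le_pi_norm ((fun j => S.ehat j (ρ * x)) - S.fvec) k).trans (hM _ (mul_mem_D hρ h) hx)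

lemma exp_smul_ψ_eq {P : Matrix (Fin n) (Fin n) ℂ}
    (hP : ∀ k, ∀ ξ ∈ S.D, ξ ≠ 0 → S.ψ k ξ = ∑ j, P j k • S.e j ξ) (k : Fin n) {ξ : ℂ}
    (hξ : ξ ∈ S.D) (h0 : ξ ≠ 0) : exp (-(ξ * S.R k)) • S.ψ k ξ =
      ∑ j, (P j k * exp (ξ * (S.R j - S.R k))) • S.ehat j ξ := by
  rw [hP k ξ hξ h0, smul_sum]
  refine sum_congr rfl fun i _ => ?_
  rw [e_eq, smul_smul, smul_smul, mul_sub, sub_eq_add_neg, exp_add]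
  congr 1; ring

/-- The behaviour of `ψ_{0k}` at infinity excludes the dominating `e_j`. -/
lemma exists_ψ_eq_e : ∃ P : Matrix (Fin n) (Fin n) ℂ,
    (∀ k, ∀ ξ ∈ S.D, ξ ≠ 0 → S.ψ k ξ = ∑ j, P j k • S.e j ξ) ∧
      ∀ k, P k k = 1 ∧ ∀ j, k < j → P j k = 0 := by
  obtain ⟨P, hP⟩ := isSol_e.exists_expansion (S := S) det_e_ne_zero isSol_ψ
  have hlim : ∀ k j, Tendsto (fun r : ℝ => P j k * exp (r * S.ref * (S.R j - S.R k))) atTop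
      (𝓝 (if j = k then 1 else 0)) := by
    intro k j
    have h2 : Tendsto (fun (r : ℝ) i => S.ehat i (r * S.ref)) atTop (𝓝 S.fvec) :=
      tendsto_pi_nhds.mpr fun i => by
        simpa only [mul_comm] using tendsto_ehat ref_mem ref_ne_zero i
    have h3 := tendsto_cramer h2 (tendsto_ψ (S := S) ref_mem_sector k) j
    have h4 : Tendsto (fun r : ℝ => (ofCols fun i => S.ehat i (r * S.ref)).det) atTop
        (𝓝 (ofCols S.fvec).det) := (continuous_ofCols.matrix_det.tendsto _).comp h2
    have e1 : S.fvec k = ∑ i, (if i = k then (1 : ℂ) else 0) • S.fvec i := by simp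
    rw [e1, cramer_ofCols] at h3
    have h5 := h3.div h4 det_fvec_ne_zero
    rw [mul_div_cancel_left₀ _ det_fvec_ne_zero] at h5
    refine h5.congr' ?_
    filter_upwards [h4.eventually_ne det_fvec_ne_zero, eventually_gt_atTop 0] with r hr hr0
    have hm := mul_ref_mem_sector (S := S) hr0
    simp only [Pi.div_apply]
    rw [exp_smul_ψ_eq hP k (subset_closure hm) hm.1, cramer_ofCols, mul_div_cancel_left₀ _ hr]
  refine ⟨P, hP, fun k => ⟨?_, fun j hjk => ?_⟩⟩
  · simpa using hlim k k
  · have h := (hlim k j).norm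
    rw [if_neg hjk.ne', norm_zero] at h
    refine norm_le_zero_iff.mp (ge_of_tendsto h ?_)
    filter_upwards [eventually_gt_atTop 0] with r hr
    have hre := monotone_re (subset_closure (mul_ref_mem_sector (S := S) hr)) hjk.le
    rw [norm_mul]
    refine le_mul_of_one_le_right (norm_nonneg _) ?_
    rw [norm_exp, Real.one_le_exp_iff, mul_sub, sub_re]
    exact sub_nonneg.mpr hre

/-- The columns `ψ_{0k} / W_k` extend to bounded continuous functions on the closed sector. -/
lemma exists_ψ_div_weight (S : Setup n) : ∃ φ : Fin n → ℂ → Fin n → ℂ,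
    (∀ k, ContinuousOn (φ k) S.D) ∧
    (∀ k, ∀ ξ ∈ S.D, ξ ≠ 0 → φ k ξ = (S.W k ξ)⁻¹ • S.ψ k ξ) ∧
    ∃ M, ∀ k, ∀ ξ ∈ S.D, ‖φ k ξ‖ ≤ M := by
  obtain ⟨P, hP, hP0⟩ := exists_ψ_eq_c (S := S)
  obtain ⟨Q, hQ, hQ0⟩ := exists_ψ_eq_e (S := S)
  obtain ⟨N, hN0, -, hN⟩ := exists_ehat_bound (S := S)
  let φ : Fin n → ℂ → Fin n → ℂ := fun k ξ => (S.what {k} ξ)⁻¹ •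
    ∑ j, (P j k * vertexPow S.ω ξ (S.μ j - S.μ k)) • S.chat j ξ
  have h1 : ∀ k, ContinuousOn (φ k) S.D := by
    refine fun k => ((continuousOn_what _).inv₀ fun ξ hξ => what_ne_zero hξ _).smul
      (continuousOn_finsetSum _ fun j _ => ?_)
    suffices h : ContinuousOn (fun ξ => P j k * vertexPow S.ω ξ (S.μ j - S.μ k)) S.D from
      h.smul (continuous_chat j).continuousOn
    rcases lt_or_ge j k with hjk | hjk
    · simp only [hP0 k j hjk, zero_mul]
      exact continuousOn_const
    · refine continuousOn_const.mul (continuousOn_vertexPow S.le_half ?_)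
      rcases eq_or_lt_of_le hjk with rfl | hlt
      · exact Or.inl (sub_self _)
      · right
        rw [sub_re]
        exact sub_pos.mpr (S.condA.ordered hlt)
  have h2 : ∀ k, ∀ ξ ∈ S.D, ξ ≠ 0 → φ k ξ = (S.W k ξ)⁻¹ • S.ψ k ξ := by
    intro k ξ hξ h0
    have e1 : S.W k ξ = S.what {k} ξ * sectorPow S.ω ξ (S.μ k) := by
      have := wt_eq (S := S) h0 {k}
      simpa only [wt, muSum, Finset.prod_singleton, Finset.sum_singleton] using this
    rw [hP k ξ hξ h0, e1, mul_inv, mul_smul]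
    change (S.what {k} ξ)⁻¹ • _ = _
    congr 1
    rw [smul_sum]
    refine sum_congr rfl fun j _ => ?_
    rw [vertexPow_of_ne h0, sectorPow_sub, c, frob, smul_smul, smul_smul]
    congr 1
    field_simp
  have h3 : ∀ k, ∃ C, 0 ≤ C ∧ ∀ ξ ∈ S.D, ‖φ k ξ‖ ≤ C := by
    refine fun k => exists_bound_of_continuousOn (h1 k) (M := ∑ j, ‖Q j k‖ * N) fun ξ hξ hξ1 => ?_
    have h0 : ξ ≠ 0 := norm_pos_iff.mp (by linarith)
    rw [h2 k ξ hξ h0, W_eq_exp hξ hξ1, ← exp_neg, exp_smul_ψ_eq hQ k hξ h0]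
    refine norm_sum_le_of_le _ fun j _ => ?_
    rw [norm_smul, norm_mul]
    refine mul_le_mul ?_ ((norm_le_pi_norm (fun j => S.ehat j ξ) j).trans (hN ξ hξ hξ1))
      (norm_nonneg _) (norm_nonneg _)
    rcases lt_or_ge k j with hjk | hjk
    · simp [(hQ0 k).2 j hjk]
    · refine mul_le_of_le_one_right (norm_nonneg _) (norm_exp_le_one ?_)
      rw [mul_sub, sub_re]
      exact sub_nonpos.mpr (monotone_re hξ hjk)
  choose C hC0 hC using h3
  exact ⟨φ, h1, h2, ∑ k, C k, fun k ξ hξ => (hC k ξ hξ).trans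
    (single_le_sum (fun k _ => hC0 k) (Finset.mem_univ k))⟩

lemma exists_what_univ_bound : ∃ C, 0 ≤ C ∧ ∀ ξ ∈ S.D, ‖S.what Finset.univ ξ‖ ≤ C :=
  exists_bound_of_continuousOn (continuousOn_what _) (M := 1) fun ξ hξ h1 => by
    rw [what_univ hξ h1, norm_one]

/-- The inverse of the matrix `Ψ̃_0` extends to a bounded continuous function on the closed
sector, since its determinant is a constant divided by the product of the weights. -/
lemma exists_inverse (S : Setup n) : ∃ Z : ℂ → Matrix (Fin n) (Fin n) ℂ,
    (∀ i j, ContinuousOn (fun ξ => Z ξ i j) S.D) ∧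
    (∀ i j, ∃ M, ∀ ξ ∈ S.D, ‖Z ξ i j‖ ≤ M) ∧
    ∀ ξ ∈ S.D, ξ ≠ 0 → Z ξ = (ofCols (fun k => S.ψ k ξ) * (weightMatrix S.W ξ)⁻¹)⁻¹ ∧
      IsUnit (ofCols (fun k => S.ψ k ξ) * (weightMatrix S.W ξ)⁻¹).det := by
  obtain ⟨φ, h1, h2, M, hM⟩ := S.exists_ψ_div_weight
  obtain ⟨C, hC0, hC⟩ := exists_what_univ_bound (S := S)
  set κ := (ofCols fun j => S.ψ j S.ref).det with hκ
  have hadj : Continuous fun u : Fin n → Fin n → ℂ => (ofCols u).adjugate :=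
    continuous_ofCols.matrix_adjugate
  refine ⟨fun ξ => (S.what Finset.univ ξ / κ) • (ofCols fun k => φ k ξ).adjugate,
    fun i j => ?_, fun i j => ?_, fun ξ hξ h0 => ?_⟩
  · exact ((continuousOn_what _).div_const κ).mul ((hadj.matrix_elem i j).comp_continuousOn
      (continuousOn_pi.mpr h1))
  · obtain ⟨N, hN⟩ := (isCompact_closedBall (0 : Fin n → Fin n → ℂ)
      |M|).exists_bound_of_continuousOn
      (hadj.matrix_elem i j).continuousOn
    refine ⟨C / ‖κ‖ * N, fun ξ hξ => ?_⟩
    change ‖S.what Finset.univ ξ / κ * (ofCols fun k => φ k ξ).adjugate i j‖ ≤ _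
    rw [norm_mul, norm_div]
    refine mul_le_mul (by gcongr; exact hC ξ hξ) (hN _ ?_) (norm_nonneg _) (by positivity)
    rw [mem_closedBall_zero_iff]
    exact (pi_norm_le_iff_of_nonneg (abs_nonneg M)).mpr fun k => (hM k ξ hξ).trans (le_abs_self M)
  · have e0 : (weightMatrix S.W ξ)⁻¹ = Matrix.diagonal fun k => (S.W k ξ)⁻¹ := by
      refine Matrix.inv_eq_left_inv ?_
      rw [weightMatrix, Matrix.diagonal_mul_diagonal, ← Matrix.diagonal_one]
      exact congrArg _ (funext fun k => inv_mul_cancel₀ (S.weight.ne_zero k ξ hξ h0))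
    have e1 : ofCols (fun k => S.ψ k ξ) * (weightMatrix S.W ξ)⁻¹ = ofCols fun k => φ k ξ := by
      ext i k
      rw [e0, Matrix.mul_diagonal]
      simp only [ofCols, Matrix.of_apply, h2 k ξ hξ h0, Pi.smul_apply, smul_eq_mul]
      ring
    have e2 : (ofCols fun k => φ k ξ).det = κ / S.wt Finset.univ ξ := by
      rw [← e1, e0, Matrix.det_mul, Matrix.det_diagonal, isSol_ψ.det hξ h0, wt,
        Finset.prod_inv_distrib,
        div_eq_mul_inv]
    have e3 : (ofCols fun k => φ k ξ).det ≠ 0 := by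
      rw [e2]
      exact div_ne_zero det_ψ_ne_zero (wt_ne_zero hξ h0 _)
    rw [e1]
    refine ⟨?_, isUnit_iff_ne_zero.mpr e3⟩
    rw [Matrix.inv_def, Ring.inverse_eq_inv', e2, inv_div, ← what_univ_eq h0]

end Setup

end UnperturbedWeyl

/-! ### Fundamental tensors and solutions of the system -/

section Coordinates

variable {ι V : Type*} [Fintype ι] [NormedAddCommGroup V] [NormedSpace ℂ V]

lemma integrable_of_dual (B : Module.Basis ι ℂ V) {α : Type*} [MeasurableSpace α] {m : Measure α}
    {f : α → V}
    (h : ∀ φ : Module.Dual ℂ V, Integrable (fun t => φ (f t)) m) : Integrable f m := by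
  have e : f = fun t => ∑ i, B.coord i (f t) • B i := funext fun t => (B.sum_repr (f t)).symm
  rw [e]
  exact integrable_finsetSum _ fun i _ => (h (B.coord i)).smul_const (B i)

lemma exists_bound_of_dual (B : Module.Basis ι ℂ V) {α : Type*} {f : α → V} {g : α → ℝ} {s : Set α}
    (hg : ∀ x ∈ s, 0 ≤ g x)
    (h : ∀ φ : Module.Dual ℂ V, ∃ M : ℝ, ∀ x ∈ s, ‖φ (f x)‖ ≤ M * g x) :
    ∃ M, 0 ≤ M ∧ ∀ x ∈ s, ‖f x‖ ≤ M * g x := by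
  choose M hM using fun i => h (B.coord i)
  refine ⟨∑ i, |M i| * ‖B i‖, by positivity, fun x hx => ?_⟩
  have e : f x = ∑ i, B.coord i (f x) • B i := (B.sum_repr (f x)).symm
  rw [e, sum_mul]
  refine norm_sum_le_of_le _ fun i _ => ?_
  rw [norm_smul]
  calc _ ≤ |M i| * g x * ‖B i‖ := by
        gcongr
        exact (hM i x hx).trans (mul_le_mul_of_nonneg_right (le_abs_self _) (hg x hx))
    _ = _ := by ring

end Coordinates

section Ends

variable {E : Type*} [NormedAddCommGroup E] [NormedSpace ℂ E]

/-- The end of `(0, ∞)` that the regions of integration contain. -/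
def regionEnd (up : Bool) : Filter ℝ := if up then atTop else 𝓝[>] 0

instance (up : Bool) : (regionEnd up).NeBot := by
  cases up
  · exact inferInstanceAs (𝓝[>] (0 : ℝ)).NeBot
  · exact inferInstanceAs (atTop : Filter ℝ).NeBot

lemma eventually_regionEnd (up : Bool) {x : ℝ} (hx : 0 < x) :
    ∀ᶠ s in regionEnd up, s ∈ region up x := by
  cases up
  · exact Ioo_mem_nhdsGT hx
  · exact Ioi_mem_atTop x

lemma tendsto_intervalIntegral_regionEnd (up : Bool) {f : ℝ → E} {x : ℝ} (hx : 0 < x)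
    (hf : IntegrableOn f (region up x)) :
    Tendsto (fun s => ∫ t in s..x, f t) (regionEnd up)
      (𝓝 (Setup.sgn up • ∫ t in region up x, f t)) := by
  cases up
  · have h1 : IntegrableOn f (uIcc 0 x) := by
      rw [uIcc_of_le hx.le]
      exact (integrableOn_Icc_iff_integrableOn_Ioo).mpr hf
    have h2 := intervalIntegral.continuousOn_primitive_interval_left h1 0 left_mem_uIcc
    have e : (∫ t in (0 : ℝ)..x, f t) = Setup.sgn false • ∫ t in region false x, f t := by
      rw [intervalIntegral.integral_of_le hx.le, integral_Ioc_eq_integral_Ioo]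
      simp [Setup.sgn, region]
    rw [← e]
    refine h2.mono_left ?_
    rw [uIcc_of_le hx.le]
    exact nhdsWithin_le_of_mem (Icc_mem_nhdsGT hx)
  · have h := (intervalIntegral_tendsto_integral_Ioi x hf tendsto_id).neg
    simp only [← intervalIntegral.integral_symm] at h
    simp only [Setup.sgn, region, if_true, neg_one_smul]
    exact h

lemma primOn_region (up : Bool) {f : ℝ → E} (hf : ∀ x > 0, IntegrableOn f (region up x)) :
    PrimOn (fun x => Setup.sgn up • ∫ t in region up x, f t) f := by
  have hi : ∀ a b, 0 < a → 0 < b → IntervalIntegrable f volume a b := by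
    intro a b ha hb
    rw [intervalIntegrable_iff]
    cases up
    · have h : IntegrableOn f (Ioc 0 (max a b)) :=
        (integrableOn_Ioc_iff_integrableOn_Ioo).mpr (hf (max a b) (lt_max_of_lt_left ha))
      exact h.mono_set fun t ht => ⟨(lt_min ha hb).trans ht.1, ht.2⟩
    · exact (hf _ (lt_min ha hb)).mono_set fun t ht => ht.1
  refine ⟨hi, fun a b ha hb => ?_⟩
  have ha' := tendsto_intervalIntegral_regionEnd up ha (hf a ha)
  have hb' := tendsto_intervalIntegral_regionEnd up hb (hf b hb)
  refine tendsto_nhds_unique (hb'.sub ha') (tendsto_const_nhds.congr' ?_)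
  filter_upwards [eventually_regionEnd up ha] with s hs
  have hs0 : 0 < s := region_subset_Ioi up ha.le hs
  rw [intervalIntegral.integral_interval_sub_left (hi s b hs0 hb) (hi s a hs0 ha)]

lemma exists_bound_of_tendsto_regionEnd {F : Type*} [NormedAddCommGroup F] (up : Bool)
    {y : ℝ → F} {y₀ : F}
    (hy : ContinuousOn y (Ioi 0)) (hlim : Tendsto y (regionEnd up) (𝓝 y₀)) {x₀ : ℝ}
    (hx₀ : 0 < x₀) : ∃ M, ∀ x ∈ insert x₀ (region up x₀), ‖y x‖ ≤ M := by
  have h1 := hlim.norm.eventually_le_const (lt_add_one ‖y₀‖)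
  suffices h : ∃ a > 0, ∃ b, ∀ x ∈ insert x₀ (region up x₀), x ∈ Icc a b ∨ ‖y x‖ ≤ ‖y₀‖ + 1 by
    obtain ⟨a, ha, b, h⟩ := h
    obtain ⟨C, hC⟩ := isCompact_Icc.exists_bound_of_continuousOn
      (hy.mono fun t (ht : t ∈ Icc a b) => ha.trans_le ht.1)
    exact ⟨max C (‖y₀‖ + 1), fun x hx => (h x hx).elim
      (fun h => (hC x h).trans (le_max_left _ _)) fun h => h.trans (le_max_right _ _)⟩
  cases up
  · obtain ⟨a, ha, h⟩ := mem_nhdsGT_iff_exists_Ioc_subset.mp h1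
    refine ⟨a, ha, x₀, fun x hx => ?_⟩
    have hx2 : 0 < x ∧ x ≤ x₀ := hx.elim (fun h => ⟨h ▸ hx₀, h.le⟩) fun h => ⟨h.1, h.2.le⟩
    rcases le_total a x with hax | hax
    · exact Or.inl ⟨hax, hx2.2⟩
    · exact Or.inr (h ⟨hx2.1, hax⟩)
  · obtain ⟨b, h⟩ := eventually_atTop.mp h1
    refine ⟨x₀, hx₀, b, fun x hx => ?_⟩
    have hx2 : x₀ ≤ x := hx.elim (fun h => h.ge) fun h => le_of_lt h
    rcases le_total x b with hax | hax
    · exact Or.inl ⟨hx2, hax⟩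
    · exact Or.inr (h x hax)

end Ends

section FundamentalTensors

/-- The representative of the potential with vanishing diagonal. -/
def Potential.fn {p : ℝ≥0∞} [Fact (1 ≤ p)] (q : Potential n p) (t : ℝ) :
    Matrix (Fin n) (Fin n) ℂ := Matrix.of fun i j => q.ent i j t

namespace Setup

variable {S : Setup n} {p : ℝ≥0∞} [Fact (1 ≤ p)] {q : Potential n p} {ρ : S.D}

lemma potOp_apply (q : Potential n p) (t : ℝ) (Z : Ext n) :
    potOp q.ent t Z = derivExt (q.fn t) Z := by rw [potOp_eq]; rfl

lemma trace_fn (q : Potential n p) (t : ℝ) : (q.fn t).trace = 0 :=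
  sum_eq_zero fun i _ => q.ent_self i t

variable (S) in
/-- The integrand of the integral equations of the fundamental tensors. -/
def tensorIntegrand (m : ℕ) (q : Potential n p) (ρ : S.D) (F : ℝ → Ext n) (x t : ℝ) : Ext n :=
  green S.μ S.ω S.chat m x t ρ (derivExt (q.fn t) (F t))

variable (S) in
/-- The fundamental tensors `F_m` (`up`) and `T_{n-m+1}`, with vector-valued integrals and with the
estimate in terms of the weights. -/
structure IsTensor (up : Bool) (m : ℕ) (q : Potential n p) (ρ : S.D) (F : ℝ → Ext n) : Prop where
  mem : ∀ x > 0, F x ∈ ⋀[ℂ]^m (Fin n → ℂ)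
  integrable : ∀ x > 0, IntegrableOn (S.tensorIntegrand m q ρ F x) (region up x)
  eqn : ∀ x : ℝ, 0 < x → F x = wedge (fun j => S.sol up j (ρ * x)) (star n up m) +
    sgn up • ∫ t in region up x, S.tensorIntegrand m q ρ F x t
  bound : ∃ M : ℝ, 0 ≤ M ∧ ∀ x : ℝ, 0 < x → ‖(S.wt (star n up m) (ρ * x))⁻¹ • F x‖ ≤ M

lemma exists_inv_wt_bound (up : Bool) (m : ℕ) : ∃ C, 0 ≤ C ∧ ∀ ξ ∈ S.D, ξ ≠ 0 →
    ‖(S.wt (star n up m) ξ)⁻¹‖ * (if ‖ξ‖ ≤ 1 then ‖sectorPow S.ω ξ (S.muSum (star n up m))‖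
      else ‖exp (ξ * S.RSum (star n up m))‖) ≤ C := by
  obtain ⟨C, hC0, hC⟩ := exists_near_bound (S := S) up m
  refine ⟨max C 1, hC0.trans (le_max_left _ _), fun ξ hξ h0 => ?_⟩
  split_ifs with h1 <;> rw [← norm_mul]
  · refine le_trans (le_of_eq ?_) ((hC ξ hξ h1).2.1.trans (le_max_left _ _))
    rw [wt_eq h0, mul_inv, inv_mul_cancel_right₀ (sectorPow_ne_zero _ _)]
  · rw [wt_eq_exp hξ (le_of_not_ge h1), inv_mul_cancel₀ (exp_ne_zero _), norm_one]
    exact le_max_right _ _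

/-- The coordinatewise formulation of the integral equation implies the vector-valued one. -/
lemma isTensor_of_dual {up : Bool} {m : ℕ} (h0 : (ρ : ℂ) ≠ 0) {F : ℝ → Ext n}
    (hmem : ∀ x > 0, F x ∈ ⋀[ℂ]^m (Fin n → ℂ))
    (hint : ∀ φ : Module.Dual ℂ (Ext n), ∀ x > 0, IntegrableOn
      (fun t => φ (green S.μ S.ω S.chat m x t ρ (derivExt (q.mat t) (F t)))) (region up x))
    (heqn : ∀ φ : Module.Dual ℂ (Ext n), ∀ x > 0,
      φ (F x) = φ (wedge (fun j => S.sol up j (ρ * x)) (star n up m)) + sgn up *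
        ∫ t in region up x, φ (green S.μ S.ω S.chat m x t ρ (derivExt (q.mat t) (F t))))
    (hbound : ∀ φ : Module.Dual ℂ (Ext n), ∃ M : ℝ, ∀ x > 0, ‖φ (F x)‖ ≤ M *
      if ‖(ρ : ℂ) * x‖ ≤ 1 then ‖sectorPow S.ω (ρ * x) (S.muSum (star n up m))‖
      else ‖exp (ρ * x * S.RSum (star n up m))‖) :
    S.IsTensor up m q ρ F := by
  have hae : ∀ (φ : Module.Dual ℂ (Ext n)), ∀ x > 0,
      (fun t => φ (green S.μ S.ω S.chat m x t ρ (derivExt (q.mat t) (F t)))) =ᵐ[volume.restrict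
        (region up x)] fun t => φ (S.tensorIntegrand m q ρ F x t) := by
    intro φ x hx
    rw [EventuallyEq, ae_restrict_iff' (measurableSet_region up x)]
    filter_upwards [q.ent_ae] with t ht hm
    rw [tensorIntegrand, Potential.fn, ht (region_subset_Ioi up hx.le hm)]
  have hi : ∀ x > 0, IntegrableOn (S.tensorIntegrand m q ρ F x) (region up x) := fun x hx =>
    integrable_of_dual (extBasis n) fun φ => (hint φ x hx).congr (hae φ x hx)
  refine ⟨hmem, hi, fun x hx => ?_, ?_⟩
  · refine (extBasis n).ext_elem fun i => ?_
    have h := heqn ((extBasis n).coord i) x hx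
    rw [integral_congr_ae (hae _ x hx)] at h
    have h2 := (LinearMap.toContinuousLinearMap ((extBasis n).coord i)).integral_comp_comm (hi x hx)
    simp only [LinearMap.coe_toContinuousLinearMap'] at h2
    rw [h2] at h
    change (extBasis n).coord i _ = (extBasis n).coord i _
    rw [map_add, map_smul]
    exact h
  · obtain ⟨C, hC0, hC⟩ := exists_inv_wt_bound (S := S) up m
    obtain ⟨M, hM0, hM⟩ := exists_bound_of_dual (extBasis n) (s := Ioi 0)
      (fun x _ => by split_ifs <;> positivity) hbound
    refine ⟨M * C, by positivity, fun x hx => ?_⟩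
    rw [norm_smul]
    refine (mul_le_mul_of_nonneg_left (hM x hx) (norm_nonneg _)).trans ?_
    rw [mul_left_comm]
    exact mul_le_mul_of_nonneg_left (hC _ (mul_mem_D ρ.2 (le_of_lt hx))
      (mul_ofReal_ne_zero h0 hx)) hM0

lemma isTensor_of_F (h0 : (ρ : ℂ) ≠ 0) {m : ℕ} {F : ℝ → Ext n}
    (hF : IsTensorF S.b S.μ S.ω S.σ S.chat S.e q.mat ρ m F) : S.IsTensor true m q ρ F :=
  isTensor_of_dual h0 hF.mem hF.integrable
    (fun φ x hx => by rw [hF.eqn φ x hx, sub_eq_add_neg, ← neg_one_mul]; rfl) hF.bound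

lemma star_false (k : Fin n) : star n false (n - k) = Finset.univ.filter (k ≤ ·) := by
  have h : n - (n - (k : ℕ)) = k := Nat.sub_sub_self k.2.le
  simp only [star, Bool.false_eq_true, if_false, h, Fin.le_def]

lemma isTensor_of_T (h0 : (ρ : ℂ) ≠ 0) {k : Fin n} {T : ℝ → Ext n}
    (hT : IsTensorT S.b S.μ S.ω S.σ S.chat q.mat ρ k T) : S.IsTensor false (n - k) q ρ T := by
  refine isTensor_of_dual h0 hT.mem
    (fun φ x hx => (hT.integrable φ x hx).mono_set Ioo_subset_Ioc_self) (fun φ x hx => ?_) ?_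
  · rw [hT.eqn φ x hx, star_false, integral_Ioc_eq_integral_Ioo]
    simp only [sgn, Bool.false_eq_true, if_false, one_mul]
    rfl
  · rw [star_false]
    exact hT.bound

lemma kernel_derivExt (up : Bool) (m : ℕ) {x t : ℝ} (hx : 0 < x) (ht : 0 < t)
    (h0 : (ρ : ℂ) ≠ 0) (V : Matrix (Fin n) (Fin n) ℂ) (Z : Ext n) :
    S.kernel up m x t ρ (derivExt V ((S.wt (star n up m) (ρ * t))⁻¹ • Z)) =
      (S.wt (star n up m) (ρ * x))⁻¹ • green S.μ S.ω S.chat m x t ρ (derivExt V Z) := by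
  rw [kernel_eq_green up m hx ht h0, derivExt_smul, green_eq_transfer, green_eq_transfer,
    transfer_smul, smul_smul, div_mul_eq_mul_div,
    mul_inv_cancel₀ (wt_ne_zero (mul_mem_D ρ.2 ht.le) (mul_ofReal_ne_zero h0 ht) _), one_div]

/-- The fundamental tensors are determined by their integral equations. -/
lemma IsTensor.eq {up : Bool} {m : ℕ} (hm : m ≤ n) (h0 : (ρ : ℂ) ≠ 0) {F : ℝ → Ext n}
    (hF : S.IsTensor up m q ρ F) {Y : Potential n p → ℝ≥0 → S.D → Ext n}
    (hY : S.IsTensorFamily up m Y) {x : ℝ} (hx : 0 < x) :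
    (S.wt (star n up m) (ρ * x))⁻¹ • F x = Y q x.toNNReal ρ := by
  obtain ⟨C, hC⟩ : ∃ C, IsVolterraKernel up (S.skernel up m) C := exists_isVolterraKernel S up hm
  have hQ := integrableOn_potOp q.integrableOn_ent
  obtain ⟨M, hM0, hM⟩ := hF.bound
  obtain ⟨N, hN0, hN⟩ := hY.bdd q
  have hker : ∀ x > 0, ∀ t ∈ region up x, S.skernel up m x.toNNReal t ρ (potOp q.ent t
      ((S.wt (star n up m) (ρ * t))⁻¹ • F t)) =
      (sgn up * (S.wt (star n up m) (ρ * x))⁻¹) • S.tensorIntegrand m q ρ F x t := by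
    intro x hx t ht
    have ht0 : 0 < t := region_subset_Ioi up hx.le ht
    rw [potOp_apply, skernel, smul_apply, coe_toNNReal x hx.le, kernel_derivExt up m hx ht0 h0,
      smul_smul]
    rfl
  rw [← sub_eq_zero]
  refine hC.eq_zero hQ (ρ := ρ) (y := fun x => (S.wt (star n up m) (ρ * x))⁻¹ • F x -
    Y q x.toNNReal ρ) hx (M := M + N) (fun y hy => ?_) fun x hx => ?_
  · have hy0 : 0 < y := hy.elim (fun h => h ▸ hx) fun h => region_subset_Ioi up hx.le h
    exact norm_sub_le_of_le (hM y hy0) (hN _ _)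
  · have h1 := hF.eqn x hx
    have h2 := hY.eqn q x.toNNReal ρ
    rw [volterra] at h2
    have i2 := integrableOn_skernel up hm hQ (hY.cont q) (hN) x.toNNReal ρ
    rw [coe_toNNReal x hx.le] at h2 i2
    have i1 : IntegrableOn (fun t => S.skernel up m x.toNNReal t ρ (potOp q.ent t
        ((S.wt (star n up m) (ρ * t))⁻¹ • F t))) (region up x) :=
      IntegrableOn.congr_fun ((hF.integrable x hx).smul (sgn up * (S.wt (star n up m) (ρ * x))⁻¹))
        (fun t ht => (hker x hx t ht).symm) (measurableSet_region up x)
    simp only [map_sub]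
    rw [integral_sub i1 i2, setIntegral_congr_fun (measurableSet_region up x) (hker x hx),
      integral_smul]
    rw [h1, h2, base_eq up hm (mul_mem_D ρ.2 hx.le) (mul_ofReal_ne_zero h0 hx), smul_add,
      smul_smul, mul_comm (sgn up)]
    abel

end Setup

end FundamentalTensors

section ExteriorSolutions

lemma PrimOn.smul_ext {A a : ℝ → ℂ} {Z k : ℝ → Ext n} (hA : PrimOn A a) (hZ : PrimOn Z k) :
    PrimOn (fun t => A t • Z t) (fun t => a t • Z t + A t • k t) := by
  have h := (hA.clm ((algebraMapCLM ℂ (Ext n)).restrictScalars ℝ)).mul hZ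
  refine (h.congr_left fun t _ => by
    rw [Algebra.smul_def]; rfl).congr_ae
    (.of_forall fun t _ => ?_)
  rw [Algebra.smul_def, Algebra.smul_def]
  rfl

namespace Setup

variable {S : Setup n} {p : ℝ≥0∞} [Fact (1 ≤ p)] {q : Potential n p} {ρ : S.D}

variable (S) in
/-- The coefficient matrix of the unperturbed system with the spectral parameter. -/
def coefM (ρ : ℂ) (t : ℝ) : Matrix (Fin n) (Fin n) ℂ :=
  (t : ℂ)⁻¹ • S.A + ρ • Matrix.diagonal S.b

lemma trace_coefM (ρ : ℂ) (t : ℝ) : (S.coefM ρ t).trace = 0 := by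
  have h1 : S.A.trace = 0 := sum_eq_zero fun i _ => S.condA.offDiag i
  rw [coefM, Matrix.trace_add, Matrix.trace_smul, Matrix.trace_smul, h1, Matrix.trace_diagonal,
    S.condB.sum_eq_zero]
  simp

variable (S) in
/-- Solutions of the equation that the system induces in the exterior algebra. -/
def SolvesExt (q : Potential n p) (ρ : S.D) (Z : ℝ → Ext n) : Prop :=
  PrimOn Z fun t => derivExt (S.coefM ρ t) (Z t) + derivExt (q.fn t) (Z t)

lemma SolvesExt.mul {Y Z : ℝ → Ext n} (hY : S.SolvesExt q ρ Y) (hZ : S.SolvesExt q ρ Z) :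
    S.SolvesExt q ρ fun t => Y t * Z t := by
  refine (PrimOn.mul hY hZ).congr_ae (.of_forall fun t _ => ?_)
  simp only [derivExt_mul]
  noncomm_ring

lemma SolvesExt.sub {Y Z : ℝ → Ext n} (hY : S.SolvesExt q ρ Y) (hZ : S.SolvesExt q ρ Z) :
    S.SolvesExt q ρ fun t => Y t - Z t := by
  refine (PrimOn.sub hY hZ).congr_ae (.of_forall fun t _ => ?_)
  have h : ∀ V : Matrix (Fin n) (Fin n) ℂ, derivExt V (Y t - Z t) = derivExt V (Y t) -
    derivExt V (Z t) := fun V => map_sub (derivExtₗ V) _ _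
  simp only [h]
  abel

lemma SolvesExt.topCoeff_eq {Z : ℝ → Ext n} (hZ : S.SolvesExt q ρ Z) {a b : ℝ} (ha : 0 < a)
    (hb : 0 < b) : topCoeff n (Z a) = topCoeff n (Z b) := by
  have h : PrimOn (fun t => topCoeff n (Z t)) fun _ => 0 :=
    (PrimOn.clm hZ ((topL n).restrictScalars ℝ)).congr_ae (.of_forall fun t _ => by
      change topCoeff n (_ + _) = 0
      rw [map_add, topCoeff_derivExt, topCoeff_derivExt, trace_coefM, trace_fn]
      simp)
  exact h.eq_of_zero ha hb

lemma primOn_wedge {u : Fin n → ℂ → Fin n → ℂ} (hu : S.IsSol u) {ρ : S.D} (h0 : (ρ : ℂ) ≠ 0)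
    (α : Finset (Fin n)) : PrimOn (fun t : ℝ => wedge (fun j => u j (ρ * t)) α)
      fun t => derivExt (S.coefM ρ t) (wedge (fun j => u j (ρ * t)) α) := by
  have hd : ∀ t : ℝ, 0 < t → HasDerivAt (fun t : ℝ => wedge (fun j => u j (ρ * t)) α)
      (derivExt (S.coefM ρ t) (wedge (fun j => u j (ρ * t)) α)) t := by
    intro t ht
    have ht0 := mul_ofReal_ne_zero h0 ht
    have h1 := hasDerivWithinAt_wedge (fun j => hu j _ (mul_mem_D ρ.2 ht.le) ht0) α
    have h2 : HasDerivWithinAt (fun t : ℝ => (ρ : ℂ) * t) ρ (Ioi 0) t := by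
      simpa using ((Complex.ofRealCLM.hasDerivAt (x := t)).const_mul (ρ : ℂ)).hasDerivWithinAt
    have h3 := HasDerivWithinAt.scomp t h1 h2 fun s hs => mul_mem_D ρ.2 (le_of_lt hs)
    refine (h3.hasDerivAt (Ioi_mem_nhds ht)).congr_deriv ?_
    rw [← derivExtₗ_apply, ← derivExtₗ_apply, ← LinearMap.smul_apply, ← map_smul]
    have ht' : (t : ℂ) ≠ 0 := by exact_mod_cast ht.ne'
    congr 2
    rw [coefM, smul_add, smul_smul, mul_inv, mul_inv_cancel_left₀ h0]
  refine PrimOn.of_hasDerivAt hd ?_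
  have hc : ContinuousOn (fun t : ℝ => wedge (fun j => u j (ρ * t)) α) (Ioi 0) := fun t ht =>
    (hd t ht).continuousAt.continuousWithinAt
  have hi : ContinuousOn (fun t : ℝ => (t : ℂ)⁻¹) (Ioi 0) :=
    (Complex.continuous_ofReal.continuousOn).inv₀ fun t ht => by exact_mod_cast (ne_of_gt ht)
  have h1 := (hi.smul ((derivL S.A).continuous.comp_continuousOn hc)).add
    ((derivL ((ρ : ℂ) • Matrix.diagonal S.b)).continuous.comp_continuousOn hc)
  refine h1.congr fun t _ => ?_
  rw [coefM, derivExt_add_left, ← derivExtₗ_apply, map_smul]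
  rfl

lemma topCoeff_transfer_mul_compl {m : ℕ} {u v : Fin n → Fin n → ℂ} (hv : (ofCols v).det = 1)
    {α : Finset (Fin n)} (hα : α.card = m) (f : Ext n) :
    topCoeff n (transfer m u v f * wedge v αᶜ) = topCoeff n (f * wedge u αᶜ) := by
  rw [transfer, sum_mul, Finset.sum_eq_single α]
  · rw [smul_mul_assoc, map_smul, topCoeff_wedge_mul_compl, hv, smul_eq_mul, mul_one,
      mul_right_comm,
      shuffleSign_mul_self, one_mul]
  · intro β hβ hne
    rw [smul_mul_assoc, wedge_mul_compl_of_ne v (hα.trans (mem_powersetCard.mp hβ).2.symm) hne,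
      smul_zero]
  · intro h
    exact absurd (mem_powersetCard.mpr ⟨Finset.subset_univ _, hα⟩) h

/-- Fundamental tensors are solutions. -/
lemma IsTensor.solves {up : Bool} {m : ℕ} (h0 : (ρ : ℂ) ≠ 0) {F : ℝ → Ext n}
    (hF : S.IsTensor up m q ρ F) : S.SolvesExt q ρ F := by
  let a : Finset (Fin n) → ℝ → ℂ := fun α t => shuffleSign α *
    topCoeff n (derivExt (q.fn t) (F t) * wedge (fun j => S.c j (ρ * t)) αᶜ)
  have hsum : ∀ x t, S.tensorIntegrand m q ρ F x t = ∑ α ∈ Finset.powersetCard m .univ,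
        a α t • wedge (fun j => S.c j (ρ * x)) α := fun x t => by
    rw [tensorIntegrand, green_eq_transfer]; rfl
  have hdet : ∀ x : ℝ, 0 < x → (ofCols fun j => S.c j (ρ * x)).det = 1 := fun x hx =>
    det_c (mul_mem_D ρ.2 hx.le) (mul_ofReal_ne_zero h0 hx)
  have ha : ∀ α ∈ Finset.powersetCard m .univ, ∀ x > 0, IntegrableOn (a α) (region up x) := by
    intro α hα x hx
    have h1 := (((topMul n (wedge (fun j => S.c j (ρ * x)) αᶜ)).integrable_comp
      (hF.integrable x hx)).const_mul (shuffleSign α))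
    refine h1.congr (.of_forall fun t => ?_)
    simp only [topMul_apply]
    rw [tensorIntegrand, green_eq_transfer,
      topCoeff_transfer_mul_compl (hdet x hx) (mem_powersetCard.mp hα).2]
  have h1 := PrimOn.sum (Finset.powersetCard m .univ) fun α hα =>
    (primOn_region up (ha α hα)).smul_ext (primOn_wedge (isSol_c (S := S)) h0 α)
  have hrep : ∀ x : ℝ, 0 < x → wedge (fun j => S.sol up j (ρ * x)) (star n up m) +
      ∑ α ∈ Finset.powersetCard m .univ,
        (sgn up • ∫ t in region up x, a α t) • wedge (fun j => S.c j (ρ * x)) α = F x := by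
    intro x hx
    rw [hF.eqn x hx]
    simp only [hsum]
    rw [integral_finsetSum _ fun α hα => (ha α hα x hx).smul_const _, smul_sum]
    simp only [integral_smul_const, smul_assoc]
  refine (((primOn_wedge (isSol_sol up) h0 (star n up m)).add h1).congr_left hrep).congr_ae
    (.of_forall fun t ht => ?_)
  have h2 := congrArg (derivExtₗ (S.coefM ρ t)) (hrep t ht)
  simp only [map_add, map_sum, map_smul, derivExtₗ_apply] at h2
  rw [← h2, sum_add_distrib, ← hsum, tensorIntegrand, green_eq_transfer,
    transfer_self (by rw [hdet t ht]; exact one_ne_zero) (derivExt_mem _ (hF.mem t ht)), hdet t ht,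
    one_smul]
  abel

/-- Variation of constants: the operator `G_m(x, t)` turns a solution into a primitive. -/
lemma SolvesExt.primOn_transfer {Z : ℝ → Ext n} (hZ : S.SolvesExt q ρ Z) (h0 : (ρ : ℂ) ≠ 0)
    (m : ℕ) (v : Fin n → Fin n → ℂ) :
    PrimOn (fun t => transfer m (fun j => S.c j (ρ * t)) v (Z t))
      fun t => transfer m (fun j => S.c j (ρ * t)) v (derivExt (q.fn t) (Z t)) := by
  refine PrimOn.sum _ fun α _ => ?_
  have h1 := (PrimOn.mul hZ (primOn_wedge (isSol_c (S := S)) h0 αᶜ)).clm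
    (((ContinuousLinearMap.toSpanSingleton ℂ (shuffleSign α • wedge v α)).comp
      (topL n)).restrictScalars ℝ)
  refine (h1.congr_left fun t _ => ?_).congr_ae (.of_forall fun t _ => ?_)
  · change topCoeff n (Z t * wedge (fun j => S.c j (ρ * t)) αᶜ) • shuffleSign α • wedge v α = _
    rw [smul_smul, mul_comm]
  · have e : (derivExt (S.coefM ρ t) (Z t) + derivExt (q.fn t) (Z t)) *
        wedge (fun j => S.c j (ρ * t)) αᶜ +
        Z t * derivExt (S.coefM ρ t) (wedge (fun j => S.c j (ρ * t)) αᶜ) =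
        derivExt (S.coefM ρ t) (Z t * wedge (fun j => S.c j (ρ * t)) αᶜ) +
          derivExt (q.fn t) (Z t) * wedge (fun j => S.c j (ρ * t)) αᶜ := by
      rw [derivExt_mul]; noncomm_ring
    rw [e]
    change topCoeff n (_ + _) • shuffleSign α • wedge v α = _
    rw [map_add, topCoeff_derivExt, trace_coefM, zero_mul, zero_add, smul_smul, mul_comm]

lemma continuousOn_wt_ray (h0 : (ρ : ℂ) ≠ 0) (α : Finset (Fin n)) :
    ContinuousOn (fun x : ℝ => (S.wt α (ρ * x))⁻¹) (Ioi 0) :=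
  ((continuousOn_wt α).comp (by fun_prop) fun x (hx : 0 < x) =>
    ⟨mul_mem_D ρ.2 hx.le, mul_ofReal_ne_zero h0 hx⟩).inv₀ fun x (hx : 0 < x) =>
      wt_ne_zero (mul_mem_D ρ.2 hx.le) (mul_ofReal_ne_zero h0 hx) α

/-- A solution of degree `m` that is small in comparison with the weight at one end vanishes,
since it solves a homogeneous Volterra equation. -/
lemma SolvesExt.eq_zero {up : Bool} {m : ℕ} (hm : m ≤ n) (h0 : (ρ : ℂ) ≠ 0) {Z : ℝ → Ext n}
    (hZ : S.SolvesExt q ρ Z) (hmem : ∀ x > 0, Z x ∈ ⋀[ℂ]^m (Fin n → ℂ))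
    (hlim : Tendsto (fun x : ℝ => (S.wt (star n up m) (ρ * x))⁻¹ • Z x) (regionEnd up) (𝓝 0))
    {x : ℝ} (hx : 0 < x) : Z x = 0 := by
  obtain ⟨C, hC⟩ : ∃ C, IsVolterraKernel up (S.skernel up m) C := exists_isVolterraKernel S up hm
  have hQ := integrableOn_potOp q.integrableOn_ent
  set y : ℝ → Ext n := fun x => (S.wt (star n up m) (ρ * x))⁻¹ • Z x with hy
  have hyc : ContinuousOn y (Ioi 0) := (continuousOn_wt_ray h0 _).smul (PrimOn.continuousOn hZ)
  have hbd := fun x₀ (hx₀ : 0 < x₀) => exists_bound_of_tendsto_regionEnd up hyc hlim hx₀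
  obtain ⟨M, hM⟩ := hbd x hx
  have hz : y x = 0 := by
    refine hC.eq_zero hQ (ρ := ρ) hx hM fun x hx => ?_
    obtain ⟨N, hN⟩ := hbd x hx
    have hi : IntegrableOn (fun t => S.kernel up m x t ρ (derivExt (q.fn t) (y t)))
      (region up x) := by
      have h1 := (hC.integrableOn hQ (x := x.toNNReal) (ρ := ρ) (v := y)
        (hyc.mono (region_subset_Ioi up x.toNNReal.2)) (M := N) fun t ht =>
          hN t (mem_insert_of_mem _ (by rwa [coe_toNNReal x hx.le] at ht)))
      rw [coe_toNNReal x hx.le] at h1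
      refine (h1.smul (sgn up)).congr (.of_forall fun t => ?_)
      simp only [Pi.smul_apply, skernel, smul_apply, smul_smul, sgn_mul_self, one_smul,
        coe_toNNReal x hx.le, potOp_apply]
    have hprim : ∀ s > 0, y x - S.kernel up m x s ρ (y s) =
        ∫ t in s..x, S.kernel up m x t ρ (derivExt (q.fn t) (y t)) := by
      intro s hs
      have hk : ∀ t > 0, ∀ f : Ext n, S.kernel up m x t ρ ((S.wt (star n up m) (ρ * t))⁻¹ • f) =
          (S.wt (star n up m) (ρ * x))⁻¹ •
            transfer m (fun j => S.c j (ρ * t)) (fun j => S.c j (ρ * x)) f := by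
        intro t ht f
        rw [kernel_eq_green up m hx ht h0, green_eq_transfer, transfer_smul, smul_smul,
          div_mul_eq_mul_div, mul_inv_cancel₀ (wt_ne_zero (mul_mem_D ρ.2 (le_of_lt ht))
            (mul_ofReal_ne_zero h0 ht) _), one_div]
      have h1 := (hZ.primOn_transfer h0 m fun j => S.c j (ρ * x)).eq s x hs hx
      have hdet := det_c (mul_mem_D ρ.2 hx.le) (mul_ofReal_ne_zero h0 hx)
      rw [transfer_self (by rw [hdet]; exact one_ne_zero) (hmem x hx), hdet, one_smul] at h1
      have h2 := congrArg (fun f => (S.wt (star n up m) (ρ * x))⁻¹ • f) h1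
      simp only [smul_sub] at h2
      rw [← hk s hs, ← intervalIntegral.integral_smul] at h2
      rw [h2]
      refine intervalIntegral.integral_congr fun t ht => ?_
      have ht0 : 0 < t := lt_of_lt_of_le (lt_min hs hx) ht.1
      simp only [hy, derivExt_smul]
      exact (hk t ht0 _).symm
    have hlim1 : Tendsto (fun s => y x - S.kernel up m x s ρ (y s)) (regionEnd up)
      (𝓝 (y x - 0)) := by
      refine tendsto_const_nhds.sub (squeeze_zero_norm' ?_ (a := fun s => C * ‖y s‖)
        (by simpa using hlim.norm.const_mul C))
      filter_upwards [eventually_regionEnd up hx] with s hs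
      have h1 := hC.bound x.toNNReal s (by rwa [coe_toNNReal x hx.le]) ρ
      rw [skernel, norm_smul, norm_sgn, one_mul, coe_toNNReal x hx.le] at h1
      exact ContinuousLinearMap.le_of_opNorm_le _ h1 _
    have h3 := tendsto_nhds_unique (hlim1.congr' ?_) (tendsto_intervalIntegral_regionEnd up hx hi)
    · rw [sub_zero] at h3
      rw [h3, ← integral_smul]
      refine integral_congr_ae (.of_forall fun t => ?_)
      simp only [skernel, smul_apply, potOp_apply, coe_toNNReal x hx.le]
    · filter_upwards [eventually_regionEnd up hx] with s hs
      exact hprim s (region_subset_Ioi up hx.le hs)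
  exact (smul_eq_zero_iff_right (inv_ne_zero (wt_ne_zero (mul_mem_D ρ.2 hx.le)
    (mul_ofReal_ne_zero h0 hx) _))).mp hz

end Setup

end ExteriorSolutions

/-! ### Weyl-type solutions and fundamental tensors -/

section WeylType

namespace Setup

variable {S : Setup n} {p : ℝ≥0∞} [Fact (1 ≤ p)] {q : Potential n p} {ρ : S.D}

/-- Weyl-type solutions are solutions of degree one in the exterior algebra. -/
lemma solvesExt_of_isWeylType {k : Fin n} {y : ℝ → Fin n → ℂ}
    (hy : IsWeylType S.A S.b S.μ S.σ q.mat ρ k y) :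
    S.SolvesExt q ρ fun t => ι ℂ (y t) := by
  let V : ℝ → Matrix (Fin n) (Fin n) ℂ := fun t =>
    (t : ℂ)⁻¹ • S.A + q.mat t + (ρ : ℂ) • Matrix.diagonal S.b
  have hV : ∀ i j a b, 0 < a → 0 < b → IntervalIntegrable (fun t => V t i j) volume a b := by
    intro i j a b ha hb
    have hsub : uIcc a b ⊆ Ioi 0 := fun t ht => lt_of_lt_of_le (lt_min ha hb) ht.1
    have h1 : IntervalIntegrable (fun t : ℝ => (t : ℂ)⁻¹ * S.A i j) volume a b :=
      ContinuousOn.intervalIntegrable (((Complex.continuous_ofReal.continuousOn).inv₀ fun t ht => by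
        exact_mod_cast (ne_of_gt (hsub ht))).mul continuousOn_const)
    have h2 : IntervalIntegrable (fun t => q.mat t i j) volume a b :=
      intervalIntegrable_iff.mpr ((L1.integrable_coeFn (q.1 i j).1).mono_measure
        (Measure.restrict_mono (uIoc_subset_uIcc.trans hsub) le_rfl))
    have h3 : IntervalIntegrable (fun _ : ℝ => (ρ : ℂ) * Matrix.diagonal S.b i j) volume a b :=
      intervalIntegrable_const
    exact (h1.add h2).add h3
  have hprim : PrimOn y fun t => (V t).mulVec (y t) := by
    have hi : ∀ a b, 0 < a → 0 < b →
        IntervalIntegrable (fun t => (V t).mulVec (y t)) volume a b := by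
      intro a b ha hb
      have hsub : uIcc a b ⊆ Ioi 0 := fun t ht => lt_of_lt_of_le (lt_min ha hb) ht.1
      refine intervalIntegrable_iff.mpr (Integrable.of_eval fun i => ?_)
      simp only [Matrix.mulVec, dotProduct]
      refine integrable_finsetSum Finset.univ (f := fun j t => V t i j * y t j) fun j _ => ?_
      exact intervalIntegrable_iff.mp ((hV i j a b ha hb).mul_continuousOn
        ((continuous_apply j).comp_continuousOn (hy.continuousOn.mono hsub)))
    refine ⟨hi, fun a b ha hb => ?_⟩
    rcases le_total a b with hab | hab
    · exact hy.eqn a ha b hab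
    · rw [intervalIntegral.integral_symm, ← hy.eqn b hb a hab, neg_sub]
  refine (hprim.clm ((ιL n).restrictScalars ℝ)).congr_ae ?_
  filter_upwards [q.ent_ae] with t ht h0
  change ι ℂ ((V t).mulVec (y t)) = _
  have e : V t = S.coefM ρ t + q.fn t := by
    rw [Potential.fn, ht h0, coefM]
    simp only [V]
    abel
  rw [e, ← derivExt_ι, derivExt_add_left]

lemma IsTensor.eq_wedge {up : Bool} {m : ℕ} {F : ℝ → Ext n} (hF : S.IsTensor up m q ρ F)
    (h : ∀ t > 0, derivExt (q.fn t) (F t) = 0) {x : ℝ} (hx : 0 < x) :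
    F x = wedge (fun j => S.sol up j (ρ * x)) (star n up m) := by
  rw [hF.eqn x hx, setIntegral_congr_fun (measurableSet_region up x) (g := fun _ => 0) fun t ht =>
    ?_,
    integral_zero, smul_zero, add_zero]
  simp only [tensorIntegrand]
  rw [h t (region_subset_Ioi up hx.le ht), green_eq_transfer]
  simp [transfer]

lemma IsTensor.topCoeff_mul_ne_zero {F : ℕ → ℝ → Ext n} {T : Fin n → ℝ → Ext n} {k : Fin n}
    (h0 : (ρ : ℂ) ≠ 0) (hF : S.IsTensor true k q ρ (F k)) (hT : S.IsTensor false (n - k) q ρ (T k))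
    (hΔ : ∃ x > 0, charFun F T k x ≠ 0) {x : ℝ} (hx : 0 < x) :
    topCoeff n (F k x * T k x) ≠ 0 := by
  obtain ⟨x₁, hx₁, h1⟩ := hΔ
  rw [charFun] at h1
  split_ifs at h1 with hk
  · have eF : F k x = 1 := by
      rw [hF.eq_wedge (fun t ht => ?_) hx]
      · simp [star, hk]
      · have hm := hF.mem t ht
        rw [hk] at hm
        obtain ⟨a, ha⟩ := eq_smul_one_of_mem_zero hm
        rw [hk, ha, derivExt_smul, derivExt_one, smul_zero]
    have eT : T k x = wedge (fun j => S.c j (ρ * x)) Finset.univ := by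
      rw [hT.eq_wedge (fun t ht => ?_) hx]
      · simp [star, hk, sol]
      · have hm := hT.mem t ht
        rw [hk, Nat.sub_zero] at hm
        rw [derivExt_of_mem_top _ hm, trace_fn, zero_smul]
    rw [eF, eT, one_mul, topCoeff_wedge_univ, det_c (mul_mem_D ρ.2 hx.le)
      (mul_ofReal_ne_zero h0 hx)]
    exact one_ne_zero
  · rwa [((hF.solves h0).mul (hT.solves h0)).topCoeff_eq hx hx₁]

lemma eventually_one_le_norm_mul (h0 : (ρ : ℂ) ≠ 0) :
    ∀ᶠ x : ℝ in atTop, 0 < x ∧ 1 ≤ ‖(ρ : ℂ) * x‖ := by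
  filter_upwards [eventually_gt_atTop 0, eventually_ge_atTop ‖(ρ : ℂ)‖⁻¹] with x hx h
  refine ⟨hx, ?_⟩
  rw [norm_mul, norm_real, norm_of_nonneg hx.le]
  calc (1 : ℝ) = ‖(ρ : ℂ)‖ * ‖(ρ : ℂ)‖⁻¹ := (mul_inv_cancel₀ (norm_ne_zero_iff.mpr h0)).symm
    _ ≤ _ := by gcongr

/-- The normalised tensors `F_m` tend to `𝔣_1 ∧ … ∧ 𝔣_m` at infinity. -/
lemma IsTensor.tendsto_atTop {m : ℕ} (hm : m ≤ n) (h0 : (ρ : ℂ) ≠ 0) {F : ℝ → Ext n}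
    (hF : S.IsTensor true m q ρ F) :
    Tendsto (fun x : ℝ => (S.wt (star n true m) (ρ * x))⁻¹ • F x) atTop
      (𝓝 (wedge S.fvec (star n true m))) := by
  obtain ⟨Y, hY⟩ := exists_isTensorFamily (p := p) S true hm
  obtain ⟨C, hC⟩ : ∃ C, IsVolterraKernel true (S.skernel true m) C :=
    exists_isVolterraKernel S true hm
  obtain ⟨M, hM0, hM⟩ := hY.bdd q
  have hQ := integrableOn_potOp q.integrableOn_ent
  have hi : IntegrableOn (fun t => C * ‖potOp q.ent t‖ * M) (Ioi 0) :=
    (hQ.norm.const_mul C).mul_const M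
  have htail : Tendsto (fun x : ℝ => ∫ t in Ioi x, C * ‖potOp q.ent t‖ * M) atTop (𝓝 0) := by
    have h1 := (intervalIntegral_tendsto_integral_Ioi 0 hi tendsto_id).const_sub
      (∫ t in Ioi 0, C * ‖potOp q.ent t‖ * M)
    rw [sub_self] at h1
    refine h1.congr' ?_
    filter_upwards [eventually_ge_atTop 0] with x hx
    simp only [id]
    rw [← intervalIntegral.integral_Ioi_sub_Ioi hi hx, sub_sub_cancel]
  have hbase : Tendsto (fun x : ℝ => S.base true m (ρ * x)) atTop
      (𝓝 (wedge S.fvec (star n true m))) := by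
    have h1 := ((continuous_wedge (star n true m)).tendsto _).comp
      (tendsto_pi_nhds.mpr fun j => tendsto_ehat ρ.2 h0 j)
    refine h1.congr' ?_
    filter_upwards [eventually_one_le_norm_mul h0] with x hx
    have hD := mul_mem_D ρ.2 hx.1.le
    rw [base_eq true hm hD (mul_ofReal_ne_zero h0 hx.1), wt_eq_exp hD hx.2]
    change _ = _ • wedge (fun j => S.e j (ρ * x)) _
    rw [wedge_e, smul_smul, inv_mul_cancel₀ (exp_ne_zero _), one_smul]
    rfl
  have hsum := hbase.add (squeeze_zero_norm' (f := fun x : ℝ =>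
    volterra true (S.skernel true m) (potOp q.ent) (Y q) x.toNNReal ρ) ?_ htail)
  · rw [add_zero] at hsum
    refine hsum.congr' ?_
    filter_upwards [eventually_gt_atTop 0] with x hx
    rw [hF.eq hm h0 hY hx, hY.eqn q x.toNNReal ρ, coe_toNNReal x hx.le]
  · filter_upwards [eventually_ge_atTop 0] with x hx
    have h1 := hC.norm_integral_le (Q := potOp q.ent) (x := x.toNNReal) (ρ := ρ)
      (v := fun t => Y q t.toNNReal ρ) (b := fun _ => M) (fun t _ => hM _ _)
      (hi.mono_set (region_subset_Ioi true x.toNNReal.2))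
    rw [coe_toNNReal x hx] at h1
    rw [volterra, coe_toNNReal x hx]
    exact h1

lemma tendsto_weyl_atTop (h0 : (ρ : ℂ) ≠ 0) {k : Fin n} {y : ℝ → Fin n → ℂ}
    (hy : IsWeylType S.A S.b S.μ S.σ q.mat ρ k y) :
    Tendsto (fun x : ℝ => (S.W k (ρ * x))⁻¹ • y x) atTop (𝓝 (S.fvec k)) := by
  refine hy.infty.congr' ?_
  filter_upwards [eventually_one_le_norm_mul h0] with x hx
  rw [W_eq_exp (mul_mem_D ρ.2 hx.1.le) hx.2, ← exp_neg, R]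
  congr 3
  ring

lemma tendsto_weyl_zero (h0 : (ρ : ℂ) ≠ 0) {j k : Fin n} (hjk : j < k) {y : ℝ → Fin n → ℂ}
    (hy : IsWeylType S.A S.b S.μ S.σ q.mat ρ k y) :
    Tendsto (fun x : ℝ => (S.W j (ρ * x))⁻¹ • y x) (𝓝[>] 0) (𝓝 0) := by
  have hν : 0 < (S.μ k - S.μ j).re := by
    rw [sub_re]; exact sub_pos.mpr (S.condA.ordered hjk)
  have hpath : Tendsto (fun x : ℝ => (ρ : ℂ) * x) (𝓝[>] 0) (𝓝[S.D \ {0}] 0) := by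
    refine tendsto_nhdsWithin_iff.mpr ⟨?_, ?_⟩
    · have : Continuous fun x : ℝ => (ρ : ℂ) * x := by fun_prop
      simpa using (this.tendsto 0).mono_left nhdsWithin_le_nhds
    · filter_upwards [self_mem_nhdsWithin] with x hx
      exact ⟨mul_mem_D ρ.2 (le_of_lt hx), mul_ofReal_ne_zero h0 hx⟩
  obtain ⟨C, hC⟩ := hy.zero.bound
  have h1 := ((S.weight.zero j).comp hpath).inv₀ one_ne_zero
  have h2 := (tendsto_norm_sectorPow S.ω S.h hν).comp hpath
  have h3 := h1.norm.mul (h2.const_mul (C * ‖sectorPow S.ω (ρ : ℂ) (S.μ k)‖⁻¹))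
  rw [mul_zero, mul_zero] at h3
  refine squeeze_zero_norm' ?_ h3
  filter_upwards [hC, self_mem_nhdsWithin] with x hx hx0
  have e : ‖(x : ℂ) ^ S.μ k‖ =
      ‖sectorPow S.ω (ρ : ℂ) (S.μ k)‖⁻¹ * ‖sectorPow S.ω (ρ * x) (S.μ k)‖ := by
    rw [mul_comm (ρ : ℂ), sectorPow_mul h0 hx0, norm_mul, mul_left_comm,
      inv_mul_cancel₀ (norm_ne_zero_iff.mpr (sectorPow_ne_zero _ _)), mul_one]
  have hp := norm_ne_zero_iff.mpr (sectorPow_ne_zero (ω := S.ω) ((ρ : ℂ) * x) (S.μ j))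
  rw [e] at hx
  rw [norm_smul]
  refine (mul_le_mul_of_nonneg_left hx (norm_nonneg _)).trans (le_of_eq ?_)
  simp only [Function.comp_apply, inv_div, norm_div, norm_inv, sectorPow_sub]
  field_simp

lemma star_true_succ (k : Fin n) (ξ : ℂ) :
    S.wt (star n true (k + 1)) ξ = S.wt (star n true k) ξ * S.W k ξ := by
  have e : star n true (k + 1) = insert k (star n true k) := by
    ext j
    simp only [star, if_true, mem_filter, Finset.mem_univ, true_and, Finset.mem_insert, Fin.ext_iff]
    omega
  rw [wt, e, Finset.prod_insert (by simp [star]), mul_comm]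
  rfl

lemma star_false_pred {m : ℕ} {j : Fin n} (hj : n - m = j + 1) (hm : m ≤ n) (ξ : ℂ) :
    S.wt (star n false (1 + m)) ξ = S.W j ξ * S.wt (star n false m) ξ := by
  have e : star n false (1 + m) = insert j (star n false m) := by
    ext i
    simp only [star, Bool.false_eq_true, if_false, mem_filter, Finset.mem_univ, true_and,
      Finset.mem_insert, Fin.ext_iff]
    omega
  rw [wt, e, Finset.prod_insert (by simp [star, hj])]
  rfl

/-- A Weyl-type solution solves the linear system defined by the fundamental tensors: the
differences `F_{k-1} ∧ y - F_k` and `y ∧ T_k` are solutions that are too small at one end. -/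
lemma solvesTensorSystem_of_isWeylType (h0 : (ρ : ℂ) ≠ 0) {F : ℕ → ℝ → Ext n}
    {T : Fin n → ℝ → Ext n} {k : Fin n} (hF : S.IsTensor true k q ρ (F k))
    (hF' : S.IsTensor true (k + 1) q ρ (F (k + 1))) (hT : S.IsTensor false (n - k) q ρ (T k))
    {y : ℝ → Fin n → ℂ} (hy : IsWeylType S.A S.b S.μ S.σ q.mat ρ k y) :
    SolvesTensorSystem F T k y := by
  have hys := solvesExt_of_isWeylType hy
  refine fun x hx => ⟨?_, ?_⟩
  · have hlim : Tendsto (fun x : ℝ => (S.wt (star n true (k + 1)) (ρ * x))⁻¹ •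
        (F k x * ι ℂ (y x) - F (k + 1) x)) (regionEnd true) (𝓝 0) := by
      have h1 := (hF.tendsto_atTop k.2.le h0).mul
        (((ιL n).continuous.tendsto _).comp (tendsto_weyl_atTop h0 hy))
      have h2 := h1.sub (hF'.tendsto_atTop k.2 h0)
      have e : wedge S.fvec (star n true (k + 1)) =
          wedge S.fvec (star n true k) * ιL n (S.fvec k) := wedge_univ_filter_succ S.fvec k
      rw [e, sub_self] at h2
      refine h2.congr fun x => ?_
      rw [star_true_succ, smul_sub, mul_inv]
      simp only [Function.comp_apply, ιL_apply, map_smul, smul_mul_smul_comm]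
    exact sub_eq_zero.mp ((((hF.solves h0).mul hys).sub (hF'.solves h0)).eq_zero k.2 h0
      (fun x hx => Submodule.sub_mem _ (mul_mem_ext (hF.mem x hx) (ι_mem_ext _)) (hF'.mem x hx))
      hlim hx)
  · have hmem : ∀ x > 0, ι ℂ (y x) * T k x ∈ ⋀[ℂ]^(1 + (n - k)) (Fin n → ℂ) :=
      fun x hx => mul_mem_ext (ι_mem_ext _) (hT.mem x hx)
    rcases Nat.eq_zero_or_pos k with hk | hk
    · refine eq_zero_of_mem_succ ?_
      have := hmem x hx
      rwa [hk, Nat.sub_zero, add_comm] at this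
    · obtain ⟨j, hj⟩ : ∃ j : Fin n, (j : ℕ) + 1 = k := ⟨⟨k - 1, by omega⟩, by simp; omega⟩
      have hjk : n - (n - (k : ℕ)) = j + 1 := by have := k.2; omega
      obtain ⟨M, hM0, hM⟩ := hT.bound
      refine (hys.mul (hT.solves h0)).eq_zero (up := false) (by have := k.2; omega) h0 hmem ?_ hx
      have h1 := ((((ιL n).continuous.tendsto _).comp (tendsto_weyl_zero h0
        (show j < k by rw [Fin.lt_def]; omega) hy)).norm.mul_const M)
      rw [map_zero, norm_zero, zero_mul] at h1
      refine squeeze_zero_norm' ?_ h1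
      filter_upwards [self_mem_nhdsWithin] with x hx
      rw [star_false_pred hjk (Nat.sub_le _ _), mul_inv, ← smul_mul_smul_comm, ← map_smul]
      exact (norm_mul_le _ _).trans (mul_le_mul_of_nonneg_left (hM x hx) (norm_nonneg _))

end Setup

end WeylType

/-! ### The quotient representation -/

section Quotient

namespace Setup

variable {S : Setup n} {p : ℝ≥0∞} [Fact (1 ≤ p)] {q : Potential n p} {ρ : S.D}

variable (S) in
/-- The Wronskian `det (e_1, …, e_{k-1}, c_k, …, c_n)`. -/
def delta (k : Fin n) : ℂ := (ofCols fun j => if j < k then S.e j S.ref else S.c j S.ref).det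

lemma delta_ne_zero (k : Fin n) : S.delta k ≠ 0 := by
  rcases Nat.eq_zero_or_pos k with hk | hk
  · have h : ∀ j : Fin n, ¬ j < k := fun j => by rw [Fin.lt_def, hk]; omega
    simp only [delta, h, if_false]
    rw [det_c ref_mem ref_ne_zero]
    exact one_ne_zero
  · exact S.condI k hk.ne' S.ref ref_mem ref_ne_zero

lemma topCoeff_wedge_e_mul_c (k : Fin n) {ξ : ℂ} (hξ : ξ ∈ S.D) (h0 : ξ ≠ 0) :
    topCoeff n (wedge (fun j => S.e j ξ) (star n true k) *
      wedge (fun j => S.c j ξ) (star n false (n - k))) = S.delta k := by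
  rw [star_false]
  have hu : S.IsSol fun j => if j < k then S.e j else S.c j := fun j => by
    dsimp only
    split_ifs
    · exact isSol_e j
    · exact isSol_c j
  have h := hu.det hξ h0
  simp only [apply_ite (fun f : ℂ → Fin n → ℂ => f ξ),
    apply_ite (fun f : ℂ → Fin n → ℂ => f S.ref)] at h
  rw [delta, ← h]
  exact wedge_initial_mul_final _ _ k

lemma wt_initial_mul_final (k : Fin n) (ξ : ℂ) :
    S.wt (star n true k) ξ * S.wt (star n false (n - k)) ξ = S.wt Finset.univ ξ := by
  have e : star n false (n - k) = (star n true k)ᶜ := by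
    rw [star_false]
    ext j
    simp only [star, if_true, mem_filter, Finset.mem_univ, true_and, Finset.mem_compl,
      Fin.le_def, not_lt]
  rw [e]
  exact Finset.prod_mul_prod_compl _ _

lemma what_mul_topCoeff_base (k : Fin n) {ξ : ℂ} (hξ : ξ ∈ S.D) (h0 : ξ ≠ 0) :
    S.what Finset.univ ξ * topCoeff n (S.base true k ξ * S.base false (n - k) ξ) = S.delta k := by
  rw [base_eq true k.2.le hξ h0, base_eq false (Nat.sub_le _ _) hξ h0, smul_mul_smul_comm, map_smul,
    ← mul_inv, wt_initial_mul_final, what_univ_eq h0, smul_eq_mul,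
    mul_inv_cancel_left₀ (wt_ne_zero hξ h0 _)]
  exact topCoeff_wedge_e_mul_c k hξ h0

/-- Cramer's rule for normalised tensors. -/
lemma cramer_normalised {F F' T : Ext n} {y : Fin n → ℂ}
    (h1 : F * ι ℂ y = F') (h2 : ι ℂ y * T = 0)
    (φ : Module.Dual ℂ (Fin n → ℂ)) (a a' w : ℂ) :
    φ y * w⁻¹ * topCoeff n ((a⁻¹ • F) * (a'⁻¹ • T)) =
      topCoeff n (((a * w)⁻¹ • F') * contract φ (a'⁻¹ • T)) := by
  have h := cramer_contract h1 h2 φ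
  rw [map_smul, smul_mul_smul_comm, smul_mul_smul_comm, map_smul, map_smul, ← h, mul_inv]
  simp only [smul_eq_mul]
  ring

/-- The unperturbed Weyl-type solutions solve the linear system of the unperturbed tensors. -/
lemma ψ_tensorSystem (k : Fin n) {ξ : ℂ} (hξ : ξ ∈ S.D) (h0 : ξ ≠ 0) :
    wedge (fun j => S.e j ξ) (star n true k) * ι ℂ (S.ψ k ξ) =
        wedge (fun j => S.e j ξ) (star n true (k + 1)) ∧
      ι ℂ (S.ψ k ξ) * wedge (fun j => S.c j ξ) (star n false (n - k)) = 0 := by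
  obtain ⟨P, hP, hP0⟩ := exists_ψ_eq_c (S := S)
  obtain ⟨Q, hQ, hQ0⟩ := exists_ψ_eq_e (S := S)
  constructor
  · rw [hQ k ξ hξ h0, map_sum, mul_sum, Finset.sum_eq_single k]
    · rw [(hQ0 k).1, one_smul]
      exact (wedge_univ_filter_succ (fun j => S.e j ξ) k).symm
    · intro j _ hjk
      rw [map_smul, mul_smul_comm]
      rcases lt_or_gt_of_ne hjk with h | h
      · rw [← wedge_singleton (fun j => S.e j ξ), wedge_mul_of_not_disjoint, smul_zero]
        simpa [star] using h
      · rw [(hQ0 k).2 j h, zero_smul]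
    · simp
  · rw [hP k ξ hξ h0, map_sum, sum_mul]
    refine sum_eq_zero fun j _ => ?_
    rw [map_smul, smul_mul_assoc]
    rcases lt_or_ge j k with h | h
    · rw [hP0 k j h, zero_smul]
    · rw [← wedge_singleton (fun j => S.c j ξ), wedge_mul_of_not_disjoint, smul_zero]
      rw [star_false]
      simpa using h

/-- The linear functional with given coordinates. -/
def rowForm (z : Fin n → ℂ) : Module.Dual ℂ (Fin n → ℂ) := ∑ i, z i • LinearMap.proj i

lemma rowForm_apply (z y : Fin n → ℂ) : rowForm z y = ∑ i, z i * y i := by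
  simp [rowForm, LinearMap.sum_apply]

/-- The contraction with a coordinate form as a continuous map. -/
def contractL (i : Fin n) : Ext n →L[ℂ] Ext n :=
  LinearMap.toContinuousLinearMap (contract (LinearMap.proj i))

lemma topCoeff_mul_contract_rowForm (z : Fin n → ℂ) (F T : Ext n) :
    topCoeff n (F * contract (rowForm z) T) = ∑ i, z i * topCoeff n (F * contractL i T) := by
  have h : contract (rowForm z) T = ∑ i, z i • contractL i T := by
    have h1 : contract (n := n) (rowForm z) = ∑ i, z i • contract (LinearMap.proj i) := by
      simp only [contract, rowForm, map_sum, map_smul]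
    rw [h1, LinearMap.sum_apply]
    rfl
  rw [h, mul_sum, map_sum]
  simp only [mul_smul_comm, map_smul, smul_eq_mul]

lemma beta_apply (k j : Fin n) {ξ : ℂ} (hξ : ξ ∈ S.D) (h0 : ξ ≠ 0) (Ψ : Matrix (Fin n) (Fin n) ℂ)
    (Z : Matrix (Fin n) (Fin n) ℂ) :
    (Z * (Ψ * (weightMatrix S.W ξ)⁻¹)) j k = rowForm (Z j) (fun i => Ψ i k) * (S.W k ξ)⁻¹ := by
  have e0 : (weightMatrix S.W ξ)⁻¹ = Matrix.diagonal fun k => (S.W k ξ)⁻¹ := by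
    refine Matrix.inv_eq_left_inv ?_
    rw [weightMatrix, Matrix.diagonal_mul_diagonal, ← Matrix.diagonal_one]
    exact congrArg _ (funext fun k => inv_mul_cancel₀ (S.weight.ne_zero k ξ hξ h0))
  rw [e0, ← Matrix.mul_assoc, Matrix.mul_diagonal, rowForm_apply]
  rfl

section Families

variable {E F : Type*} [NormedAddCommGroup E] [NormedSpace ℂ E] [NormedAddCommGroup F]
  [NormedSpace ℂ F]

lemma IsGood.bilin_sub {G : Type*} [NormedAddCommGroup G] [NormedSpace ℂ G]
    (L : E →L[ℂ] F →L[ℂ] G) {u u₀ : Potential n p → ℝ≥0 → S.D → E}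
    {w w₀ : Potential n p → ℝ≥0 → S.D → F} (hu : IsGood fun q x ρ => u q x ρ - u₀ q x ρ)
    (hu₀ : IsReg u₀) (hw : IsGood fun q x ρ => w q x ρ - w₀ q x ρ) (hw' : IsReg w) :
    IsGood fun q x ρ => L (u q x ρ) (w q x ρ) - L (u₀ q x ρ) (w₀ q x ρ) := by
  have h := (hu.bilin L hw').add (IsGood.bilin_right L hu₀ hw)
  convert h using 4
  simp only [map_sub, sub_apply]
  abel

end Families

lemma isGood_scalar_mul {f : ℂ → ℂ} (hf : ContinuousOn f S.D) {M : ℝ}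
    (hM : ∀ ξ ∈ S.D, ‖f ξ‖ ≤ M) {u : Potential n p → ℝ≥0 → S.D → ℂ} (hu : IsGood u) :
    IsGood fun q x ρ => f (ρ * (x : ℝ)) * u q x ρ :=
  IsGood.bilin_right (ContinuousLinearMap.mul ℂ ℂ) (isReg_of_continuous
    (hf.comp_continuous (by fun_prop) fun y => mul_mem_D y.2.2 y.1.coe_nonneg)
    fun x ρ => hM _ (mul_mem_D ρ.2 x.coe_nonneg)) hu

variable {Y Y' : Potential n p → ℝ≥0 → S.D → Ext n}

lemma isGood_topCoeff_sub (hp : 2 < p) {m m' : ℕ} (hm : m ≤ n) (hm' : m' ≤ n)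
    (hY : S.IsTensorFamily true m Y) (hY' : S.IsTensorFamily false m' Y')
    (Λ : Ext n →L[ℂ] Ext n) :
    IsGood fun q x ρ => topCoeff n (Y q x ρ * Λ (Y' q x ρ)) -
      topCoeff n (S.base true m (ρ * (x : ℝ)) * Λ (S.base false m' (ρ * (x : ℝ)))) := by
  have h1 : IsGood fun q x ρ => Y q x ρ - S.base true m (ρ * (x : ℝ)) := hY.isGood hp hm
  have h2 := (hY'.isGood hp hm').clm Λ
  simp only [pert, map_sub] at h2
  have h3 : IsReg fun q x ρ => Λ (Y' q x ρ) := (hY'.isReg hm').clm Λ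
  have h4 := h1.bilin_sub (topMul n).flip (isReg_base true hm) h2 h3
  simp only [ContinuousLinearMap.flip_apply, topMul_apply] at h4
  exact h4

end Setup

end Quotient

section Representation

namespace Setup

/-- At a point of the open half-line, Cramer's rule represents the entries of `β` as quotients of
functionals of the normalised tensors. -/
lemma beta_mul_topCoeff (S : Setup n) {Z Ψ : Matrix (Fin n) (Fin n) ℂ} {F F' T : Ext n} {k : Fin n}
    {ξ : ℂ} (hξ : ξ ∈ S.D) (h0 : ξ ≠ 0)
    (h1 : F * ι ℂ (fun i => Ψ i k) = F')
    (h2 : ι ℂ (fun i => Ψ i k) * T = 0) (j : Fin n) :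
    (Z * (Ψ * (weightMatrix S.W ξ)⁻¹)) j k *
      topCoeff n (((S.wt (star n true k) ξ)⁻¹ • F) * ((S.wt (star n false (n - k)) ξ)⁻¹ • T)) =
      ∑ i, Z j i * topCoeff n (((S.wt (star n true (k + 1)) ξ)⁻¹ • F') *
        contractL i ((S.wt (star n false (n - k)) ξ)⁻¹ • T)) := by
  rw [beta_apply k j hξ h0, cramer_normalised h1 h2, ← star_true_succ,
    topCoeff_mul_contract_rowForm]

/-- The quotient representation of `β`, for a sector contained in a half-plane. -/
theorem exists_quotient_representation (S : Setup n) {p : ℝ≥0∞} [Fact (1 ≤ p)] (hp : 2 < p) :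
    ∃ (d : Fin n → Fin n → SectorClass n p S.ω S.h) (d' : Fin n → SectorClass n p S.ω S.h),
      (∀ (q : Potential n p) (ρ : S.D), (ρ : ℂ) ≠ 0 → ∀ (F : ℕ → ℝ → Ext n) (T : Fin n → ℝ → Ext n),
          (∀ m ≤ n, IsTensorF S.b S.μ S.ω S.σ S.chat S.e q.mat ρ m (F m)) →
          (∀ k, IsTensorT S.b S.μ S.ω S.σ S.chat q.mat ρ k (T k)) →
          ∀ k : Fin n, (∃ x > 0, charFun F T k x ≠ 0) → ∀ Ψ : ℝ → Matrix (Fin n) (Fin n) ℂ,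
              (((ρ : ℂ) ∉ singularLines S.b ∧
                  IsWeylType S.A S.b S.μ S.σ q.mat ρ k fun x i => Ψ x i k) ∨
                SolvesTensorSystem F T k fun x i => Ψ x i k) →
              ∀ x : ℝ≥0, 0 < x → 1 + d' k q x ρ ≠ 0 ∧ ∀ j, beta S.W S.ψ Ψ x ρ j k =
                  ((if j = k then 1 else 0) + d j k q x ρ) / (1 + d' k q x ρ)) ∧
      ∀ z ∈ S.D, z ≠ 0 → (∀ j k, RestrictsToRay (d j k) z) ∧ ∀ k, RestrictsToRay (d' k) z := by
  obtain ⟨Z, hZc, hZb, hZ⟩ := S.exists_inverse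
  obtain ⟨C, hC0, hC⟩ := exists_what_univ_bound (S := S)
  have hF : ∀ m, ∃ Y : Potential n p → ℝ≥0 → S.D → Ext n, m ≤ n → S.IsTensorFamily true m Y := by
    intro m
    by_cases hm : m ≤ n
    · obtain ⟨Y, hY⟩ := exists_isTensorFamily (p := p) S true hm
      exact ⟨Y, fun _ => hY⟩
    · exact ⟨0, fun h => absurd h hm⟩
  choose FF hFF using hF
  choose TT hTT using fun k : Fin n => exists_isTensorFamily (p := p) S false (Nat.sub_le n k)
  have hPb : ∀ k, ∀ ξ ∈ S.D, ‖S.what Finset.univ ξ / S.delta k‖ ≤ C / ‖S.delta k‖ :=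
    fun k ξ hξ => by
    rw [norm_div]
    exact div_le_div_of_nonneg_right (hC ξ hξ) (norm_nonneg _)
  have hPc : ∀ k, ContinuousOn (fun ξ => S.what Finset.univ ξ / S.delta k) S.D := fun k =>
    (continuousOn_what _).div_const _
  have g1 : ∀ k : Fin n, IsGood fun (q : Potential n p) x (ρ : S.D) =>
      S.what Finset.univ (ρ * (x : ℝ)) / S.delta k * (topCoeff n (FF k q x ρ * TT k q x ρ) -
          topCoeff n (S.base true k (ρ * (x : ℝ)) * S.base false (n - k) (ρ * (x : ℝ)))) := fun k =>
    isGood_scalar_mul (hPc k) (hPb k) (isGood_topCoeff_sub hp k.2.le (Nat.sub_le n k)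
      (hFF k k.2.le) (hTT k) (ContinuousLinearMap.id ℂ _))
  have g2 : ∀ j k : Fin n, IsGood fun (q : Potential n p) x (ρ : S.D) =>
      ∑ i, S.what Finset.univ (ρ * (x : ℝ)) / S.delta k * Z (ρ * (x : ℝ)) j i *
        (topCoeff n (FF (k + 1) q x ρ * contractL i (TT k q x ρ)) -
          topCoeff n (S.base true (k + 1) (ρ * (x : ℝ)) *
            contractL i (S.base false (n - k) (ρ * (x : ℝ))))) := by
    refine fun j k => IsGood.sum Finset.univ fun i _ => ?_
    obtain ⟨M, hM⟩ := hZb j i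
    refine isGood_scalar_mul (f := fun ξ => S.what Finset.univ ξ / S.delta k * Z ξ j i)
      ((hPc k).mul (hZc j i)) (M := C / ‖S.delta k‖ * M) (fun ξ hξ => ?_)
      (isGood_topCoeff_sub hp k.2 (Nat.sub_le n k) (hFF _ k.2) (hTT k) (contractL i))
    rw [norm_mul]
    exact mul_le_mul (hPb k ξ hξ) (hM ξ hξ) (norm_nonneg _) (by positivity)
  choose d' hd' hr' using fun k => (g1 k).exists_class
  choose d hd hr using fun j k => (g2 j k).exists_class
  refine ⟨d, d', fun q ρ h0 F T hF hT k hΔ Ψ hΨ x hx => ?_,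
    fun z hz hz0 => ⟨fun j k => hr j k z hz hz0, fun k => hr' k z hz hz0⟩⟩
  have hx' : 0 < (x : ℝ) := hx
  have tF : S.IsTensor true k q ρ (F k) := isTensor_of_F h0 (hF k k.2.le)
  have tF' : S.IsTensor true (k + 1) q ρ (F (k + 1)) := isTensor_of_F h0 (hF (k + 1) k.2)
  have tT : S.IsTensor false (n - k) q ρ (T k) := isTensor_of_T h0 (hT k)
  have hsys : SolvesTensorSystem F T k fun x i => Ψ x i k :=
    hΨ.elim (fun h => solvesTensorSystem_of_isWeylType h0 tF tF' tT h.2) id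
  have hne := tF.topCoeff_mul_ne_zero h0 tT hΔ hx'
  have eF := tF.eq k.2.le h0 (hFF k k.2.le) hx'
  have eF' := tF'.eq k.2 h0 (hFF (k + 1) k.2) hx'
  have eT := tT.eq (Nat.sub_le n k) h0 (hTT k) hx'
  rw [Real.toNNReal_coe] at eF eF' eT
  have hξ := mul_mem_D ρ.2 hx'.le
  have hξ0 := mul_ofReal_ne_zero h0 hx'
  rw [hd']
  simp only [hd]
  set ξ : ℂ := (ρ : ℂ) * (x : ℝ) with hξdef
  have hP0 : S.what Finset.univ ξ / S.delta k * topCoeff n (S.base true k ξ *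
      S.base false (n - k) ξ) = 1 := by
    rw [div_mul_eq_mul_div, what_mul_topCoeff_base k hξ hξ0, div_self (delta_ne_zero k)]
  have hA : topCoeff n (FF k q x ρ * TT k q x ρ) ≠ 0 := by
    rw [← eF, ← eT, smul_mul_smul_comm, map_smul, smul_eq_mul]
    exact mul_ne_zero (mul_ne_zero (inv_ne_zero (wt_ne_zero hξ hξ0 _))
      (inv_ne_zero (wt_ne_zero hξ hξ0 _))) hne
  rw [mul_sub, hP0, add_sub_cancel]
  have hPA := mul_ne_zero (left_ne_zero_of_mul_eq_one hP0) hA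
  refine ⟨hPA, fun j => ?_⟩
  have hβ := S.beta_mul_topCoeff (Z := Z ξ) hξ hξ0 (hsys x hx').1 (hsys x hx').2 j
  rw [eF, eF', eT] at hβ
  have hψ := S.beta_mul_topCoeff (Z := Z ξ) (Ψ := ofCols fun k => S.ψ k ξ) (k := k) hξ hξ0
    (ψ_tensorSystem k hξ hξ0).1 (ψ_tensorSystem k hξ hξ0).2 j
  obtain ⟨hZξ, hu⟩ := hZ ξ hξ hξ0
  have b1 := base_eq true k.2.le hξ hξ0
  have b2 := base_eq true k.2 hξ hξ0
  have b3 := base_eq false (Nat.sub_le n k) hξ hξ0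
  simp only [sol, if_true, Bool.false_eq_true, if_false] at b1 b2 b3
  rw [← b1, ← b2, ← b3, hZξ, Matrix.nonsing_inv_mul _ hu, Matrix.one_apply, ← hZξ] at hψ
  simp only [mul_sub, Finset.sum_sub_distrib, mul_assoc, ← mul_sum]
  rw [← hψ, ← hβ, eq_div_iff hPA, hZξ]
  generalize (if j = k then (1 : ℂ) else 0) = δ
  change beta S.W S.ψ Ψ x ρ j k * _ = _ + (_ * (beta S.W S.ψ Ψ x ρ j k * _) - _)
  linear_combination δ * hP0

end Setup

end Representation

end WeylSystem

end

theorem theorem2 {n : ℕ}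
    (A : Matrix (Fin n) (Fin n) ℂ) (b μ : Fin n → ℂ)
    (hA : WeylSystem.ConditionA A μ) (hB : WeylSystem.ConditionB b)
    -- the open sector `S`, disjoint from `Σ`
    (ω h : ℝ) (hpos : 0 < h) (hle : h ≤ Real.pi)
    (hS : Disjoint (WeylSystem.sector ω h) (WeylSystem.singularLines b))
    -- the ordering `R_k = b (σ k)` of the numbers `b_1, …, b_n` in `S`
    (σ : Equiv.Perm (Fin n))
    (hσ : ∀ x ∈ WeylSystem.sector ω h, StrictMono fun k => (b (σ k) * x).re)
    -- the fundamental matrices of the unperturbed system and the weights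
    (chat e ψ : Fin n → ℂ → Fin n → ℂ)
    (hc : WeylSystem.IsFrobenius A b μ ω h chat) (he : WeylSystem.IsJost A b ω h σ e)
    (hI : WeylSystem.ConditionI μ ω h chat e)
    (hψ : WeylSystem.IsWeylZero A b μ ω h σ ψ)
    (W : Fin n → ℂ → ℂ) (hW : WeylSystem.IsWeight b μ ω h σ W)
    (p : ℝ≥0∞) [Fact (1 ≤ p)] (hp : 2 < p) :
    ∃ (d : Fin n → Fin n → WeylSystem.SectorClass n p ω h)
      (d' : Fin n → WeylSystem.SectorClass n p ω h),
      (∀ (q : WeylSystem.Potential n p) (ρ : WeylSystem.closedSector ω h), (ρ : ℂ) ≠ 0 →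
        ∀ (F : ℕ → ℝ → WeylSystem.Ext n) (T : Fin n → ℝ → WeylSystem.Ext n),
          (∀ m ≤ n, WeylSystem.IsTensorF b μ ω σ chat e q.mat ρ m (F m)) →
          (∀ k, WeylSystem.IsTensorT b μ ω σ chat q.mat ρ k (T k)) →
          ∀ k : Fin n, (∃ x > 0, WeylSystem.charFun F T k x ≠ 0) →
            ∀ Ψ : ℝ → Matrix (Fin n) (Fin n) ℂ,
              (((ρ : ℂ) ∉ WeylSystem.singularLines b ∧
                  WeylSystem.IsWeylType A b μ σ q.mat ρ k fun x i => Ψ x i k) ∨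
                WeylSystem.SolvesTensorSystem F T k fun x i => Ψ x i k) →
              ∀ x : ℝ≥0, 0 < x →
                1 + d' k q x ρ ≠ 0 ∧
                ∀ j, WeylSystem.beta W ψ Ψ x ρ j k =
                  ((if j = k then 1 else 0) + d j k q x ρ) / (1 + d' k q x ρ)) ∧
      ∀ z ∈ WeylSystem.closedSector ω h, z ≠ 0 →
        (∀ j k, WeylSystem.RestrictsToRay (d j k) z) ∧
        ∀ k, WeylSystem.RestrictsToRay (d' k) z := by
  rcases Nat.lt_or_ge n 2 with hn | hn
  · interval_cases n
    · exact ⟨fun k => k.elim0, fun k => k.elim0, fun _ _ _ _ _ _ _ k => k.elim0,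
        fun _ _ _ => ⟨fun k => k.elim0, fun k => k.elim0⟩⟩
    · -- for `n = 1` the sum of the `b_j` is `b_1 ≠ 0`
      exact absurd (by simpa using hB.sum_eq_zero) (hB.ne_zero 0)
  have h01 : (⟨0, by omega⟩ : Fin n) ≠ ⟨1, hn⟩ := by simp [Fin.ext_iff]
  let S : WeylSystem.Setup n :=
    { A, b, μ, ω, h, σ, chat, e, ψ, W
      condA := hA
      condB := hB
      pos := hpos
      le_half := WeylSystem.le_pi_div_two_of_disjoint h01 hS (hB.injective.ne h01)
      ordered := hσ
      frobenius := hc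
      jost := he
      condI := hI
      weyl := hψ
      weight := hW }
  exact S.exists_quotient_representation hp
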